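/- Let $N\ge 1$, $0<\sigma<1$, $s=1+\sigma$, let $\Omega\subset\mathbb{R}^N$ be a bounded $C^{1,1}$ domain with outer unit normal field $\nu$ on $\partial\Omega$, and put $c_{N,\sigma}=\Big(\int_{\mathbb{R}^N}\frac{1-\cos \xi_1}{|\xi|^{N+2\sigma}}\,d\xi\Big)^{-1}$. For $A\subseteq\mathbb{R}^N$ and a scalar- or vector-valued function $w$ write $$(-\Delta)^\sigma_A w(x)=c_{N,\sigma}\lim_{\varepsilon\to0^+}\int_{A\setminus B_\varepsilon(x)}\frac{w(x)-w(y)}{|x-y|^{N+2\sigma}}\,dy ,$$ and for $u\in\mathcal S(\mathbb{R}^N)$ (real-valued) let $$(-\Delta)^su(x)=(-\Delta)^\sigma_{\mathbb{R}^N}(-\Delta u)(x)=c_{N,\sigma}\,\mathrm{P.V.}\!\int_{\mathbb{R}^N}\frac{(-\Delta u(x))-(-\Delta u(y))}{|x-y|^{N+2\sigma}}\,dy .$$ Define $$\mathcal N^1_\sigma u(x)=-\operatorname{div}\big((-\Delta)^\sigma_\Omega\nabla u\big)(x),\quad x\in\mathbb{R}^N\setminus\overline\Omega,$$ and let $\mathcal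 N^2_\sigma u=(-\Delta)^\sigma_{\mathbb{R}^N\setminus\Omega}(\nabla u)\cdot\nu$ on $\partial\Omega$ in the sense of the normal trace from inside $\Omega$, that is, $$\mathcal N^2_\sigma u(x)=\lim_{t\to0^+}(-\Delta)^\sigma_{\mathbb{R}^N\setminus\Omega}(\nabla u)\big(x-t\nu(x)\big)\cdot\nu(x),\quad x\in\partial\Omega .$$ Let $p(x)=c_0+c\cdot x$ with $c_0\in\mathbb{R}$, $c\in\mathbb{R}^N$, and let $u\in\mathcal S(\mathbb{R}^N)$ be such that $$\int_{\mathbb{R}^N\setminus\Omega}\big|\operatorname{div}\big((-\Delta)^\sigma_\Omega\nabla u\big)(x)\,p(x)\big|\,dx<+\infty .$$ Then the limit defining $\mathcal N^2_\sigma u(x)$ exists in $\mathbb{R}$ at every $x\in\partial\Omega$ with $p(x)\ne0$; the function $p\,(-\Delta)^su$ is integrable on $\Omega$, $p\,\mathcal N^1_\sigma u$ is integrable on $\mathbb{R}^N\setminus\Omega$, and $p\,\mathcal N^2_\sigma u$ (understood as $0$ where $p=0$) is integrable on $\partial\Omega$ with respect to the surface measure $dS$; and $$\int_\Omega p\,(-\Delta)^su\,dx=-\int_{\mathbb{R}^N\setminus\Omega}p\,\mathcal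 N^1_\sigma u\,dx-\int_{\partial\Omega}p\,\mathcal N^2_\sigma u\,dS .$$ -/

import Mathlib

open MeasureTheory Filter Topology Set
open scoped NNReal Gradient SchwartzMap

namespace HigherNeumann

/-- `ℝ^N` with its Euclidean structure. -/
abbrev Euc (N : ℕ) : Type := EuclideanSpace ℝ (Fin N)

/-- A bounded `C^{1,1}` domain: a bounded, connected open set (Mathlib's `IsConnected` includes
non-emptiness) that near each boundary point `z` is the strict subgraph, in some unit direction
`e`, of a function `g` of the projection onto the hyperplane orthogonal to `e`, where `g` is
differentiable with Lipschitz derivative. -/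
structure IsBoundedC11Domain {N : ℕ} (Ω : Set (Euc N)) : Prop where
  isOpen : IsOpen Ω
  isConnected : IsConnected Ω
  isBounded : Bornology.IsBounded Ω
  boundary : ∀ z ∈ frontier Ω, ∃ (e : Euc N) (g : Euc N → ℝ) (r : ℝ),
    ‖e‖ = 1 ∧ 0 < r ∧ Differentiable ℝ g ∧ (∃ K : ℝ≥0, LipschitzWith K (fderiv ℝ g)) ∧
    ∀ y ∈ Metric.ball z r,
      (y ∈ Ω ↔ inner ℝ e y < g (y - (inner ℝ e y) • e))

/-- `ν` is an outer unit normal to `∂Ω` at `x`: up to first order at `x`, the set `Ω` is the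
half-space `{y | ⟨ν, y - x⟩ < 0}`. -/
def IsOuterUnitNormal {N : ℕ} (Ω : Set (Euc N)) (x ν : Euc N) : Prop :=
  ‖ν‖ = 1 ∧ ∀ ε > 0, ∀ᶠ y in 𝓝 x,
    (y ∈ Ω → inner ℝ ν (y - x) ≤ ε * ‖y - x‖) ∧
    (y ∉ Ω → -(ε * ‖y - x‖) ≤ inner ℝ ν (y - x))

/-- There is at most one outer unit normal at each point. -/
theorem IsOuterUnitNormal.unique {N : ℕ} {Ω : Set (Euc N)} {x ν ν' : Euc N}
    (h : IsOuterUnitNormal Ω x ν) (h' : IsOuterUnitNormal Ω x ν') : ν = ν' := by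
  by_contra hne
  set d : Euc N := ν' - ν with hd
  have hdpos : 0 < ‖d‖ := by
    rw [norm_pos_iff, hd, sub_ne_zero]
    exact fun h => hne h.symm
  have hn : inner ℝ ν ν = 1 := by rw [real_inner_self_eq_norm_sq, h.1]; norm_num
  have hn' : inner ℝ ν' ν' = 1 := by rw [real_inner_self_eq_norm_sq, h'.1]; norm_num
  have hdd : ‖d‖ ^ 2 = 2 - 2 * inner ℝ ν ν' := by
    rw [← real_inner_self_eq_norm_sq, hd, inner_sub_left, inner_sub_right, inner_sub_right, hn, hn',
      real_inner_comm ν ν']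
    ring
  have h1 : inner ℝ ν d = -(‖d‖ ^ 2 / 2) := by
    rw [hdd, hd, inner_sub_right, hn]; ring
  have h2 : inner ℝ ν' d = ‖d‖ ^ 2 / 2 := by
    rw [hdd, hd, inner_sub_right, hn', real_inner_comm ν ν']; ring
  have hε : (0 : ℝ) < ‖d‖ / 4 := by positivity
  have ht : Tendsto (fun t : ℝ => x + t • d) (𝓝[>] 0) (𝓝 x) := by
    have : Tendsto (fun t : ℝ => x + t • d) (𝓝 0) (𝓝 (x + (0 : ℝ) • d)) :=
      Continuous.tendsto (by fun_prop) 0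
    rw [zero_smul, add_zero] at this
    exact this.mono_left nhdsWithin_le_nhds
  obtain ⟨t, ⟨⟨_, hb⟩, ⟨ha', _⟩⟩, ht0⟩ :=
    ((ht.eventually (h.2 _ hε)).and (ht.eventually (h'.2 _ hε))
      |>.and self_mem_nhdsWithin).exists
  have ht0 : (0 : ℝ) < t := ht0
  simp only [add_sub_cancel_left, inner_smul_right, norm_smul, Real.norm_eq_abs,
    abs_of_pos ht0, h1, h2] at hb ha'
  have hq : 0 < t * ‖d‖ ^ 2 := by positivity
  by_cases hmem : x + t • d ∈ Ω
  · nlinarith [ha' hmem]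
  · nlinarith [hb hmem]

open Classical in
/-- The outer unit normal field of `Ω` (with value `0` at points without a normal). -/
noncomputable def outerNormal {N : ℕ} (Ω : Set (Euc N)) (x : Euc N) : Euc N :=
  if h : ∃ ν, IsOuterUnitNormal Ω x ν then h.choose else 0

/-- The surface measure on `∂Ω`: the `(N-1)`-dimensional Hausdorff measure, normalized as
Lebesgue measure on `ℝ^{N-1}`, restricted to `∂Ω`. -/
noncomputable def surfaceMeasure {N : ℕ} (Ω : Set (Euc N)) : Measure (Euc N) :=
  (Measure.euclideanHausdorffMeasure (N - 1)).restrict (frontier Ω)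

/-- `c_{N,σ} = (∫_{ℝ^N} (1 - cos ξ₁) / |ξ|^{N+2σ} dξ)⁻¹`. -/
noncomputable def normConst (N : ℕ) [NeZero N] (σ : ℝ) : ℝ :=
  (∫ ξ : Euc N, (1 - Real.cos (ξ 0)) / ‖ξ‖ ^ ((N : ℝ) + 2 * σ))⁻¹

/-- The regional fractional Laplacian
`c_{N,σ} lim_{ε → 0⁺} ∫_{A \ B_ε(x)} (w x - w y) / |x - y|^{N+2σ} dy`
of a scalar or vector valued function `w` on `ℝ^N`. -/
noncomputable def regionalFracLap {N : ℕ} [NeZero N] {F : Type*} [NormedAddCommGroup F]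
    [NormedSpace ℝ F] (σ : ℝ) (A : Set (Euc N)) (w : Euc N → F) (x : Euc N) : F :=
  normConst N σ • limUnder (𝓝[>] (0 : ℝ)) fun ε : ℝ =>
    ∫ y in A \ Metric.ball x ε, (‖x - y‖ ^ ((N : ℝ) + 2 * σ))⁻¹ • (w x - w y)

/-- The fractional Laplacian `(-Δ)^s u` for `1 < s < 2`, that is, with `σ = s - 1`,
`c_{N,σ} P.V. ∫_{ℝ^N} ((-Δu)(x) - (-Δu)(y)) / |x - y|^{N+2σ} dy`. -/
noncomputable def higherFracLap {N : ℕ} [NeZero N] (s : ℝ) (u : Euc N → ℝ) (x : Euc N) : ℝ :=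
  regionalFracLap (s - 1) univ (fun y => -(Laplacian.laplacian u y)) x

/-- The divergence `∑ i, ∂V_i/∂x_i` of a vector field on `ℝ^N`. -/
noncomputable def divergence {N : ℕ} (V : Euc N → Euc N) (x : Euc N) : ℝ :=
  ∑ i : Fin N, (fderiv ℝ V x (EuclideanSpace.single i 1)) i

/-- `N¹_σ u = -div((-Δ)^σ_Ω ∇u)`, on the exterior of `Ω`. -/
noncomputable def neumannOne {N : ℕ} [NeZero N] (σ : ℝ) (Ω : Set (Euc N)) (u : Euc N → ℝ)
    (x : Euc N) : ℝ :=
  -divergence (regionalFracLap σ Ω (∇ u)) x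

/-- The normal component `(-Δ)^σ_{ℝ^N \ Ω}(∇u)(x - tν(x)) · ν(x)`, for `x ∈ ∂Ω`, at the point at
distance `t` from `x` along the inner normal. -/
noncomputable def innerNormalComponent {N : ℕ} [NeZero N] (σ : ℝ) (Ω : Set (Euc N))
    (u : Euc N → ℝ) (x : Euc N) (t : ℝ) : ℝ :=
  inner ℝ (regionalFracLap σ Ωᶜ (∇ u) (x - t • outerNormal Ω x)) (outerNormal Ω x)

/-- `N²_σ u = (-Δ)^σ_{ℝ^N \ Ω}(∇u) · ν` on `∂Ω`, in the sense of the normal trace from inside `Ω`: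
the integral that defines `(-Δ)^σ_{ℝ^N \ Ω}` converges absolutely inside `Ω`, and the boundary
value is the limit along the normal. -/
noncomputable def neumannTwo {N : ℕ} [NeZero N] (σ : ℝ) (Ω : Set (Euc N)) (u : Euc N → ℝ)
    (x : Euc N) : ℝ :=
  limUnder (𝓝[>] (0 : ℝ)) (innerNormalComponent σ Ω u x)

/-- The space `P₁(ℝ^N)` of the functions `x ↦ c₀ + (c, x)`. -/
def affinePolynomials (N : ℕ) : Set (Euc N → ℝ) :=
  {p | ∃ (c₀ : ℝ) (c : Euc N), ∀ x, p x = c₀ + inner ℝ c x}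

end HigherNeumann

set_option linter.unusedSectionVars false



/-! Write V = ∇u, b = 2σ and q = N + b. For a radial kernel κ(|z|²), `diffDiv` is the divergence in
x of κ(|x - y|²)(V(x) - V(y)). With κ(s) = s^(-q/2) and up to the normalizing constant, -(-Δ)^s u is
the principal value of the integral of this divergence over y in ℝ^N, -N¹u is its integral over y in
Ω, and N²u is the limit of the normal component of the integral of κ(|x - y|²)(V(x) - V(y)) over y
outside Ω.

If κ is smooth and decays fast, the identity is elementary
(`IsBoundedC11Domain.integral_mul_diffDiv`). The divergence in x of p κ (V(x) - V(y)) is p times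
`diffDiv` plus Q(x, y) = κ c·(V(x) - V(y)), which is antisymmetric because p is affine. For y
outside Ω the divergence theorem on Ω gives the boundary term; for y in Ω the integral over all x
vanishes. On adding the two, all contributions of Q cancel. The kernel is therefore replaced by
`regProfile`, in which s + ε removes the singularity and (1 + εs)⁻¹ supplies the decay needed
against p. What remains is to pass to the limit ε → 0 in three integrals.

Inside Ω, an integration by parts in y turns the integral into one of second differences of div V =
Δu against the kernel. These are O(min(|z|², 1)), and b < 2 gives domination (`interior_limit`,
`higherFracLap_eq`).

Outside Ω, let x have nearest boundary point x₀ at distance t. Up to O(t^(-b/2)), the integral over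
Ω equals the integral over the tangent half-space of the divergence of κ(|z|²) DV(x₀)z. By
tangential integration and by symmetry the latter sees only a = DV(x₀)ν·ν
(`KernelProfile.integral_halfSpace`), and for the true kernel it is of exact order a t^(-b). If b <
1 this is integrable. If b ≥ 1, the integrability hypothesis forces p a = 0 on ∂Ω, since 1/dist is
not integrable up to the boundary (`IsBoundedC11Domain.mul_normalDeriv_eq_zero`); the leading term
then disappears and only the integrable error t^(-b/2) remains. Either way there is a majorant
uniform in ε (`IsBoundedC11Domain.exists_dominating`).

On ∂Ω, where p ≠ 0, either b < 1 or a = 0. In the second case the first-order term of (V(x) -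
V(y))·ν is odd under the reflection that fixes ν, so it can be subtracted over the tangent
half-space without changing the integral. The rest is dominated by an integrable function, because Ω
differs from the half-space only between two paraboloids. Both the regularized boundary values and
the values at x - tν converge, to the same limit (`IsBoundedC11Domain.exists_trace`).

Uniqueness of limits in the regularized formula then gives the theorem. The divergence theorem
itself is proved in graph charts, where the Hausdorff measure is computed by an area formula for
graphs. -/

namespace HigherNeumann

/-! ### Fubini along the lines parallel to a unit vector. -/

section Slice

variable {E : Type*} [NormedAddCommGroup E] [InnerProductSpace ℝ E] [FiniteDimensional ℝ E]
  [MeasurableSpace E] [BorelSpace E]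

/-- Coordinates `(h, t) ↦ h + t e` adapted to a unit vector `e`. -/
noncomputable def sliceEquiv (e : E) (he : ‖e‖ = 1) : E ≃ᵐ (ℝ ∙ e)ᗮ × ℝ where
  toFun y := ((ℝ ∙ e)ᗮ.orthogonalProjectionOnto y, inner ℝ e y)
  invFun q := (q.1 : E) + q.2 • e
  left_inv y := by
    have h := (ℝ ∙ e).starProjection_add_starProjection_orthogonal y
    have h2 := Submodule.starProjection_unit_singleton ℝ he y
    rw [h2] at h
    simp only
    rw [add_comm]
    exact h
  right_inv q := by
    obtain ⟨⟨h, hh⟩, t⟩ := q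
    have hhe : inner ℝ e h = 0 := (Submodule.mem_orthogonal_singleton_iff_inner_right).1 hh
    ext
    · simp only [map_add, Submodule.coe_add]
      rw [Submodule.orthogonalProjectionOnto_mem_subspace_eq_self (⟨h, hh⟩ : (ℝ ∙ e)ᗮ)]
      have : (ℝ ∙ e)ᗮ.orthogonalProjectionOnto (t • e) = 0 := by
        apply Submodule.orthogonalProjectionOnto_orthogonal_apply_eq_zero
        exact Submodule.smul_mem _ _ (Submodule.mem_span_singleton_self e)
      rw [this]; simp
    · simp [inner_add_right, hhe, inner_smul_right, he]
  measurable_toFun := by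
    have : Continuous fun y : E => ((ℝ ∙ e)ᗮ.orthogonalProjectionOnto y, inner ℝ e y) := by fun_prop
    exact this.measurable
  measurable_invFun := by
    have : Continuous fun q : (ℝ ∙ e)ᗮ × ℝ => (q.1 : E) + q.2 • e := by fun_prop
    exact this.measurable

theorem sliceEquiv_apply (e : E) (he : ‖e‖ = 1) (y : E) :
    sliceEquiv e he y = ((ℝ ∙ e)ᗮ.orthogonalProjectionOnto y, inner ℝ e y) := rfl

/-- The orthogonal decomposition along the line of e is an isometry onto the L² product, and passing
to the ordinary product and identifying the line with ℝ both preserve volume. -/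
theorem measurePreserving_sliceEquiv (e : E) (he : ‖e‖ = 1) :
    MeasurePreserving (sliceEquiv e he) := by
  have h1 := (ℝ ∙ e).orthogonalDecomposition.measurePreserving
  have h2 := WithLp.volume_preserving_ofLp (ℝ ∙ e) (ℝ ∙ e)ᗮ
  have h3 := (LinearIsometryEquiv.toSpanUnitSingleton (𝕜 := ℝ) e he).symm.measurePreserving
  have h4 : MeasurePreserving (Prod.map (LinearIsometryEquiv.toSpanUnitSingleton (𝕜 := ℝ) e he).symm
      (id : (ℝ ∙ e)ᗮ → (ℝ ∙ e)ᗮ)) := h3.prod (MeasurePreserving.id _)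
  have h5 := (Measure.measurePreserving_swap (μ := (volume : Measure ℝ))
    (ν := (volume : Measure (ℝ ∙ e)ᗮ)))
  have := h5.comp (h4.comp (h2.comp h1))
  convert! this using 1
  ext y
  · simp [sliceEquiv_apply]
  · simp only [sliceEquiv_apply, Function.comp_apply, Submodule.orthogonalDecomposition_apply,
      Prod.map_apply, Prod.snd_swap]
    rw [eq_comm, LinearIsometryEquiv.symm_apply_eq]
    ext
    simp [Submodule.starProjection_unit_singleton ℝ he y]

theorem inner_coe_orthogonal_span (e : E) (h : (ℝ ∙ e)ᗮ) : inner ℝ e (h : E) = 0 :=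
  (Submodule.mem_orthogonal_singleton_iff_inner_right).1 h.2

theorem orthogonalProjectionOnto_add_smul (e : E) (he : ‖e‖ = 1) (h : (ℝ ∙ e)ᗮ) (t : ℝ) :
    (ℝ ∙ e)ᗮ.orthogonalProjectionOnto ((h : E) + t • e) = h :=
  congrArg Prod.fst ((sliceEquiv e he).right_inv (h, t))

theorem inner_add_smul (e : E) (he : ‖e‖ = 1) (h : (ℝ ∙ e)ᗮ) (t : ℝ) :
    inner ℝ e ((h : E) + t • e) = t :=
  congrArg Prod.snd ((sliceEquiv e he).right_inv (h, t))

theorem coe_projection_eq (e : E) (he : ‖e‖ = 1) (y : E) :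
    ((ℝ ∙ e)ᗮ.orthogonalProjectionOnto y : E) = y - (inner ℝ e y : ℝ) • e := by
  have := (sliceEquiv e he).left_inv y
  exact eq_sub_of_add_eq this

theorem norm_sq_add_smul (e : E) (he : ‖e‖ = 1) (h : (ℝ ∙ e)ᗮ) (t : ℝ) :
    ‖(h : E) + t • e‖ ^ 2 = ‖h‖ ^ 2 + t ^ 2 := by
  rw [norm_add_sq_real, inner_smul_right, real_inner_comm, inner_coe_orthogonal_span, norm_smul, he]
  simp

theorem integral_slice {F : Type*} [NormedAddCommGroup F] [NormedSpace ℝ F]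
    (e : E) (he : ‖e‖ = 1) {f : E → F} (hf : Integrable f) :
    ∫ y, f y = ∫ h : (ℝ ∙ e)ᗮ, ∫ t : ℝ, f (h + t • e) := by
  have h1 := (measurePreserving_sliceEquiv e he).symm
  rw [← h1.integral_comp', Measure.volume_eq_prod, integral_prod]
  · rfl
  · exact (h1.integrable_comp_emb (MeasurableEquiv.measurableEmbedding _)).2 hf

theorem integrable_slice {F : Type*} [NormedAddCommGroup F] [NormedSpace ℝ F]
    (e : E) (he : ‖e‖ = 1) {f : E → F} (hf : Integrable f) :
    Integrable (fun q : (ℝ ∙ e)ᗮ × ℝ => f (q.1 + q.2 • e)) (volume.prod volume) := by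
  have h1 := (measurePreserving_sliceEquiv e he).symm
  exact (h1.integrable_comp_emb (MeasurableEquiv.measurableEmbedding _)).2 hf

theorem lintegral_slice (e : E) (he : ‖e‖ = 1) {f : E → ENNReal} (hf : Measurable f) :
    ∫⁻ y, f y = ∫⁻ h : (ℝ ∙ e)ᗮ, ∫⁻ t : ℝ, f (h + t • e) := by
  have h1 := (measurePreserving_sliceEquiv e he).symm
  rw [← h1.lintegral_comp hf, Measure.volume_eq_prod, lintegral_prod]
  · rfl
  · exact (hf.comp h1.measurable).aemeasurable

/-- A function with integrable line derivative in direction `v` that vanishes at infinity along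
the lines in direction `v` has a line derivative of integral zero. -/
theorem integral_lineDeriv_eq_zero (e : E) (he : ‖e‖ = 1) {f f' : E → ℝ}
    (hf' : Integrable f') (hd : ∀ x, ∀ t : ℝ, HasDerivAt (fun s : ℝ => f (x + s • e)) (f' (x + t • e)) t)
    (hbot : ∀ x, Tendsto (fun s : ℝ => f (x + s • e)) atBot (𝓝 0))
    (htop : ∀ x, Tendsto (fun s : ℝ => f (x + s • e)) atTop (𝓝 0)) : ∫ x, f' x = 0 := by
  rw [integral_slice e he hf']
  have h := (integrable_slice e he hf').prod_right_ae
  rw [integral_eq_zero_of_ae]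
  filter_upwards [h] with x hx
  rw [integral_of_hasDerivAt_of_tendsto (fun t => hd x t) hx (hbot x) (htop x)]
  simp

theorem finrank_orthogonal_span (e : E) (he : ‖e‖ = 1) :
    Module.finrank ℝ (ℝ ∙ e)ᗮ + 1 = Module.finrank ℝ E := by
  have := (ℝ ∙ e).finrank_add_finrank_orthogonal
  rw [finrank_span_singleton (by rintro rfl; simp at he)] at this
  omega

end Slice

end HigherNeumann

namespace HigherNeumann

/-! ### Area formula and Hausdorff measure of graphs. -/

section Area

open scoped ENNReal

/-- The hypothesis makes f₁ constant on the fibres of f₂ in s, so f₁ factors through f₂ by a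
C-Lipschitz map, whichever preimages are chosen. Injectivity of f₂ is not needed. -/
theorem euclideanHausdorffMeasure_image_le_of_dist_le {α X Y : Type*} [MetricSpace X]
    [MetricSpace Y] [MeasurableSpace X] [BorelSpace X] [MeasurableSpace Y] [BorelSpace Y]
    {f₁ : α → X} {f₂ : α → Y} {s : Set α} {C : ℝ≥0} (d : ℕ)
    (h : ∀ x ∈ s, ∀ y ∈ s, dist (f₁ x) (f₁ y) ≤ C * dist (f₂ x) (f₂ y)) :
    μHE[d] (f₁ '' s) ≤ (C : ℝ≥0∞) ^ d * μHE[d] (f₂ '' s) := by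
  classical
  rcases s.eq_empty_or_nonempty with rfl | ⟨x₀, hx₀⟩
  · simp
  have : Nonempty α := ⟨x₀⟩
  have hinv : ∀ x ∈ s, Function.invFunOn f₂ s (f₂ x) ∈ s ∧
      f₂ (Function.invFunOn f₂ s (f₂ x)) = f₂ x := fun x hx =>
    ⟨Function.invFunOn_mem ⟨x, hx, rfl⟩, Function.invFunOn_eq ⟨x, hx, rfl⟩⟩
  have hL : LipschitzOnWith C (fun z => f₁ (Function.invFunOn f₂ s z)) (f₂ '' s) := by
    apply LipschitzOnWith.of_dist_le_mul
    rintro _ ⟨x, hx, rfl⟩ _ ⟨y, hy, rfl⟩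
    have := h _ (hinv x hx).1 _ (hinv y hy).1
    rwa [(hinv x hx).2, (hinv y hy).2] at this
  have him : (fun z => f₁ (Function.invFunOn f₂ s z)) '' (f₂ '' s) = f₁ '' s := by
    rw [image_image]
    apply image_congr
    intro x hx
    have := h _ (hinv x hx).1 _ hx
    rw [(hinv x hx).2, dist_self, mul_zero] at this
    exact dist_le_zero.1 this
  have := hL.hausdorffMeasure_image_le (d := d) (Nat.cast_nonneg d)
  rw [him] at this
  simp only [Measure.euclideanHausdorffMeasure_def, Measure.smul_apply, ENNReal.rpow_natCast,
    Measure.nnreal_smul_coe_apply] at this ⊢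
  calc _ ≤ _ := mul_le_mul_right this _
    _ = _ := mul_left_comm _ _ _

variable {U V : Type*} [NormedAddCommGroup U] [InnerProductSpace ℝ U] [FiniteDimensional ℝ U]
  [MeasurableSpace U] [BorelSpace U] [NormedAddCommGroup V] [InnerProductSpace ℝ V]
  [FiniteDimensional ℝ V] [MeasurableSpace V] [BorelSpace V]

/-- No determinant is computed: the images of the unit ball under the two maps are compared by the
preceding Lipschitz estimate, and the common factor, the volume of the ball, cancels. -/
theorem normDet_le_of_norm_le {L L' : U →L[ℝ] V} {C : ℝ≥0} (h : ∀ z, ‖L z‖ ≤ C * ‖L' z‖) :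
    ENNReal.ofReal (L : U →ₗ[ℝ] V).normDet ≤
      (C : ℝ≥0∞) ^ Module.finrank ℝ U * ENNReal.ofReal (L' : U →ₗ[ℝ] V).normDet := by
  have h1 := euclideanHausdorffMeasure_image_le_of_dist_le (f₁ := L) (f₂ := L')
    (s := Metric.ball 0 1) (C := C) (Module.finrank ℝ U) (by
      intro x _ y _
      rw [dist_eq_norm, dist_eq_norm, ← map_sub, ← map_sub]
      exact h _)
  have h2 := (L : U →ₗ[ℝ] V).euclideanHausdorffMeasure_image_eq_normDet_mul_volume (Metric.ball 0 1)
  have h3 := (L' : U →ₗ[ℝ] V).euclideanHausdorffMeasure_image_eq_normDet_mul_volume (Metric.ball 0 1)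
  simp only [ContinuousLinearMap.coe_coe] at h2 h3
  rw [h2, h3, ← mul_assoc] at h1
  have hpos : volume (Metric.ball (0 : U) 1) ≠ 0 :=
    (Metric.measure_ball_pos volume (0 : U) one_pos).ne'
  have hfin : volume (Metric.ball (0 : U) 1) ≠ ∞ := measure_ball_lt_top.ne
  exact (ENNReal.mul_le_mul_iff_left hpos hfin).1 h1

/-- Area formula for injective maps with Lipschitz derivative that expand lengths infinitesimally. -/
theorem euclideanHausdorffMeasure_image_eq_lintegral_normDet {f : U → V} {f' : U → U →L[ℝ] V}
    {K : ℝ≥0} (hf : ∀ x, HasFDerivAt f (f' x) x) (hK : LipschitzWith K f')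
    (hexp : ∀ x z, ‖z‖ ≤ ‖f' x z‖) (hinj : Function.Injective f)
    {J : U → ℝ} (hJ : Measurable J) (hJf : ∀ x, J x = (f' x : U →ₗ[ℝ] V).normDet)
    {A : Set U} (hA : MeasurableSet A) :
    μHE[Module.finrank ℝ U] (f '' A) = ∫⁻ x in A, ENNReal.ofReal (J x) := by
  set d := Module.finrank ℝ U with hd
  have hcont : Continuous f := continuous_iff_continuousAt.2 fun x => (hf x).continuousAt
  have hemb : MeasurableEmbedding f := hcont.measurableEmbedding hinj
  -- Both inequalities are first proved with a loss c^(2d) for arbitrary c > 1, and c tends to 1 at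
  -- the end. On a set of diameter at most 2δ, one factor c^d comes from comparing f with its
  -- differential at a point, the other from the variation of the Jacobian.
  have key : ∀ c : ℝ≥0, 1 < c →
      μHE[d] (f '' A) ≤ (c : ℝ≥0∞) ^ (2 * d) * ∫⁻ x in A, ENNReal.ofReal (J x) ∧
      ∫⁻ x in A, ENNReal.ofReal (J x) ≤ (c : ℝ≥0∞) ^ (2 * d) * μHE[d] (f '' A) := by
    intro c hc
    have hc' : (1 : ℝ) < c := hc
    obtain ⟨η, hη0, hη1, hη2⟩ : ∃ η : ℝ, 0 < η ∧ 1 + η ≤ c ∧ 1 ≤ c * (1 - η) := by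
      refine ⟨min (c - 1) (1 - 1 / c), lt_min (by linarith) ?_, ?_, ?_⟩
      · rw [sub_pos, div_lt_one (by linarith)]; exact hc'
      · linarith [min_le_left ((c : ℝ) - 1) (1 - 1 / c)]
      · have h1 := min_le_right ((c : ℝ) - 1) (1 - 1 / c)
        have h2 : (c : ℝ) * (1 / c) = 1 := by field_simp
        nlinarith
    obtain ⟨δ, hδ0, hδ⟩ : ∃ δ : ℝ, 0 < δ ∧ K * (2 * δ) ≤ η := by
      refine ⟨η / (2 * (K + 1)), by positivity, ?_⟩
      have : (K : ℝ) * (2 * (η / (2 * (K + 1)))) = η * (K / (K + 1)) := by field_simp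
      rw [this]
      have : (K : ℝ) / (K + 1) ≤ 1 := by
        rw [div_le_one (by positivity)]; linarith
      nlinarith
    have hder : ∀ a x, dist x a ≤ 2 * δ → ‖f' x - f' a‖ ≤ η := by
      intro a x hx
      rw [← dist_eq_norm]
      refine (hK.dist_le_mul x a).trans (le_trans ?_ hδ)
      gcongr
    -- Since `f' a` does not shrink vectors, an error η‖z‖ is at most η‖f' a z‖: absolute errors
    -- become relative ones.
    have hlin : ∀ a x, dist x a ≤ 2 * δ → ∀ z, ‖f' x z‖ ≤ c * ‖f' a z‖ := by
      intro a x hx z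
      have h1 := (f' x - f' a).le_of_opNorm_le (hder a x hx) z
      have h2 : ‖f' x z‖ ≤ ‖f' a z‖ + ‖(f' x - f' a) z‖ := by
        have : f' x z = f' a z + (f' x - f' a) z := by simp
        conv_lhs => rw [this]
        exact norm_add_le _ _
      have h3 := hexp a z
      nlinarith [norm_nonneg z, norm_nonneg (f' a z)]
    have hpt : ∀ p, ∀ a ∈ Metric.ball p δ, ∀ x ∈ Metric.ball p δ, ∀ y ∈ Metric.ball p δ,
        ‖f x - f y - f' a (x - y)‖ ≤ η * ‖x - y‖ := by
      intro p a ha x hx y hy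
      refine (convex_ball p δ).norm_image_sub_le_of_norm_hasFDerivWithin_le' (𝕜 := ℝ)
        (fun z hz => (hf z).hasFDerivWithinAt) (fun z hz => ?_) hy hx
      apply hder
      calc dist z a ≤ dist z p + dist p a := dist_triangle _ _ _
        _ ≤ 2 * δ := by
          rw [Metric.mem_ball] at hz ha
          rw [dist_comm p a]; linarith
    have hsmall : ∀ p, ∀ B ⊆ Metric.ball p δ, MeasurableSet B →
        μHE[d] (f '' B) ≤ (c : ℝ≥0∞) ^ (2 * d) * ∫⁻ x in B, ENNReal.ofReal (J x) ∧
        ∫⁻ x in B, ENNReal.ofReal (J x) ≤ (c : ℝ≥0∞) ^ (2 * d) * μHE[d] (f '' B) := by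
      intro p B hB hBm
      rcases B.eq_empty_or_nonempty with rfl | ⟨a, ha⟩
      · simp
      have hdist : ∀ x ∈ B, ∀ y ∈ B, dist x y ≤ 2 * δ := by
        intro x hx y hy
        have h1 := hB hx
        have h2 := hB hy
        rw [Metric.mem_ball] at h1 h2
        have := dist_triangle_right x y p
        linarith
      have h1 := euclideanHausdorffMeasure_image_le_of_dist_le (f₁ := f) (f₂ := f' a) (s := B)
        (C := c) d (by
          intro x hx y hy
          rw [dist_eq_norm, dist_eq_norm, ← map_sub]
          have h1 := hpt p a (hB ha) x (hB hx) y (hB hy)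
          have h2 := hexp a (x - y)
          have h3 : ‖f x - f y‖ ≤ ‖f' a (x - y)‖ + ‖f x - f y - f' a (x - y)‖ := by
            have := norm_add_le (f' a (x - y)) (f x - f y - f' a (x - y))
            simpa using this
          nlinarith [norm_nonneg (x - y)])
      have h2 := euclideanHausdorffMeasure_image_le_of_dist_le (f₁ := f' a) (f₂ := f) (s := B)
        (C := c) d (by
          intro x hx y hy
          rw [dist_eq_norm, dist_eq_norm, ← map_sub]
          have h1 := hpt p a (hB ha) x (hB hx) y (hB hy)
          have h2 := hexp a (x - y)
          have h3 : ‖f' a (x - y)‖ ≤ ‖f x - f y‖ + ‖f x - f y - f' a (x - y)‖ := by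
            have := norm_sub_le (f x - f y) (f x - f y - f' a (x - y))
            simpa using this
          have h4 : (1 - η) * ‖f' a (x - y)‖ ≤ ‖f x - f y‖ := by
            nlinarith
          have h5 : 1 * ‖f' a (x - y)‖ ≤ c * (1 - η) * ‖f' a (x - y)‖ := by gcongr
          nlinarith)
      have h3 := (f' a : U →ₗ[ℝ] V).euclideanHausdorffMeasure_image_eq_normDet_mul_volume B
      rw [ContinuousLinearMap.coe_coe, ← hJf] at h3
      rw [h3] at h1 h2
      have hJle : ∀ x ∈ B, ENNReal.ofReal (J x) ≤ (c : ℝ≥0∞) ^ d * ENNReal.ofReal (J a) := by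
        intro x hx
        rw [hJf, hJf]
        exact normDet_le_of_norm_le (hlin a x (hdist x hx a ha))
      have hJle' : ∀ x ∈ B, ENNReal.ofReal (J a) ≤ (c : ℝ≥0∞) ^ d * ENNReal.ofReal (J x) := by
        intro x hx
        rw [hJf, hJf]
        exact normDet_le_of_norm_le (hlin x a (hdist a ha x hx))
      constructor
      · refine h1.trans ?_
        have : ENNReal.ofReal (J a) * volume B ≤
            (c : ℝ≥0∞) ^ d * ∫⁻ x in B, ENNReal.ofReal (J x) := by
          rw [← setLIntegral_const, ← lintegral_const_mul _ hJ.ennreal_ofReal]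
          exact setLIntegral_mono' hBm hJle'
        calc _ ≤ (c : ℝ≥0∞) ^ d * ((c : ℝ≥0∞) ^ d * ∫⁻ x in B, ENNReal.ofReal (J x)) := by gcongr
          _ = _ := by rw [← mul_assoc, ← pow_add, two_mul]
      · calc ∫⁻ x in B, ENNReal.ofReal (J x)
            ≤ ∫⁻ x in B, (c : ℝ≥0∞) ^ d * ENNReal.ofReal (J a) := setLIntegral_mono' hBm hJle
          _ = (c : ℝ≥0∞) ^ d * (ENNReal.ofReal (J a) * volume B) := by
            rw [setLIntegral_const, mul_assoc]
          _ ≤ (c : ℝ≥0∞) ^ d * ((c : ℝ≥0∞) ^ d * μHE[d] (f '' B)) := by gcongr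
          _ = _ := by rw [← mul_assoc, ← pow_add, two_mul]
    let P : ℕ → Set U := disjointed fun n => Metric.ball (TopologicalSpace.denseSeq U n) δ
    have hPm : ∀ n, MeasurableSet (P n) := fun n =>
      MeasurableSet.disjointed (fun _ => Metric.isOpen_ball.measurableSet) n
    have hPsub : ∀ n, P n ⊆ Metric.ball (TopologicalSpace.denseSeq U n) δ :=
      fun n => disjointed_subset _ n
    have hPU : ⋃ n, P n = univ := by
      rw [iUnion_disjointed]
      refine eq_univ_of_forall fun x => ?_
      obtain ⟨n, hn⟩ := (TopologicalSpace.denseRange_denseSeq U).exists_dist_lt x hδ0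
      exact mem_iUnion.2 ⟨n, hn⟩
    have hAU : A = ⋃ n, A ∩ P n := by rw [← inter_iUnion, hPU, inter_univ]
    have hdis : Pairwise (Function.onFun Disjoint fun n => A ∩ P n) := fun i j hij =>
      ((disjoint_disjointed _) hij).mono inter_subset_right inter_subset_right
    have hm : ∀ n, MeasurableSet (A ∩ P n) := fun n => hA.inter (hPm n)
    have e1 : μHE[d] (f '' A) = ∑' n, μHE[d] (f '' (A ∩ P n)) := by
      conv_lhs => rw [hAU, image_iUnion]
      rw [measure_iUnion]
      · intro i j hij
        exact (disjoint_image_iff hinj).2 (hdis hij)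
      · exact fun n => hemb.measurableSet_image.2 (hm n)
    have e2 : ∫⁻ x in A, ENNReal.ofReal (J x) = ∑' n, ∫⁻ x in A ∩ P n, ENNReal.ofReal (J x) := by
      conv_lhs => rw [hAU]
      rw [lintegral_iUnion hm hdis]
    have hs := fun n => hsmall _ (A ∩ P n) (inter_subset_right.trans (hPsub n)) (hm n)
    rw [e1, e2, ← ENNReal.tsum_mul_left, ← ENNReal.tsum_mul_left]
    exact ⟨ENNReal.tsum_le_tsum fun n => (hs n).1, ENNReal.tsum_le_tsum fun n => (hs n).2⟩
  have hlim : ∀ X : ℝ≥0∞, Tendsto (fun c : ℝ≥0 => (c : ℝ≥0∞) ^ (2 * d) * X) (𝓝[>] 1) (𝓝 X) := by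
    intro X
    have h1 : Tendsto (fun c : ℝ≥0 => ((c ^ (2 * d) : ℝ≥0) : ℝ≥0∞)) (𝓝[>] 1) (𝓝 1) := by
      rw [← ENNReal.coe_one, ENNReal.tendsto_coe]
      have : Tendsto (fun c : ℝ≥0 => c ^ (2 * d)) (𝓝 1) (𝓝 (1 ^ (2 * d))) :=
        (continuous_pow _).tendsto 1
      rw [one_pow] at this
      exact this.mono_left nhdsWithin_le_nhds
    have := ENNReal.Tendsto.mul_const (b := X) h1 (Or.inl one_ne_zero)
    rw [one_mul] at this
    simpa using this
  apply le_antisymm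
  · exact ge_of_tendsto (hlim _) (eventually_nhdsWithin_of_forall fun c hc => (key c hc).1)
  · exact ge_of_tendsto (hlim _) (eventually_nhdsWithin_of_forall fun c hc => (key c hc).2)

/-- The volume factor of the parametrization of a graph with slope `b`. -/
theorem normDet_graph (e : V) (he : ‖e‖ = 1) (b : (ℝ ∙ e)ᗮ) :
    (((ℝ ∙ e)ᗮ.subtypeL + (innerSL ℝ b).smulRight e : (ℝ ∙ e)ᗮ →L[ℝ] V) :
      (ℝ ∙ e)ᗮ →ₗ[ℝ] V).normDet = √(1 + ‖b‖ ^ 2) := by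
  set L : (ℝ ∙ e)ᗮ →L[ℝ] V := (ℝ ∙ e)ᗮ.subtypeL + (innerSL ℝ b).smulRight e with hL
  rw [eq_comm, Real.sqrt_eq_iff_eq_sq (by positivity) (LinearMap.normDet_nonneg _)]
  have B := stdOrthonormalBasis ℝ (ℝ ∙ e)ᗮ
  have h := LinearMap.normDet_sq_eq_det_gram (L : (ℝ ∙ e)ᗮ →ₗ[ℝ] V) B
  -- In an orthonormal basis the Gram matrix is the identity plus the rank-one matrix built from the
  -- coordinates of b; its determinant is 1 + ‖b‖² by the matrix determinant lemma.
  have hgram : Matrix.gram ℝ (fun i => (L : (ℝ ∙ e)ᗮ →ₗ[ℝ] V) (B i)) =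
      1 + Matrix.replicateCol Unit (fun i => inner ℝ b (B i)) *
        Matrix.replicateRow Unit (fun i => inner ℝ b (B i)) := by
    ext i j
    have hij := orthonormal_iff_ite.1 B.orthonormal i j
    simp only [Matrix.gram_apply, ContinuousLinearMap.coe_coe, hL, add_apply,
      Submodule.subtypeL_apply, ContinuousLinearMap.smulRight_apply, innerSL_apply_apply,
      inner_add_left, inner_add_right, real_inner_smul_left, real_inner_smul_right,
      inner_coe_orthogonal_span, real_inner_self_eq_norm_sq, he, Matrix.add_apply, Matrix.one_apply,
      Matrix.mul_apply, Matrix.replicateCol_apply, Matrix.replicateRow_apply, Finset.univ_unique,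
      Finset.sum_singleton, ← Submodule.coe_inner, hij]
    rw [real_inner_comm e, inner_coe_orthogonal_span]
    simp [mul_comm]
  rw [hgram, Matrix.det_one_add_replicateCol_mul_replicateRow] at h
  simp only [RCLike.ofReal_real_eq_id, id_eq] at h
  rw [h]
  congr 1
  rw [← B.sum_sq_norm_inner_right b]
  simp only [dotProduct, Real.norm_eq_abs, sq_abs, ← sq]
  exact Finset.sum_congr rfl fun i _ => by rw [real_inner_comm]

/-- The parametrization of the graph of `γ` over the hyperplane orthogonal to `e`. -/
noncomputable def graphMap (e : V) (γ : (ℝ ∙ e)ᗮ → ℝ) (h : (ℝ ∙ e)ᗮ) : V := (h : V) + γ h • e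

theorem graphMap_injective (e : V) (he : ‖e‖ = 1) (γ : (ℝ ∙ e)ᗮ → ℝ) :
    Function.Injective (graphMap e γ) := fun h h' hh => by
  have := congrArg ((ℝ ∙ e)ᗮ.orthogonalProjectionOnto) hh
  rwa [graphMap, graphMap, orthogonalProjectionOnto_add_smul e he,
    orthogonalProjectionOnto_add_smul e he] at this

theorem continuous_graphMap (e : V) {γ : (ℝ ∙ e)ᗮ → ℝ} (hγ : Continuous γ) :
    Continuous (graphMap e γ) := by unfold graphMap; fun_prop

theorem measurableEmbedding_graphMap (e : V) (he : ‖e‖ = 1) {γ : (ℝ ∙ e)ᗮ → ℝ}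
    (hγ : Continuous γ) : MeasurableEmbedding (graphMap e γ) :=
  (continuous_graphMap e hγ).measurableEmbedding (graphMap_injective e he γ)

theorem lipschitzWith_gradient {H : Type*} [NormedAddCommGroup H] [InnerProductSpace ℝ H]
    [CompleteSpace H] {γ : H → ℝ} {K : ℝ≥0} (hK : LipschitzWith K (fderiv ℝ γ)) :
    LipschitzWith K (∇ γ) := by
  have := (InnerProductSpace.toDual ℝ H).symm.lipschitz.comp hK
  rwa [one_mul] at this

/-- This expresses the surface measure in graph coordinates. The area formula applies because the
differential z ↦ z + ⟨∇γ, z⟩e does not shrink lengths, by Pythagoras, and inherits its Lipschitz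
constant from that of γ. -/
theorem map_graphMap_eq_restrict (e : V) (he : ‖e‖ = 1) {γ : (ℝ ∙ e)ᗮ → ℝ}
    (hγ : Differentiable ℝ γ) {K : ℝ≥0} (hK : LipschitzWith K (fderiv ℝ γ)) :
    (μHE[Module.finrank ℝ V - 1] : Measure V).restrict (range (graphMap e γ)) =
      (volume.withDensity fun h => ENNReal.ofReal √(1 + ‖∇ γ h‖ ^ 2)).map (graphMap e γ) := by
  have hemb := measurableEmbedding_graphMap e he hγ.continuous
  have hgc : Continuous (∇ γ) := (lipschitzWith_gradient hK).continuous
  have hrank : Module.finrank ℝ V - 1 = Module.finrank ℝ (ℝ ∙ e)ᗮ := by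
    have := finrank_orthogonal_span e he
    omega
  ext S hS
  rw [Measure.restrict_apply hS, hemb.map_apply, withDensity_apply _ (hemb.measurable hS),
    ← image_preimage_eq_inter_range, hrank]
  refine euclideanHausdorffMeasure_image_eq_lintegral_normDet (K := K)
    (f' := fun h => (ℝ ∙ e)ᗮ.subtypeL + (innerSL ℝ (∇ γ h)).smulRight e) ?_ ?_ ?_
    (graphMap_injective e he γ) ?_ ?_ (hemb.measurable hS)
  · intro x
    have h1 := (hγ x).hasGradientAt.hasFDerivAt
    have h2 : HasFDerivAt (fun h : (ℝ ∙ e)ᗮ => (h : V)) (ℝ ∙ e)ᗮ.subtypeL x :=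
      (ℝ ∙ e)ᗮ.subtypeL.hasFDerivAt
    exact h2.add (h1.smul_const e)
  · refine LipschitzWith.of_dist_le_mul fun x y => ?_
    rw [dist_eq_norm, add_sub_add_left_eq_sub]
    refine ContinuousLinearMap.opNorm_le_bound _ (by positivity) fun z => ?_
    have h1 := (lipschitzWith_gradient hK).dist_le_mul x y
    rw [dist_eq_norm] at h1
    simp only [sub_apply, ContinuousLinearMap.smulRight_apply,
      innerSL_apply_apply]
    rw [← sub_smul, ← inner_sub_left, norm_smul, he, mul_one]
    exact (norm_inner_le_norm _ _).trans (by gcongr)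
  · intro x z
    simp only [add_apply, ContinuousLinearMap.smulRight_apply,
      innerSL_apply_apply, Submodule.subtypeL_apply]
    have := norm_sq_add_smul e he z (inner ℝ (∇ γ x) z)
    exact le_of_sq_le_sq (by rw [this]; nlinarith [sq_nonneg (inner ℝ (∇ γ x) z)]) (norm_nonneg _)
  · fun_prop
  · exact fun x => (normDet_graph e he _).symm

end Area

end HigherNeumann

namespace HigherNeumann

/-! ### Divergence in coordinates. -/

section Coordinates

variable {N : ℕ}

theorem sum_coord_smul_apply (L : Euc N →L[ℝ] ℝ) (v : Euc N) :
    ∑ i, L (EuclideanSpace.single i 1) * v i = L v := by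
  have := (EuclideanSpace.basisFun (Fin N) ℝ).sum_repr v
  conv_rhs => rw [← this]
  rw [map_sum]
  refine Finset.sum_congr rfl fun i _ => ?_
  simp [mul_comm]

theorem fderiv_coord {F : Euc N → Euc N} {x : Euc N} (hF : DifferentiableAt ℝ F x) (i : Fin N)
    (v : Euc N) : fderiv ℝ (fun y => F y i) x v = fderiv ℝ F x v i := by
  have := ((EuclideanSpace.proj i : Euc N →L[ℝ] ℝ).hasFDerivAt (x := F x)).comp x hF.hasFDerivAt
  have h2 := this.fderiv
  have h3 : (⇑(EuclideanSpace.proj i : Euc N →L[ℝ] ℝ) ∘ F) = fun y => F y i := rfl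
  rw [h3] at h2
  rw [h2]; rfl

theorem contDiff_coord {F : Euc N → Euc N} {n : WithTop ℕ∞} (hF : ContDiff ℝ n F) (i : Fin N) :
    ContDiff ℝ n fun y => F y i :=
  (EuclideanSpace.proj i : Euc N →L[ℝ] ℝ).contDiff.comp hF

theorem continuous_divergence {F : Euc N → Euc N} (hF : ContDiff ℝ 1 F) :
    Continuous (divergence F) := by
  have h1 := hF.continuous_fderiv one_ne_zero
  unfold divergence
  refine continuous_finsetSum _ fun i _ => ?_
  exact (EuclideanSpace.proj i : Euc N →L[ℝ] ℝ).continuous.comp (h1.clm_apply continuous_const)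

theorem hasCompactSupport_divergence {F : Euc N → Euc N} (hF : HasCompactSupport F) :
    HasCompactSupport (divergence F) := by
  have h1 := hF.fderiv (𝕜 := ℝ)
  refine h1.mono fun x hx => ?_
  contrapose! hx
  simp only [Function.mem_support, not_not] at hx ⊢
  simp [divergence, hx]

/-- Coordinatewise integration by parts without boundary term. It is applied with χ a smoothed
indicator of a subgraph, and with χ = 1 for interior patches. -/
theorem integral_mul_divergence {χ : Euc N → ℝ} {F : Euc N → Euc N} (hχ : ContDiff ℝ 1 χ)
    (hF : ContDiff ℝ 1 F) (hc : HasCompactSupport F) :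
    ∫ x, χ x * divergence F x = -∫ x, fderiv ℝ χ x (F x) := by
  have hsupp : ∀ i, HasCompactSupport fun x => F x i := fun i =>
    hc.comp_left (g := fun v : Euc N => v i) rfl
  have hχd := hχ.continuous_fderiv one_ne_zero
  have hFi := fun i => contDiff_coord hF i
  have hI1 : ∀ i, Integrable fun x => χ x * fderiv ℝ (fun y => F y i) x (EuclideanSpace.single i 1) := by
    intro i
    refine Continuous.integrable_of_hasCompactSupport ?_ ?_
    · exact hχ.continuous.mul (((hFi i).continuous_fderiv one_ne_zero).clm_apply continuous_const)
    · refine HasCompactSupport.mul_left ?_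
      exact ((hsupp i).fderiv (𝕜 := ℝ)).comp_left (g := fun L : Euc N →L[ℝ] ℝ => L _) rfl
  have hI2 : ∀ i, Integrable fun x => fderiv ℝ χ x (EuclideanSpace.single i 1) * F x i := by
    intro i
    refine Continuous.integrable_of_hasCompactSupport ?_ ?_
    · exact (hχd.clm_apply continuous_const).mul (hFi i).continuous
    · exact (hsupp i).mul_left
  have hI3 : ∀ i, Integrable fun x => χ x * F x i := fun i =>
    Continuous.integrable_of_hasCompactSupport (hχ.continuous.mul (hFi i).continuous)
      (hsupp i).mul_left
  have key : ∀ i, ∫ x, χ x * fderiv ℝ (fun y => F y i) x (EuclideanSpace.single i 1) =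
      -∫ x, fderiv ℝ χ x (EuclideanSpace.single i 1) * F x i := fun i =>
    integral_mul_fderiv_eq_neg_fderiv_mul_of_integrable (hI2 i) (hI1 i) (hI3 i)
      (fun x _ => (hχ.differentiable one_ne_zero) x)
      (fun x _ => ((hFi i).differentiable one_ne_zero) x)
  have e1 : (fun x => χ x * divergence F x) = fun x => ∑ i, χ x *
      fderiv ℝ (fun y => F y i) x (EuclideanSpace.single i 1) := by
    ext x
    rw [divergence, Finset.mul_sum]
    exact Finset.sum_congr rfl fun i _ => by
      rw [fderiv_coord ((hF.differentiable one_ne_zero) x)]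
  have e2 : (fun x => fderiv ℝ χ x (F x)) = fun x => ∑ i,
      fderiv ℝ χ x (EuclideanSpace.single i 1) * F x i := by
    ext x
    rw [sum_coord_smul_apply]
  rw [e1, e2, integral_finsetSum _ fun i _ => hI1 i, integral_finsetSum _ fun i _ => hI2 i,
    ← Finset.sum_neg_distrib]
  exact Finset.sum_congr rfl fun i _ => key i

end Coordinates

/-! ### Gauss-Green formula below a graph. -/

section Subgraph

variable {N : ℕ}

theorem integral_deriv_smoothTransition : ∫ τ, deriv Real.smoothTransition τ = 1 := by
  have hd : Differentiable ℝ Real.smoothTransition :=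
    Real.smoothTransition.contDiff.differentiable (n := 1) one_ne_zero
  have hc : Continuous (deriv Real.smoothTransition) :=
    Real.smoothTransition.contDiff.continuous_deriv (n := 1) le_rfl
  have h0 : ∀ τ ∉ Icc (0 : ℝ) 1, deriv Real.smoothTransition τ = 0 := by
    intro τ hτ
    rw [mem_Icc, not_and_or, not_le, not_le] at hτ
    rcases hτ with hτ | hτ
    · have : Real.smoothTransition =ᶠ[𝓝 τ] fun _ => 0 := by
        filter_upwards [Iio_mem_nhds hτ] with x hx
        exact Real.smoothTransition.zero_of_nonpos (le_of_lt hx)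
      rw [this.deriv_eq]; simp
    · have : Real.smoothTransition =ᶠ[𝓝 τ] fun _ => 1 := by
        filter_upwards [Ioi_mem_nhds hτ] with x hx
        exact Real.smoothTransition.one_of_one_le (le_of_lt hx)
      rw [this.deriv_eq]; simp
  have hint : Integrable (deriv Real.smoothTransition) :=
    hc.integrable_of_hasCompactSupport (HasCompactSupport.intro isCompact_Icc h0)
  rw [integral_of_hasDerivAt_of_tendsto (m := 0) (n := 1) (fun x => (hd x).hasDerivAt) hint]
  · simp
  · refine tendsto_const_nhds.congr' ?_
    filter_upwards [eventually_le_atBot 0] with x hx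
    exact (Real.smoothTransition.zero_of_nonpos hx).symm
  · refine tendsto_const_nhds.congr' ?_
    filter_upwards [eventually_ge_atTop 1] with x hx
    exact (Real.smoothTransition.one_of_one_le hx).symm

theorem deriv_smoothTransition_eq_zero {τ : ℝ} (hτ : τ ∉ Icc (0 : ℝ) 1) :
    deriv Real.smoothTransition τ = 0 := by
  rw [mem_Icc, not_and_or, not_le, not_le] at hτ
  rcases hτ with hτ | hτ
  · have : Real.smoothTransition =ᶠ[𝓝 τ] fun _ => 0 := by
      filter_upwards [Iio_mem_nhds hτ] with x hx
      exact Real.smoothTransition.zero_of_nonpos (le_of_lt hx)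
    rw [this.deriv_eq]; simp
  · have : Real.smoothTransition =ᶠ[𝓝 τ] fun _ => 1 := by
      filter_upwards [Ioi_mem_nhds hτ] with x hx
      exact Real.smoothTransition.one_of_one_le (le_of_lt hx)
    rw [this.deriv_eq]; simp

/-- Gauss-Green formula on the subgraph of a `C¹` function, with the surface integral written in
the parametrization of the graph. -/
theorem integral_divergence_subgraph {e : Euc N} (he : ‖e‖ = 1) {γ : (ℝ ∙ e)ᗮ → ℝ}
    (hγ : ContDiff ℝ 1 γ) {F : Euc N → Euc N} (hF : ContDiff ℝ 1 F) (hc : HasCompactSupport F) :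
    ∫ y in {y | inner ℝ e y < γ ((ℝ ∙ e)ᗮ.orthogonalProjectionOnto y)}, divergence F y =
      ∫ h : (ℝ ∙ e)ᗮ, inner ℝ (F (graphMap e γ h)) (e - ((∇ γ h : (ℝ ∙ e)ᗮ) : Euc N)) := by
  set P := (ℝ ∙ e)ᗮ.orthogonalProjectionOnto with hP
  set G : Euc N → ℝ := fun y => inner ℝ e y - γ (P y) with hG
  have hγc : Continuous γ := hγ.continuous
  have hgc : Continuous (∇ γ) :=
    (InnerProductSpace.toDual ℝ (ℝ ∙ e)ᗮ).symm.continuous.comp (hγ.continuous_fderiv one_ne_zero)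
  have hGC : ContDiff ℝ 1 G := (contDiff_const.inner ℝ contDiff_id).sub (hγ.comp P.contDiff)
  have hφC : ContDiff ℝ 1 Real.smoothTransition := Real.smoothTransition.contDiff (n := 1)
  have hφ'c : Continuous (deriv Real.smoothTransition) := hφC.continuous_deriv le_rfl
  have hGfd : ∀ y v, fderiv ℝ G y v = inner ℝ v (e - ((∇ γ (P y) : (ℝ ∙ e)ᗮ) : Euc N)) := by
    intro y v
    have h1 : HasFDerivAt (fun y : Euc N => inner ℝ e y) (innerSL ℝ e) y :=
      (innerSL ℝ e).hasFDerivAt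
    have h2 := (((hγ.differentiable one_ne_zero) (P y)).hasGradientAt.hasFDerivAt).comp y
      (P.hasFDerivAt (x := y))
    have h3 := h1.sub h2
    have : fderiv ℝ G y = _ := h3.fderiv
    rw [this]
    simp only [sub_apply, innerSL_apply_apply, ContinuousLinearMap.comp_apply,
      InnerProductSpace.toDual_apply_apply, inner_sub_right]
    rw [real_inner_comm, real_inner_comm ((∇ γ (P y) : (ℝ ∙ e)ᗮ) : Euc N) v]
    congr 1
    have : v = (P v : Euc N) + (inner ℝ e v : ℝ) • e := ((sliceEquiv e he).left_inv v).symm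
    conv_rhs => rw [this, inner_add_right, real_inner_smul_right, real_inner_comm e,
      inner_coe_orthogonal_span]
    rw [Submodule.coe_inner]; ring
  obtain ⟨R, hR0, hR⟩ : ∃ R, 0 < R ∧ ∀ y, F y ≠ 0 → ‖y‖ ≤ R := by
    obtain ⟨R, hR0, hR⟩ := hc.isCompact.isBounded.exists_pos_norm_le
    exact ⟨R, hR0, fun y hy => hR y (subset_tsupport _ hy)⟩
  obtain ⟨M₁, hM₁⟩ := hF.continuous.bounded_above_of_compact_support hc
  obtain ⟨M₂, hM₂⟩ := (isCompact_closedBall (0 : (ℝ ∙ e)ᗮ) R).exists_bound_of_continuousOn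
    (f := fun h : (ℝ ∙ e)ᗮ => e - ((∇ γ h : (ℝ ∙ e)ᗮ) : Euc N)) (by fun_prop)
  have hM₁0 : 0 ≤ M₁ := (norm_nonneg _).trans (hM₁ 0)
  have hM₂0 : 0 ≤ M₂ := (norm_nonneg _).trans (hM₂ 0 (by simp [hR0.le]))
  obtain ⟨M₃, hM₃⟩ := (isCompact_Icc (a := (0 : ℝ)) (b := 1)).exists_bound_of_continuousOn
    hφ'c.continuousOn
  have hnorm : ∀ (h : (ℝ ∙ e)ᗮ) (t : ℝ), ‖h‖ ≤ ‖(h : Euc N) + t • e‖ := by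
    intro h t
    refine le_of_sq_le_sq ?_ (norm_nonneg _)
    rw [norm_sq_add_smul e he]; nlinarith [sq_nonneg t]
  have hbd : ∀ (h : (ℝ ∙ e)ᗮ) (t : ℝ), |inner ℝ (F (h + t • e)) (e - ((∇ γ h : (ℝ ∙ e)ᗮ) : Euc N))| ≤
      (Metric.closedBall (0 : (ℝ ∙ e)ᗮ) R).indicator (fun _ => M₁ * M₂) h := by
    intro h t
    by_cases hh : h ∈ Metric.closedBall (0 : (ℝ ∙ e)ᗮ) R
    · rw [indicator_of_mem hh]
      exact (abs_real_inner_le_norm _ _).trans (by gcongr; exacts [hM₁ _, hM₂ h hh])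
    · rw [indicator_of_notMem hh]
      have : F (h + t • e) = 0 := by
        by_contra hne
        exact hh (by simpa using (hnorm h t).trans (hR _ hne))
      simp [this]
  set c : ℕ → ℝ := fun n => n + 1 with hcdef
  have hcpos : ∀ n, 0 < c n := fun n => by positivity
  have hctop : Tendsto c atTop atTop :=
    tendsto_atTop_add_const_right _ _ tendsto_natCast_atTop_atTop
  -- `χ n` vanishes where G ≥ 0 and equals 1 where G ≤ -1/c n, so it converges to the indicator of
  -- the subgraph while its gradient lives in the layer 0 ≤ -G ≤ 1/c n.
  set χ : ℕ → Euc N → ℝ := fun n y => Real.smoothTransition (-c n * G y) with hχ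
  have hχC : ∀ n, ContDiff ℝ 1 (χ n) := fun n => hφC.comp (contDiff_const.mul hGC)
  have hχfd : ∀ n y v, fderiv ℝ (χ n) y v =
      -(c n * deriv Real.smoothTransition (-c n * G y)) * inner ℝ v (e - ((∇ γ (P y) : (ℝ ∙ e)ᗮ) : Euc N)) := by
    intro n y v
    have h1 := ((hGC.differentiable one_ne_zero) y).hasFDerivAt.const_mul (-c n)
    have h2 := ((hφC.differentiable one_ne_zero) (-c n * G y)).hasDerivAt.comp_hasFDerivAt y h1
    have h3 : fderiv ℝ (χ n) y = _ := h2.fderiv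
    rw [h3]
    simp only [smul_apply, hGfd, smul_eq_mul]
    ring
  -- rewrite the right-hand side of the integration by parts formula
  have hstep : ∀ n, ∫ y, χ n y * divergence F y = ∫ q : (ℝ ∙ e)ᗮ × ℝ,
      deriv Real.smoothTransition q.2 *
        inner ℝ (F (q.1 + (γ q.1 - q.2 / c n) • e)) (e - ((∇ γ q.1 : (ℝ ∙ e)ᗮ) : Euc N))
        ∂(volume.prod volume) := by
    intro n
    rw [integral_mul_divergence (hχC n) hF hc]
    have hint : Integrable fun y => fderiv ℝ (χ n) y (F y) := by
      refine Continuous.integrable_of_hasCompactSupport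
        (((hχC n).continuous_fderiv one_ne_zero).clm_apply hF.continuous) ?_
      refine hc.mono fun y hy => ?_
      contrapose! hy
      simp only [Function.mem_support, not_not] at hy ⊢
      simp [hy]
    have hint2 : Integrable (fun q : (ℝ ∙ e)ᗮ × ℝ => deriv Real.smoothTransition q.2 *
        inner ℝ (F (q.1 + (γ q.1 - q.2 / c n) • e)) (e - ((∇ γ q.1 : (ℝ ∙ e)ᗮ) : Euc N)))
        (volume.prod volume) := by
      refine Continuous.integrable_of_hasCompactSupport ?_ ?_
      · have := hF.continuous
        fun_prop
      · refine HasCompactSupport.intro ((isCompact_closedBall (0 : (ℝ ∙ e)ᗮ) R).prod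
          (isCompact_Icc (a := (0 : ℝ)) (b := 1))) ?_
        rintro ⟨h, τ⟩ hq
        rw [mem_prod, not_and_or] at hq
        rcases hq with hq | hq
        · have := hbd h (γ h - τ / c n)
          rw [indicator_of_notMem hq] at this
          have := abs_nonpos_iff.1 this
          simp [this]
        · simp only at hq
          simp [deriv_smoothTransition_eq_zero hq]
    rw [integral_slice e he hint, integral_prod _ hint2, ← integral_neg]
    congr 1
    ext h
    have e1 : ∀ t : ℝ, fderiv ℝ (χ n) (h + t • e) (F (h + t • e)) =
        (fun t => -(c n * deriv Real.smoothTransition (c n * (γ h - t))) *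
          inner ℝ (F (h + t • e)) (e - ((∇ γ h : (ℝ ∙ e)ᗮ) : Euc N))) t := by
      intro t
      rw [hχfd]
      simp only [hG, hP, orthogonalProjectionOnto_add_smul e he, inner_add_smul e he]
      congr 4
      ring
    -- The substitution τ = c n (γ h - t) on each vertical line absorbs the factor c n of the
    -- gradient. The profile `deriv Real.smoothTransition τ` becomes independent of n, and dominated
    -- convergence applies.
    rw [integral_congr_ae (Eventually.of_forall e1), ← integral_sub_left_eq_self _ _ (γ h),
      ← integral_neg]
    have := Measure.integral_comp_div (fun t => -((fun t =>
      -(c n * deriv Real.smoothTransition (c n * (γ h - t))) *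
          inner ℝ (F (h + t • e)) (e - ((∇ γ h : (ℝ ∙ e)ᗮ) : Euc N))) (γ h - t))) (c n)
    rw [abs_of_pos (hcpos n), smul_eq_mul, eq_comm, mul_comm, ← eq_div_iff (hcpos n).ne'] at this
    rw [this, ← integral_div]
    congr 1
    ext τ
    have := (hcpos n).ne'
    simp only [sub_sub_cancel, mul_div_cancel₀ _ this]
    field_simp
  have hl1 : Tendsto (fun n => ∫ y, χ n y * divergence F y) atTop
      (𝓝 (∫ y in {y | inner ℝ e y < γ (P y)}, divergence F y)) := by
    have hmeas : MeasurableSet {y : Euc N | inner ℝ e y < γ (P y)} :=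
      (isOpen_lt (by fun_prop) (by fun_prop)).measurableSet
    rw [← integral_indicator hmeas]
    have hdc := continuous_divergence hF
    refine tendsto_integral_of_dominated_convergence (fun y => ‖divergence F y‖) ?_ ?_ ?_ ?_
    · exact fun n => ((hχC n).continuous.mul hdc).aestronglyMeasurable
    · exact (hdc.integrable_of_hasCompactSupport (hasCompactSupport_divergence hc)).norm
    · intro n
      refine Eventually.of_forall fun y => ?_
      rw [norm_mul, Real.norm_eq_abs, abs_of_nonneg (Real.smoothTransition.nonneg _)]
      exact mul_le_of_le_one_left (norm_nonneg _) (Real.smoothTransition.le_one _)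
    · refine Eventually.of_forall fun y => ?_
      by_cases hy : G y < 0
      · rw [indicator_of_mem (by exact sub_neg.1 hy)]
        refine tendsto_const_nhds.congr' ?_
        have : Tendsto (fun n => -c n * G y) atTop atTop := by
          have := hctop.atTop_mul_const (neg_pos.2 hy)
          refine this.congr fun n => by ring
        filter_upwards [this.eventually_ge_atTop 1] with n hn
        simp only [hχ]
        rw [Real.smoothTransition.one_of_one_le hn, one_mul]
      · rw [indicator_of_notMem (by simpa [hG] using hy)]
        refine tendsto_const_nhds.congr fun n => ?_
        simp only [hχ]
        rw [Real.smoothTransition.zero_of_nonpos, zero_mul]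
        have := hcpos n
        nlinarith
  have hl2 : Tendsto (fun n => ∫ y, χ n y * divergence F y) atTop
      (𝓝 (∫ q : (ℝ ∙ e)ᗮ × ℝ, deriv Real.smoothTransition q.2 *
        inner ℝ (F (graphMap e γ q.1)) (e - ((∇ γ q.1 : (ℝ ∙ e)ᗮ) : Euc N)) ∂(volume.prod volume))) := by
    simp_rw [hstep]
    refine tendsto_integral_of_dominated_convergence
      ((Metric.closedBall (0 : (ℝ ∙ e)ᗮ) R ×ˢ Icc (0 : ℝ) 1).indicator fun _ => M₃ * (M₁ * M₂))
      ?_ ?_ ?_ ?_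
    · intro n
      have := hF.continuous
      refine Continuous.aestronglyMeasurable ?_
      fun_prop
    · rw [integrable_indicator_iff ((Metric.isClosed_closedBall).measurableSet.prod measurableSet_Icc)]
      refine integrableOn_const ?_
      rw [Measure.prod_prod]
      exact ENNReal.mul_ne_top (measure_closedBall_lt_top).ne (by simp)
    · intro n
      refine Eventually.of_forall ?_
      rintro ⟨h, τ⟩
      have h1 := hbd h (γ h - τ / c n)
      simp only
      rw [norm_mul, Real.norm_eq_abs (inner ℝ _ _)]
      by_cases hτ : τ ∈ Icc (0 : ℝ) 1
      · by_cases hh : h ∈ Metric.closedBall (0 : (ℝ ∙ e)ᗮ) R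
        · rw [indicator_of_mem (mem_prod.2 ⟨hh, hτ⟩)]
          rw [indicator_of_mem hh] at h1
          have := hM₃ τ hτ
          gcongr
          exact (norm_nonneg _).trans this
        · rw [indicator_of_notMem hh] at h1
          rw [indicator_of_notMem fun h => hh (mem_prod.1 h).1, le_antisymm h1 (abs_nonneg _)]
          simp
      · rw [indicator_of_notMem fun h => hτ (mem_prod.1 h).2, deriv_smoothTransition_eq_zero hτ]
        simp
    · refine Eventually.of_forall ?_
      rintro ⟨h, τ⟩
      have h1 : Tendsto (fun n => τ / c n) atTop (𝓝 0) := hctop.const_div_atTop τ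
      have h2 : Continuous fun s : ℝ => deriv Real.smoothTransition τ *
        inner ℝ (F (h + (γ h - s) • e)) (e - ((∇ γ h : (ℝ ∙ e)ᗮ) : Euc N)) := by
        have := hF.continuous
        fun_prop
      have h3 := (h2.tendsto 0).comp h1
      simpa [graphMap, Function.comp_def] using h3
  rw [tendsto_nhds_unique hl1 hl2]
  -- In the limit the variables separate, and the τ-integral contributes the total mass 1 of the
  -- transition.
  have := integral_prod_mul (μ := (volume : Measure ℝ)) (ν := (volume : Measure (ℝ ∙ e)ᗮ))
    (deriv Real.smoothTransition)
    (fun h : (ℝ ∙ e)ᗮ => inner ℝ (F (graphMap e γ h)) (e - ((∇ γ h : (ℝ ∙ e)ᗮ) : Euc N)))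
  rw [← integral_prod_swap, integral_deriv_smoothTransition, one_mul] at this
  exact this

end Subgraph

end HigherNeumann

namespace HigherNeumann

/-! ### Graph charts, normals and the two-sided paraboloid condition. -/

section Charts

/-- The mean value inequality on the closed ball about a through b, where the derivative differs
from its value at a by at most K‖b - a‖. The constant K is not optimal, but suffices. -/
theorem norm_sub_sub_fderiv_le {H F : Type*} [NormedAddCommGroup H] [NormedSpace ℝ H]
    [NormedAddCommGroup F] [NormedSpace ℝ F] {γ : H → F} (hγ : Differentiable ℝ γ) {K : ℝ≥0}
    (hK : LipschitzWith K (fderiv ℝ γ)) (a b : H) :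
    ‖γ b - γ a - fderiv ℝ γ a (b - a)‖ ≤ K * ‖b - a‖ ^ 2 := by
  have := (convex_closedBall a ‖b - a‖).norm_image_sub_le_of_norm_hasFDerivWithin_le' (𝕜 := ℝ)
    (f := γ) (f' := fderiv ℝ γ) (φ := fderiv ℝ γ a) (x := a) (y := b) (C := K * ‖b - a‖)
    (fun z _ => (hγ z).hasFDerivAt.hasFDerivWithinAt) (fun z hz => ?_)
    (Metric.mem_closedBall_self (norm_nonneg _)) (by simp [dist_eq_norm])
  · rwa [mul_assoc, ← sq] at this
  · rw [← dist_eq_norm]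
    refine (hK.dist_le_mul z a).trans ?_
    gcongr
    exact hz

variable {N : ℕ}

/-- A local description of `Ω` near `z` as a strict subgraph. -/
structure GraphChart (Ω : Set (Euc N)) (z : Euc N) where
  e : Euc N
  norm_e : ‖e‖ = 1
  r : ℝ
  r_pos : 0 < r
  γ : (ℝ ∙ e)ᗮ → ℝ
  differentiable : Differentiable ℝ γ
  K : ℝ≥0
  lipschitz : LipschitzWith K (fderiv ℝ γ)
  mem_iff : ∀ y ∈ Metric.ball z r, y ∈ Ω ↔ inner ℝ e y < γ ((ℝ ∙ e)ᗮ.orthogonalProjectionOnto y)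

/-- Only the restriction of g to the hyperplane orthogonal to e matters, and restricting does not
increase the Lipschitz constant of the derivative. -/
theorem IsBoundedC11Domain.nonempty_graphChart {Ω : Set (Euc N)} (hΩ : IsBoundedC11Domain Ω)
    {z : Euc N} (hz : z ∈ frontier Ω) : Nonempty (GraphChart Ω z) := by
  obtain ⟨e, g, r, he, hr, hg, ⟨K, hK⟩, hmem⟩ := hΩ.boundary z hz
  have hd : ∀ h : (ℝ ∙ e)ᗮ, HasFDerivAt (fun h : (ℝ ∙ e)ᗮ => g h)
      ((fderiv ℝ g h) ∘L (ℝ ∙ e)ᗮ.subtypeL) h := fun h =>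
    (hg h).hasFDerivAt.comp h (ℝ ∙ e)ᗮ.subtypeL.hasFDerivAt
  refine ⟨⟨e, he, r, hr, fun h => g h, fun h => (hd h).differentiableAt, K, ?_, ?_⟩⟩
  · refine LipschitzWith.of_dist_le_mul fun x y => ?_
    rw [(hd x).fderiv, (hd y).fderiv, dist_eq_norm, ← ContinuousLinearMap.sub_comp]
    refine (ContinuousLinearMap.opNorm_comp_le _ _).trans ?_
    have h1 := hK.dist_le_mul (x : Euc N) y
    rw [dist_eq_norm] at h1
    calc _ ≤ ‖fderiv ℝ g x - fderiv ℝ g y‖ * 1 := by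
          gcongr
          exact Submodule.norm_subtypeL_le _
      _ ≤ K * dist x y := by rw [mul_one]; exact h1
  · intro y hy
    rw [hmem y hy, coe_projection_eq e he]

namespace GraphChart

variable {Ω : Set (Euc N)} {z : Euc N} (C : GraphChart Ω z)

/-- The projection to the hyperplane of a chart. -/
noncomputable def proj : Euc N →L[ℝ] (ℝ ∙ C.e)ᗮ := (ℝ ∙ C.e)ᗮ.orthogonalProjectionOnto

theorem contDiff : ContDiff ℝ 1 C.γ :=
  contDiff_one_iff_fderiv.2 ⟨C.differentiable, C.lipschitz.continuous⟩

theorem norm_proj_le (y : Euc N) : ‖C.proj y‖ ≤ ‖y‖ :=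
  (ℝ ∙ C.e)ᗮ.norm_orthogonalProjectionOnto_apply_le y

theorem proj_add_smul (h : (ℝ ∙ C.e)ᗮ) (t : ℝ) : C.proj ((h : Euc N) + t • C.e) = h :=
  orthogonalProjectionOnto_add_smul C.e C.norm_e h t

theorem inner_add_smul (h : (ℝ ∙ C.e)ᗮ) (t : ℝ) : inner ℝ C.e ((h : Euc N) + t • C.e) = t :=
  HigherNeumann.inner_add_smul C.e C.norm_e h t

theorem proj_add_inner_smul (y : Euc N) :
    (C.proj y : Euc N) + (inner ℝ C.e y : ℝ) • C.e = y := (sliceEquiv C.e C.norm_e).left_inv y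

theorem mem_iff' {y : Euc N} (hy : y ∈ Metric.ball z C.r) :
    y ∈ Ω ↔ inner ℝ C.e y < C.γ (C.proj y) := C.mem_iff y hy

/-- A point strictly above the graph has a neighbourhood that misses Ω, while a point y on the graph
is the limit of the points y - te, which lie in Ω for small t > 0. -/
theorem mem_frontier_iff (hΩ : IsOpen Ω) {y : Euc N} (hy : y ∈ Metric.ball z C.r) :
    y ∈ frontier Ω ↔ inner ℝ C.e y = C.γ (C.proj y) := by
  have hγ := C.contDiff.continuous
  have hball := Metric.isOpen_ball.mem_nhds hy
  rw [hΩ.frontier_eq, Set.mem_sdiff, C.mem_iff' hy, not_lt]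
  constructor
  · rintro ⟨h1, h2⟩
    refine le_antisymm ?_ h2
    by_contra hlt
    rw [not_le] at hlt
    have hopen : IsOpen {y | C.γ (C.proj y) < inner ℝ C.e y} :=
      isOpen_lt (by fun_prop) (by fun_prop)
    obtain ⟨w, ⟨hw1, hw2⟩, hw3⟩ := mem_closure_iff_nhds.1 h1 _
      (inter_mem hball (hopen.mem_nhds hlt))
    exact lt_asymm ((C.mem_iff' hw1).1 hw3) hw2
  · intro h
    refine ⟨?_, h.ge⟩
    have ht : Tendsto (fun t : ℝ => y - t • C.e) (𝓝[>] 0) (𝓝 y) := by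
      have : Tendsto (fun t : ℝ => y - t • C.e) (𝓝 0) (𝓝 (y - (0 : ℝ) • C.e)) :=
        Continuous.tendsto (by fun_prop) 0
      rw [zero_smul, sub_zero] at this
      exact this.mono_left nhdsWithin_le_nhds
    refine mem_closure_of_tendsto ht ?_
    filter_upwards [ht.eventually hball, self_mem_nhdsWithin] with t ht1 ht2
    rw [C.mem_iff' ht1]
    have h3 : y - t • C.e = (C.proj y : Euc N) + (inner ℝ C.e y - t) • C.e := by
      conv_lhs => rw [← C.proj_add_inner_smul y]
      rw [sub_smul]; abel
    rw [h3, C.inner_add_smul, C.proj_add_smul, h]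
    have : (0 : ℝ) < t := ht2
    linarith

theorem mem_frontier_iff_mem_range (hΩ : IsOpen Ω) {y : Euc N} (hy : y ∈ Metric.ball z C.r) :
    y ∈ frontier Ω ↔ y ∈ range (graphMap C.e C.γ) := by
  rw [C.mem_frontier_iff hΩ hy]
  constructor
  · intro h
    refine ⟨C.proj y, ?_⟩
    rw [graphMap, ← h, C.proj_add_inner_smul]
  · rintro ⟨h, rfl⟩
    rw [graphMap, C.inner_add_smul, C.proj_add_smul]

/-- The unit normal field of the graph, extended constantly along the direction of the chart. -/
noncomputable def normal (y : Euc N) : Euc N :=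
  (√(1 + ‖∇ C.γ (C.proj y)‖ ^ 2))⁻¹ • (C.e - ((∇ C.γ (C.proj y) : (ℝ ∙ C.e)ᗮ) : Euc N))

theorem continuous_gradient : Continuous (∇ C.γ) := (lipschitzWith_gradient C.lipschitz).continuous

theorem continuous_normal : Continuous C.normal := by
  have := C.continuous_gradient
  unfold normal
  have h0 : ∀ y, √(1 + ‖∇ C.γ (C.proj y)‖ ^ 2) ≠ 0 := fun y => by positivity
  fun_prop (disch := exact h0)

theorem norm_normal (y : Euc N) : ‖C.normal y‖ = 1 := by
  have h1 : ‖C.e - ((∇ C.γ (C.proj y) : (ℝ ∙ C.e)ᗮ) : Euc N)‖ = √(1 + ‖∇ C.γ (C.proj y)‖ ^ 2) := by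
    rw [eq_comm, Real.sqrt_eq_iff_eq_sq (by positivity) (norm_nonneg _)]
    have := norm_sq_add_smul C.e C.norm_e (-(∇ C.γ (C.proj y))) 1
    rw [norm_neg, one_smul, Submodule.coe_neg, neg_add_eq_sub] at this
    rw [this]; ring
  rw [normal, norm_smul, h1, norm_inv, Real.norm_eq_abs, abs_of_nonneg (Real.sqrt_nonneg _)]
  exact inv_mul_cancel₀ (by positivity)

theorem sqrt_mul_inner_normal (y v : Euc N) :
    √(1 + ‖∇ C.γ (C.proj y)‖ ^ 2) * inner ℝ (C.normal y) v =
      inner ℝ C.e v - fderiv ℝ C.γ (C.proj y) (C.proj v) := by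
  have h0 : √(1 + ‖∇ C.γ (C.proj y)‖ ^ 2) ≠ 0 := by positivity
  rw [normal, real_inner_smul_left, mul_inv_cancel_left₀ h0, inner_sub_left]
  congr 1
  rw [← inner_gradient_left]
  conv_lhs => rw [← C.proj_add_inner_smul v, inner_add_right, real_inner_smul_right,
    real_inner_comm C.e, inner_coe_orthogonal_span]
  rw [Submodule.coe_inner]; ring

/-- Multiplied by √(1 + |∇γ|²), the normal component of y - x is the linear part at x of the height
above the graph. The height vanishes at x, its sign at y decides membership in Ω, and its Taylor
remainder is at most K‖y - x‖². The factor is at least 1 and can be dropped. -/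
theorem inner_normal_bounds (hΩ : IsOpen Ω) {x y : Euc N} (hx : x ∈ frontier Ω)
    (hxz : x ∈ Metric.ball z C.r) (hy : y ∈ Metric.ball z C.r) :
    (y ∈ Ω → inner ℝ (C.normal x) (y - x) ≤ C.K * ‖y - x‖ ^ 2) ∧
    (y ∉ Ω → -(C.K * ‖y - x‖ ^ 2) ≤ inner ℝ (C.normal x) (y - x)) := by
  rw [C.mem_frontier_iff hΩ hxz] at hx
  rw [C.mem_iff' hy, not_lt]
  have h1 := C.sqrt_mul_inner_normal x (y - x)
  have h2 := norm_sub_sub_fderiv_le C.differentiable C.lipschitz (C.proj x) (C.proj y)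
  rw [inner_sub_right C.e, hx, map_sub] at h1
  have h3 : ‖C.proj y - C.proj x‖ ≤ ‖y - x‖ := by rw [← map_sub]; exact C.norm_proj_le _
  have h4 : (C.K : ℝ) * ‖C.proj y - C.proj x‖ ^ 2 ≤ C.K * ‖y - x‖ ^ 2 := by gcongr
  have h5 := abs_le.1 (h2.trans h4)
  have hJ : 1 ≤ √(1 + ‖∇ C.γ (C.proj x)‖ ^ 2) := Real.one_le_sqrt.2 (by nlinarith [sq_nonneg ‖∇ C.γ (C.proj x)‖])
  have h6 : 0 ≤ (C.K : ℝ) * ‖y - x‖ ^ 2 := by positivity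
  set J := √(1 + ‖∇ C.γ (C.proj x)‖ ^ 2)
  set I := inner ℝ (C.normal x) (y - x)
  constructor
  · intro h
    by_contra! hlt
    nlinarith
  · intro h
    by_contra! hlt
    nlinarith

theorem isOuterUnitNormal (hΩ : IsOpen Ω) {x : Euc N} (hx : x ∈ frontier Ω)
    (hxz : x ∈ Metric.ball z C.r) : IsOuterUnitNormal Ω x (C.normal x) := by
  refine ⟨C.norm_normal x, fun ε hε => ?_⟩
  have h1 : ∀ᶠ y in 𝓝 x, C.K * ‖y - x‖ < ε := by
    have : Tendsto (fun y => (C.K : ℝ) * ‖y - x‖) (𝓝 x) (𝓝 (C.K * ‖x - x‖)) :=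
      Continuous.tendsto (by fun_prop) x
    rw [sub_self, norm_zero, mul_zero] at this
    exact this.eventually_lt_const hε
  filter_upwards [h1, Metric.isOpen_ball.mem_nhds hxz] with y hy1 hy2
  have h2 := C.inner_normal_bounds hΩ hx hxz hy2
  have h3 : C.K * ‖y - x‖ ^ 2 ≤ ε * ‖y - x‖ := by
    rw [sq, ← mul_assoc]; gcongr
  exact ⟨fun h => (h2.1 h).trans h3, fun h => by linarith [h2.2 h]⟩

end GraphChart

theorem IsOuterUnitNormal.outerNormal_eq {Ω : Set (Euc N)} {x ν : Euc N}
    (h : IsOuterUnitNormal Ω x ν) : outerNormal Ω x = ν := by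
  have hex : ∃ ν, IsOuterUnitNormal Ω x ν := ⟨ν, h⟩
  rw [outerNormal, dif_pos hex]
  exact hex.choose_spec.unique h

theorem GraphChart.outerNormal_eq {Ω : Set (Euc N)} {z : Euc N} (C : GraphChart Ω z)
    (hΩ : IsOpen Ω) {x : Euc N} (hx : x ∈ frontier Ω) (hxz : x ∈ Metric.ball z C.r) :
    outerNormal Ω x = C.normal x := (C.isOuterUnitNormal hΩ hx hxz).outerNormal_eq

namespace IsBoundedC11Domain

variable {Ω : Set (Euc N)}



theorem isCompact_frontier (hΩ : IsBoundedC11Domain Ω) : IsCompact (frontier Ω) :=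
  hΩ.isBounded.isCompact_closure.of_isClosed_subset isClosed_frontier frontier_subset_closure

theorem continuousOn_outerNormal (hΩ : IsBoundedC11Domain Ω) : ContinuousOn (outerNormal Ω) (frontier Ω) := by
  intro x hx
  obtain ⟨C⟩ := hΩ.nonempty_graphChart hx
  refine (C.continuous_normal.continuousAt (x := x)).continuousWithinAt.congr_of_eventuallyEq ?_
    (C.outerNormal_eq hΩ.isOpen hx (Metric.mem_ball_self C.r_pos))
  filter_upwards [self_mem_nhdsWithin,
    mem_nhdsWithin_of_mem_nhds (Metric.ball_mem_nhds x C.r_pos)] with y hy1 hy2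
  exact C.outerNormal_eq hΩ.isOpen hy1 hy2

theorem norm_outerNormal (hΩ : IsBoundedC11Domain Ω) {x : Euc N} (hx : x ∈ frontier Ω) : ‖outerNormal Ω x‖ = 1 := by
  obtain ⟨C⟩ := hΩ.nonempty_graphChart hx
  rw [C.outerNormal_eq hΩ.isOpen hx (Metric.mem_ball_self C.r_pos), C.norm_normal]

/-- Uniform interior and exterior ball condition. -/
theorem exists_normal_bound (hΩ : IsBoundedC11Domain Ω) : ∃ K : ℝ, 0 < K ∧ ∀ x ∈ frontier Ω, ∀ y,
    (y ∈ Ω → inner ℝ (outerNormal Ω x) (y - x) ≤ K * ‖y - x‖ ^ 2) ∧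
    (y ∉ Ω → -(K * ‖y - x‖ ^ 2) ≤ inner ℝ (outerNormal Ω x) (y - x)) := by
  have hloc : ∀ z ∈ frontier Ω, ∃ t ∈ 𝓝[frontier Ω] z, ∃ K : ℝ, 0 < K ∧
      ∀ x ∈ frontier Ω ∩ t, ∀ y,
      (y ∈ Ω → inner ℝ (outerNormal Ω x) (y - x) ≤ K * ‖y - x‖ ^ 2) ∧
      (y ∉ Ω → -(K * ‖y - x‖ ^ 2) ≤ inner ℝ (outerNormal Ω x) (y - x)) := by
    intro z hz
    obtain ⟨C⟩ := hΩ.nonempty_graphChart hz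
    have hr := C.r_pos
    refine ⟨_, mem_nhdsWithin_of_mem_nhds (Metric.ball_mem_nhds z (half_pos hr)),
      C.K + 2 / C.r, by positivity, ?_⟩
    rintro x ⟨hx, hxz⟩ y
    have hxz' : x ∈ Metric.ball z C.r := Metric.ball_subset_ball (by linarith) hxz
    have h0 : 0 ≤ (2 / C.r) * ‖y - x‖ ^ 2 := by positivity
    by_cases hy : y ∈ Metric.ball z C.r
    · rw [C.outerNormal_eq hΩ.isOpen hx hxz']
      have h := C.inner_normal_bounds hΩ.isOpen hx hxz' hy
      rw [add_mul]
      exact ⟨fun h' => by linarith [h.1 h'], fun h' => by linarith [h.2 h']⟩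
    -- Outside the chart y is at distance at least r/2 from x, and there the summand 2/r in the
    -- constant makes both bounds follow from Cauchy-Schwarz.
    · have h1 : C.r / 2 ≤ ‖y - x‖ := by
        rw [← dist_eq_norm]
        rw [Metric.mem_ball] at hy hxz
        linarith [dist_triangle y x z]
      have h2 : ‖y - x‖ ≤ (2 / C.r) * ‖y - x‖ ^ 2 := by
        have : (1 : ℝ) ≤ (2 / C.r) * ‖y - x‖ := by
          rw [div_mul_eq_mul_div, le_div_iff₀ hr]; linarith
        nlinarith [norm_nonneg (y - x)]
      have h3 : |inner ℝ (outerNormal Ω x) (y - x)| ≤ ‖y - x‖ := by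
        have := abs_real_inner_le_norm (outerNormal Ω x) (y - x)
        rwa [hΩ.norm_outerNormal hx, one_mul] at this
      have h4 := abs_le.1 h3
      have h5 : 0 ≤ (C.K : ℝ) * ‖y - x‖ ^ 2 := by positivity
      rw [add_mul]
      exact ⟨fun _ => by linarith, fun _ => by linarith⟩
  obtain ⟨K, hK0, hK⟩ := hΩ.isCompact_frontier.induction_on
    (p := fun t => ∃ K : ℝ, 0 < K ∧ ∀ x ∈ frontier Ω ∩ t, ∀ y,
      (y ∈ Ω → inner ℝ (outerNormal Ω x) (y - x) ≤ K * ‖y - x‖ ^ 2) ∧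
      (y ∉ Ω → -(K * ‖y - x‖ ^ 2) ≤ inner ℝ (outerNormal Ω x) (y - x)))
    ⟨1, one_pos, by simp⟩
    (fun s t hst ⟨K, hK0, hK⟩ => ⟨K, hK0, fun x hx => hK x ⟨hx.1, hst hx.2⟩⟩)
    (fun s t ⟨K, hK0, hK⟩ ⟨K', hK0', hK'⟩ => ⟨K + K', by positivity, fun x hx y => by
      have h0 : 0 ≤ K * ‖y - x‖ ^ 2 := by positivity
      have h0' : 0 ≤ K' * ‖y - x‖ ^ 2 := by positivity
      rw [add_mul]
      rcases hx.2 with h | h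
      · have := hK x ⟨hx.1, h⟩ y
        exact ⟨fun h' => by linarith [this.1 h'], fun h' => by linarith [this.2 h']⟩
      · have := hK' x ⟨hx.1, h⟩ y
        exact ⟨fun h' => by linarith [this.1 h'], fun h' => by linarith [this.2 h']⟩⟩)
    hloc
  exact ⟨K, hK0, fun x hx y => hK x ⟨hx, hx⟩ y⟩

end IsBoundedC11Domain

end Charts

end HigherNeumann

namespace HigherNeumann

/-! ### Surface measure and the divergence theorem. -/

section GaussGreen

variable {N : ℕ} {Ω : Set (Euc N)}

theorem GraphChart.restrict_range_eq {z : Euc N} (C : GraphChart Ω z) :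
    (Measure.euclideanHausdorffMeasure (N - 1) : Measure (Euc N)).restrict
      (range (graphMap C.e C.γ)) =
      (volume.withDensity fun h => ENNReal.ofReal √(1 + ‖∇ C.γ h‖ ^ 2)).map (graphMap C.e C.γ) := by
  have := map_graphMap_eq_restrict C.e C.norm_e C.differentiable C.lipschitz
  rwa [finrank_euclideanSpace_fin] at this

theorem divergence_eq_zero_of_notMem_tsupport {F : Euc N → Euc N} {x : Euc N}
    (hx : x ∉ tsupport F) : divergence F x = 0 := by
  have : fderiv ℝ F x = 0 := by
    by_contra h
    exact hx (support_fderiv_subset ℝ h)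
  simp [divergence, this]

/-- Since F is supported in the chart ball, Ω may be replaced by the full subgraph and ∂Ω by the
full graph. The surface density √(1 + |∇γ|²) cancels the normalization of the unit normal. -/
theorem GraphChart.integral_divergence {z : Euc N} (C : GraphChart Ω z) (hΩ : IsOpen Ω)
    {F : Euc N → Euc N} (hF : ContDiff ℝ 1 F) (hs : tsupport F ⊆ Metric.ball z C.r) :
    ∫ x in Ω, divergence F x = ∫ x, inner ℝ (F x) (outerNormal Ω x) ∂(surfaceMeasure Ω) := by
  have hc : HasCompactSupport F :=
    Metric.isCompact_of_isClosed_isBounded (isClosed_tsupport F) (Metric.isBounded_ball.subset hs)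
  have hγ := C.contDiff.continuous
  have hg := C.continuous_gradient
  have hemb := measurableEmbedding_graphMap C.e C.norm_e hγ
  have hmeas : MeasurableSet {y : Euc N | inner ℝ C.e y < C.γ (C.proj y)} :=
    (isOpen_lt (by fun_prop) (by fun_prop)).measurableSet
  have h1 : ∫ x in Ω, divergence F x =
      ∫ y in {y | inner ℝ C.e y < C.γ (C.proj y)}, divergence F y := by
    rw [← integral_indicator hΩ.measurableSet, ← integral_indicator hmeas]
    congr 1
    ext y
    by_cases hy : y ∈ Metric.ball z C.r
    · have := C.mem_iff' hy
      by_cases hyΩ : y ∈ Ω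
      · rw [indicator_of_mem hyΩ, indicator_of_mem (by exact this.1 hyΩ)]
      · rw [indicator_of_notMem hyΩ, indicator_of_notMem (by exact fun h => hyΩ (this.2 h))]
    · have := divergence_eq_zero_of_notMem_tsupport (F := F) fun h => hy (hs h)
      simp [indicator, this]
  have h2 := integral_divergence_subgraph C.norm_e C.contDiff hF hc
  rw [h1]
  refine h2.trans ?_
  have h3 : ∫ x, inner ℝ (F x) (outerNormal Ω x) ∂(surfaceMeasure Ω) =
      ∫ x in range (graphMap C.e C.γ), inner ℝ (F x) (C.normal x)
        ∂(Measure.euclideanHausdorffMeasure (N - 1)) := by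
    rw [surfaceMeasure, ← integral_indicator isClosed_frontier.measurableSet,
      ← integral_indicator hemb.measurableSet_range]
    congr 1
    ext y
    by_cases hy : y ∈ Metric.ball z C.r
    · have := C.mem_frontier_iff_mem_range hΩ hy
      by_cases hyΩ : y ∈ frontier Ω
      · rw [indicator_of_mem hyΩ, indicator_of_mem (this.1 hyΩ), C.outerNormal_eq hΩ hyΩ hy]
      · rw [indicator_of_notMem hyΩ, indicator_of_notMem fun h => hyΩ (this.2 h)]
    · have : F y = 0 := image_eq_zero_of_notMem_tsupport fun h => hy (hs h)
      simp [indicator, this]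
  have hJm : Measurable fun h => ENNReal.ofReal √(1 + ‖∇ C.γ h‖ ^ 2) := by
    have : Continuous fun h => √(1 + ‖∇ C.γ h‖ ^ 2) := by fun_prop
    exact this.measurable.ennreal_ofReal
  rw [h3, C.restrict_range_eq, hemb.integral_map, integral_withDensity_eq_integral_toReal_smul hJm
    (by simp)]
  congr 1
  ext h
  have hp : C.proj (graphMap C.e C.γ h) = h := C.proj_add_smul h _
  rw [ENNReal.toReal_ofReal (Real.sqrt_nonneg _), GraphChart.normal, hp, real_inner_smul_right,
    smul_eq_mul, mul_inv_cancel_left₀ (by positivity)]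

/-- Each chart piece of the compact boundary is the image of a bounded parameter set on which the
continuous surface density is bounded. -/
theorem IsBoundedC11Domain.isFiniteMeasure_surfaceMeasure (hΩ : IsBoundedC11Domain Ω) :
    IsFiniteMeasure (surfaceMeasure Ω) := by
  constructor
  rw [surfaceMeasure, Measure.restrict_apply_univ]
  refine hΩ.isCompact_frontier.measure_lt_top_of_nhdsWithin fun z hz => ?_
  obtain ⟨C⟩ := hΩ.nonempty_graphChart hz
  have hγ := C.contDiff.continuous
  have hg := C.continuous_gradient
  have hemb := measurableEmbedding_graphMap C.e C.norm_e hγ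
  refine ⟨frontier Ω ∩ Metric.ball z C.r, inter_mem_nhdsWithin _ (Metric.ball_mem_nhds z C.r_pos), ?_⟩
  have hsub : frontier Ω ∩ Metric.ball z C.r =
      (frontier Ω ∩ Metric.ball z C.r) ∩ range (graphMap C.e C.γ) := by
    rw [eq_comm, inter_eq_left]
    exact fun y hy => (C.mem_frontier_iff_mem_range hΩ.isOpen hy.2).1 hy.1
  have hm : MeasurableSet (frontier Ω ∩ Metric.ball z C.r) :=
    isClosed_frontier.measurableSet.inter Metric.isOpen_ball.measurableSet
  rw [hsub, ← Measure.restrict_apply hm, C.restrict_range_eq, hemb.map_apply,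
    withDensity_apply _ (hemb.measurable hm)]
  have hsub2 : graphMap C.e C.γ ⁻¹' (frontier Ω ∩ Metric.ball z C.r) ⊆
      Metric.closedBall (C.proj z) C.r := by
    rintro h ⟨-, hh⟩
    rw [Metric.mem_ball, dist_eq_norm] at hh
    rw [Metric.mem_closedBall, dist_eq_norm]
    have := C.norm_proj_le (graphMap C.e C.γ h - z)
    rw [map_sub, graphMap, C.proj_add_smul] at this
    exact this.trans hh.le
  refine (lintegral_mono_set hsub2).trans_lt ?_
  have hcont : ContinuousOn (fun h => √(1 + ‖∇ C.γ h‖ ^ 2)) (Metric.closedBall (C.proj z) C.r) := by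
    fun_prop
  have := (hcont.integrableOn_compact (μ := volume) (isCompact_closedBall _ _)).lintegral_lt_top
  exact this

theorem divergence_smul {f : Euc N → ℝ} {F : Euc N → Euc N} {x : Euc N}
    (hf : DifferentiableAt ℝ f x) (hF : DifferentiableAt ℝ F x) :
    divergence (fun y => f y • F y) x = f x * divergence F x + fderiv ℝ f x (F x) := by
  rw [divergence, fderiv_fun_smul hf hF, ← sum_coord_smul_apply, divergence, Finset.mul_sum,
    ← Finset.sum_add_distrib]
  simp

theorem divergence_congr {F G : Euc N → Euc N} {x : Euc N} (h : F =ᶠ[𝓝 x] G) :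
    divergence F x = divergence G x := by
  simp [divergence, h.fderiv_eq]

theorem divergence_sum {ι : Type*} (s : Finset ι) {F : ι → Euc N → Euc N} {x : Euc N}
    (hF : ∀ i ∈ s, DifferentiableAt ℝ (F i) x) :
    divergence (fun y => ∑ i ∈ s, F i y) x = ∑ i ∈ s, divergence (F i) x := by
  simp only [divergence]
  rw [fderiv_fun_sum hF, Finset.sum_comm]
  refine Finset.sum_congr rfl fun i _ => ?_
  simp

namespace IsBoundedC11Domain

theorem measurableSet (hΩ : IsBoundedC11Domain Ω) : MeasurableSet Ω := hΩ.isOpen.measurableSet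

theorem ae_mem_frontier (Ω : Set (Euc N)) : ∀ᵐ x ∂(surfaceMeasure Ω), x ∈ frontier Ω :=
  ae_restrict_mem isClosed_frontier.measurableSet

theorem aestronglyMeasurable_outerNormal (hΩ : IsBoundedC11Domain Ω) :
    AEStronglyMeasurable (outerNormal Ω) (surfaceMeasure Ω) :=
  hΩ.continuousOn_outerNormal.aestronglyMeasurable isClosed_frontier.measurableSet

theorem integrable_inner_outerNormal (hΩ : IsBoundedC11Domain Ω) {F : Euc N → Euc N}
    (hF : Continuous F) :
    Integrable (fun x => inner ℝ (F x) (outerNormal Ω x)) (surfaceMeasure Ω) := by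
  have := hΩ.isFiniteMeasure_surfaceMeasure
  obtain ⟨M, hM⟩ := hΩ.isCompact_frontier.exists_bound_of_continuousOn hF.continuousOn
  refine Integrable.of_bound (C := M)
    (hF.aestronglyMeasurable.inner hΩ.aestronglyMeasurable_outerNormal) ?_
  filter_upwards [ae_mem_frontier Ω] with x hx
  have := abs_real_inner_le_norm (F x) (outerNormal Ω x)
  rw [hΩ.norm_outerNormal hx, mul_one] at this
  exact this.trans (hM x hx)

/-- The divergence theorem on a bounded `C^{1,1}` domain. -/
theorem integral_divergence (hΩ : IsBoundedC11Domain Ω) {F : Euc N → Euc N}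
    (hF : ContDiff ℝ 1 F) :
    ∫ x in Ω, divergence F x = ∫ x, inner ℝ (F x) (outerNormal Ω x) ∂(surfaceMeasure Ω) := by
  classical
  have hΩo := hΩ.isOpen
  -- a neighbourhood of every point of the closure on which the theorem holds
  have hloc : ∀ z ∈ closure Ω, ∃ r > 0, ∀ G : Euc N → Euc N, ContDiff ℝ 1 G →
      tsupport G ⊆ Metric.ball z r →
      ∫ x in Ω, divergence G x = ∫ x, inner ℝ (G x) (outerNormal Ω x) ∂(surfaceMeasure Ω) := by
    intro z hz
    by_cases hzΩ : z ∈ Ω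
    · obtain ⟨r, hr, hball⟩ := Metric.isOpen_iff.1 hΩo z hzΩ
      refine ⟨r, hr, fun G hG hs => ?_⟩
      have hc : HasCompactSupport G := Metric.isCompact_of_isClosed_isBounded (isClosed_tsupport G)
        (Metric.isBounded_ball.subset hs)
      have h1 := integral_mul_divergence (χ := fun _ => 1) contDiff_const hG hc
      simp only [one_mul, fderiv_fun_const, Pi.zero_apply, _root_.zero_apply, integral_zero,
        neg_zero] at h1
      rw [setIntegral_eq_integral_of_forall_compl_eq_zero, h1, eq_comm]
      · refine integral_eq_zero_of_ae ?_
        filter_upwards [ae_mem_frontier Ω] with x hx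
        have : G x = 0 := image_eq_zero_of_notMem_tsupport fun h => by
          rw [hΩo.frontier_eq] at hx
          exact hx.2 (hball (hs h))
        simp [this]
      · intro x hx
        exact divergence_eq_zero_of_notMem_tsupport fun h => hx (hball (hs h))
    · have hzf : z ∈ frontier Ω := by rw [hΩo.frontier_eq]; exact ⟨hz, hzΩ⟩
      obtain ⟨C⟩ := hΩ.nonempty_graphChart hzf
      exact ⟨C.r, C.r_pos, fun G hG hs => C.integral_divergence hΩo hG hs⟩
  choose! r hr0 hr using hloc
  obtain ⟨t, hcov⟩ := hΩ.isBounded.isCompact_closure.elim_nhds_subcover'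
    (fun z _ => Metric.ball z (r z)) (fun z hz => Metric.ball_mem_nhds z (hr0 z hz))
  -- The partition sums to 1 on the closure, hence in a neighbourhood of each point of the open set
  -- Ω, so that the decomposition of F may be differentiated there; on the frontier only values are
  -- needed.
  obtain ⟨ρ, hρ⟩ := SmoothPartitionOfUnity.exists_isSubordinate (modelWithCornersSelf ℝ (Euc N))
    (s := closure Ω) isClosed_closure (fun i : t => Metric.ball (i.1 : Euc N) (r i.1))
    (fun i => Metric.isOpen_ball) (hcov.trans (by simp [iUnion_subtype]))
  have hρC : ∀ i, ContDiff ℝ 1 (ρ i) := fun i => (ρ i).contMDiff.contDiff.of_le (by simp)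
  have hsum : ∀ x ∈ closure Ω, ∑ i, ρ i x = 1 := fun x hx => by
    rw [← finsum_eq_sum_of_fintype]; exact ρ.sum_eq_one hx
  set G : t → Euc N → Euc N := fun i x => ρ i x • F x with hG
  have hGC : ∀ i, ContDiff ℝ 1 (G i) := fun i => (hρC i).smul hF
  have hGs : ∀ i, tsupport (G i) ⊆ Metric.ball (i.1 : Euc N) (r i.1) := fun i =>
    (tsupport_smul_subset_left _ _).trans (hρ i)
  have e1 : ∀ x ∈ Ω, divergence F x = ∑ i, divergence (G i) x := by
    intro x hx
    rw [← divergence_sum _ fun i _ => ((hGC i).differentiable one_ne_zero) x]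
    refine divergence_congr ?_
    filter_upwards [hΩo.mem_nhds hx] with y hy
    rw [← Finset.sum_smul, hsum y (subset_closure hy), one_smul]
  have e2 : ∀ x ∈ frontier Ω, inner ℝ (F x) (outerNormal Ω x) =
      ∑ i, inner ℝ (G i x) (outerNormal Ω x) := by
    intro x hx
    rw [← sum_inner, ← Finset.sum_smul, hsum x (frontier_subset_closure hx), one_smul]
  rw [setIntegral_congr_fun hΩ.measurableSet e1,
    integral_congr_ae ((ae_mem_frontier Ω).mono e2), integral_finsetSum, integral_finsetSum]
  · exact Finset.sum_congr rfl fun i _ => hr _ i.1.2 _ (hGC i) (hGs i)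
  · exact fun i _ => hΩ.integrable_inner_outerNormal (hGC i).continuous
  · intro i _
    exact ((continuous_divergence (hGC i)).continuousOn.integrableOn_compact
      hΩ.isBounded.isCompact_closure).mono_set subset_closure

end IsBoundedC11Domain

end GaussGreen

end HigherNeumann

namespace HigherNeumann

/-! ### Integrability of powers of the distance to Ω. -/

section Distance

variable {N : ℕ} {Ω : Set (Euc N)}

theorem GraphChart.exists_lipschitz {z : Euc N} (C : GraphChart Ω z) : ∃ L : ℝ, 0 ≤ L ∧
    ∀ x ∈ Metric.ball z C.r, ∀ y ∈ Metric.ball z C.r,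
      |C.γ (C.proj y) - C.γ (C.proj x)| ≤ L * ‖y - x‖ := by
  have hg : Continuous (fderiv ℝ C.γ) := C.lipschitz.continuous
  obtain ⟨L, hL⟩ : ∃ L, ∀ h ∈ Metric.closedBall (C.proj z) C.r, ‖fderiv ℝ C.γ h‖ ≤ L :=
    (isCompact_closedBall (C.proj z) C.r).exists_bound_of_continuousOn (f := fderiv ℝ C.γ)
      (by exact hg.continuousOn)
  have hL0 : 0 ≤ L := (norm_nonneg (fderiv ℝ C.γ (C.proj z))).trans
    (hL _ (Metric.mem_closedBall_self C.r_pos.le))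
  have hmem : ∀ x ∈ Metric.ball z C.r, C.proj x ∈ Metric.closedBall (C.proj z) C.r := by
    intro x hx
    rw [Metric.mem_closedBall, dist_eq_norm, ← map_sub]
    rw [Metric.mem_ball, dist_eq_norm] at hx
    exact (C.norm_proj_le _).trans hx.le
  refine ⟨L, hL0, fun x hx y hy => ?_⟩
  have := (convex_closedBall (C.proj z) C.r).norm_image_sub_le_of_norm_fderiv_le (𝕜 := ℝ)
    (fun w _ => C.differentiable w) hL (hmem x hx) (hmem y hy)
  rw [← map_sub] at this
  exact this.trans (by gcongr; exact C.norm_proj_le _)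

/-- In a chart, each vertical line meets the boundary in at most one point. -/
theorem volume_frontier (hΩ : IsBoundedC11Domain Ω) : volume (frontier Ω) = 0 := by
  refine measure_null_of_locally_null _ fun z hz => ?_
  obtain ⟨C⟩ := hΩ.nonempty_graphChart hz
  have hγ := C.contDiff.continuous
  refine ⟨frontier Ω ∩ Metric.ball z C.r, inter_mem_nhdsWithin _ (Metric.ball_mem_nhds z C.r_pos), ?_⟩
  have hm : MeasurableSet {y : Euc N | inner ℝ C.e y = C.γ (C.proj y)} :=
    (isClosed_eq (by fun_prop) (by fun_prop)).measurableSet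
  refine measure_mono_null (t := {y : Euc N | inner ℝ C.e y = C.γ (C.proj y)})
    (fun y hy => (C.mem_frontier_iff hΩ.isOpen hy.2).1 hy.1) ?_
  rw [← lintegral_indicator_one hm, lintegral_slice C.e C.norm_e (measurable_one.indicator hm),
    lintegral_eq_zero_iff']
  · refine Eventually.of_forall fun h => ?_
    have : ∀ t : ℝ, indicator {y : Euc N | inner ℝ C.e y = C.γ (C.proj y)} 1
        ((h : Euc N) + t • C.e) = indicator {C.γ h} (1 : ℝ → ENNReal) t := by
      intro t
      simp only [indicator, mem_ofPred_eq, C.inner_add_smul, C.proj_add_smul, mem_singleton_iff]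
      rfl
    simp only [this, Pi.zero_apply]
    rw [lintegral_indicator_one (measurableSet_singleton _)]
    simp
  · refine (Measurable.lintegral_prod_right ?_).aemeasurable
    exact (measurable_one.indicator hm).comp (by fun_prop)

namespace IsBoundedC11Domain

/-- A nearest point of `∂Ω` to an exterior point, which lies on the normal through that point. -/
theorem exists_nearest (hΩ : IsBoundedC11Domain Ω) {x : Euc N} (hx : x ∉ Ω) :
    ∃ y ∈ frontier Ω, x = y + Metric.infDist x Ω • outerNormal Ω y := by
  have hne := hΩ.isConnected.nonempty
  have hbdd := hΩ.isBounded.isCompact_closure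
  obtain ⟨y, hy, hd⟩ := hbdd.exists_infDist_eq_dist hne.closure x
  rw [Metric.infDist_closure] at hd
  set t := Metric.infDist x Ω with ht
  rcases Metric.infDist_nonneg.eq_or_lt' (a := t) with h0 | h0
  · rw [h0, eq_comm, dist_eq_zero] at hd
    subst hd
    refine ⟨x, ?_, by simp [h0]⟩
    rw [hΩ.isOpen.frontier_eq]; exact ⟨hy, hx⟩
  have hle : ∀ w ∈ Ω, t ≤ ‖x - w‖ := fun w hw => by
    rw [← dist_eq_norm]; exact Metric.infDist_le_dist_of_mem hw
  rw [dist_eq_norm] at hd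
  set d : Euc N := t⁻¹ • (x - y) with hdd
  have hxy : x - y = t • d := by rw [hdd, smul_inv_smul₀ h0.ne']
  have hdn : ‖d‖ = 1 := by
    rw [hdd, norm_smul, ← hd, norm_inv, Real.norm_eq_abs, abs_of_pos h0]
    exact inv_mul_cancel₀ h0.ne'
  -- If y lay in the open set Ω, a small move towards x would give a point of Ω closer to x.
  have hyf : y ∈ frontier Ω := by
    rw [hΩ.isOpen.frontier_eq]
    refine ⟨hy, fun hyΩ => ?_⟩
    have hT : Tendsto (fun s : ℝ => y + s • d) (𝓝[>] 0) (𝓝 y) := by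
      have : Tendsto (fun s : ℝ => y + s • d) (𝓝 0) (𝓝 (y + (0 : ℝ) • d)) :=
        Continuous.tendsto (by fun_prop) 0
      rw [zero_smul, add_zero] at this
      exact this.mono_left nhdsWithin_le_nhds
    obtain ⟨s, ⟨hs1, hs2⟩, hs3⟩ := ((hT.eventually (hΩ.isOpen.mem_nhds hyΩ)).and
      (mem_nhdsWithin_of_mem_nhds (Iio_mem_nhds h0))).and self_mem_nhdsWithin |>.exists
    have hs3 : 0 < s := hs3
    have hs2 : s < t := hs2
    have := hle _ hs1
    rw [← sub_sub, hxy, ← sub_smul, norm_smul, hdn, Real.norm_eq_abs, abs_of_pos (by linarith)] at this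
    linarith
  refine ⟨y, hyf, ?_⟩
  suffices d = outerNormal Ω y by rw [← this, ← hxy]; abel
  set ν := outerNormal Ω y with hν
  have hνn : ‖ν‖ = 1 := hΩ.norm_outerNormal hyf
  obtain ⟨K, hK0, hK⟩ := hΩ.exists_normal_bound
  set m := 1 - inner ℝ d ν with hm
  have hsq : ‖d - ν‖ ^ 2 = 2 * m := by
    rw [norm_sub_sq_real, hdn, hνn]; ring
  by_contra hne'
  have hm0 : 0 < m := by
    have : 0 < ‖d - ν‖ := norm_pos_iff.2 (sub_ne_zero.2 hne')
    nlinarith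
  -- If the direction d towards x differed from ν, then ⟨ν, d - ν⟩ = -m < 0, so that d - ν points
  -- into Ω. A step s along it lands in Ω when 2Ks < 1, and changes the squared distance to x by
  -- -2sm(t - s), negative when s < t: a contradiction with minimality.
  obtain ⟨s, hs0, hst, hsK⟩ : ∃ s : ℝ, 0 < s ∧ s < t ∧ 2 * K * s < 1 := by
    refine ⟨min (t / 2) (1 / (4 * K)), by positivity, ?_, ?_⟩
    · linarith [min_le_left (t / 2) (1 / (4 * K))]
    · have h1 := min_le_right (t / 2) (1 / (4 * K))
      calc 2 * K * min (t / 2) (1 / (4 * K)) ≤ 2 * K * (1 / (4 * K)) := by gcongr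
        _ = 1 / 2 := by field_simp; norm_num
        _ < 1 := by norm_num
  have hmem : y + s • (d - ν) ∈ Ω := by
    by_contra h
    have := (hK y hyf (y + s • (d - ν))).2 h
    rw [add_sub_cancel_left, norm_smul, mul_pow, hsq, real_inner_smul_right, inner_sub_right,
      real_inner_self_eq_norm_sq, hνn, real_inner_comm, Real.norm_eq_abs, sq_abs] at this
    have h2 : inner ℝ d ν = 1 - m := by rw [hm]; ring
    rw [h2] at this
    nlinarith [mul_pos hs0 hm0]
  have h3 := hle _ hmem
  have h4 : ‖x - (y + s • (d - ν))‖ ^ 2 = t ^ 2 - 2 * s * m * (t - s) := by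
    have h6 : ‖s • (d - ν)‖ ^ 2 = s ^ 2 * (2 * m) := by
      rw [norm_smul, mul_pow, hsq, Real.norm_eq_abs, sq_abs]
    have h7 : ‖t • d‖ ^ 2 = t ^ 2 := by
      rw [norm_smul, mul_pow, hdn, Real.norm_eq_abs, sq_abs, one_pow, mul_one]
    rw [← sub_sub, hxy, norm_sub_sq_real, h6, h7,
      real_inner_smul_left, real_inner_smul_right, inner_sub_right, real_inner_self_eq_norm_sq, hdn]
    have h2 : inner ℝ d ν = 1 - m := by rw [hm]; ring
    rw [h2]; ring
  have h5 : t ^ 2 ≤ ‖x - (y + s • (d - ν))‖ ^ 2 := by gcongr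
  have : 0 < s * m * (t - s) := mul_pos (mul_pos hs0 hm0) (by linarith)
  nlinarith

theorem infDist_pos (hΩ : IsBoundedC11Domain Ω) {x : Euc N} (hx : x ∉ closure Ω) :
    0 < Metric.infDist x Ω := by
  rw [← Metric.infDist_closure]
  exact (isClosed_closure.notMem_iff_infDist_pos hΩ.isConnected.nonempty.closure).1 hx

/-- Near the boundary, the height above the graph is at most 1 + L times the distance, where L is a
Lipschitz constant of the graph. The power -β of the distance is thus bounded by that of the height,
which is integrable on vertical lines as β < 1. Away from the closure the function is continuous. -/
theorem integrableOn_infDist_rpow (hΩ : IsBoundedC11Domain Ω) {β : ℝ} (hβ0 : 0 < β) (hβ1 : β < 1)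
    {S : Set (Euc N)} (hS : IsCompact S) (hSΩ : S ⊆ Ωᶜ) :
    IntegrableOn (fun x => Metric.infDist x Ω ^ (-β)) S := by
  have hmeas : Measurable fun x => Metric.infDist x Ω ^ (-β) :=
    (Metric.continuous_infDist_pt Ω).measurable.pow_const _
  refine LocallyIntegrableOn.integrableOn_isCompact (fun z hz => ?_) hS
  by_cases hzf : z ∈ closure Ω
  · have hzf : z ∈ frontier Ω := by rw [hΩ.isOpen.frontier_eq]; exact ⟨hzf, hSΩ hz⟩
    obtain ⟨C⟩ := hΩ.nonempty_graphChart hzf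
    obtain ⟨L, hL0, hL⟩ := C.exists_lipschitz
    have hγ := C.contDiff.continuous
    have hr := C.r_pos
    refine ⟨S ∩ Metric.ball z (C.r / 2), inter_mem_nhdsWithin _ (Metric.ball_mem_nhds z (by linarith)),
      hmeas.aestronglyMeasurable, ?_⟩
    have hsub : ∀ x ∈ S ∩ Metric.ball z (C.r / 2), x ∉ frontier Ω →
        0 < Metric.infDist x Ω ∧
        0 < inner ℝ C.e x - C.γ (C.proj x) ∧
        inner ℝ C.e x - C.γ (C.proj x) ≤ (1 + L) * Metric.infDist x Ω ∧
        inner ℝ C.e x - C.γ (C.proj x) ≤ (1 + L) * C.r := by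
      rintro x ⟨hxS, hxz⟩ hxf
      have hxΩ : x ∉ Ω := hSΩ hxS
      have hxb : x ∈ Metric.ball z C.r := Metric.ball_subset_ball (by linarith) hxz
      obtain ⟨y, hy, hxy⟩ := hΩ.exists_nearest hxΩ
      have hpos : 0 < Metric.infDist x Ω := hΩ.infDist_pos fun h =>
        hxf (by rw [hΩ.isOpen.frontier_eq]; exact ⟨h, hxΩ⟩)
      have hdist : ‖x - y‖ = Metric.infDist x Ω := by
        conv_lhs => rw [hxy]
        rw [add_sub_cancel_left, norm_smul, hΩ.norm_outerNormal hy, mul_one, Real.norm_eq_abs,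
          abs_of_pos hpos]
      have hlt : Metric.infDist x Ω < C.r / 2 := by
        rw [← Metric.infDist_closure]
        exact (Metric.infDist_le_dist_of_mem (frontier_subset_closure hzf)).trans_lt hxz
      have hyb : y ∈ Metric.ball z C.r := by
        rw [Metric.mem_ball] at hxz ⊢
        have := dist_triangle_left y z x
        rw [dist_eq_norm x y, hdist] at this
        linarith
      have hgy := (C.mem_frontier_iff hΩ.isOpen hyb).1 hy
      have h1 := hL x hxb y hyb
      have h2 : inner ℝ C.e x - inner ℝ C.e y ≤ ‖x - y‖ := by
        rw [← inner_sub_right]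
        have := real_inner_le_norm C.e (x - y)
        rwa [C.norm_e, one_mul] at this
      rw [norm_sub_rev, hdist] at h1
      rw [hdist] at h2
      have h3 := (abs_le.1 h1).2
      have h4 : inner ℝ C.e x - C.γ (C.proj x) ≤ (1 + L) * Metric.infDist x Ω := by linarith
      refine ⟨hpos, ?_, h4, h4.trans (by gcongr; linarith)⟩
      have h5 := (C.mem_iff' hxb).not.1 hxΩ
      have h6 := (C.mem_frontier_iff hΩ.isOpen hxb).not.1 hxf
      rw [not_lt] at h5
      exact sub_pos.2 (lt_of_le_of_ne h5 (Ne.symm h6))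
    set B := (1 + L) * C.r with hB
    have hB0 : 0 < B := by positivity
    set c := (1 + L) ^ β with hc
    set Φ : Euc N → ENNReal := fun x => (Metric.closedBall (C.proj z) C.r).indicator 1 (C.proj x) *
      (Ioo (0 : ℝ) (B + 1)).indicator (fun τ => ENNReal.ofReal (c * τ ^ (-β)))
        (inner ℝ C.e x - C.γ (C.proj x)) with hΦ
    have hΦm : Measurable Φ := by
      refine Measurable.mul ?_ ?_
      · exact (measurable_one.indicator Metric.isClosed_closedBall.measurableSet).comp
          C.proj.continuous.measurable
      · have h1 : Measurable fun τ : ℝ => ENNReal.ofReal (c * τ ^ (-β)) :=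
          ((measurable_id.pow_const _).const_mul _).ennreal_ofReal
        refine (h1.indicator measurableSet_Ioo).comp ?_
        have : Continuous fun x : Euc N => inner ℝ C.e x - C.γ (C.proj x) := by fun_prop
        exact this.measurable
    have hle : ∫⁻ x in S ∩ Metric.ball z (C.r / 2), ‖Metric.infDist x Ω ^ (-β)‖ₑ ≤ ∫⁻ x, Φ x := by
      refine (lintegral_mono_ae ?_).trans (setLIntegral_le_lintegral (S ∩ Metric.ball z (C.r / 2)) Φ)
      have hm : MeasurableSet (S ∩ Metric.ball z (C.r / 2)) :=
        hS.measurableSet.inter Metric.isOpen_ball.measurableSet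
      have hnf : ∀ᵐ x ∂(volume.restrict (S ∩ Metric.ball z (C.r / 2))), x ∉ frontier Ω :=
        ae_restrict_of_ae (measure_eq_zero_iff_ae_notMem.1 (volume_frontier hΩ))
      filter_upwards [ae_restrict_mem hm, hnf] with x hx hxf
      obtain ⟨h1, h2, h3, h4⟩ := hsub x hx hxf
      have hmemb : C.proj x ∈ Metric.closedBall (C.proj z) C.r := by
        rw [Metric.mem_closedBall, dist_eq_norm, ← map_sub]
        have := hx.2
        rw [Metric.mem_ball, dist_eq_norm] at this
        exact (C.norm_proj_le _).trans (by linarith)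
      simp only [hΦ]
      rw [indicator_of_mem hmemb, Pi.one_apply, one_mul,
        indicator_of_mem (show inner ℝ C.e x - C.γ (C.proj x) ∈ Ioo (0 : ℝ) (B + 1) from
          ⟨h2, by linarith⟩),
        Real.enorm_of_nonneg (by positivity)]
      refine ENNReal.ofReal_le_ofReal ?_
      have h5 := Real.rpow_le_rpow_of_nonpos h2 h3 (neg_nonpos.2 hβ0.le)
      rw [Real.mul_rpow (by positivity) h1.le] at h5
      calc Metric.infDist x Ω ^ (-β) = c * ((1 + L) ^ (-β) * Metric.infDist x Ω ^ (-β)) := by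
            rw [← mul_assoc, hc, ← Real.rpow_add (by positivity), add_neg_cancel, Real.rpow_zero,
              one_mul]
        _ ≤ _ := by gcongr
    refine hle.trans_lt ?_
    rw [lintegral_slice C.e C.norm_e hΦm]
    have hin : ∀ h : (ℝ ∙ C.e)ᗮ, ∫⁻ t : ℝ, Φ (h + t • C.e) =
        (Metric.closedBall (C.proj z) C.r).indicator (fun _ =>
          ∫⁻ τ in Ioo (0 : ℝ) (B + 1), ENNReal.ofReal (c * τ ^ (-β))) h := by
      intro h
      simp only [hΦ, C.inner_add_smul, C.proj_add_smul]
      rw [lintegral_const_mul' _ _ (by simp [indicator]; split_ifs <;> simp),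
        lintegral_sub_right_eq_self (fun t => (Ioo (0 : ℝ) (B + 1)).indicator
          (fun τ => ENNReal.ofReal (c * τ ^ (-β))) t) (C.γ h),
        lintegral_indicator measurableSet_Ioo]
      by_cases hh : h ∈ Metric.closedBall (C.proj z) C.r <;> simp [hh]
    simp_rw [hin]
    rw [lintegral_indicator Metric.isClosed_closedBall.measurableSet, setLIntegral_const]
    refine ENNReal.mul_lt_top ?_ measure_closedBall_lt_top
    have : IntegrableOn (fun τ : ℝ => c * τ ^ (-β)) (Ioo 0 (B + 1)) :=
      ((intervalIntegral.integrableOn_Ioo_rpow_iff (by linarith)).2 (by linarith)).const_mul c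
    exact this.lintegral_lt_top
  · have hpos := hΩ.infDist_pos hzf
    have hcont : ContinuousAt (fun x => Metric.infDist x Ω ^ (-β)) z :=
      (Metric.continuous_infDist_pt Ω).continuousAt.rpow_const (Or.inl hpos.ne')
    exact ((hcont.integrableAtFilter hmeas.stronglyMeasurable.stronglyMeasurableAtFilter
      (Measure.finiteAt_nhds _ _)).filter_mono nhdsWithin_le_nhds)

/-- The distance is at most the vertical height τ above the graph, and ∫ dτ/τ diverges on every line
over a ball of positive measure. This is the obstruction that kills the leading term when b ≥ 1. -/
theorem not_integrableOn_infDist_inv (hΩ : IsBoundedC11Domain Ω) {z : Euc N} (hz : z ∈ frontier Ω)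
    {δ : ℝ} (hδ : 0 < δ) :
    ¬ IntegrableOn (fun x => (Metric.infDist x Ω)⁻¹) (Ωᶜ ∩ Metric.ball z δ) := by
  intro hint
  obtain ⟨C⟩ := hΩ.nonempty_graphChart hz
  have hγ := C.contDiff.continuous
  have hr := C.r_pos
  have hz0 : (C.proj z : Euc N) + (C.γ (C.proj z)) • C.e = z := by
    rw [← (C.mem_frontier_iff hΩ.isOpen (Metric.mem_ball_self hr)).1 hz]
    exact C.proj_add_inner_smul z
  obtain ⟨η, hη0, hη⟩ : ∃ η > 0, ∀ h ∈ Metric.ball (C.proj z) η, ∀ τ ∈ Ioo (-η) η,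
      (h : Euc N) + (C.γ h + τ) • C.e ∈ Metric.ball z (min δ C.r) := by
    have hc : Continuous fun q : (ℝ ∙ C.e)ᗮ × ℝ => (q.1 : Euc N) + (C.γ q.1 + q.2) • C.e := by
      fun_prop
    have := hc.continuousAt (x := (C.proj z, 0)) |>.preimage_mem_nhds
      (t := Metric.ball z (min δ C.r)) (by
        simp only [add_zero]
        rw [hz0]; exact Metric.ball_mem_nhds _ (lt_min hδ hr))
    obtain ⟨η, hη0, hη⟩ := Metric.mem_nhds_iff.1 this
    refine ⟨η, hη0, fun h hh τ hτ => @hη (h, τ) ?_⟩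
    rw [Metric.mem_ball, Prod.dist_eq]
    refine max_lt hh ?_
    rw [Real.dist_eq, sub_zero]
    exact abs_lt.2 hτ
  have hfin := hint.2
  set Φ : Euc N → ENNReal := fun x => (Metric.ball (C.proj z) η).indicator 1 (C.proj x) *
      (Ioo (0 : ℝ) η).indicator (fun τ => ENNReal.ofReal (τ⁻¹))
        (inner ℝ C.e x - C.γ (C.proj x)) with hΦ
  have hΦm : Measurable Φ := by
    refine Measurable.mul ?_ ?_
    · exact (measurable_one.indicator Metric.isOpen_ball.measurableSet).comp
        C.proj.continuous.measurable
    · have h1 : Measurable fun τ : ℝ => ENNReal.ofReal (τ⁻¹) := measurable_inv.ennreal_ofReal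
      refine (h1.indicator measurableSet_Ioo).comp ?_
      have : Continuous fun x : Euc N => inner ℝ C.e x - C.γ (C.proj x) := by fun_prop
      exact this.measurable
  have hle : ∫⁻ x, Φ x ≤ ∫⁻ x in Ωᶜ ∩ Metric.ball z δ, ‖(Metric.infDist x Ω)⁻¹‖ₑ := by
    rw [← lintegral_indicator (hΩ.measurableSet.compl.inter Metric.isOpen_ball.measurableSet)]
    refine lintegral_mono fun x => ?_
    by_cases h1 : C.proj x ∈ Metric.ball (C.proj z) η
    swap
    · simp [hΦ, h1]
    by_cases h2 : inner ℝ C.e x - C.γ (C.proj x) ∈ Ioo (0 : ℝ) η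
    swap
    · simp [hΦ, h2]
    set τ := inner ℝ C.e x - C.γ (C.proj x) with hτ
    have hx : x = (C.proj x : Euc N) + (C.γ (C.proj x) + τ) • C.e := by
      rw [hτ, add_sub_cancel, C.proj_add_inner_smul]
    have hxb := hη _ h1 τ ⟨by linarith [h2.1], h2.2⟩
    rw [← hx] at hxb
    have hxr : x ∈ Metric.ball z C.r := Metric.ball_subset_ball (min_le_right _ _) hxb
    have hxΩ : x ∉ Ω := fun h => by
      have := (C.mem_iff' hxr).1 h
      linarith [h2.1]
    have hyb := hη _ h1 0 ⟨by linarith, hη0⟩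
    have hyf : (C.proj x : Euc N) + (C.γ (C.proj x) + 0) • C.e ∈ frontier Ω := by
      rw [C.mem_frontier_iff hΩ.isOpen (Metric.ball_subset_ball (min_le_right _ _) hyb),
        C.inner_add_smul, C.proj_add_smul, add_zero]
    have hd : Metric.infDist x Ω ≤ τ := by
      rw [← Metric.infDist_closure]
      refine (Metric.infDist_le_dist_of_mem (frontier_subset_closure hyf)).trans_eq ?_
      have h3 : x - ((C.proj x : Euc N) + (C.γ (C.proj x) + 0) • C.e) = τ • C.e := by
        rw [sub_eq_iff_eq_add]
        conv_lhs => rw [hx]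
        rw [add_zero, add_smul]; abel
      rw [dist_eq_norm, h3, norm_smul, C.norm_e, mul_one, Real.norm_eq_abs, abs_of_pos h2.1]
    have hpos : 0 < Metric.infDist x Ω := hΩ.infDist_pos fun h => by
      have : x ∈ frontier Ω := by rw [hΩ.isOpen.frontier_eq]; exact ⟨h, hxΩ⟩
      have := (C.mem_frontier_iff hΩ.isOpen hxr).1 this
      linarith [h2.1]
    rw [indicator_of_mem (show x ∈ Ωᶜ ∩ Metric.ball z δ from
      ⟨hxΩ, Metric.ball_subset_ball (min_le_left _ _) hxb⟩)]
    simp only [hΦ]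
    rw [indicator_of_mem h1, Pi.one_apply, one_mul, indicator_of_mem h2,
      Real.enorm_of_nonneg (by positivity)]
    exact ENNReal.ofReal_le_ofReal (inv_anti₀ hpos hd)
  have htop : ∫⁻ x, Φ x = ⊤ := by
    rw [lintegral_slice C.e C.norm_e hΦm]
    have hin : ∀ h : (ℝ ∙ C.e)ᗮ, ∫⁻ t : ℝ, Φ (h + t • C.e) =
        (Metric.ball (C.proj z) η).indicator (fun _ =>
          ∫⁻ τ in Ioo (0 : ℝ) η, ENNReal.ofReal (τ⁻¹)) h := by
      intro h
      simp only [hΦ, C.inner_add_smul, C.proj_add_smul]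
      rw [lintegral_const_mul' _ _ (by simp [indicator]; split_ifs <;> simp),
        lintegral_sub_right_eq_self (fun t => (Ioo (0 : ℝ) η).indicator
          (fun τ => ENNReal.ofReal (τ⁻¹)) t) (C.γ h),
        lintegral_indicator measurableSet_Ioo]
      by_cases hh : h ∈ Metric.ball (C.proj z) η <;> simp [hh]
    simp_rw [hin]
    rw [lintegral_indicator Metric.isOpen_ball.measurableSet, setLIntegral_const]
    have h1 : ∫⁻ τ in Ioo (0 : ℝ) η, ENNReal.ofReal (τ⁻¹) = ⊤ := by
      by_contra h
      have h2 : IntegrableOn (fun τ : ℝ => τ⁻¹) (Ioo 0 η) := by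
        refine ⟨measurable_inv.aestronglyMeasurable, ?_⟩
        have : ∫⁻ τ in Ioo (0 : ℝ) η, ‖(τ⁻¹ : ℝ)‖ₑ = ∫⁻ τ in Ioo (0 : ℝ) η, ENNReal.ofReal (τ⁻¹) :=
          setLIntegral_congr_fun measurableSet_Ioo fun τ hτ =>
            Real.enorm_of_nonneg (inv_nonneg.2 (le_of_lt hτ.1))
        rw [HasFiniteIntegral, this]
        exact lt_top_iff_ne_top.2 h
      have h3 := (intervalIntegrable_iff_integrableOn_Ioo_of_le hη0.le).2 h2
      rw [intervalIntegrable_inv_iff] at h3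
      rcases h3 with h3 | h3
      · exact hη0.ne h3
      · exact h3 left_mem_uIcc
    rw [h1, ENNReal.top_mul]
    exact (Metric.measure_ball_pos _ _ hη0).ne'
  rw [htop, top_le_iff] at hle
  exact hfin.ne hle

end IsBoundedC11Domain

end Distance

end HigherNeumann

namespace HigherNeumann

/-! ### Integrability of powers of the norm, by polar coordinates. -/

section NormPowers

variable {N : ℕ} [NeZero N]

theorem integrable_indicator_norm_iff {S : Set ℝ} (hS : MeasurableSet S) (f : ℝ → ℝ) :
    IntegrableOn (fun z : Euc N => f ‖z‖) ((fun z => ‖z‖) ⁻¹' S) ↔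
      IntegrableOn (fun r => r ^ (N - 1) * f r) (Ioi 0 ∩ S) := by
  rw [← integrable_indicator_iff (measurable_norm hS)]
  have h1 : (indicator ((fun z : Euc N => ‖z‖) ⁻¹' S) fun z => f ‖z‖) =
      fun z => (S.indicator f) ‖z‖ := rfl
  rw [h1, integrable_fun_norm_addHaar (μ := (volume : Measure (Euc N))), finrank_euclideanSpace_fin,
    inter_comm, ← integrableOn_indicator_iff hS]
  refine iff_of_eq ?_
  congr 1
  ext r
  by_cases hr : r ∈ S <;> simp [hr]

theorem norm_pow_mul_rpow {r : ℝ} (hr : 0 < r) (b : ℝ) :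
    r ^ (N - 1) * r ^ (b - N) = r ^ (b - 1) := by
  rw [← Real.rpow_natCast, ← Real.rpow_add hr]
  congr 1
  rw [Nat.cast_sub NeZero.one_le]
  push_cast; ring

theorem integrableOn_norm_rpow_ball {b : ℝ} (hb : 0 < b) {R : ℝ} (hR : 0 < R) :
    IntegrableOn (fun z : Euc N => ‖z‖ ^ (b - N)) (Metric.ball 0 R) := by
  have h1 : Metric.ball (0 : Euc N) R = (fun z => ‖z‖) ⁻¹' Iio R := by
    ext z; simp
  rw [h1, integrable_indicator_norm_iff measurableSet_Iio fun r => r ^ (b - N), Ioi_inter_Iio]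
  refine ((intervalIntegral.integrableOn_Ioo_rpow_iff hR (s := b - 1)).2 (by linarith)).congr_fun
    (fun r hr => ?_) measurableSet_Ioo
  exact (norm_pow_mul_rpow hr.1 b).symm

theorem integrableOn_norm_rpow_compl_ball {b : ℝ} (hb : 0 < b) {t : ℝ} (ht : 0 < t) :
    IntegrableOn (fun z : Euc N => ‖z‖ ^ (-(N + b))) (Metric.ball 0 t)ᶜ := by
  have h1 : (Metric.ball (0 : Euc N) t)ᶜ = (fun z => ‖z‖) ⁻¹' Ici t := by
    ext z; simp
  rw [h1, integrable_indicator_norm_iff measurableSet_Ici fun r => r ^ (-(N + b)),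
    inter_eq_right.2 (show Ici t ⊆ Ioi 0 from fun r hr => ht.trans_le hr), integrableOn_Ici_iff_integrableOn_Ioi]
  refine (integrableOn_Ioi_rpow_of_lt (a := -b - 1) (by linarith) ht).congr_fun
    (fun r hr => ?_) measurableSet_Ioi
  have : -((N : ℝ) + b) = -b - N := by ring
  simp only [this]
  exact (norm_pow_mul_rpow (ht.trans hr) (-b)).symm

theorem exists_integral_norm_rpow_compl_ball_le {b : ℝ} (hb : 0 < b) : ∃ C : ℝ, 0 < C ∧
    ∀ t : ℝ, 0 < t → ∫ z in (Metric.ball (0 : Euc N) t)ᶜ, ‖z‖ ^ (-(N + b)) ≤ C * t ^ (-b) := by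
  refine ⟨(N • volume.real (Metric.ball (0 : Euc N) 1)) / b + 1, by positivity, fun t ht => ?_⟩
  have h1 : (Metric.ball (0 : Euc N) t)ᶜ = (fun z => ‖z‖) ⁻¹' Ici t := by
    ext z; simp
  rw [h1, ← integral_indicator (measurable_norm measurableSet_Ici)]
  have h2 : (indicator ((fun z : Euc N => ‖z‖) ⁻¹' Ici t) fun z => ‖z‖ ^ (-(N + b))) =
      fun z => (indicator (Ici t) fun r => r ^ (-(N + b))) ‖z‖ := rfl
  rw [h2, integral_fun_norm_addHaar (μ := (volume : Measure (Euc N))), finrank_euclideanSpace_fin]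
  have h3 : ∫ r in Ioi (0 : ℝ), r ^ (N - 1) • (indicator (Ici t) fun r => r ^ (-(N + b))) r =
      t ^ (-b) / b := by
    have e1 : (fun r : ℝ => r ^ (N - 1) • (indicator (Ici t) fun r => r ^ (-((N : ℝ) + b))) r) =
        indicator (Ici t) fun r => r ^ (N - 1) * r ^ (-((N : ℝ) + b)) := by
      ext r
      by_cases hr : r ∈ Ici t <;> simp [hr]
    rw [e1, setIntegral_indicator measurableSet_Ici, inter_eq_right.2 (show Ici t ⊆ Ioi 0 from fun r hr => ht.trans_le hr),
      integral_Ici_eq_integral_Ioi]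
    have e2 : ∫ r in Ioi t, r ^ (N - 1) * r ^ (-((N : ℝ) + b)) = ∫ r in Ioi t, r ^ (-b - 1) := by
      refine setIntegral_congr_fun measurableSet_Ioi fun r hr => ?_
      have : -((N : ℝ) + b) = -b - N := by ring
      simp only [this]
      exact norm_pow_mul_rpow (ht.trans hr) (-b)
    rw [e2, integral_Ioi_rpow_of_lt (by linarith) ht]
    rw [sub_add_cancel, div_neg, neg_div, neg_neg]
  rw [h3, add_mul, one_mul, nsmul_eq_mul, nsmul_eq_mul, smul_eq_mul]
  have h4 : 0 < t ^ (-b) := by positivity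
  have h5 : (N : ℝ) * (volume.real (Metric.ball (0 : Euc N) 1) * (t ^ (-b) / b)) =
      N * volume.real (Metric.ball (0 : Euc N) 1) / b * t ^ (-b) := by ring
  linarith

end NormPowers

/-! ### Negative powers and the measure of sublevel sets. -/

section Layers

/-- A negative power of a function with small sublevel sets is integrable. -/
theorem lintegral_rpow_neg_lt_top {α : Type*} [MeasurableSpace α] {μ : Measure α} {ρ : α → ℝ}
    (hρ : Measurable ρ) {C b q : ℝ} (hq : 0 ≤ q) (hqb : q < b) (hC : 0 ≤ C)
    (h : ∀ r, 0 < r → r ≤ 1 → μ {x | ρ x ≤ r} ≤ ENNReal.ofReal (C * r ^ b)) :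
    ∫⁻ x in {x | 0 < ρ x ∧ ρ x ≤ 1}, ENNReal.ofReal (ρ x ^ (-q)) ∂μ < ⊤ := by
  have hm : ∀ j : ℕ, MeasurableSet {x | ρ x ≤ (1 / 2 : ℝ) ^ j} := fun j =>
    measurableSet_le hρ measurable_const
  have hm2 : MeasurableSet {x | 0 < ρ x ∧ ρ x ≤ 1} :=
    (measurableSet_lt measurable_const hρ).inter (measurableSet_le hρ measurable_const)
  -- On the dyadic shell 2^(-j-1) < ρ ≤ 2^(-j) the power is at most its value at the lower end. The
  -- resulting series is geometric of ratio 2^(q-b) < 1.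
  have hle : ∀ x ∈ {x | 0 < ρ x ∧ ρ x ≤ 1}, ENNReal.ofReal (ρ x ^ (-q)) ≤
      ∑' j : ℕ, ENNReal.ofReal (((1 / 2 : ℝ) ^ (j + 1)) ^ (-q)) *
        indicator {x | ρ x ≤ (1 / 2 : ℝ) ^ j} 1 x := by
    rintro x ⟨h0, h1⟩
    obtain ⟨j, hj1, hj2⟩ := exists_nat_pow_near_of_lt_one h0 h1 (by norm_num : (0 : ℝ) < 1 / 2)
      (by norm_num)
    refine le_trans ?_ (ENNReal.le_tsum j)
    rw [indicator_of_mem (by exact hj2), Pi.one_apply, mul_one]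
    exact ENNReal.ofReal_le_ofReal
      (Real.rpow_le_rpow_of_nonpos (by positivity) hj1.le (neg_nonpos.2 hq))
  refine (setLIntegral_mono' hm2 hle).trans_lt ?_
  refine (setLIntegral_le_lintegral _ _).trans_lt ?_
  rw [lintegral_tsum fun j => ((measurable_one.indicator (hm j)).const_mul _).aemeasurable]
  have hterm : ∀ j : ℕ, ∫⁻ x, ENNReal.ofReal (((1 / 2 : ℝ) ^ (j + 1)) ^ (-q)) *
        indicator {x | ρ x ≤ (1 / 2 : ℝ) ^ j} 1 x ∂μ ≤
      ENNReal.ofReal ((1 / 2 : ℝ) ^ (-q) * C * ((1 / 2 : ℝ) ^ (b - q)) ^ j) := by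
    intro j
    rw [lintegral_const_mul _ (measurable_one.indicator (hm j)), lintegral_indicator_one (hm j)]
    refine (mul_le_mul_right (h _ (by positivity) (pow_le_one₀ (by norm_num) (by norm_num))) _).trans_eq ?_
    rw [← ENNReal.ofReal_mul (by positivity)]
    congr 1
    have e1 : ((1 / 2 : ℝ) ^ (j + 1)) ^ (-q) = (1 / 2 : ℝ) ^ (-q) * ((1 / 2 : ℝ) ^ (-q)) ^ j := by
      rw [pow_succ, Real.mul_rpow (by positivity) (by positivity), mul_comm,
        ← Real.rpow_natCast, ← Real.rpow_natCast, ← Real.rpow_mul (by positivity),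
        ← Real.rpow_mul (by positivity), mul_comm (j : ℝ)]
    have e2 : ((1 / 2 : ℝ) ^ j) ^ b = ((1 / 2 : ℝ) ^ b) ^ j := by
      rw [← Real.rpow_natCast, ← Real.rpow_natCast, ← Real.rpow_mul (by positivity),
        ← Real.rpow_mul (by positivity), mul_comm (j : ℝ)]
    rw [e1, e2, sub_eq_add_neg, add_comm b, Real.rpow_add (by positivity), mul_pow]
    ring
  refine (ENNReal.tsum_le_tsum hterm).trans_lt ?_
  have hr1 : (1 / 2 : ℝ) ^ (b - q) < 1 := Real.rpow_lt_one (by norm_num) (by norm_num) (by linarith)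
  have hs : Summable fun j : ℕ => (1 / 2 : ℝ) ^ (-q) * C * ((1 / 2 : ℝ) ^ (b - q)) ^ j :=
    (summable_geometric_of_lt_one (by positivity) hr1).mul_left _
  rw [← ENNReal.ofReal_tsum_of_nonneg (fun j => by positivity) hs]
  exact ENNReal.ofReal_lt_top

end Layers

/-! ### The region between two tangent paraboloids. -/

section Thin

variable {N : ℕ} [NeZero N]

theorem exists_isometry_map_eq {ν ν' : Euc N} (h : ‖ν‖ = ‖ν'‖) :
    ∃ R : Euc N ≃ₗᵢ[ℝ] Euc N, R ν = ν' :=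
  ⟨(ℝ ∙ (ν - ν'))ᗮ.reflection, Submodule.reflection_sub h⟩

/-- The region between two paraboloids tangent at the origin to the hyperplane orthogonal to `ν`. -/
def thinSet (K : ℝ) (ν : Euc N) : Set (Euc N) := {w | |inner ℝ ν w| ≤ K * ‖w‖ ^ 2}

theorem measurableSet_thinSet (K : ℝ) (ν : Euc N) : MeasurableSet (thinSet K ν) :=
  (isClosed_le (by fun_prop) (by fun_prop)).measurableSet

/-- The part of the region in a ball of radius r lies in a flat cylinder of base radius r and height
2Kr². Its volume is O(r^(N+1)), one power better than that of the ball, and this gains one power in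
the admissible singularity. -/
theorem integrableOn_thinSet {K : ℝ} (hK : 0 < K) {ν : Euc N} (hν : ‖ν‖ = 1) {q : ℝ} (hq0 : 0 < q)
    (hq : q < N + 1) :
    IntegrableOn (fun w : Euc N => ‖w‖ ^ (-q)) (thinSet K ν ∩ Metric.closedBall 0 1) := by
  have hmeas : Measurable fun w : Euc N => ‖w‖ ^ (-q) := measurable_norm.pow_const _
  refine ⟨hmeas.aestronglyMeasurable, ?_⟩
  set μ := (volume : Measure (Euc N)).restrict (thinSet K ν) with hμ
  set A := volume.real (Metric.closedBall (0 : (ℝ ∙ ν)ᗮ) 1) with hA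
  have hN : Module.finrank ℝ (ℝ ∙ ν)ᗮ + 1 = N := by
    rw [finrank_orthogonal_span ν hν, finrank_euclideanSpace_fin]
  have key := lintegral_rpow_neg_lt_top (μ := μ) (ρ := fun w : Euc N => ‖w‖) measurable_norm
    (C := A * (2 * K)) (b := N + 1) hq0.le hq (by positivity) (fun r hr0 hr1 => by
      have hm : MeasurableSet {w : Euc N | ‖w‖ ≤ r} := measurableSet_le measurable_norm measurable_const
      rw [hμ, Measure.restrict_apply hm]
      have hsub : {w : Euc N | ‖w‖ ≤ r} ∩ thinSet K ν ⊆ sliceEquiv ν hν ⁻¹'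
          (Metric.closedBall (0 : (ℝ ∙ ν)ᗮ) r ×ˢ Icc (-(K * r ^ 2)) (K * r ^ 2)) := by
        rintro w ⟨h1, h2⟩
        simp only [mem_ofPred_eq] at h1
        refine ⟨?_, ?_⟩
        · simp only [sliceEquiv_apply, Metric.mem_closedBall, dist_zero_right]
          exact ((ℝ ∙ ν)ᗮ.norm_orthogonalProjectionOnto_apply_le w).trans h1
        · simp only [sliceEquiv_apply]
          have h2 : |inner ℝ ν w| ≤ K * ‖w‖ ^ 2 := h2
          have : K * ‖w‖ ^ 2 ≤ K * r ^ 2 := by gcongr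
          exact abs_le.1 (h2.trans this)
      refine (measure_mono hsub).trans ?_
      rw [(measurePreserving_sliceEquiv ν hν).measure_preimage_equiv, Measure.volume_eq_prod,
        Measure.prod_prod, Real.volume_Icc, Measure.addHaar_closedBall' _ _ hr0.le]
      have : volume (Metric.closedBall (0 : (ℝ ∙ ν)ᗮ) 1) = ENNReal.ofReal A :=
        (ENNReal.ofReal_toReal measure_closedBall_lt_top.ne).symm
      rw [this, ← ENNReal.ofReal_mul (by positivity), ← ENNReal.ofReal_mul (by positivity)]
      refine ENNReal.ofReal_le_ofReal (le_of_eq ?_)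
      have e1 : r ^ ((N : ℝ) + 1) = r ^ (Module.finrank ℝ (ℝ ∙ ν)ᗮ) * r ^ 2 := by
        rw [← pow_add, ← Real.rpow_natCast]
        congr 1
        have : (N : ℝ) = Module.finrank ℝ (ℝ ∙ ν)ᗮ + 1 := by exact_mod_cast hN.symm
        push_cast; linarith
      rw [e1]; ring)
  rw [hμ, Measure.restrict_restrict] at key
  · have h1 : HasFiniteIntegral (fun w : Euc N => ‖w‖ ^ (-q))
        (volume.restrict (thinSet K ν ∩ Metric.closedBall 0 1)) := by
      have h2 : ∫⁻ w in thinSet K ν ∩ Metric.closedBall 0 1, ‖‖w‖ ^ (-q)‖ₑ ≤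
          ∫⁻ w in {w : Euc N | 0 < ‖w‖ ∧ ‖w‖ ≤ 1} ∩ thinSet K ν, ENNReal.ofReal (‖w‖ ^ (-q)) := by
        have hm1 : MeasurableSet (thinSet K ν ∩ Metric.closedBall 0 1) :=
          (measurableSet_thinSet K ν).inter Metric.isClosed_closedBall.measurableSet
        have hm2 : MeasurableSet ({w : Euc N | 0 < ‖w‖ ∧ ‖w‖ ≤ 1} ∩ thinSet K ν) :=
          ((measurableSet_lt measurable_const measurable_norm).inter
            (measurableSet_le measurable_norm measurable_const)).inter (measurableSet_thinSet K ν)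
        rw [← lintegral_indicator hm1, ← lintegral_indicator hm2]
        refine lintegral_mono fun w => ?_
        by_cases hw : w ∈ thinSet K ν ∩ Metric.closedBall 0 1
        · rw [indicator_of_mem hw]
          rcases (norm_nonneg w).eq_or_lt' with h0 | h0
          · rw [h0, Real.zero_rpow (by linarith)]; simp
          · rw [indicator_of_mem (show w ∈ {w : Euc N | 0 < ‖w‖ ∧ ‖w‖ ≤ 1} ∩ thinSet K ν from
              ⟨⟨h0, by simpa using hw.2⟩, hw.1⟩), Real.enorm_of_nonneg (by positivity)]
        · rw [indicator_of_notMem hw]; exact zero_le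
      exact h2.trans_lt key
    exact h1
  · exact (measurableSet_lt measurable_const measurable_norm).inter
      (measurableSet_le measurable_norm measurable_const)

theorem thinSet_preimage (K : ℝ) (ν : Euc N) (R : Euc N ≃ₗᵢ[ℝ] Euc N) :
    R ⁻¹' (thinSet K (R ν)) = thinSet K ν := by
  ext w; simp [thinSet]

/-- By rotation invariance the integral has the same value for all unit vectors ν. The uniformity in
ν is what makes all boundary estimates uniform in the boundary point. -/
theorem exists_integral_thinSet_le (K q : ℝ) : ∃ C : ℝ, 0 ≤ C ∧ ∀ ν : Euc N, ‖ν‖ = 1 →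
    ∫ w in thinSet K ν ∩ Metric.closedBall 0 1, ‖w‖ ^ (-q) ≤ C := by
  obtain ⟨ν₀, hν₀⟩ := exists_norm_eq (Euc N) zero_le_one
  refine ⟨∫ w in thinSet K ν₀ ∩ Metric.closedBall 0 1, ‖w‖ ^ (-q),
    integral_nonneg fun w => by positivity, fun ν hν => ?_⟩
  obtain ⟨R, hR⟩ := exists_isometry_map_eq (hν.trans hν₀.symm)
  have h1 : thinSet K ν ∩ Metric.closedBall 0 1 =
      R.toMeasurableEquiv ⁻¹' (thinSet K ν₀ ∩ Metric.closedBall 0 1) := by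
    rw [preimage_inter, ← hR]
    have h2 := thinSet_preimage K ν R
    have h3 : R ⁻¹' (Metric.closedBall 0 1) = Metric.closedBall 0 1 := by
      ext w; simp
    have e : ⇑R.toMeasurableEquiv = ⇑R := rfl
    rw [e, h2, h3]
  have h2 := (R.measurePreserving.setIntegral_preimage_emb R.toMeasurableEquiv.measurableEmbedding
    (fun w : Euc N => ‖w‖ ^ (-q)) (thinSet K ν₀ ∩ Metric.closedBall 0 1))
  rw [h1]
  simp only [LinearIsometryEquiv.norm_map] at h2
  exact h2.le

end Thin

end HigherNeumann

namespace HigherNeumann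

/-! ### The singular kernel and its regularizations. -/

section Profiles

/-- A radial kernel `z ↦ κ (‖z‖²)` bounded, with its gradient, like `‖z‖ ^ (-q)`. -/
structure KernelProfile (q : ℝ) (κ κ' : ℝ → ℝ) : Prop where
  measurable : Measurable κ
  measurable' : Measurable κ'
  hasDerivAt : ∀ s, 0 < s → HasDerivAt κ (κ' s) s
  nonneg : ∀ s, 0 < s → 0 ≤ κ s
  le : ∀ r, 0 < r → κ (r ^ 2) ≤ r ^ (-q)
  deriv_le : ∀ r, 0 < r → |κ' (r ^ 2)| ≤ (q + 2) * r ^ (-q - 2)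

theorem sq_rpow_neg_half {r : ℝ} (hr : 0 < r) (q : ℝ) : (r ^ 2) ^ (-(q / 2)) = r ^ (-q) := by
  rw [← Real.rpow_natCast, ← Real.rpow_mul hr.le]
  congr 1
  push_cast; ring

/-- The profile of the kernel of the fractional Laplacian. -/
theorem kernelProfile_rpow {q : ℝ} (hq : 0 ≤ q) :
    KernelProfile q (fun s => s ^ (-(q / 2))) (fun s => -(q / 2) * s ^ (-(q / 2) - 1)) where
  measurable := measurable_id.pow_const _
  measurable' := (measurable_id.pow_const _).const_mul _
  hasDerivAt s hs := Real.hasDerivAt_rpow_const (Or.inl hs.ne')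
  nonneg s hs := by positivity
  le r hr := (sq_rpow_neg_half hr q).le
  deriv_le r hr := by
    have : (r ^ 2) ^ (-(q / 2) - 1) = r ^ (-q - 2) := by
      rw [← Real.rpow_natCast, ← Real.rpow_mul hr.le]
      congr 1
      push_cast; ring
    rw [this, abs_mul, abs_neg, abs_of_nonneg (by positivity), abs_of_pos (by positivity)]
    gcongr
    linarith

/-- The profile of the regularized kernels. -/
noncomputable def regProfile (q ε s : ℝ) : ℝ := (s + ε) ^ (-(q / 2)) * (1 + ε * s)⁻¹

/-- Written as a logarithmic derivative times the profile, so that bounds on the profile carry over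
to its derivative. -/
noncomputable def regProfileDeriv (q ε s : ℝ) : ℝ :=
  -(q / 2 * (s + ε)⁻¹ + ε * (1 + ε * s)⁻¹) * regProfile q ε s

theorem hasDerivAt_regProfile {q ε s : ℝ} (hε : 0 < ε) (hs : 0 ≤ s) :
    HasDerivAt (regProfile q ε) (regProfileDeriv q ε s) s := by
  have h1 : HasDerivAt (fun s => (s + ε) ^ (-(q / 2))) (1 * (-(q / 2)) * (s + ε) ^ (-(q / 2) - 1)) s :=
    ((hasDerivAt_id s).add_const ε).rpow_const (Or.inl (by positivity))
  have h2 : HasDerivAt (fun s => (1 + ε * s)⁻¹) (-(ε * 1) / (1 + ε * s) ^ 2) s :=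
    (((hasDerivAt_id s).const_mul ε).const_add 1).inv (by positivity)
  refine (h1.mul h2).congr_deriv ?_
  rw [regProfileDeriv, regProfile, Real.rpow_sub_one (by positivity)]
  field_simp
  ring

/-- All bounds are those of the singular kernel and do not involve ε, because (s + ε)⁻¹ ≤ s⁻¹ and
ε/(1 + εs) ≤ s⁻¹. Every estimate proved for a `KernelProfile` is therefore uniform in the
regularization. -/
theorem kernelProfile_reg {q ε : ℝ} (hq : 0 ≤ q) (hε : 0 < ε) :
    KernelProfile q (regProfile q ε) (regProfileDeriv q ε) := by
  have hm : Measurable (regProfile q ε) := by unfold regProfile; fun_prop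
  have hle : ∀ s, 0 < s → regProfile q ε s ≤ s ^ (-(q / 2)) := by
    intro s hs
    have h1 : (s + ε) ^ (-(q / 2)) ≤ s ^ (-(q / 2)) :=
      Real.rpow_le_rpow_of_nonpos hs (by linarith) (by linarith)
    have h2 : (1 + ε * s)⁻¹ ≤ 1 := inv_le_one_of_one_le₀ (by nlinarith)
    calc _ ≤ s ^ (-(q / 2)) * 1 := by unfold regProfile; gcongr
      _ = _ := mul_one _
  have hnn : ∀ s, 0 < s → 0 ≤ regProfile q ε s := fun s hs => by unfold regProfile; positivity
  refine ⟨hm, ?_, fun s hs => hasDerivAt_regProfile hε hs.le, hnn, ?_, ?_⟩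
  · unfold regProfileDeriv; fun_prop
  · intro r hr
    rw [← sq_rpow_neg_half hr]
    exact hle _ (by positivity)
  · intro r hr
    have hs : 0 < r ^ 2 := by positivity
    have h1 : q / 2 * (r ^ 2 + ε)⁻¹ ≤ q / 2 * (r ^ 2)⁻¹ := by gcongr; linarith
    have h2 : ε * (1 + ε * r ^ 2)⁻¹ ≤ (r ^ 2)⁻¹ := by
      rw [← div_eq_mul_inv, div_le_iff₀ (by positivity), inv_mul_eq_div, le_div_iff₀ hs]
      linarith
    have h3 : r ^ (-q - 2) = (r ^ 2)⁻¹ * r ^ (-q) := by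
      rw [Real.rpow_sub hr, div_eq_inv_mul]; norm_cast
    have h4 := hle _ hs
    rw [sq_rpow_neg_half hr] at h4
    rw [regProfileDeriv, abs_mul, abs_neg, abs_of_nonneg (by positivity), abs_of_nonneg (hnn _ hs), h3]
    calc _ ≤ (q / 2 * (r ^ 2)⁻¹ + (r ^ 2)⁻¹) * r ^ (-q) := by gcongr; exact hnn _ hs
      _ = (q / 2 + 1) * ((r ^ 2)⁻¹ * r ^ (-q)) := by ring
      _ ≤ _ := by gcongr; linarith; norm_num

theorem tendsto_regProfile {q s : ℝ} (hs : 0 < s) :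
    Tendsto (fun ε => regProfile q ε s) (𝓝[>] 0) (𝓝 (s ^ (-(q / 2)))) := by
  have h : ContinuousAt (fun ε => regProfile q ε s) 0 := by
    unfold regProfile
    refine ContinuousAt.mul ?_ ?_
    · exact ContinuousAt.rpow_const (by fun_prop) (Or.inl (by simpa using hs.ne'))
    · exact ContinuousAt.inv₀ (by fun_prop) (by simp)
  have := h.tendsto.mono_left (nhdsWithin_le_nhds (s := Ioi 0))
  simpa [regProfile] using this

theorem tendsto_regProfileDeriv {q s : ℝ} (hs : 0 < s) :
    Tendsto (fun ε => regProfileDeriv q ε s) (𝓝[>] 0) (𝓝 (-(q / 2) * s ^ (-(q / 2) - 1))) := by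
  have h : ContinuousAt (fun ε => -(q / 2 * (s + ε)⁻¹ + ε * (1 + ε * s)⁻¹)) 0 := by
    have h1 : ContinuousAt (fun ε => (s + ε)⁻¹) 0 :=
      ContinuousAt.inv₀ (by fun_prop) (by simpa using hs.ne')
    have h2 : ContinuousAt (fun ε => (1 + ε * s)⁻¹) 0 :=
      ContinuousAt.inv₀ (by fun_prop) (by simp)
    fun_prop
  have := (h.tendsto.mono_left (nhdsWithin_le_nhds (s := Ioi 0))).mul (tendsto_regProfile (q := q) hs)
  have e : -(q / 2) * s ^ (-(q / 2) - 1) =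
      -(q / 2 * (s + 0)⁻¹ + 0 * (1 + 0 * s)⁻¹) * s ^ (-(q / 2)) := by
    rw [Real.rpow_sub_one hs.ne']; simp; ring
  rw [e]
  exact this

end Profiles

end HigherNeumann

namespace HigherNeumann

/-! ### Kernel integrals over half-spaces. -/

section HalfSpace

variable {N : ℕ}

/-- The trace of a linear map in the standard coordinates. -/
noncomputable def coordTrace (B : Euc N →L[ℝ] Euc N) : ℝ := ∑ i : Fin N, B (EuclideanSpace.single i 1) i

theorem divergence_eq_coordTrace (V : Euc N → Euc N) (x : Euc N) :
    divergence V x = coordTrace (fderiv ℝ V x) := rfl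

/-- Basis independence of the trace allows the divergence to be split along a basis that contains
the normal. -/
theorem coordTrace_eq_sum_inner {ι : Type*} [Fintype ι] (b : OrthonormalBasis ι ℝ (Euc N))
    (B : Euc N →L[ℝ] Euc N) : coordTrace B = ∑ i, inner ℝ (b i) (B (b i)) := by
  rw [coordTrace, ← ContinuousLinearMap.coe_coe, ← LinearMap.trace_eq_sum_inner _ b,
    LinearMap.trace_eq_sum_inner _ (EuclideanSpace.basisFun (Fin N) ℝ)]
  refine Finset.sum_congr rfl fun i _ => ?_
  simp [EuclideanSpace.inner_single_left]

theorem coordTrace_sub (A B : Euc N →L[ℝ] Euc N) :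
    coordTrace (A - B) = coordTrace A - coordTrace B := by
  simp [coordTrace]

theorem coordTrace_smul (c : ℝ) (A : Euc N →L[ℝ] Euc N) :
    coordTrace (c • A) = c * coordTrace A := by
  simp [coordTrace, Finset.mul_sum]

theorem coordTrace_id : coordTrace (ContinuousLinearMap.id ℝ (Euc N)) = N := by
  simp [coordTrace]

theorem abs_coordTrace_le (B : Euc N →L[ℝ] Euc N) : |coordTrace B| ≤ N * ‖B‖ := by
  refine (Finset.abs_sum_le_sum_abs _ _).trans ?_
  calc _ ≤ ∑ _i : Fin N, ‖B‖ := by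
        refine Finset.sum_le_sum fun i _ => ?_
        have h1 := PiLp.norm_apply_le (B (EuclideanSpace.single i 1)) i
        have h2 := B.le_opNorm (EuclideanSpace.single i 1)
        rw [PiLp.norm_single, norm_one, mul_one] at h2
        exact h1.trans h2
    _ = _ := by simp

/-- The divergence of the vector field `z ↦ κ (‖z‖²) B z`. -/
noncomputable def kernelDiv (κ κ' : ℝ → ℝ) (B : Euc N →L[ℝ] Euc N) (z : Euc N) : ℝ :=
  coordTrace B * κ (‖z‖ ^ 2) + 2 * κ' (‖z‖ ^ 2) * inner ℝ (B z) z

variable {q : ℝ} {κ κ' : ℝ → ℝ}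

theorem KernelProfile.measurable_kernelDiv (hκ : KernelProfile q κ κ') (B : Euc N →L[ℝ] Euc N) :
    Measurable (kernelDiv κ κ' B) := by
  have h1 := hκ.measurable
  have h2 := hκ.measurable'
  have h3 : Measurable fun z : Euc N => inner ℝ (B z) z :=
    (by fun_prop : Continuous fun z : Euc N => inner ℝ (B z) z).measurable
  unfold kernelDiv
  fun_prop

theorem KernelProfile.q_nonneg (hκ : KernelProfile q κ κ') : 0 ≤ q + 2 := by
  have := hκ.deriv_le 1 one_pos
  simp only [Real.one_rpow, mul_one] at this
  exact (abs_nonneg _).trans this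

theorem rpow_sub_two_mul_sq {r : ℝ} (hr : 0 < r) (b : ℝ) : r ^ (b - 2) * r ^ 2 = r ^ b := by
  rw [Real.rpow_sub hr]
  norm_cast
  field_simp

theorem KernelProfile.abs_kernelDiv_le (hκ : KernelProfile q κ κ') (B : Euc N →L[ℝ] Euc N)
    {z : Euc N} (hz : z ≠ 0) :
    |kernelDiv κ κ' B z| ≤ (N + 2 * (q + 2)) * ‖B‖ * ‖z‖ ^ (-q) := by
  have hr : 0 < ‖z‖ := norm_pos_iff.2 hz
  have h1 := hκ.le _ hr
  have h2 := hκ.deriv_le _ hr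
  have h3 := hκ.nonneg (‖z‖ ^ 2) (by positivity)
  have h4 := abs_coordTrace_le B
  have h5 : |inner ℝ (B z) z| ≤ ‖B‖ * ‖z‖ ^ 2 := by
    refine (abs_real_inner_le_norm _ _).trans ?_
    rw [sq, ← mul_assoc]
    gcongr
    exact B.le_opNorm z
  have h6 := hκ.q_nonneg
  have h7 := rpow_sub_two_mul_sq hr (-q)
  calc |kernelDiv κ κ' B z|
      ≤ |coordTrace B| * κ (‖z‖ ^ 2) + 2 * |κ' (‖z‖ ^ 2)| * |inner ℝ (B z) z| := by
        refine (abs_add_le _ _).trans ?_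
        rw [abs_mul, abs_mul, abs_mul, abs_of_nonneg h3, abs_of_pos (two_pos (α := ℝ))]
    _ ≤ (N * ‖B‖) * ‖z‖ ^ (-q) + 2 * ((q + 2) * ‖z‖ ^ (-q - 2)) * (‖B‖ * ‖z‖ ^ 2) := by gcongr
    _ = (N * ‖B‖) * ‖z‖ ^ (-q) + 2 * (q + 2) * ‖B‖ * (‖z‖ ^ (-q - 2) * ‖z‖ ^ 2) := by ring
    _ = _ := by rw [h7]; ring

variable [NeZero N]

theorem halfSpace_subset {ν : Euc N} (hν : ‖ν‖ = 1) (t : ℝ) :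
    {z : Euc N | t < inner ℝ ν z} ⊆ (Metric.ball 0 t)ᶜ := by
  intro z hz
  have h1 : t < inner ℝ ν z := hz
  have h2 := real_inner_le_norm ν z
  rw [hν, one_mul] at h2
  simp only [mem_compl_iff, Metric.mem_ball, dist_zero_right, not_lt]
  linarith

theorem measurableSet_halfSpace (ν : Euc N) (t : ℝ) : MeasurableSet {z : Euc N | t < inner ℝ ν z} :=
  (isOpen_lt (by fun_prop) (by fun_prop)).measurableSet

theorem integrableOn_of_norm_rpow_bound {f : Euc N → ℝ} (hf : AEStronglyMeasurable f) {b : ℝ}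
    (hb : 0 < b) {t : ℝ} (ht : 0 < t) {C : ℝ}
    (h : ∀ z : Euc N, z ≠ 0 → |f z| ≤ C * ‖z‖ ^ (-(N + b))) :
    IntegrableOn f (Metric.ball 0 t)ᶜ := by
  refine Integrable.mono' ((integrableOn_norm_rpow_compl_ball hb ht).const_mul C) hf.restrict ?_
  filter_upwards [ae_restrict_mem Metric.isOpen_ball.measurableSet.compl] with z hz
  refine h z ?_
  rintro rfl
  exact hz (Metric.mem_ball_self ht)

theorem KernelProfile.integrableOn_kernelDiv {b : ℝ} (hb : 0 < b)
    (hκ : KernelProfile (N + b) κ κ') (B : Euc N →L[ℝ] Euc N) {t : ℝ} (ht : 0 < t) :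
    IntegrableOn (kernelDiv κ κ' B) (Metric.ball 0 t)ᶜ :=
  integrableOn_of_norm_rpow_bound (hκ.measurable_kernelDiv B).aestronglyMeasurable hb ht
    fun _ hz => hκ.abs_kernelDiv_le B hz

/-- A tangential derivative has integral zero over a half-space. -/
theorem KernelProfile.integral_halfSpace_tangential {b : ℝ} (hb : 0 < b)
    (hκ : KernelProfile (N + b) κ κ') (B : Euc N →L[ℝ] Euc N) {t : ℝ} (ht : 0 < t) {ν e : Euc N}
    (hν : ‖ν‖ = 1) (he : ‖e‖ = 1) (hνe : inner ℝ ν e = 0) :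
    IntegrableOn (fun z : Euc N => inner ℝ e (B e) * κ (‖z‖ ^ 2) +
      2 * κ' (‖z‖ ^ 2) * (inner ℝ (B z) e * inner ℝ e z)) {z | t < inner ℝ ν z} ∧
    ∫ z in {z : Euc N | t < inner ℝ ν z}, (inner ℝ e (B e) * κ (‖z‖ ^ 2) +
      2 * κ' (‖z‖ ^ 2) * (inner ℝ (B z) e * inner ℝ e z)) = 0 := by
  set g' : Euc N → ℝ := fun z => inner ℝ e (B e) * κ (‖z‖ ^ 2) +
      2 * κ' (‖z‖ ^ 2) * (inner ℝ (B z) e * inner ℝ e z)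
  set g : Euc N → ℝ := fun z => inner ℝ (B z) e * κ (‖z‖ ^ 2) with hg
  have hm1 := hκ.measurable
  have hm2 := hκ.measurable'
  have hmH := measurableSet_halfSpace ν t
  have hmeas : Measurable g' := by
    have h3 : Measurable fun z : Euc N => inner ℝ (B z) e * inner ℝ e z :=
      (by fun_prop : Continuous fun z : Euc N => inner ℝ (B z) e * inner ℝ e z).measurable
    fun_prop
  have h6 := hκ.q_nonneg
  have hint : IntegrableOn g' {z | t < inner ℝ ν z} := by
    refine (integrableOn_of_norm_rpow_bound hmeas.aestronglyMeasurable hb ht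
      (C := ‖B‖ + 2 * (N + b + 2) * ‖B‖) fun z hz => ?_).mono_set (halfSpace_subset hν t)
    have hr : 0 < ‖z‖ := norm_pos_iff.2 hz
    have h1 := hκ.le _ hr
    have h2 := hκ.deriv_le _ hr
    have h3 := hκ.nonneg (‖z‖ ^ 2) (by positivity)
    have h4 : |inner ℝ e (B e)| ≤ ‖B‖ := by
      refine (abs_real_inner_le_norm _ _).trans ?_
      have := B.le_opNorm e
      rw [he, mul_one] at this
      rwa [he, one_mul]
    have h5 : |inner ℝ (B z) e * inner ℝ e z| ≤ ‖B‖ * ‖z‖ ^ 2 := by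
      rw [abs_mul]
      have e1 := abs_real_inner_le_norm (B z) e
      have e2 := abs_real_inner_le_norm e z
      rw [he, mul_one] at e1
      rw [he, one_mul] at e2
      rw [sq, ← mul_assoc]
      gcongr
      exact e1.trans (B.le_opNorm z)
    have h7 := rpow_sub_two_mul_sq hr (-(N + b))
    calc |g' z| ≤ |inner ℝ e (B e)| * κ (‖z‖ ^ 2) +
          2 * |κ' (‖z‖ ^ 2)| * |inner ℝ (B z) e * inner ℝ e z| := by
          refine (abs_add_le _ _).trans ?_
          rw [abs_mul, abs_mul (2 * _), abs_mul 2, abs_of_nonneg h3, abs_of_pos (two_pos (α := ℝ))]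
      _ ≤ ‖B‖ * ‖z‖ ^ (-(N + b)) + 2 * ((N + b + 2) * ‖z‖ ^ (-(N + b) - 2)) * (‖B‖ * ‖z‖ ^ 2) := by
          gcongr
      _ = ‖B‖ * ‖z‖ ^ (-(N + b)) + 2 * (N + b + 2) * ‖B‖ * (‖z‖ ^ (-(N + b) - 2) * ‖z‖ ^ 2) := by ring
      _ = _ := by rw [h7]; ring
  refine ⟨hint, ?_⟩
  rw [← integral_indicator hmH]
  -- Lines in the tangential direction e never cross the boundary hyperplane, so the field cut off
  -- to the half-space stays differentiable along them. It decays like ‖z‖^(1-N-b), a negative power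
  -- since N ≥ 1 and b > 0.
  have hcst : ∀ x : Euc N, ∀ s : ℝ, inner ℝ ν (x + s • e) = inner ℝ ν x := fun x s => by
    rw [inner_add_right, real_inner_smul_right, hνe, mul_zero, add_zero]
  have hlim : ∀ (x : Euc N) (l : Filter ℝ), Tendsto (fun s : ℝ => ‖x + s • e‖) l atTop →
      Tendsto (fun s : ℝ => indicator {z : Euc N | t < inner ℝ ν z} g (x + s • e)) l (𝓝 0) := by
    intro x l hl
    have hN1 : (1 : ℝ) ≤ N := by exact_mod_cast NeZero.one_le
    have h1 : Tendsto (fun s : ℝ => ‖B‖ * ‖x + s • e‖ ^ (-(N + b - 1))) l (𝓝 0) := by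
      have := ((tendsto_rpow_neg_atTop (y := N + b - 1) (by linarith)).comp hl).const_mul ‖B‖
      simpa using this
    refine squeeze_zero_norm (fun s => ?_) h1
    by_cases hx : t < inner ℝ ν x
    · rw [indicator_of_mem (by show t < inner ℝ ν (x + s • e); rwa [hcst])]
      have hr : 0 < ‖x + s • e‖ := by
        have h1 := real_inner_le_norm ν (x + s • e)
        rw [hν, one_mul, hcst] at h1
        linarith
      have h3 := hκ.nonneg (‖x + s • e‖ ^ 2) (by positivity)
      have h4 : |inner ℝ (B (x + s • e)) e| ≤ ‖B‖ * ‖x + s • e‖ := by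
        refine (abs_real_inner_le_norm _ _).trans ?_
        rw [he, mul_one]
        exact B.le_opNorm _
      rw [hg, Real.norm_eq_abs, abs_mul, abs_of_nonneg h3]
      calc _ ≤ ‖B‖ * ‖x + s • e‖ * ‖x + s • e‖ ^ (-(N + b)) := by
            gcongr
            exact hκ.le _ hr
        _ = _ := by
            rw [mul_assoc]
            congr 1
            nth_rewrite 1 [← Real.rpow_one ‖x + s • e‖]
            rw [← Real.rpow_add hr]
            congr 1
            ring
    · rw [indicator_of_notMem (by show ¬ t < inner ℝ ν (x + s • e); rwa [hcst])]
      simp; positivity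
  have hnorm : ∀ (x : Euc N) (s : ℝ), |s| - ‖x‖ ≤ ‖x + s • e‖ := fun x s => by
    have h1 : ‖s • e‖ ≤ ‖x + s • e‖ + ‖x‖ := by
      have := norm_sub_le (x + s • e) x
      rwa [add_sub_cancel_left] at this
    rw [norm_smul, he, mul_one, Real.norm_eq_abs] at h1
    linarith
  refine integral_lineDeriv_eq_zero e he (f := indicator {z : Euc N | t < inner ℝ ν z} g)
    (hint.integrable_indicator hmH) ?_ ?_ ?_
  · intro x s
    by_cases hx : t < inner ℝ ν x
    · have e1 : (fun s : ℝ => indicator {z : Euc N | t < inner ℝ ν z} g (x + s • e)) =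
          fun s => g (x + s • e) := by
        ext s
        rw [indicator_of_mem (by show t < inner ℝ ν (x + s • e); rwa [hcst])]
      rw [e1, indicator_of_mem (by show t < inner ℝ ν (x + s • e); rwa [hcst])]
      have hr : 0 < ‖x + s • e‖ := by
        have h1 := real_inner_le_norm ν (x + s • e)
        rw [hν, one_mul, hcst] at h1
        linarith
      have hl : HasDerivAt (fun s : ℝ => x + s • e) e s := by
        have := ((hasDerivAt_id s).smul_const e).const_add x
        simpa using this
      have d1 : HasDerivAt (fun s : ℝ => inner ℝ (B (x + s • e)) e) (inner ℝ (B e) e) s := by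
        have := (B.hasFDerivAt.comp_hasDerivAt s hl).inner ℝ (hasDerivAt_const s e)
        simpa using this
      have d2 : HasDerivAt (fun s : ℝ => ‖x + s • e‖ ^ 2) (2 * inner ℝ (x + s • e) e) s :=
        hl.norm_sq
      have d3 := (hκ.hasDerivAt (‖x + s • e‖ ^ 2) (by positivity)).comp s d2
      refine (d1.mul d3).congr_deriv ?_
      simp only [Function.comp_apply]
      rw [real_inner_comm e (B e), real_inner_comm e (x + s • e)]
      ring
    · have e1 : (fun s : ℝ => indicator {z : Euc N | t < inner ℝ ν z} g (x + s • e)) =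
          fun s => 0 := by
        ext s
        rw [indicator_of_notMem (by show ¬ t < inner ℝ ν (x + s • e); rwa [hcst])]
      rw [e1, indicator_of_notMem (by show ¬ t < inner ℝ ν (x + s • e); rwa [hcst])]
      exact hasDerivAt_const _ _
  · intro x
    refine hlim x _ (tendsto_atTop_mono (hnorm x) ?_)
    exact tendsto_atTop_add_const_right _ _ tendsto_abs_atBot_atTop
  · intro x
    refine hlim x _ (tendsto_atTop_mono (hnorm x) ?_)
    exact tendsto_atTop_add_const_right _ _ tendsto_abs_atTop_atTop

/-- An integral over a half-space vanishes if the integrand changes sign under the reflection that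
fixes the normal direction. -/
theorem integral_halfSpace_eq_zero_of_odd {ν : Euc N} {S : Set ℝ} (hS : MeasurableSet S)
    {f : Euc N → ℝ} (hf : ∀ z, f ((ℝ ∙ ν).reflection z) = -f z) :
    ∫ z in {z : Euc N | inner ℝ ν z ∈ S}, f z = 0 := by
  have hm : MeasurableSet {z : Euc N | inner ℝ ν z ∈ S} :=
    (by fun_prop : Continuous fun z : Euc N => inner ℝ ν z).measurable hS
  set R := (ℝ ∙ ν).reflection with hR
  have hRν : R ν = ν := Submodule.reflection_mem_subspace_eq_self (Submodule.mem_span_singleton_self ν)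
  have h1 := R.measurePreserving.setIntegral_preimage_emb R.toMeasurableEquiv.measurableEmbedding
    f {z : Euc N | inner ℝ ν z ∈ S}
  have h2 : R ⁻¹' {z : Euc N | inner ℝ ν z ∈ S} = {z : Euc N | inner ℝ ν z ∈ S} := by
    ext z
    simp only [mem_preimage, mem_ofPred_eq]
    rw [← hRν, R.inner_map_map, hRν]
  rw [h2] at h1
  simp only [hf, integral_neg] at h1
  linarith

/-- Complete ν to an orthonormal basis and split the divergence. The tangential summands integrate
to zero. In the normal summand the term with ⟨Bν, ν⟩ drops out, and the rest is odd under the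
reflection z ↦ 2⟨ν, z⟩ν - z, which preserves the half-space. -/
theorem KernelProfile.integral_halfSpace_eq_zero {b : ℝ} (hb : 0 < b)
    (hκ : KernelProfile (N + b) κ κ') (B : Euc N →L[ℝ] Euc N) {t : ℝ} (ht : 0 < t) {ν : Euc N}
    (hν : ‖ν‖ = 1) (hB : inner ℝ (B ν) ν = 0) :
    ∫ z in {z : Euc N | t < inner ℝ ν z}, kernelDiv κ κ' B z = 0 := by
  classical
  obtain ⟨u, bs, hub, hbs⟩ := Orthonormal.exists_orthonormalBasis_extension (𝕜 := ℝ)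
    (v := {ν}) (by
      rw [orthonormal_subtype_iff_ite]
      simp [hν])
  have hνu : ν ∈ u := by simpa using hub
  set i₀ : u := ⟨ν, hνu⟩
  have hb0 : bs i₀ = ν := by rw [hbs]
  have hexp : ∀ z : Euc N, kernelDiv κ κ' B z = ∑ i, (inner ℝ (bs i) (B (bs i)) * κ (‖z‖ ^ 2) +
      2 * κ' (‖z‖ ^ 2) * (inner ℝ (B z) (bs i) * inner ℝ (bs i) z)) := by
    intro z
    rw [Finset.sum_add_distrib, ← Finset.sum_mul, ← Finset.mul_sum, bs.sum_inner_mul_inner,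
      ← coordTrace_eq_sum_inner, kernelDiv]
  have hzero : ∀ i, i ≠ i₀ → inner ℝ ν (bs i) = 0 := fun i hi => by
    rw [← hb0]; exact bs.orthonormal.2 hi.symm
  have hint : ∀ i, IntegrableOn (fun z : Euc N => inner ℝ (bs i) (B (bs i)) * κ (‖z‖ ^ 2) +
      2 * κ' (‖z‖ ^ 2) * (inner ℝ (B z) (bs i) * inner ℝ (bs i) z)) {z | t < inner ℝ ν z} := by
    have hne : ∀ i, i ≠ i₀ → IntegrableOn (fun z : Euc N => inner ℝ (bs i) (B (bs i)) * κ (‖z‖ ^ 2) +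
        2 * κ' (‖z‖ ^ 2) * (inner ℝ (B z) (bs i) * inner ℝ (bs i) z)) {z | t < inner ℝ ν z} :=
      fun i hi => (hκ.integral_halfSpace_tangential hb B ht hν (bs.norm_eq_one i) (hzero i hi)).1
    intro i
    by_cases hi : i = i₀
    -- The normal summand is not estimated directly: it is the whole divergence minus the tangential
    -- summands, all of which are integrable.
    · subst hi
      have h1 := (hκ.integrableOn_kernelDiv hb B ht).mono_set (halfSpace_subset hν t)
      have h2 : IntegrableOn (fun z : Euc N => ∑ i ∈ Finset.univ.erase i₀,
          (inner ℝ (bs i) (B (bs i)) * κ (‖z‖ ^ 2) +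
          2 * κ' (‖z‖ ^ 2) * (inner ℝ (B z) (bs i) * inner ℝ (bs i) z))) {z | t < inner ℝ ν z} :=
        integrable_finsetSum _ fun i hi => hne i (Finset.ne_of_mem_erase hi)
      refine (h1.sub h2).congr (Eventually.of_forall fun z => ?_)
      simp only [Pi.sub_apply]
      rw [hexp, ← Finset.add_sum_erase _ _ (Finset.mem_univ i₀)]
      ring
    · exact hne i hi
  simp_rw [hexp]
  rw [integral_finsetSum _ fun i _ => hint i]
  refine Finset.sum_eq_zero fun i _ => ?_
  by_cases hi : i = i₀
  · subst hi
    rw [hb0]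
    have hB' : inner ℝ ν (B ν) = 0 := by rw [real_inner_comm]; exact hB
    simp only [hB', zero_mul, zero_add]
    refine integral_halfSpace_eq_zero_of_odd (S := Ioi t) measurableSet_Ioi fun z => ?_
    have hz : (ℝ ∙ ν).reflection z = (2 * inner ℝ ν z) • ν - z := by
      rw [Submodule.reflection_apply, Submodule.starProjection_unit_singleton ℝ hν, two_smul,
        two_mul, add_smul]
    rw [LinearIsometryEquiv.norm_map, hz, map_sub, map_smul, inner_sub_left, inner_sub_right,
      real_inner_smul_left, real_inner_smul_right, hB, real_inner_self_eq_norm_sq, hν]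
    ring
  · exact (hκ.integral_halfSpace_tangential hb B ht hν (bs.norm_eq_one i) (hzero i hi)).2

/-- The half-space integral depends only on the normal-normal component of `B`. -/
theorem KernelProfile.integral_halfSpace {b : ℝ} (hb : 0 < b)
    (hκ : KernelProfile (N + b) κ κ') (B : Euc N →L[ℝ] Euc N) {t : ℝ} (ht : 0 < t) {ν : Euc N}
    (hν : ‖ν‖ = 1) :
    ∫ z in {z : Euc N | t < inner ℝ ν z}, kernelDiv κ κ' B z =
      inner ℝ (B ν) ν * ∫ z in {z : Euc N | t < inner ℝ ν z},
        kernelDiv κ κ' (ContinuousLinearMap.id ℝ _) z := by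
  set c := inner ℝ (B ν) ν with hc
  -- Removing the multiple of the identity with the same normal-normal component leaves a map to
  -- which the vanishing result applies.
  have h1 := hκ.integral_halfSpace_eq_zero hb (B - c • ContinuousLinearMap.id ℝ _) ht hν (by
    simp [inner_sub_left, real_inner_smul_left, hν, ← hc])
  have h2 : ∀ z, kernelDiv κ κ' (B - c • ContinuousLinearMap.id ℝ _) z =
      kernelDiv κ κ' B z - c * kernelDiv κ κ' (ContinuousLinearMap.id ℝ _) z := by
    intro z
    simp only [kernelDiv, coordTrace_sub, coordTrace_smul, sub_apply, smul_apply, inner_sub_left,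
      real_inner_smul_left]
    ring
  simp_rw [h2] at h1
  have i1 := fun A => (hκ.integrableOn_kernelDiv hb A ht).mono_set (halfSpace_subset hν t)
  rw [integral_sub (i1 _) ((i1 _).const_mul _), integral_const_mul] at h1
  linarith

theorem exists_abs_integral_halfSpace_le {b : ℝ} (hb : 0 < b) : ∃ C : ℝ, 0 < C ∧
    ∀ κ κ', KernelProfile (N + b) κ κ' → ∀ t : ℝ, 0 < t → ∀ ν : Euc N, ‖ν‖ = 1 →
    |∫ z in {z : Euc N | t < inner ℝ ν z}, kernelDiv κ κ' (ContinuousLinearMap.id ℝ (Euc N)) z| ≤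
      C * t ^ (-b) := by
  obtain ⟨C, hC0, hC⟩ := exists_integral_norm_rpow_compl_ball_le (N := N) hb
  set C' := (N + 2 * (N + b + 2)) * ‖ContinuousLinearMap.id ℝ (Euc N)‖ with hC'
  have hC'0 : 0 ≤ C' := by positivity
  refine ⟨(C' + 1) * C, by positivity, fun κ κ' hκ t ht ν hν => ?_⟩
  have h1 := integrableOn_norm_rpow_compl_ball (N := N) hb ht
  calc _ ≤ ∫ z in {z : Euc N | t < inner ℝ ν z},
          ‖kernelDiv κ κ' (ContinuousLinearMap.id ℝ (Euc N)) z‖ := norm_integral_le_integral_norm _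
    _ ≤ ∫ z in (Metric.ball 0 t)ᶜ, ‖kernelDiv κ κ' (ContinuousLinearMap.id ℝ (Euc N)) z‖ :=
        setIntegral_mono_set (hκ.integrableOn_kernelDiv hb _ ht).norm
          (Eventually.of_forall fun _ => norm_nonneg _)
          (Eventually.of_forall (halfSpace_subset hν t))
    _ ≤ ∫ z in (Metric.ball (0 : Euc N) t)ᶜ, C' * ‖z‖ ^ (-(N + b)) := by
        refine setIntegral_mono_on (hκ.integrableOn_kernelDiv hb _ ht).norm (h1.const_mul _)
          Metric.isOpen_ball.measurableSet.compl fun z hz => ?_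
        refine hκ.abs_kernelDiv_le _ ?_
        rintro rfl
        exact hz (Metric.mem_ball_self ht)
    _ = C' * ∫ z in (Metric.ball (0 : Euc N) t)ᶜ, ‖z‖ ^ (-(N + b)) := integral_const_mul _ _
    _ ≤ (C' + 1) * (C * t ^ (-b)) := by
        have := hC t ht
        have h3 : 0 ≤ C * t ^ (-b) := by positivity
        calc _ ≤ C' * (C * t ^ (-b)) := by gcongr
          _ ≤ _ := by linarith
    _ = _ := by ring

/-- For the exact kernel the divergence of ‖z‖^(-N-b) z is -b‖z‖^(-N-b), of constant sign. The ball
of radius t about 2tν lies in the half-space and inside the ball of radius 3t about the origin,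
which bounds the integral of the norm power from below by a multiple of t^(-b). -/
theorem exists_le_integral_halfSpace_rpow {b : ℝ} (hb : 0 < b) : ∃ c : ℝ, 0 < c ∧
    ∀ t : ℝ, 0 < t → ∀ ν : Euc N, ‖ν‖ = 1 →
    ∫ z in {z : Euc N | t < inner ℝ ν z}, kernelDiv (fun s => s ^ (-((N + b) / 2)))
      (fun s => -((N + b) / 2) * s ^ (-((N + b) / 2) - 1)) (ContinuousLinearMap.id ℝ (Euc N)) z ≤
      -(c * t ^ (-b)) := by
  set A := volume.real (Metric.ball (0 : Euc N) 1) with hA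
  have hA0 : 0 < A := ENNReal.toReal_pos (Metric.measure_ball_pos _ _ one_pos).ne'
    measure_ball_lt_top.ne
  refine ⟨b * (A * 3 ^ (-(N + b))), by positivity, fun t ht ν hν => ?_⟩
  have hmH := measurableSet_halfSpace ν t
  have h1 := (integrableOn_norm_rpow_compl_ball (N := N) hb ht).mono_set (halfSpace_subset hν t)
  have e1 : ∫ z in {z : Euc N | t < inner ℝ ν z}, kernelDiv (fun s => s ^ (-((N + b) / 2)))
      (fun s => -((N + b) / 2) * s ^ (-((N + b) / 2) - 1)) (ContinuousLinearMap.id ℝ (Euc N)) z =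
      ∫ z in {z : Euc N | t < inner ℝ ν z}, -b * ‖z‖ ^ (-(N + b)) := by
    refine setIntegral_congr_fun hmH fun z hz => ?_
    have hr : 0 < ‖z‖ := by
      have := halfSpace_subset hν t hz
      simp only [mem_compl_iff, Metric.mem_ball, dist_zero_right, not_lt] at this
      linarith
    simp only [kernelDiv, coordTrace_id, ContinuousLinearMap.id_apply, real_inner_self_eq_norm_sq]
    rw [Real.rpow_sub_one (by positivity), sq_rpow_neg_half hr]
    field_simp
    ring
  rw [e1, integral_const_mul]
  have hsub : Metric.ball ((2 * t) • ν) t ⊆ {z : Euc N | t < inner ℝ ν z} := by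
    intro z hz
    rw [Metric.mem_ball, dist_eq_norm] at hz
    have h2 := abs_real_inner_le_norm ν (z - (2 * t) • ν)
    rw [hν, one_mul, inner_sub_right, real_inner_smul_right, real_inner_self_eq_norm_sq, hν] at h2
    have := (abs_le.1 h2).1
    show t < inner ℝ ν z
    linarith
  have h3 : A * t ^ N * ((3 : ℝ) * t) ^ (-((N : ℝ) + b)) ≤
      ∫ z in {z : Euc N | t < inner ℝ ν z}, ‖z‖ ^ (-(N + b)) := by
    calc _ = ∫ z in Metric.ball ((2 * t) • ν) t, ((3 : ℝ) * t) ^ (-((N : ℝ) + b)) := by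
          rw [setIntegral_const, smul_eq_mul, Measure.real, Measure.addHaar_ball _ _ ht.le,
            ENNReal.toReal_mul, ENNReal.toReal_ofReal (by positivity), finrank_euclideanSpace_fin]
          rw [hA, Measure.real]; ring
      _ ≤ ∫ z in Metric.ball ((2 * t) • ν) t, ‖z‖ ^ (-(N + b)) := by
          refine setIntegral_mono_on ?_ (h1.mono_set hsub) Metric.isOpen_ball.measurableSet ?_
          · exact integrableOn_const measure_ball_lt_top.ne
          · intro z hz
            have hr : 0 < ‖z‖ := by
              have := halfSpace_subset hν t (hsub hz)
              simp only [mem_compl_iff, Metric.mem_ball, dist_zero_right, not_lt] at this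
              linarith
            refine Real.rpow_le_rpow_of_nonpos hr ?_ (by linarith [(Nat.cast_nonneg N : (0 : ℝ) ≤ N)])
            rw [Metric.mem_ball, dist_eq_norm] at hz
            have h4 := norm_le_norm_sub_add z ((2 * t) • ν)
            rw [norm_smul, hν, mul_one, Real.norm_eq_abs, abs_of_pos (by linarith)] at h4
            linarith
      _ ≤ _ := setIntegral_mono_set h1 (Eventually.of_forall fun z => by positivity)
          (Eventually.of_forall hsub)
  have h5 : A * t ^ N * ((3 : ℝ) * t) ^ (-((N : ℝ) + b)) = A * 3 ^ (-((N : ℝ) + b)) * t ^ (-b) := by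
    rw [Real.mul_rpow (by norm_num) ht.le]
    have : t ^ N * t ^ (-((N : ℝ) + b)) = t ^ (-b) := by
      rw [← Real.rpow_natCast, ← Real.rpow_add ht]
      congr 1; ring
    rw [← this]; ring
  rw [h5] at h3
  nlinarith

end HalfSpace

end HigherNeumann

namespace HigherNeumann

/-! ### Tame fields and pointwise bounds for the divergence of the kernel. -/

section Exterior

variable {N : ℕ}

/-- A bounded vector field with bounded and Lipschitz derivative. -/
structure IsTameField (V : Euc N → Euc N) (M : ℝ) : Prop where
  contDiff : ContDiff ℝ 2 V
  norm_le : ∀ x, ‖V x‖ ≤ M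
  norm_fderiv_le : ∀ x, ‖fderiv ℝ V x‖ ≤ M
  norm_fderiv_sub_le : ∀ x y, ‖fderiv ℝ V x - fderiv ℝ V y‖ ≤ M * ‖x - y‖

namespace IsTameField

variable {V : Euc N → Euc N} {M : ℝ}

theorem nonneg (hV : IsTameField V M) : 0 ≤ M := (norm_nonneg _).trans (hV.norm_le 0)

theorem norm_sub_sub_le (hV : IsTameField V M) (x y : Euc N) :
    ‖V x - V y - fderiv ℝ V x (x - y)‖ ≤ M * ‖x - y‖ ^ 2 := by
  have h := norm_sub_sub_fderiv_le (hV.contDiff.differentiable (by norm_num))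
    (K := ⟨M, hV.nonneg⟩)
    (LipschitzWith.of_dist_le_mul fun a b => by
      rw [dist_eq_norm, dist_eq_norm]; exact hV.norm_fderiv_sub_le a b) x y
  rw [norm_sub_rev x y, ← norm_neg]
  refine le_trans (le_of_eq ?_) h
  congr 1
  rw [← neg_sub y x, map_neg]
  abel

theorem norm_sub_le (hV : IsTameField V M) (x y : Euc N) : ‖V x - V y‖ ≤ M * ‖x - y‖ :=
  Convex.norm_image_sub_le_of_norm_fderiv_le (𝕜 := ℝ)
    (fun z _ => hV.contDiff.differentiable (by norm_num) z)
    (fun z _ => hV.norm_fderiv_le z) convex_univ (mem_univ _) (mem_univ _)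

theorem abs_divergence_le (hV : IsTameField V M) (x : Euc N) : |divergence V x| ≤ N * M := by
  rw [divergence_eq_coordTrace]
  exact (abs_coordTrace_le _).trans (by gcongr; exact hV.norm_fderiv_le x)

end IsTameField

/-- The divergence in `x` of `κ (‖x - y‖²) (V x - V y)`. -/
noncomputable def diffDiv (κ κ' : ℝ → ℝ) (V : Euc N → Euc N) (x y : Euc N) : ℝ :=
  divergence V x * κ (‖x - y‖ ^ 2) + 2 * κ' (‖x - y‖ ^ 2) * inner ℝ (V x - V y) (x - y)

variable {V : Euc N → Euc N} {M : ℝ} {κ κ' : ℝ → ℝ} {q : ℝ}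

theorem KernelProfile.abs_two_mul_deriv_le (hκ : KernelProfile q κ κ') {z v : Euc N} (hz : z ≠ 0)
    {C a : ℝ} (hv : ‖v‖ ≤ C * ‖z‖ ^ (a + 1)) :
    |2 * κ' (‖z‖ ^ 2) * inner ℝ v z| ≤ 2 * (q + 2) * C * ‖z‖ ^ (a - q) := by
  have hz0 : 0 < ‖z‖ := norm_pos_iff.2 hz
  rw [abs_mul, abs_mul, abs_two]
  have hq := hκ.q_nonneg
  calc 2 * |κ' (‖z‖ ^ 2)| * |inner ℝ v z|
      ≤ 2 * ((q + 2) * ‖z‖ ^ (-q - 2)) * ((C * ‖z‖ ^ (a + 1)) * ‖z‖) := by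
        gcongr
        · exact hκ.deriv_le _ hz0
        · exact (abs_real_inner_le_norm _ _).trans (by gcongr)
    _ = 2 * (q + 2) * C * (‖z‖ ^ (-q - 2) * ‖z‖ ^ (a + 1) * ‖z‖ ^ (1 : ℝ)) := by
        rw [Real.rpow_one]; ring
    _ = _ := by
        rw [← Real.rpow_add hz0, ← Real.rpow_add hz0]
        congr 2; ring

theorem IsTameField.abs_diffDiv_le (hV : IsTameField V M) (hκ : KernelProfile q κ κ')
    {x y : Euc N} (hxy : x ≠ y) :
    |diffDiv κ κ' V x y| ≤ (N * M + 2 * (q + 2) * M) * ‖x - y‖ ^ (-q) := by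
  have hz : x - y ≠ 0 := sub_ne_zero.2 hxy
  have hz0 : 0 < ‖x - y‖ := norm_pos_iff.2 hz
  have h1 := hκ.abs_two_mul_deriv_le hz (v := V x - V y) (C := M) (a := 0)
    (by simpa using hV.norm_sub_le x y)
  rw [zero_sub] at h1
  have h2 : |divergence V x * κ (‖x - y‖ ^ 2)| ≤ N * M * ‖x - y‖ ^ (-q) := by
    rw [abs_mul, abs_of_nonneg (hκ.nonneg _ (by positivity))]
    exact mul_le_mul (hV.abs_divergence_le x) (hκ.le _ hz0) (hκ.nonneg _ (by positivity))
      (by have := hV.nonneg; positivity)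
  rw [diffDiv]
  refine (abs_add_le _ _).trans ?_
  linarith

/-- For distant x, the factor |div V(x)| is kept so that its decay can be used, and V(x) - V(y) is
merely bounded, which leaves an extra inverse power of the distance. Both are needed to absorb the
linear growth of p. -/
theorem IsTameField.abs_diffDiv_le_of_far (hV : IsTameField V M) (hκ : KernelProfile q κ κ')
    {x y : Euc N} (hxy : x ≠ y) :
    |diffDiv κ κ' V x y| ≤ |divergence V x| * ‖x - y‖ ^ (-q) +
      2 * (q + 2) * (2 * M) * ‖x - y‖ ^ (-1 - q) := by
  have hz : x - y ≠ 0 := sub_ne_zero.2 hxy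
  have hz0 : 0 < ‖x - y‖ := norm_pos_iff.2 hz
  have h1 := hκ.abs_two_mul_deriv_le hz (v := V x - V y) (C := 2 * M) (a := -1)
    (by simpa using (_root_.norm_sub_le _ _).trans (by linarith [hV.norm_le x, hV.norm_le y]))
  have h2 : |divergence V x * κ (‖x - y‖ ^ 2)| ≤ |divergence V x| * ‖x - y‖ ^ (-q) := by
    rw [abs_mul, abs_of_nonneg (hκ.nonneg _ (by positivity))]
    exact mul_le_mul_of_nonneg_left (hκ.le _ hz0) (abs_nonneg _)
  rw [diffDiv]
  refine (abs_add_le _ _).trans ?_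
  linarith

/-- Linearizing V at x₀ instead of at x costs a Taylor remainder plus the change of DV between x and
x₀. Both gain one power of ‖x - y‖, because x₀ is no farther from x than y is. -/
theorem IsTameField.abs_diffDiv_sub_kernelDiv_le (hV : IsTameField V M)
    (hκ : KernelProfile q κ κ') {x₀ x y : Euc N} (hxy : x ≠ y) (h : ‖x - x₀‖ ≤ ‖x - y‖) :
    |diffDiv κ κ' V x y - kernelDiv κ κ' (fderiv ℝ V x₀) (x - y)| ≤
      (N * M + 2 * (q + 2) * (2 * M)) * ‖x - y‖ ^ (1 - q) := by
  have hz : x - y ≠ 0 := sub_ne_zero.2 hxy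
  have hz0 : 0 < ‖x - y‖ := norm_pos_iff.2 hz
  have hM := hV.nonneg
  have hA : ‖fderiv ℝ V x - fderiv ℝ V x₀‖ ≤ M * ‖x - y‖ :=
    (hV.norm_fderiv_sub_le _ _).trans (by gcongr)
  have h1 := hκ.abs_two_mul_deriv_le hz (v := V x - V y - fderiv ℝ V x₀ (x - y)) (C := 2 * M)
    (a := 1) (by
      have e : V x - V y - fderiv ℝ V x₀ (x - y) = (V x - V y - fderiv ℝ V x (x - y)) +
        (fderiv ℝ V x - fderiv ℝ V x₀) (x - y) := by
        rw [sub_apply]; abel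
      rw [e]
      refine (norm_add_le _ _).trans ?_
      have h3 := ((fderiv ℝ V x - fderiv ℝ V x₀).le_opNorm (x - y)).trans
        (mul_le_mul_of_nonneg_right hA (norm_nonneg _))
      have h4 := hV.norm_sub_sub_le x y
      have : ‖x - y‖ ^ ((1 : ℝ) + 1) = ‖x - y‖ ^ 2 := by norm_num
      rw [this]
      nlinarith)
  have h2 : |(divergence V x - coordTrace (fderiv ℝ V x₀)) * κ (‖x - y‖ ^ 2)| ≤
      N * M * ‖x - y‖ ^ (1 - q) := by
    rw [divergence_eq_coordTrace, ← coordTrace_sub, abs_mul,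
      abs_of_nonneg (hκ.nonneg _ (by positivity)), sub_eq_add_neg 1 q, Real.rpow_add hz0,
      Real.rpow_one]
    calc _ ≤ (N * (M * ‖x - y‖)) * ‖x - y‖ ^ (-q) :=
          mul_le_mul ((abs_coordTrace_le _).trans (by gcongr)) (hκ.le _ hz0)
            (hκ.nonneg _ (by positivity)) (by positivity)
      _ = _ := by ring
  have e : diffDiv κ κ' V x y - kernelDiv κ κ' (fderiv ℝ V x₀) (x - y) =
      (divergence V x - coordTrace (fderiv ℝ V x₀)) * κ (‖x - y‖ ^ 2) +
      2 * κ' (‖x - y‖ ^ 2) * inner ℝ (V x - V y - fderiv ℝ V x₀ (x - y)) (x - y) := by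
    rw [diffDiv, kernelDiv, inner_sub_left (V x - V y)]; ring
  rw [e]
  refine (abs_add_le _ _).trans ?_
  linarith

theorem KernelProfile.measurable_diffDiv (hκ : KernelProfile q κ κ') (hV : IsTameField V M)
    : Measurable fun a : Euc N × Euc N => diffDiv κ κ' V a.1 a.2 := by
  have h1 := hκ.measurable
  have h2 := hκ.measurable'
  have h0 : Continuous (divergence V) := continuous_divergence (hV.contDiff.of_le (by norm_num))
  have hc := hV.contDiff.continuous
  have h3 : Continuous fun a : Euc N × Euc N => inner ℝ (V a.1 - V a.2) (a.1 - a.2) := by fun_prop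
  have h3 := h3.measurable
  have h4 : Measurable fun a : Euc N × Euc N => ‖a.1 - a.2‖ ^ 2 :=
    (by fun_prop : Continuous fun a : Euc N × Euc N => ‖a.1 - a.2‖ ^ 2).measurable
  have h5 : Measurable fun a : Euc N × Euc N => divergence V a.1 :=
    (h0.comp continuous_fst).measurable
  unfold diffDiv
  exact (h5.mul (h1.comp h4)).add (((h2.comp h4).const_mul 2).mul h3)

/-- Integrals over two sets differ by at most the integral of a bound on their symmetric
difference. -/
theorem abs_setIntegral_sub_le {α : Type*} [MeasurableSpace α] {μ : Measure α} {f g : α → ℝ}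
    {S T : Set α} (hS : MeasurableSet S) (hT : MeasurableSet T) (hfS : IntegrableOn f S μ)
    (hfT : IntegrableOn f T μ) (hg : Integrable g μ) (hg0 : ∀ z, 0 ≤ g z)
    (h : ∀ z, (z ∈ S ∧ z ∉ T) ∨ (z ∈ T ∧ z ∉ S) → |f z| ≤ g z) :
    |∫ z in S, f z ∂μ - ∫ z in T, f z ∂μ| ≤ ∫ z, g z ∂μ := by
  rw [← integral_indicator hS, ← integral_indicator hT, ← integral_sub
    (hfS.integrable_indicator hS) (hfT.integrable_indicator hT), ← Real.norm_eq_abs]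
  refine norm_integral_le_of_norm_le hg (Eventually.of_forall fun z => ?_)
  rw [Real.norm_eq_abs]
  by_cases h1 : z ∈ S <;> by_cases h2 : z ∈ T
  · simpa [h1, h2] using hg0 z
  · simpa [h1, h2] using h z (Or.inl ⟨h1, h2⟩)
  · simpa [h1, h2] using h z (Or.inr ⟨h2, h1⟩)
  · simpa [h1, h2] using hg0 z

end Exterior

end HigherNeumann

namespace HigherNeumann

/-! ### Comparison of Ω with its tangent half-space. -/

section Exterior

variable {N : ℕ} [NeZero N] {Ω : Set (Euc N)} {V : Euc N → Euc N} {M : ℝ} {κ κ' : ℝ → ℝ}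

theorem setIntegral_sub_left (f : Euc N → ℝ) (A : Set (Euc N)) (hA : MeasurableSet A) (x : Euc N) :
    ∫ y in A, f (x - y) = ∫ z in (fun z => x - z) ⁻¹' A, f z := by
  have hm : MeasurableSet ((fun z => x - z) ⁻¹' A) :=
    (by fun_prop : Continuous fun z : Euc N => x - z).measurable hA
  rw [← integral_indicator hA, ← integral_indicator hm,
    ← integral_sub_left_eq_self (fun y => A.indicator (fun y => f (x - y)) y) volume x]
  congr 1 with z
  by_cases h : x - z ∈ A
  · rw [indicator_of_mem h, indicator_of_mem (show z ∈ (fun z => x - z) ⁻¹' A from h)]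
    congr 1; abel
  · rw [indicator_of_notMem h, indicator_of_notMem (show z ∉ (fun z => x - z) ⁻¹' A from h)]

theorem integrableOn_sub_left {F : Type*} [NormedAddCommGroup F] {f : Euc N → F}
    {A : Set (Euc N)} (hA : MeasurableSet A) (x : Euc N)
    (hf : IntegrableOn f ((fun z => x - z) ⁻¹' A)) : IntegrableOn (fun y => f (x - y)) A := by
  have hm : MeasurableSet ((fun z => x - z) ⁻¹' A) :=
    (by fun_prop : Continuous fun z : Euc N => x - z).measurable hA
  rw [← integrable_indicator_iff hA]
  have h := ((integrable_indicator_iff hm).2 hf).comp_sub_left x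
  refine h.congr (Eventually.of_forall fun y => ?_)
  beta_reduce
  by_cases h : y ∈ A
  · rw [indicator_of_mem h, indicator_of_mem (by simpa using h)]
  · rw [indicator_of_notMem h, indicator_of_notMem (by simpa using h)]

/-- Part of a singularity too strong to be integrated is paid for by a power of t, a lower bound for
the distance. -/
theorem rpow_neg_add_le {r t b c : ℝ} (ht : 0 < t) (htr : t ≤ r) (hc : 0 ≤ c) :
    r ^ (-(b + c)) ≤ t ^ (-c) * r ^ (-b) := by
  have hr : 0 < r := ht.trans_le htr
  rw [neg_add, add_comm, Real.rpow_add hr]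
  exact mul_le_mul_of_nonneg_right (Real.rpow_le_rpow_of_nonpos ht htr (by linarith))
    (by positivity)

/-- A kernel integral over `Ω` seen from an exterior point is close to the one over the tangent
half-space. -/
theorem IsBoundedC11Domain.exists_abs_integral_sub_halfSpace_le (hΩ : IsBoundedC11Domain Ω) {b : ℝ}
    (hb : 0 < b) (hb2 : b < 2) : ∃ C : ℝ, 0 ≤ C ∧ ∀ (f : Euc N → ℝ) (M : ℝ), 0 ≤ M → Measurable f →
    (∀ z : Euc N, z ≠ 0 → |f z| ≤ M * ‖z‖ ^ (-(N + b))) → ∀ x₀ ∈ frontier Ω, ∀ t : ℝ, 0 < t → t ≤ 1 →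
    (∀ y ∈ Ω, t ≤ ‖x₀ + t • outerNormal Ω x₀ - y‖) →
    |(∫ y in Ω, f (x₀ + t • outerNormal Ω x₀ - y)) -
      ∫ z in {z : Euc N | t < inner ℝ (outerNormal Ω x₀) z}, f z| ≤ C * M * t ^ (-(b / 2)) := by
  obtain ⟨K, hK, hnb⟩ := hΩ.exists_normal_bound
  obtain ⟨C₁, hC₁, hthin⟩ := exists_integral_thinSet_le (N := N) K (N + b / 2)
  set C₂ : ℝ := ∫ z in (Metric.ball (0 : Euc N) (1 / 2))ᶜ, ‖z‖ ^ (-(N + b)) with hC₂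
  have hC₂0 : 0 ≤ C₂ := integral_nonneg fun z => by positivity
  refine ⟨2 ^ (N + b / 2) * C₁ + C₂, by positivity, fun f M hM hf hfb x₀ hx₀ t ht ht1 hfar => ?_⟩
  have hν := hΩ.norm_outerNormal hx₀
  have hnx := hnb x₀ hx₀
  set ν := outerNormal Ω x₀
  set S : Set (Euc N) := (fun z => x₀ + t • ν - z) ⁻¹' Ω with hS
  have hSm : MeasurableSet S :=
    (by fun_prop : Continuous fun z : Euc N => x₀ + t • ν - z).measurable hΩ.measurableSet
  have hTm := measurableSet_halfSpace ν t
  have hx₀Ω : x₀ ∉ Ω := fun h => by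
    have := hx₀.2
    rw [hΩ.isOpen.interior_eq] at this
    exact this h
  have hfi : IntegrableOn f (Metric.ball 0 t)ᶜ :=
    integrableOn_of_norm_rpow_bound hf.aestronglyMeasurable hb ht hfb
  have hSsub : S ⊆ (Metric.ball 0 t)ᶜ := fun z hz => by
    have := hfar _ hz
    simpa using this
  -- With w = tν - z, the position of y relative to x₀, the two domains differ only for w between
  -- the paraboloids. Near x₀ the exponent N + b is split into b/2, paid by t ≤ ‖z‖, and N + b/2 < N
  -- + 1, integrable on the thin set by `g₁`. For ‖w‖ > 1 one has ‖z‖ ≥ 1/2, and `g₂` takes over.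
  set g₁ : Euc N → ℝ := (thinSet K ν ∩ Metric.closedBall 0 1).indicator
    fun w => ‖w‖ ^ (-(N + b / 2)) with hg₁
  set g₂ : Euc N → ℝ := (Metric.ball 0 (1 / 2))ᶜ.indicator fun z => ‖z‖ ^ (-(N + b)) with hg₂
  have hKm : MeasurableSet (thinSet K ν ∩ Metric.closedBall 0 1) :=
    (measurableSet_thinSet K ν).inter Metric.isClosed_closedBall.measurableSet
  have hg₁i : Integrable g₁ := (integrable_indicator_iff hKm).2
    (integrableOn_thinSet hK hν (by positivity) (by linarith))
  have hg₂i : Integrable g₂ := (integrable_indicator_iff Metric.isOpen_ball.measurableSet.compl).2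
    (integrableOn_norm_rpow_compl_ball hb (by norm_num))
  have hg₁0 : ∀ w, 0 ≤ g₁ w := fun w => indicator_nonneg (fun _ _ => by positivity) _
  have hg₂0 : ∀ w, 0 ≤ g₂ w := fun w => indicator_nonneg (fun _ _ => by positivity) _
  have hG1 : Integrable fun z => M * t ^ (-(b / 2)) * 2 ^ (N + b / 2) * g₁ (t • ν - z) :=
    (hg₁i.comp_sub_left (t • ν)).const_mul _
  have hG2 : Integrable fun z => M * t ^ (-(b / 2)) * g₂ z := hg₂i.const_mul _
  have hone : 1 ≤ t ^ (-(b / 2)) := Real.one_le_rpow_of_pos_of_le_one_of_nonpos ht ht1 (by linarith)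
  have key := abs_setIntegral_sub_le hSm hTm (hfi.mono_set hSsub)
    (hfi.mono_set (halfSpace_subset hν t)) (hG1.add hG2)
    (fun z => by
      have := hg₁0 (t • ν - z); have := hg₂0 z
      simp only [Pi.add_apply]; positivity) (fun z hz => by
    have hzt : t ≤ ‖z‖ := by
      rcases hz with h | h
      · simpa using hSsub h.1
      · simpa using halfSpace_subset hν t h.1
    have hz0 : 0 < ‖z‖ := ht.trans_le hzt
    have hiw : inner ℝ ν (t • ν - z) = t - inner ℝ ν z := by
      rw [inner_sub_right, inner_smul_right, real_inner_self_eq_norm_sq, hν]; ring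
    have hnz := hnx (x₀ + t • ν - z)
    have ew : x₀ + t • ν - z - x₀ = t • ν - z := by abel
    rw [ew, hiw] at hnz
    have hthinw : t • ν - z ∈ thinSet K ν ∧ t • ν - z ≠ 0 := by
      rw [thinSet, Set.mem_ofPred_eq, hiw, abs_le]
      have hp : 0 ≤ K * ‖t • ν - z‖ ^ 2 := by positivity
      rcases hz with ⟨h1, h2⟩ | ⟨h1, h2⟩
      · have h3 := hnz.1 h1
        have h2 : ¬ t < inner ℝ ν z := h2
        refine ⟨⟨by linarith, h3⟩, fun h => hx₀Ω ?_⟩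
        have h1 : x₀ + t • ν - z ∈ Ω := h1
        rwa [add_sub_assoc, h, add_zero] at h1
      · have h3 := hnz.2 h2
        have h1 : t < inner ℝ ν z := h1
        refine ⟨⟨h3, by linarith⟩, fun h => ?_⟩
        rw [h, inner_zero_right] at hiw
        linarith
    have hw0 : 0 < ‖t • ν - z‖ := norm_pos_iff.2 hthinw.2
    have hzw : ‖t • ν - z‖ / 2 ≤ ‖z‖ := by
      have h1 := norm_sub_le (t • ν) z
      rw [norm_smul, hν, Real.norm_eq_abs, abs_of_pos ht] at h1
      linarith
    refine (hfb z (norm_pos_iff.1 hz0)).trans ?_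
    simp only [Pi.add_apply]
    have h1 := hg₁0 (t • ν - z)
    have h2 := hg₂0 z
    by_cases hw1 : ‖t • ν - z‖ ≤ 1
    · have e1 : g₁ (t • ν - z) = ‖t • ν - z‖ ^ (-(N + b / 2)) :=
        indicator_of_mem (s := thinSet K ν ∩ Metric.closedBall 0 1) ⟨hthinw.1, by simpa using hw1⟩ _
      have h4 : ‖z‖ ^ (-(N + b)) ≤ t ^ (-(b / 2)) * (2 ^ (N + b / 2) * g₁ (t • ν - z)) := by
        have e2 : (N : ℝ) + b = (N + b / 2) + b / 2 := by ring
        rw [e2]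
        refine (rpow_neg_add_le ht hzt (by linarith)).trans ?_
        refine mul_le_mul_of_nonneg_left ?_ (by positivity)
        refine (Real.rpow_le_rpow_of_nonpos (by positivity) hzw
          (neg_nonpos.2 (by positivity))).trans (le_of_eq ?_)
        rw [e1, Real.div_rpow hw0.le (by norm_num), Real.rpow_neg (by norm_num : (0 : ℝ) ≤ 2)]
        field_simp
      calc _ ≤ M * (t ^ (-(b / 2)) * (2 ^ (N + b / 2) * g₁ (t • ν - z))) := by gcongr
        _ = M * t ^ (-(b / 2)) * 2 ^ (N + b / 2) * g₁ (t • ν - z) := by ring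
        _ ≤ _ := le_add_of_nonneg_right (by positivity)
    · have e1 : g₂ z = ‖z‖ ^ (-(N + b)) :=
        indicator_of_mem (by simp; linarith) _
      calc M * ‖z‖ ^ (-(N + b)) ≤ M * t ^ (-(b / 2)) * ‖z‖ ^ (-(N + b)) := by
            gcongr; exact le_mul_of_one_le_right hM hone
        _ = M * t ^ (-(b / 2)) * g₂ z := by rw [e1]
        _ ≤ _ := le_add_of_nonneg_left (by positivity))
  have e : ∫ y in Ω, f (x₀ + t • ν - y) = ∫ z in S, f z :=
    setIntegral_sub_left f Ω hΩ.measurableSet (x₀ + t • ν)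
  rw [e]
  refine key.trans ?_
  rw [integral_add' hG1 hG2, integral_const_mul, integral_const_mul, integral_sub_left_eq_self g₁,
    hg₁, hg₂, integral_indicator hKm, integral_indicator Metric.isOpen_ball.measurableSet.compl]
  have := hthin ν hν
  calc _ ≤ M * t ^ (-(b / 2)) * 2 ^ (N + b / 2) * C₁ + M * t ^ (-(b / 2)) * C₂ := by gcongr
    _ = _ := by ring

end Exterior

end HigherNeumann

namespace HigherNeumann

/-! ### Boundary asymptotics of the exterior operator. -/

section Exterior

variable {N : ℕ} [NeZero N] {Ω : Set (Euc N)} {V : Euc N → Euc N} {M : ℝ} {κ κ' : ℝ → ℝ}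

theorem IsTameField.integrableOn_diffDiv (hV : IsTameField V M) {b : ℝ} (hb : 0 < b)
    (hκ : KernelProfile (N + b) κ κ') {x : Euc N} {t : ℝ} (ht : 0 < t) :
    IntegrableOn (diffDiv κ κ' V x) (Metric.ball x t)ᶜ := by
  have hm : Measurable (diffDiv κ κ' V x) :=
    (hκ.measurable_diffDiv hV).comp (by fun_prop : Measurable fun y : Euc N => (x, y))
  have h1 : IntegrableOn (fun y => (N * M + 2 * ((N + b) + 2) * M) * ‖x - y‖ ^ (-(N + b)))
      (Metric.ball x t)ᶜ := by
    refine (integrableOn_sub_left Metric.isOpen_ball.measurableSet.compl x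
      (f := fun z => ‖z‖ ^ (-(N + b))) ?_).const_mul _
    convert integrableOn_norm_rpow_compl_ball (N := N) hb ht using 2
    ext z
    simp
  refine Integrable.mono' h1 hm.aestronglyMeasurable ?_
  refine (ae_restrict_iff' Metric.isOpen_ball.measurableSet.compl).2 (Eventually.of_forall ?_)
  intro y hy
  have hxy : x ≠ y := by
    rintro rfl
    exact hy (Metric.mem_ball_self ht)
  exact hV.abs_diffDiv_le hκ hxy

/-- Boundary behaviour from outside of the regional operator on `Ω`. -/
theorem IsBoundedC11Domain.exists_abs_integral_diffDiv_sub_le (hΩ : IsBoundedC11Domain Ω)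
    (hV : IsTameField V M) {b : ℝ} (hb : 0 < b) (hb2 : b < 2) : ∃ C : ℝ, 0 ≤ C ∧
    ∀ κ κ', KernelProfile (N + b) κ κ' → ∀ x₀ ∈ frontier Ω, ∀ t : ℝ, 0 < t → t ≤ 1 →
    (∀ y ∈ Ω, t ≤ ‖x₀ + t • outerNormal Ω x₀ - y‖) →
    |(∫ y in Ω, diffDiv κ κ' V (x₀ + t • outerNormal Ω x₀) y) -
      inner ℝ (fderiv ℝ V x₀ (outerNormal Ω x₀)) (outerNormal Ω x₀) *
      ∫ z in {z : Euc N | t < inner ℝ (outerNormal Ω x₀) z},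
        kernelDiv κ κ' (ContinuousLinearMap.id ℝ (Euc N)) z| ≤ C * t ^ (-(b / 2)) := by
  obtain ⟨C₁, hC₁, h1⟩ := hΩ.exists_abs_integral_sub_halfSpace_le hb hb2
  obtain ⟨R, hR0, hR⟩ := hΩ.isBounded.subset_closedBall_lt 0 0
  have hM := hV.nonneg
  set C₂ : ℝ := ∫ z in Metric.ball (0 : Euc N) (R + R + 2), ‖z‖ ^ ((1 - b / 2) - N) with hC₂
  have hC₂0 : 0 ≤ C₂ := integral_nonneg fun z => by positivity
  have hC₂i := integrableOn_norm_rpow_ball (N := N) (b := 1 - b / 2) (by linarith)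
    (R := R + R + 2) (by positivity)
  set C₃ : ℝ := N * M + 2 * ((N + b) + 2) * (2 * M) with hC₃
  have hC₃0 : 0 ≤ C₃ := by positivity
  refine ⟨C₁ * ((N + 2 * ((N + b) + 2)) * M) + C₃ * C₂, by positivity,
    fun κ κ' hκ x₀ hx₀ t ht ht1 hfar => ?_⟩
  have hν := hΩ.norm_outerNormal hx₀
  have h1 := h1 (kernelDiv κ κ' (fderiv ℝ V x₀)) ((N + 2 * ((N + b) + 2)) * M) (by positivity)
    (hκ.measurable_kernelDiv _) (fun z hz => (hκ.abs_kernelDiv_le _ hz).trans (by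
      have := hV.norm_fderiv_le x₀
      gcongr)) x₀ hx₀ t ht ht1 hfar
  rw [hκ.integral_halfSpace hb _ ht hν] at h1
  set ν := outerNormal Ω x₀
  set x := x₀ + t • ν with hx
  have hsub : Ω ⊆ (Metric.ball x t)ᶜ := fun y hy => by
    have := hfar y hy
    rw [mem_compl_iff, Metric.mem_ball, dist_comm, dist_eq_norm, not_lt]
    exact this
  have hi1 : IntegrableOn (diffDiv κ κ' V x) Ω := (hV.integrableOn_diffDiv hb hκ ht).mono_set hsub
  have hi2 : IntegrableOn (fun y => kernelDiv κ κ' (fderiv ℝ V x₀) (x - y)) Ω := by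
    refine integrableOn_sub_left hΩ.measurableSet x
      ((hκ.integrableOn_kernelDiv hb (fderiv ℝ V x₀) ht).mono_set fun z hz => ?_)
    have := hsub hz
    simpa using this
  have hx₀R : ‖x₀‖ ≤ R := by
    have := closure_minimal hR Metric.isClosed_closedBall (frontier_subset_closure hx₀)
    simpa using this
  set S : Set (Euc N) := (fun z => x - z) ⁻¹' Ω with hS
  have hSball : S ⊆ Metric.ball 0 (R + R + 2) := fun z hz => by
    have h3 : ‖x - z‖ ≤ R := by simpa using hR hz
    have h4 : ‖x‖ ≤ R + 1 := by
      refine (norm_add_le _ _).trans ?_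
      rw [norm_smul, hν, Real.norm_eq_abs, abs_of_pos ht]
      linarith
    have h5 : ‖z‖ ≤ ‖x‖ + ‖x - z‖ := by
      simpa using norm_sub_le x (x - z)
    rw [mem_ball_zero_iff]; linarith
  have hi3 : IntegrableOn (fun y => C₃ * t ^ (-(b / 2)) * ‖x - y‖ ^ ((1 - b / 2) - N)) Ω :=
    (integrableOn_sub_left (f := fun z => ‖z‖ ^ ((1 - b / 2) - N)) hΩ.measurableSet x
      (hC₂i.mono_set hSball)).const_mul _
  -- The linearization error is of order ‖x - y‖^(1-N-b). Again b/2 of the exponent is paid by t,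
  -- and the rest, 1 - b/2 - N, is locally integrable because b < 2.
  have h2 : |(∫ y in Ω, diffDiv κ κ' V x y) - ∫ y in Ω, kernelDiv κ κ' (fderiv ℝ V x₀) (x - y)| ≤
      C₃ * C₂ * t ^ (-(b / 2)) := by
    rw [← integral_sub hi1 hi2, ← Real.norm_eq_abs]
    refine (norm_integral_le_of_norm_le hi3 ?_).trans ?_
    · refine (ae_restrict_iff' hΩ.measurableSet).2 (Eventually.of_forall fun y hy => ?_)
      have hty : t ≤ ‖x - y‖ := hfar y hy
      have hne : x ≠ y := by
        rintro h
        rw [h, sub_self, norm_zero] at hty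
        linarith
      have h0 : ‖x - x₀‖ = t := by
        rw [hx, add_sub_cancel_left, norm_smul, hν, Real.norm_eq_abs, abs_of_pos ht, mul_one]
      refine (hV.abs_diffDiv_sub_kernelDiv_le hκ hne (h0.trans_le hty)).trans ?_
      rw [mul_assoc C₃]
      refine mul_le_mul_of_nonneg_left ?_ hC₃0
      have e : 1 - ((N : ℝ) + b) = -((N - 1 + b / 2) + b / 2) := by ring
      have e' : (1 - b / 2) - N = -((N : ℝ) - 1 + b / 2) := by ring
      rw [e, e']
      exact rpow_neg_add_le ht hty (by linarith)
    · rw [integral_const_mul, setIntegral_sub_left (fun z => ‖z‖ ^ ((1 - b / 2) - N)) Ω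
        hΩ.measurableSet x]
      have : ∫ z in S, ‖z‖ ^ ((1 - b / 2) - N) ≤ C₂ :=
        setIntegral_mono_set hC₂i (Eventually.of_forall fun z => by positivity)
          hSball.eventuallyLE
      calc _ ≤ C₃ * t ^ (-(b / 2)) * C₂ := by gcongr
        _ = _ := by ring
  have := abs_sub_le (∫ y in Ω, diffDiv κ κ' V x y)
    (∫ y in Ω, kernelDiv κ κ' (fderiv ℝ V x₀) (x - y))
    (inner ℝ (fderiv ℝ V x₀ ν) ν * ∫ z in {z : Euc N | t < inner ℝ ν z},
        kernelDiv κ κ' (ContinuousLinearMap.id ℝ (Euc N)) z)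
  refine this.trans ((add_le_add h2 h1).trans (le_of_eq ?_))
  ring

end Exterior

end HigherNeumann

namespace HigherNeumann

/-! ### Forced vanishing of the normal derivative, and a uniform majorant. -/

section Exterior

variable {N : ℕ} [NeZero N] {Ω : Set (Euc N)} {V : Euc N → Euc N} {M : ℝ} {κ κ' : ℝ → ℝ}
  {p : Euc N → ℝ} {c₀ : ℝ} {c : Euc N}

/-- The normal derivative of the normal component at a boundary point. -/
noncomputable def normalDeriv (Ω : Set (Euc N)) (V : Euc N → Euc N) (x : Euc N) : ℝ :=
  inner ℝ (fderiv ℝ V x (outerNormal Ω x)) (outerNormal Ω x)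

theorem IsTameField.abs_normalDeriv_le (hV : IsTameField V M) (hΩ : IsBoundedC11Domain Ω)
    {x : Euc N} (hx : x ∈ frontier Ω) : |normalDeriv Ω V x| ≤ M := by
  have hν := hΩ.norm_outerNormal hx
  refine (abs_real_inner_le_norm _ _).trans ?_
  rw [hν, mul_one]
  refine ((fderiv ℝ V x).le_opNorm _).trans ?_
  rw [hν, mul_one]
  exact hV.norm_fderiv_le x

theorem IsTameField.continuousOn_normalDeriv (hV : IsTameField V M) (hΩ : IsBoundedC11Domain Ω) :
    ContinuousOn (normalDeriv Ω V) (frontier Ω) := by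
  have h1 := hΩ.continuousOn_outerNormal
  have h2 : Continuous (fderiv ℝ V) := hV.contDiff.continuous_fderiv (by norm_num)
  exact (h2.continuousOn.clm_apply h1).inner h1

/-- Replacing p(x) by p(x₀) costs O(t) times the main term O(t^(-b)), and t^(1-b) ≤ t^(-b/2) for t ≤
1 and b < 2. The point x₀ is chosen before the kernel, so the estimate is uniform over all profiles.
-/
theorem IsBoundedC11Domain.exists_abs_mul_integral_diffDiv_sub_le (hΩ : IsBoundedC11Domain Ω)
    (hV : IsTameField V M) (hp : ∀ x, p x = c₀ + inner ℝ c x) {b : ℝ} (hb : 0 < b) (hb2 : b < 2) :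
    ∃ C : ℝ, 0 ≤ C ∧ ∀ x ∉ closure Ω, Metric.infDist x Ω ≤ 1 → ∃ x₀ ∈ frontier Ω,
      dist x x₀ = Metric.infDist x Ω ∧ ∀ κ κ', KernelProfile (N + b) κ κ' →
      |p x * (∫ y in Ω, diffDiv κ κ' V x y) - p x₀ * normalDeriv Ω V x₀ *
        ∫ z in {z : Euc N | Metric.infDist x Ω < inner ℝ (outerNormal Ω x₀) z},
          kernelDiv κ κ' (ContinuousLinearMap.id ℝ (Euc N)) z| ≤
        C * Metric.infDist x Ω ^ (-(b / 2)) := by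
  obtain ⟨C₁, hC₁, h1⟩ := hΩ.exists_abs_integral_diffDiv_sub_le hV hb hb2
  obtain ⟨C₂, hC₂, h2⟩ := exists_abs_integral_halfSpace_le (N := N) hb
  obtain ⟨R, hR0, hR⟩ := hΩ.isBounded.subset_closedBall_lt 0 0
  have hM := hV.nonneg
  refine ⟨(|c₀| + ‖c‖ * R + ‖c‖) * C₁ + ‖c‖ * (M * C₂), by positivity, fun x hx hx1 => ?_⟩
  have hxΩ : x ∉ Ω := fun h => hx (subset_closure h)
  have ht := hΩ.infDist_pos hx
  obtain ⟨x₀, hx₀, hxx⟩ := hΩ.exists_nearest hxΩ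
  have hfar : ∀ y ∈ Ω, Metric.infDist x Ω ≤ ‖x - y‖ := fun y hy => by
    rw [← dist_eq_norm]; exact Metric.infDist_le_dist_of_mem hy
  set t := Metric.infDist x Ω
  have hν := hΩ.norm_outerNormal hx₀
  have hd : ‖x - x₀‖ = t := by
    conv_lhs => rw [hxx]
    rw [add_sub_cancel_left, norm_smul, hν, Real.norm_eq_abs, abs_of_pos ht, mul_one]
  refine ⟨x₀, hx₀, by rw [dist_eq_norm, hd], fun κ κ' hκ => ?_⟩
  have h1 := h1 κ κ' hκ x₀ hx₀ t ht hx1 (by rw [← hxx]; exact hfar)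
  have h2 := h2 κ κ' hκ t ht _ hν
  rw [← hxx] at h1
  set D := ∫ y in Ω, diffDiv κ κ' V x y
  set Θ := ∫ z in {z : Euc N | t < inner ℝ (outerNormal Ω x₀) z},
          kernelDiv κ κ' (ContinuousLinearMap.id ℝ (Euc N)) z
  have ha := hV.abs_normalDeriv_le hΩ hx₀
  have h1 : |D - normalDeriv Ω V x₀ * Θ| ≤ C₁ * t ^ (-(b / 2)) := h1
  set a := normalDeriv Ω V x₀
  have hpp : |p x - p x₀| ≤ ‖c‖ * t := by
    rw [hp, hp, add_sub_add_left_eq_sub, ← inner_sub_right, ← hd]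
    exact abs_real_inner_le_norm _ _
  have hx₀R : ‖x₀‖ ≤ R := by
    have := closure_minimal hR Metric.isClosed_closedBall (frontier_subset_closure hx₀)
    simpa using this
  have hpx : |p x| ≤ |c₀| + ‖c‖ * R + ‖c‖ := by
    have h3 : |p x₀| ≤ |c₀| + ‖c‖ * R := by
      rw [hp]
      exact (abs_add_le _ _).trans (by gcongr; exact (abs_real_inner_le_norm _ _).trans (by gcongr))
    have h4 : ‖c‖ * t ≤ ‖c‖ := mul_le_of_le_one_right (norm_nonneg _) hx1
    have := abs_sub_abs_le_abs_sub (p x) (p x₀)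
    linarith
  have e : p x * D - p x₀ * a * Θ = p x * (D - a * Θ) + (p x - p x₀) * (a * Θ) := by ring
  rw [e]
  have htt : t * t ^ (-b) ≤ t ^ (-(b / 2)) := by
    have : t * t ^ (-b) = t ^ (1 + -b) := by rw [Real.rpow_add ht, Real.rpow_one]
    rw [this]
    exact Real.rpow_le_rpow_of_exponent_ge ht hx1 (by linarith)
  calc _ ≤ |p x| * |D - a * Θ| + |p x - p x₀| * (|a| * |Θ|) := by
        refine (abs_add_le _ _).trans (le_of_eq ?_)
        rw [abs_mul, abs_mul, abs_mul a]
    _ ≤ (|c₀| + ‖c‖ * R + ‖c‖) * (C₁ * t ^ (-(b / 2))) + ‖c‖ * t * (M * (C₂ * t ^ (-b))) := by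
        gcongr
    _ = (|c₀| + ‖c‖ * R + ‖c‖) * C₁ * t ^ (-(b / 2)) + ‖c‖ * (M * C₂) * (t * t ^ (-b)) := by ring
    _ ≤ (|c₀| + ‖c‖ * R + ‖c‖) * C₁ * t ^ (-(b / 2)) + ‖c‖ * (M * C₂) * t ^ (-(b / 2)) := by gcongr
    _ = _ := by ring

/-- Integrability outside `Ω` forces the normal derivative to vanish on the boundary in the
strongly singular case. -/
theorem IsBoundedC11Domain.mul_normalDeriv_eq_zero (hΩ : IsBoundedC11Domain Ω)
    (hV : IsTameField V M) (hp : ∀ x, p x = c₀ + inner ℝ c x) {b : ℝ} (hb : 1 ≤ b) (hb2 : b < 2)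
    (hint : IntegrableOn (fun x => p x * ∫ y in Ω, diffDiv (fun s => s ^ (-((N + b) / 2)))
      (fun s => -((N + b) / 2) * s ^ (-((N + b) / 2) - 1)) V x y) Ωᶜ) {z : Euc N}
    (hz : z ∈ frontier Ω) : p z * normalDeriv Ω V z = 0 := by
  by_contra hne
  have hb0 : 0 < b := by linarith
  have hκ := kernelProfile_rpow (q := N + b) (by positivity)
  obtain ⟨C, hC, h1⟩ := hΩ.exists_abs_mul_integral_diffDiv_sub_le hV hp hb0 hb2
  obtain ⟨k, hk, h2⟩ := exists_le_integral_halfSpace_rpow (N := N) hb0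
  set D : Euc N → ℝ := fun x => ∫ y in Ω, diffDiv (fun s => s ^ (-((N + b) / 2)))
      (fun s => -((N + b) / 2) * s ^ (-((N + b) / 2) - 1)) V x y with hD
  have hpc : Continuous p := by
    have : p = fun x => c₀ + inner ℝ c x := funext hp
    rw [this]; fun_prop
  have hac : ContinuousOn (fun x => |p x * normalDeriv Ω V x|) (frontier Ω) :=
    (hpc.continuousOn.mul (hV.continuousOn_normalDeriv hΩ)).abs
  -- If p a were nonzero at z, it would exceed m in absolute value on the boundary near z. The main
  -- term, at least m k t^(-b), then beats the error C t^(-b/2) for small t, and the integrand is at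
  -- least (mk/2)t^(-b) ≥ (mk/2)/t, where t is the distance to Ω.
  set m := |p z * normalDeriv Ω V z| / 2 with hm
  have hm0 : 0 < m := half_pos (abs_pos.2 hne)
  have hnear : ∀ᶠ x in 𝓝[frontier Ω] z, m < |p x * normalDeriv Ω V x| :=
    (hac z hz).eventually (lt_mem_nhds (half_lt_self (abs_pos.2 hne)))
  obtain ⟨r, hr, hrm⟩ := Metric.mem_nhdsWithin_iff.1 hnear
  have hsm : ∀ᶠ t : ℝ in 𝓝[>] 0, C * t ^ (b / 2) < m * k / 2 := by
    have : Tendsto (fun t : ℝ => C * t ^ (b / 2)) (𝓝 0) (𝓝 (C * 0 ^ (b / 2))) :=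
      (Real.continuousAt_rpow_const 0 (b / 2) (Or.inr (by positivity))).tendsto.const_mul C
    rw [Real.zero_rpow (by positivity), mul_zero] at this
    exact (this.mono_left nhdsWithin_le_nhds).eventually (gt_mem_nhds (by positivity))
  obtain ⟨τ, hτ, hτm⟩ := mem_nhdsGT_iff_exists_Ioo_subset.1 hsm
  have hτ : 0 < τ := hτ
  set δ := min (r / 2) (min τ 1) with hδ
  have hδ0 : 0 < δ := by positivity
  refine hΩ.not_integrableOn_infDist_inv hz hδ0 ?_
  have hmeas : MeasurableSet (Ωᶜ ∩ Metric.ball z δ) :=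
    hΩ.measurableSet.compl.inter Metric.isOpen_ball.measurableSet
  have hi := (hint.mono_set (inter_subset_left (t := Metric.ball z δ))).norm.const_mul (m * k / 2)⁻¹
  refine Integrable.mono' hi (Metric.continuous_infDist_pt Ω).measurable.inv.aestronglyMeasurable ?_
  have hfr : ∀ᵐ x : Euc N, x ∉ frontier Ω :=
    measure_eq_zero_iff_ae_notMem.1 (volume_frontier hΩ)
  filter_upwards [ae_restrict_mem hmeas, ae_restrict_of_ae hfr] with x hx hxf
  have hxcl : x ∉ closure Ω := fun h => hxf ⟨h, by
    rw [hΩ.isOpen.interior_eq]; exact hx.1⟩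
  have ht := hΩ.infDist_pos hxcl
  have htδ : Metric.infDist x Ω < δ := by
    rw [← Metric.infDist_closure]
    exact (Metric.infDist_le_dist_of_mem (frontier_subset_closure hz)).trans_lt hx.2
  have ht1 : Metric.infDist x Ω ≤ 1 :=
    htδ.le.trans ((min_le_right _ _).trans (min_le_right _ _))
  obtain ⟨x₀, hx₀, hd, h3⟩ := h1 x hxcl ht1
  have h3 := h3 _ _ hκ
  set t := Metric.infDist x Ω
  have hx₀r : x₀ ∈ Metric.ball z r := by
    have h5 := dist_triangle_left x₀ z x
    have h6 : dist x z < δ := hx.2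
    have h7 : δ ≤ r / 2 := min_le_left _ _
    rw [Metric.mem_ball]; linarith
  have hmx : m < |p x₀ * normalDeriv Ω V x₀| := hrm ⟨hx₀r, hx₀⟩
  have h4 := h2 t ht _ (hΩ.norm_outerNormal hx₀)
  set Θ := ∫ z in {z : Euc N | t < inner ℝ (outerNormal Ω x₀) z},
          kernelDiv (fun s => s ^ (-((N + b) / 2)))
      (fun s => -((N + b) / 2) * s ^ (-((N + b) / 2) - 1)) (ContinuousLinearMap.id ℝ (Euc N)) z
  have hΘ : k * t ^ (-b) ≤ |Θ| := by
    have := neg_le_abs Θ; linarith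
  have h5 : C * t ^ (b / 2) < m * k / 2 :=
    hτm ⟨ht, htδ.trans_le ((min_le_right _ _).trans (min_le_left _ _))⟩
  have h6 : m * (k * t ^ (-b)) ≤ |p x * D x| + C * t ^ (-(b / 2)) := by
    have h7 : m * (k * t ^ (-b)) ≤ |p x₀ * normalDeriv Ω V x₀ * Θ| := by
      rw [abs_mul]; gcongr
    have h8 := abs_sub_abs_le_abs_sub (p x₀ * normalDeriv Ω V x₀ * Θ) (p x * D x)
    rw [abs_sub_comm] at h8
    linarith
  have h7 : C * t ^ (-(b / 2)) ≤ m * k / 2 * t ^ (-b) := by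
    have : t ^ (-(b / 2)) = t ^ (b / 2) * t ^ (-b) := by
      rw [← Real.rpow_add ht]; congr 1; ring
    rw [this, ← mul_assoc]
    gcongr
  have h8 : t⁻¹ ≤ t ^ (-b) := by
    rw [← Real.rpow_neg_one]
    exact Real.rpow_le_rpow_of_exponent_ge ht ht1 (by linarith)
  rw [Real.norm_eq_abs, abs_of_pos (by positivity), Real.norm_eq_abs, le_inv_mul_iff₀ (by positivity)]
  calc m * k / 2 * t⁻¹ ≤ m * k / 2 * t ^ (-b) := by gcongr
    _ ≤ |p x * D x| := by linarith

/-- The regional operators outside `Ω` are dominated uniformly in the kernel profile. -/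
theorem IsBoundedC11Domain.exists_dominating (hΩ : IsBoundedC11Domain Ω)
    (hV : IsTameField V M) (hdec : ∀ x, |divergence V x| * (1 + ‖x‖) ≤ M)
    (hp : ∀ x, p x = c₀ + inner ℝ c x) {b : ℝ} (hb : 0 < b) (hb2 : b < 2)
    (h0 : b < 1 ∨ ∀ z ∈ frontier Ω, p z * normalDeriv Ω V z = 0) :
    ∃ g : Euc N → ℝ, IntegrableOn g Ωᶜ ∧ ∀ κ κ', KernelProfile (N + b) κ κ' → ∀ x ∉ closure Ω,
      |p x * ∫ y in Ω, diffDiv κ κ' V x y| ≤ g x := by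
  obtain ⟨C, hC, h1⟩ := hΩ.exists_abs_mul_integral_diffDiv_sub_le hV hp hb hb2
  obtain ⟨C₂, hC₂, h2⟩ := exists_abs_integral_halfSpace_le (N := N) hb
  obtain ⟨R, hR0, hR⟩ := hΩ.isBounded.subset_closedBall_lt 0 0
  have hM := hV.nonneg
  have hcl : ∀ x₀ ∈ frontier Ω, ‖x₀‖ ≤ R := fun x₀ hx₀ => by
    have := closure_minimal hR Metric.isClosed_closedBall (frontier_subset_closure hx₀)
    simpa using this
  have hpb : ∀ x, |p x| ≤ (|c₀| + ‖c‖) * (1 + ‖x‖) := fun x => by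
    rw [hp]
    have h3 := (abs_add_le c₀ (inner ℝ c x)).trans
      (add_le_add_right (abs_real_inner_le_norm c x) _)
    nlinarith [abs_nonneg c₀, norm_nonneg c, norm_nonneg x]
  -- For b < 1 the leading order t^(-b) is itself integrable, so β = b. Otherwise the leading term
  -- is absent, and the error gives β = b/2 < 1.
  have hnear : ∃ β C₃ : ℝ, 0 < β ∧ β < 1 ∧ 0 ≤ C₃ ∧ ∀ κ κ', KernelProfile (N + b) κ κ' →
      ∀ x ∉ closure Ω, Metric.infDist x Ω ≤ 1 →
      |p x * ∫ y in Ω, diffDiv κ κ' V x y| ≤ C₃ * Metric.infDist x Ω ^ (-β) := by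
    rcases h0 with h0 | h0
    · refine ⟨b, C + (|c₀| + ‖c‖) * (1 + R) * M * C₂, hb, h0, by positivity,
        fun κ κ' hκ x hx hx1 => ?_⟩
      have ht := hΩ.infDist_pos hx
      obtain ⟨x₀, hx₀, -, h3⟩ := h1 x hx hx1
      have h3 := h3 κ κ' hκ
      have h4 := h2 κ κ' hκ _ ht _ (hΩ.norm_outerNormal hx₀)
      set t := Metric.infDist x Ω
      have h5 : |p x₀ * normalDeriv Ω V x₀| ≤ (|c₀| + ‖c‖) * (1 + R) * M := by
        rw [abs_mul]
        have := hcl x₀ hx₀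
        have := hV.abs_normalDeriv_le hΩ hx₀
        have := (hpb x₀)
        calc _ ≤ ((|c₀| + ‖c‖) * (1 + ‖x₀‖)) * M := by gcongr
          _ ≤ _ := by gcongr
      have h6 : t ^ (-(b / 2)) ≤ t ^ (-b) :=
        Real.rpow_le_rpow_of_exponent_ge ht hx1 (by linarith)
      have h7 := abs_sub_abs_le_abs_sub (p x * ∫ y in Ω, diffDiv κ κ' V x y)
        (p x₀ * normalDeriv Ω V x₀ * ∫ z in {z : Euc N | t < inner ℝ (outerNormal Ω x₀) z},
          kernelDiv κ κ' (ContinuousLinearMap.id ℝ (Euc N)) z)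
      rw [abs_mul (p x₀ * normalDeriv Ω V x₀)] at h7
      calc _ ≤ C * t ^ (-(b / 2)) + |p x₀ * normalDeriv Ω V x₀| * _ :=
            sub_le_iff_le_add.1 (h7.trans h3)
        _ ≤ C * t ^ (-b) + (|c₀| + ‖c‖) * (1 + R) * M * (C₂ * t ^ (-b)) := by gcongr
        _ = _ := by ring
    · refine ⟨b / 2, C, by positivity, by linarith, hC, fun κ κ' hκ x hx hx1 => ?_⟩
      obtain ⟨x₀, hx₀, -, h3⟩ := h1 x hx hx1
      have h3 := h3 κ κ' hκ
      rwa [h0 x₀ hx₀, zero_mul, sub_zero] at h3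
  obtain ⟨β, C₃, hβ0, hβ1, hC₃, hnear⟩ := hnear
  set S : Set (Euc N) := {x | Metric.infDist x Ω ≤ 1} ∩ Ωᶜ with hS
  have hSc : IsClosed S :=
    (isClosed_le (Metric.continuous_infDist_pt Ω) continuous_const).inter hΩ.isOpen.isClosed_compl
  have hne : Ω.Nonempty := hΩ.isConnected.nonempty
  have hSk : IsCompact S := by
    refine Metric.isCompact_of_isClosed_isBounded hSc ?_
    refine (Metric.isBounded_closedBall (x := (0 : Euc N)) (r := R + 2)).subset fun x hx => ?_
    obtain ⟨y, hy, hxy⟩ := (Metric.infDist_lt_iff hne).1 (lt_of_le_of_lt hx.1 (by norm_num : (1 : ℝ) < 2))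
    have h3 : ‖y‖ ≤ R := by simpa using hR hy
    rw [dist_eq_norm] at hxy
    have := norm_le_norm_add_norm_sub' x y
    rw [mem_closedBall_zero_iff]
    linarith
  set v : ℝ := volume.real Ω with hv
  have hvol : volume Ω < ⊤ := hΩ.isBounded.measure_lt_top
  set C₄ : ℝ := (|c₀| + ‖c‖) * ((M * (R + 2) ^ (N + b) +
    2 * ((N + b) + 2) * (2 * M) * (R + 2) ^ (1 + (N + b))) * v) with hC₄
  have hC₄0 : 0 ≤ C₄ := by positivity
  refine ⟨fun x => S.indicator (fun x => C₃ * Metric.infDist x Ω ^ (-β)) x +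
    C₄ * (1 + ‖x‖) ^ (-(N + b)), ?_, fun κ κ' hκ x hx => ?_⟩
  · refine Integrable.add ?_ ?_
    · exact ((integrable_indicator_iff hSc.measurableSet).2
        ((hΩ.integrableOn_infDist_rpow hβ0 hβ1 hSk inter_subset_right).const_mul _)).integrableOn
    · exact ((integrable_one_add_norm (by simp; linarith)).const_mul _).integrableOn
  · have hxΩ : x ∉ Ω := fun h => hx (subset_closure h)
    have hpos : 0 < 1 + ‖x‖ := by positivity
    by_cases hx1 : Metric.infDist x Ω ≤ 1
    · have e : S.indicator (fun x => C₃ * Metric.infDist x Ω ^ (-β)) x =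
        C₃ * Metric.infDist x Ω ^ (-β) := indicator_of_mem (show x ∈ S from ⟨hx1, hxΩ⟩) _
      refine (hnear κ κ' hκ x hx hx1).trans ?_
      beta_reduce
      rw [e]
      exact le_add_of_nonneg_right (by positivity)
    · have e : S.indicator (fun x => C₃ * Metric.infDist x Ω ^ (-β)) x = 0 :=
        indicator_of_notMem (show x ∉ S from fun h => hx1 h.1) _
      beta_reduce
      rw [e, zero_add]
      -- Far from Ω, ‖x - y‖ is comparable to 1 + ‖x‖. The exponent -1 - (N + b) leaves -(N + b)
      -- after multiplication by |p(x)| = O(1 + ‖x‖), hence integrability on ℝ^N.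
      have hb1 : ∀ y ∈ Ω, ‖diffDiv κ κ' V x y‖ ≤ (M * (R + 2) ^ (N + b) +
          2 * ((N + b) + 2) * (2 * M) * (R + 2) ^ (1 + (N + b))) * (1 + ‖x‖) ^ (-1 - (N + b)) := by
        intro y hy
        have h3 : 1 ≤ ‖x - y‖ := by
          rw [← dist_eq_norm]
          exact (not_le.1 hx1).le.trans (Metric.infDist_le_dist_of_mem hy)
        have h4 : ‖y‖ ≤ R := by simpa using hR hy
        have h5 : (1 + ‖x‖) / (R + 2) ≤ ‖x - y‖ := by
          rw [div_le_iff₀ (by positivity)]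
          have := norm_le_norm_add_norm_sub' x y
          nlinarith
        have hne : x ≠ y := by rintro rfl; exact hxΩ hy
        have hr : ∀ a : ℝ, 0 ≤ a → ‖x - y‖ ^ (-a) ≤ (R + 2) ^ a * (1 + ‖x‖) ^ (-a) := by
          intro a ha
          refine (Real.rpow_le_rpow_of_nonpos (by positivity) h5 (by linarith)).trans (le_of_eq ?_)
          rw [Real.div_rpow (by positivity) (by positivity), Real.rpow_neg (by positivity : 0 ≤ R + 2)]
          field_simp
        rw [Real.norm_eq_abs]
        refine (hV.abs_diffDiv_le_of_far hκ hne).trans ?_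
        have h6 := hr (N + b) (by positivity)
        have h7 := hr (1 + (N + b)) (by positivity)
        have e1 : -(1 + ((N : ℝ) + b)) = -1 - (N + b) := by ring
        rw [e1] at h7
        have h8 : |divergence V x| ≤ M * (1 + ‖x‖) ^ (-1 : ℝ) := by
          rw [Real.rpow_neg_one, ← div_eq_mul_inv, le_div_iff₀ hpos]
          exact hdec x
        have e2 : (1 + ‖x‖) ^ (-1 - ((N : ℝ) + b)) = (1 + ‖x‖) ^ (-1 : ℝ) * (1 + ‖x‖) ^ (-((N : ℝ) + b)) := by
          rw [← Real.rpow_add hpos]; congr 1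
        calc _ ≤ (M * (1 + ‖x‖) ^ (-1 : ℝ)) * ((R + 2) ^ (N + b) * (1 + ‖x‖) ^ (-(N + b))) +
              2 * ((N + b) + 2) * (2 * M) * ((R + 2) ^ (1 + (N + b)) * (1 + ‖x‖) ^ (-1 - (N + b))) := by
              gcongr
          _ = _ := by rw [e2]; ring
      have h3 := norm_setIntegral_le_of_norm_le_const hvol hb1
      rw [Real.norm_eq_abs] at h3
      rw [abs_mul]
      calc _ ≤ ((|c₀| + ‖c‖) * (1 + ‖x‖)) * ((M * (R + 2) ^ (N + b) +
          2 * ((N + b) + 2) * (2 * M) * (R + 2) ^ (1 + (N + b))) * (1 + ‖x‖) ^ (-1 - (N + b)) * v) :=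
            mul_le_mul (hpb x) h3 (abs_nonneg _) (by positivity)
        _ = C₄ * ((1 + ‖x‖) ^ (1 : ℝ) * (1 + ‖x‖) ^ (-1 - ((N : ℝ) + b))) := by
            rw [Real.rpow_one]; ring
        _ = _ := by
            rw [← Real.rpow_add hpos]; congr 2; ring

end Exterior

end HigherNeumann

namespace HigherNeumann

/-! ### The divergence of the regional operator outside Ω. -/

section Exterior

variable {N : ℕ} [NeZero N] {Ω : Set (Euc N)} {V : Euc N → Euc N} {M : ℝ} {κ κ' : ℝ → ℝ}

/-- At positive distance from A the removed ball is eventually disjoint from A, and the limit is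
that of a constant. The two forms of the kernel differ at most at y = x, where w x - w y vanishes.
-/
theorem regionalFracLap_eq_of_disjoint {F : Type*} [NormedAddCommGroup F] [NormedSpace ℝ F] (σ : ℝ)
    {A : Set (Euc N)} (w : Euc N → F) {x : Euc N} {δ : ℝ} (hδ : 0 < δ)
    (h : ∀ y ∈ A, δ ≤ ‖x - y‖) :
    regionalFracLap σ A w x =
      normConst N σ • ∫ y in A, (‖x - y‖ ^ 2) ^ (-((N + 2 * σ) / 2)) • (w x - w y) := by
  rw [regionalFracLap]
  congr 1
  refine Tendsto.limUnder_eq (tendsto_const_nhds.congr' ?_)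
  filter_upwards [Ioo_mem_nhdsGT hδ] with ε hε
  have e : A \ Metric.ball x ε = A := by
    refine sdiff_eq_left.2 (disjoint_left.2 fun y hy hb => ?_)
    rw [Metric.mem_ball, dist_comm, dist_eq_norm] at hb
    linarith [h y hy, hε.2]
  rw [e]
  congr 1 with y
  by_cases hxy : x = y
  · simp [hxy]
  · rw [sq_rpow_neg_half (norm_pos_iff.2 (sub_ne_zero.2 hxy)), Real.rpow_neg (norm_nonneg _)]

/-- `coordTrace` as a continuous linear functional. -/
noncomputable def coordTraceCLM (N : ℕ) : (Euc N →L[ℝ] Euc N) →L[ℝ] ℝ :=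
  ∑ i : Fin N, (EuclideanSpace.proj i : Euc N →L[ℝ] ℝ).comp
    (ContinuousLinearMap.apply ℝ (Euc N) (EuclideanSpace.single i (1 : ℝ)))

theorem coordTraceCLM_apply (B : Euc N →L[ℝ] Euc N) : coordTraceCLM N B = coordTrace B := by
  simp [coordTraceCLM, coordTrace]

theorem coordTrace_smulRight_innerSL (z v : Euc N) :
    coordTrace ((innerSL ℝ z).smulRight v) = inner ℝ v z := by
  rw [coordTrace, PiLp.inner_apply]
  refine Finset.sum_congr rfl fun i _ => ?_
  simp [EuclideanSpace.inner_single_right]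

/-- The derivative in `x` of `κ (‖x - y‖²) (V x - V y)`. -/
noncomputable def kernelFDeriv (κ κ' : ℝ → ℝ) (V : Euc N → Euc N) (x y : Euc N) :
    Euc N →L[ℝ] Euc N :=
  κ (‖x - y‖ ^ 2) • fderiv ℝ V x +
    (2 * κ' (‖x - y‖ ^ 2)) • (innerSL ℝ (x - y)).smulRight (V x - V y)

theorem coordTrace_kernelFDeriv (x y : Euc N) :
    coordTrace (kernelFDeriv κ κ' V x y) = diffDiv κ κ' V x y := by
  rw [kernelFDeriv, diffDiv, ← coordTraceCLM_apply, map_add, map_smul, map_smul,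
    coordTraceCLM_apply, coordTraceCLM_apply, coordTrace_smulRight_innerSL,
    ← divergence_eq_coordTrace, smul_eq_mul, smul_eq_mul, mul_comm (κ _)]

theorem hasFDerivAt_kernel (hV : Differentiable ℝ V) {x y : Euc N}
    (h : HasDerivAt κ (κ' (‖x - y‖ ^ 2)) (‖x - y‖ ^ 2)) :
    HasFDerivAt (fun x => κ (‖x - y‖ ^ 2) • (V x - V y)) (kernelFDeriv κ κ' V x y) x := by
  have h1 : HasFDerivAt (fun x : Euc N => ‖x - y‖ ^ 2) (2 • innerSL ℝ (x - y)) x := by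
    have := ((hasFDerivAt_id x).sub_const y).norm_sq
    simpa using this
  have h2 := (h.comp_hasFDerivAt x h1).smul ((hV x).hasFDerivAt.sub_const (V y))
  refine h2.congr_fderiv ?_
  rw [kernelFDeriv]
  ext v : 1
  simp only [Function.comp_apply, add_apply, smul_apply, ContinuousLinearMap.smulRight_apply,
    innerSL_apply_apply, smul_smul]
  congr 2
  simp; ring

theorem norm_kernelFDeriv_le {q : ℝ} (hV : IsTameField V M) (hκ : KernelProfile q κ κ') {x y : Euc N}
    (hxy : x ≠ y) : ‖kernelFDeriv κ κ' V x y‖ ≤ (M + 2 * (q + 2) * M) * ‖x - y‖ ^ (-q) := by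
  have hz0 : 0 < ‖x - y‖ := norm_pos_iff.2 (sub_ne_zero.2 hxy)
  have hM := hV.nonneg
  have hq := hκ.q_nonneg
  rw [kernelFDeriv]
  refine (norm_add_le _ _).trans ?_
  rw [norm_smul, norm_smul, ContinuousLinearMap.norm_smulRight_apply, innerSL_apply_norm,
    Real.norm_eq_abs, Real.norm_eq_abs, abs_mul, abs_two,
    abs_of_nonneg (hκ.nonneg _ (by positivity))]
  have h1 := hκ.le _ hz0
  have h2 := hκ.deriv_le _ hz0
  have h3 := hV.norm_fderiv_le x
  have h4 := hV.norm_sub_le x y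
  have h5 : ‖x - y‖ ^ (-q - 2) * ‖x - y‖ ^ 2 = ‖x - y‖ ^ (-q) := rpow_sub_two_mul_sq hz0 _
  calc _ ≤ ‖x - y‖ ^ (-q) * M + 2 * ((q + 2) * ‖x - y‖ ^ (-q - 2)) * (‖x - y‖ * (M * ‖x - y‖)) := by
        gcongr
    _ = ‖x - y‖ ^ (-q) * M + 2 * (q + 2) * M * (‖x - y‖ ^ (-q - 2) * ‖x - y‖ ^ 2) := by ring
    _ = _ := by rw [h5]; ring

/-- Differentiation under the integral away from the domain of integration. -/
theorem hasFDerivAt_integral_kernel {q : ℝ} {A : Set (Euc N)} (hA : MeasurableSet A)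
    (hAf : volume A < ⊤) (hV : IsTameField V M) (hκ : KernelProfile q κ κ') (hq : 0 ≤ q)
    {x : Euc N} {δ : ℝ} (hδ : 0 < δ) (h : ∀ y ∈ A, δ ≤ ‖x - y‖) :
    IntegrableOn (kernelFDeriv κ κ' V x) A ∧
    HasFDerivAt (fun x => ∫ y in A, κ (‖x - y‖ ^ 2) • (V x - V y))
      (∫ y in A, kernelFDeriv κ κ' V x y) x := by
  have hM := hV.nonneg
  have hVc := hV.contDiff.continuous
  have hm : ∀ x, Measurable fun y : Euc N => ‖x - y‖ ^ 2 := fun x => by fun_prop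
  have hF : ∀ x, Measurable fun y => κ (‖x - y‖ ^ 2) • (V x - V y) := fun x =>
    (hκ.measurable.comp (hm x)).smul (by fun_prop : Continuous fun y => V x - V y).measurable
  have hF' : Measurable (kernelFDeriv κ κ' V x) := by
    have h1 : Measurable fun y : Euc N => κ (‖x - y‖ ^ 2) • fderiv ℝ V x :=
      (hκ.measurable.comp (hm x)).smul_const _
    have h2 : Continuous fun y : Euc N => (innerSL ℝ (x - y)).smulRight (V x - V y) := by fun_prop
    exact h1.add (((hκ.measurable'.comp (hm x)).const_mul 2).smul h2.measurable)
  have hfar : ∀ x' ∈ Metric.ball x (δ / 2), ∀ y ∈ A, δ / 2 ≤ ‖x' - y‖ := fun x' hx' y hy => by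
    have h1 := h y hy
    have h2 := norm_sub_le_norm_sub_add_norm_sub x x' y
    rw [Metric.mem_ball, dist_comm, dist_eq_norm] at hx'
    linarith
  have hb : ∀ y ∈ A, ∀ x' ∈ Metric.ball x (δ / 2), ‖kernelFDeriv κ κ' V x' y‖ ≤
      (M + 2 * (q + 2) * M) * (δ / 2) ^ (-q) := fun y hy x' hx' => by
    have h1 := hfar x' hx' y hy
    have hne : x' ≠ y := by
      rintro rfl
      rw [sub_self, norm_zero] at h1
      linarith
    refine (norm_kernelFDeriv_le hV hκ hne).trans ?_
    gcongr ?_ * ?_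
    exact Real.rpow_le_rpow_of_nonpos (by positivity) h1 (by linarith)
  have hx : x ∈ Metric.ball x (δ / 2) := Metric.mem_ball_self (by positivity)
  have hAf' : volume A ≠ ⊤ := hAf.ne
  have hconst : ∀ K : ℝ, IntegrableOn (fun _ : Euc N => K) A := fun K => integrableOn_const hAf'
  refine ⟨Integrable.mono' (hconst _) hF'.aestronglyMeasurable
    ((ae_restrict_iff' hA).2 (Eventually.of_forall fun y hy => hb y hy x hx)), ?_⟩
  refine hasFDerivAt_integral_of_dominated_of_fderiv_le (bound := fun _ =>
    (M + 2 * (q + 2) * M) * (δ / 2) ^ (-q)) (Metric.ball_mem_nhds x (ε := δ / 2) (by positivity))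
    (Eventually.of_forall fun x' => (hF x').aestronglyMeasurable) ?_ hF'.aestronglyMeasurable
    ((ae_restrict_iff' hA).2 (Eventually.of_forall fun y hy x' hx' => hb y hy x' hx'))
    (hconst _) ((ae_restrict_iff' hA).2 (Eventually.of_forall fun y hy x' hx' => ?_))
  · refine Integrable.mono' (hconst (δ ^ (-q) * (2 * M))) (hF x).aestronglyMeasurable
      ((ae_restrict_iff' hA).2 (Eventually.of_forall fun y hy => ?_))
    have h1 := h y hy
    have hz0 : 0 < ‖x - y‖ := by linarith
    rw [norm_smul, Real.norm_eq_abs, abs_of_nonneg (hκ.nonneg _ (by positivity))]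
    have h2 : ‖x - y‖ ^ (-q) ≤ δ ^ (-q) := Real.rpow_le_rpow_of_nonpos hδ h1 (by linarith)
    exact mul_le_mul ((hκ.le _ hz0).trans h2)
      ((norm_sub_le _ _).trans (by linarith [hV.norm_le x, hV.norm_le y])) (norm_nonneg _)
      (by positivity)
  · have h1 := hfar x' hx' y hy
    have hz0 : 0 < ‖x' - y‖ := by linarith
    exact hasFDerivAt_kernel (hV.contDiff.differentiable (by norm_num))
      (hκ.hasDerivAt _ (by positivity))

/-- The principal value is an ordinary integral on a whole neighbourhood of x, so it can be
differentiated under the integral sign. The trace, a continuous linear functional, commutes with the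
integral and yields `diffDiv`. -/
theorem IsBoundedC11Domain.divergence_regionalFracLap (hΩ : IsBoundedC11Domain Ω)
    (hV : IsTameField V M) {σ : ℝ} (hσ : 0 < σ) {x : Euc N} (hx : x ∉ closure Ω) :
    divergence (regionalFracLap σ Ω V) x = normConst N σ *
      ∫ y in Ω, diffDiv (fun s => s ^ (-((N + 2 * σ) / 2)))
        (fun s => -((N + 2 * σ) / 2) * s ^ (-((N + 2 * σ) / 2) - 1)) V x y := by
  have hδ := hΩ.infDist_pos hx
  obtain ⟨hi, hd⟩ := hasFDerivAt_integral_kernel hΩ.measurableSet hΩ.isBounded.measure_lt_top hV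
    (kernelProfile_rpow (q := N + 2 * σ) (by positivity)) (by positivity) hδ
    (fun y hy => by rw [← dist_eq_norm]; exact Metric.infDist_le_dist_of_mem hy)
  have he : regionalFracLap σ Ω V =ᶠ[𝓝 x] fun x => normConst N σ •
      ∫ y in Ω, (‖x - y‖ ^ 2) ^ (-((N + 2 * σ) / 2)) • (V x - V y) := by
    filter_upwards [isClosed_closure.isOpen_compl.mem_nhds hx] with x' hx'
    exact regionalFracLap_eq_of_disjoint σ V (hΩ.infDist_pos hx')
      (fun y hy => by rw [← dist_eq_norm]; exact Metric.infDist_le_dist_of_mem hy)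
  have h1 := (hd.const_smul (normConst N σ)).congr_of_eventuallyEq he
  rw [divergence_eq_coordTrace, h1.fderiv, coordTrace_smul, ← coordTraceCLM_apply,
    ← ContinuousLinearMap.integral_comp_comm _ hi]
  simp only [coordTraceCLM_apply, coordTrace_kernelFDeriv]

end Exterior

end HigherNeumann

namespace HigherNeumann

/-! ### A corrected integrand for the normal trace and its majorant. -/

section Trace

variable {N : ℕ} [NeZero N] {Ω : Set (Euc N)} {V : Euc N → Euc N} {M : ℝ} {κ κ' : ℝ → ℝ}

/-- Away from the strongly singular case, or where the normal derivative vanishes, increments of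
the normal component are of higher order up to a field that is odd in the normal direction. -/
theorem IsTameField.exists_corrector (hV : IsTameField V M) {b : ℝ} (hb : 0 < b) (hb2 : b < 2) :
    ∃ θ : ℝ, 0 < θ ∧ θ ≤ 1 ∧ ∀ x₀ ν : Euc N, ‖ν‖ = 1 →
      (b < 1 ∨ inner ℝ (fderiv ℝ V x₀ ν) ν = 0) →
      ∃ B : Euc N →L[ℝ] Euc N, ‖B‖ ≤ M ∧ inner ℝ (B ν) ν = 0 ∧ ∀ x y, x ≠ y → ‖x - x₀‖ ≤ ‖x - y‖ →
        |inner ℝ (V x - V y) ν - (1 + ‖x - y‖ ^ 2)⁻¹ * inner ℝ (B (x - y)) ν| ≤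
          3 * M * ‖x - y‖ ^ (b + θ) ∧
        |inner ℝ (V x - V y) ν - (1 + ‖x - y‖ ^ 2)⁻¹ * inner ℝ (B (x - y)) ν| ≤ 3 * M := by
  have hM := hV.nonneg
  have hsup : ∀ x y ν : Euc N, ‖ν‖ = 1 → |inner ℝ (V x - V y) ν| ≤ 2 * M := fun x y ν hν => by
    refine (abs_real_inner_le_norm _ _).trans ?_
    rw [hν, mul_one]
    exact (_root_.norm_sub_le _ _).trans (by linarith [hV.norm_le x, hV.norm_le y])
  by_cases hb1 : b < 1
  -- For b < 1 no corrector is needed: b + θ = (1 + b)/2 < 1, so the Lipschitz bound on V suffices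
  -- near the point.
  · refine ⟨(1 - b) / 2, by linarith, by linarith, fun x₀ ν hν _ => ⟨0, by simpa using hM, by simp,
      fun x y hxy _ => ?_⟩⟩
    have hz0 : 0 < ‖x - y‖ := norm_pos_iff.2 (sub_ne_zero.2 hxy)
    rw [zero_apply, inner_zero_left, mul_zero, sub_zero]
    refine ⟨?_, (hsup x y ν hν).trans (by linarith)⟩
    rcases le_total ‖x - y‖ 1 with h1 | h1
    · have h2 : ‖x - y‖ ≤ ‖x - y‖ ^ (b + (1 - b) / 2) := by
        conv_lhs => rw [← Real.rpow_one ‖x - y‖]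
        exact Real.rpow_le_rpow_of_exponent_ge hz0 h1 (by linarith)
      refine (abs_real_inner_le_norm _ _).trans ?_
      rw [hν, mul_one]
      calc _ ≤ M * ‖x - y‖ := hV.norm_sub_le x y
        _ ≤ 3 * M * ‖x - y‖ ^ (b + (1 - b) / 2) := by gcongr; linarith
    · have h2 : 1 ≤ ‖x - y‖ ^ (b + (1 - b) / 2) := Real.one_le_rpow h1 (by linarith)
      refine (hsup x y ν hν).trans ?_
      nlinarith
  -- For b ≥ 1, b + θ = 1 + b/2 < 2 and a second-order remainder suffices, with corrector B =
  -- DV(x₀). The factor (1 + r²)⁻¹ keeps the corrector bounded at infinity and costs only M r² near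
  -- the point.
  · refine ⟨1 - b / 2, by linarith, by linarith, fun x₀ ν hν h => ?_⟩
    have h := h.resolve_left hb1
    refine ⟨fderiv ℝ V x₀, hV.norm_fderiv_le x₀, h, fun x y hxy hxx => ?_⟩
    have hz0 : 0 < ‖x - y‖ := norm_pos_iff.2 (sub_ne_zero.2 hxy)
    set r := ‖x - y‖ with hr
    set A := fderiv ℝ V x₀ with hA
    have hAz : |inner ℝ (A (x - y)) ν| ≤ M * r := by
      refine (abs_real_inner_le_norm _ _).trans ?_
      rw [hν, mul_one]
      exact (A.le_opNorm _).trans (by gcongr; exact hV.norm_fderiv_le x₀)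
    have hφ0 : 0 < (1 + r ^ 2)⁻¹ := by positivity
    have hφr : (1 + r ^ 2)⁻¹ * r ≤ 1 := by
      rw [inv_mul_le_iff₀ (by positivity)]
      nlinarith [sq_nonneg (r - 1)]
    have hbd : |(1 + r ^ 2)⁻¹ * inner ℝ (A (x - y)) ν| ≤ M := by
      rw [abs_mul, abs_of_pos hφ0]
      calc _ ≤ (1 + r ^ 2)⁻¹ * (M * r) := by gcongr
        _ = M * ((1 + r ^ 2)⁻¹ * r) := by ring
        _ ≤ M := mul_le_of_le_one_right hM hφr
    have hall : |inner ℝ (V x - V y) ν - (1 + r ^ 2)⁻¹ * inner ℝ (A (x - y)) ν| ≤ 3 * M :=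
      (abs_sub _ _).trans (by linarith [hsup x y ν hν])
    refine ⟨?_, hall⟩
    rcases le_total r 1 with h1 | h1
    · have h2 : r ^ 2 ≤ r ^ (b + (1 - b / 2)) := by
        rw [← Real.rpow_natCast]
        exact Real.rpow_le_rpow_of_exponent_ge hz0 h1 (by push_cast; linarith)
      have e : inner ℝ (V x - V y) ν - (1 + r ^ 2)⁻¹ * inner ℝ (A (x - y)) ν =
          inner ℝ ((V x - V y - fderiv ℝ V x (x - y)) + (fderiv ℝ V x - A) (x - y)) ν +
          r ^ 2 * ((1 + r ^ 2)⁻¹ * inner ℝ (A (x - y)) ν) := by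
        rw [sub_apply, sub_add_sub_cancel, inner_sub_left (V x - V y)]
        field_simp
        ring
      rw [e]
      refine (abs_add_le _ _).trans ?_
      have h3 : |inner ℝ ((V x - V y - fderiv ℝ V x (x - y)) + (fderiv ℝ V x - A) (x - y)) ν| ≤
          2 * M * r ^ 2 := by
        refine (abs_real_inner_le_norm _ _).trans ?_
        rw [hν, mul_one]
        refine (norm_add_le _ _).trans ?_
        have h4 := hV.norm_sub_sub_le x y
        have h5 : ‖(fderiv ℝ V x - A) (x - y)‖ ≤ M * r * r :=
          ((fderiv ℝ V x - A).le_opNorm _).trans (by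
            gcongr
            exact (hV.norm_fderiv_sub_le _ _).trans (by gcongr))
        nlinarith
      have h4 : |r ^ 2 * ((1 + r ^ 2)⁻¹ * inner ℝ (A (x - y)) ν)| ≤ r ^ 2 * M := by
        rw [abs_mul, abs_of_nonneg (sq_nonneg r)]
        gcongr
      have h5 : 3 * M * r ^ 2 ≤ 3 * M * r ^ (b + (1 - b / 2)) := by gcongr
      linarith
    · have h2 : 1 ≤ r ^ (b + (1 - b / 2)) := Real.one_le_rpow h1 (by linarith)
      refine hall.trans ?_
      exact le_mul_of_one_le_right (by positivity) h2

/-- The integrand of the normal component of the operator on the complement of `Ω`, minus a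
function that is odd in a half-space. -/
noncomputable def traceIntegrand (Ω : Set (Euc N)) (V : Euc N → Euc N) (B : Euc N →L[ℝ] Euc N)
    (x₀ ν : Euc N) (κ : ℝ → ℝ) (x y : Euc N) : ℝ :=
  Ωᶜ.indicator (fun y => inner ℝ (V x - V y) ν * κ (‖x - y‖ ^ 2)) y -
    {y | 0 < inner ℝ ν (y - x₀)}.indicator
      (fun y => (1 + ‖x - y‖ ^ 2)⁻¹ * inner ℝ (B (x - y)) ν * κ (‖x - y‖ ^ 2)) y

/-- The dominating function for `traceIntegrand`. -/
noncomputable def traceBound (K b θ : ℝ) (ν w : Euc N) : ℝ :=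
  (Metric.ball 0 2).indicator (fun w => ‖w‖ ^ (θ - N)) w +
    (Metric.ball 0 1)ᶜ.indicator (fun w => ‖w‖ ^ (-(N + b))) w +
    (thinSet K ν ∩ Metric.closedBall 0 1).indicator (fun w => ‖w‖ ^ (-(N + b - 1))) w

theorem traceBound_nonneg (K b θ : ℝ) (ν w : Euc N) : 0 ≤ traceBound K b θ ν w := by
  unfold traceBound
  have h1 : 0 ≤ (Metric.ball 0 2).indicator (fun w : Euc N => ‖w‖ ^ (θ - N)) w :=
    indicator_nonneg (fun _ _ => by positivity) _
  have h2 : 0 ≤ (Metric.ball 0 1)ᶜ.indicator (fun w : Euc N => ‖w‖ ^ (-(N + b))) w :=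
    indicator_nonneg (fun _ _ => by positivity) _
  have h3 : 0 ≤ (thinSet K ν ∩ Metric.closedBall 0 1).indicator
    (fun w : Euc N => ‖w‖ ^ (-(N + b - 1))) w := indicator_nonneg (fun _ _ => by positivity) _
  positivity

/-- The three pieces need respectively θ > 0, b > 0, and N + b - 1 < N + 1, which is b < 2. Only the
last one depends on ν, and rotation invariance bounds it uniformly. -/
theorem exists_integral_traceBound_le {K b θ : ℝ} (hK : 0 < K) (hb : 0 < b) (hb2 : b < 2)
    (hθ : 0 < θ) : ∃ C : ℝ, 0 ≤ C ∧ ∀ ν : Euc N, ‖ν‖ = 1 →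
      Integrable (traceBound K b θ ν) ∧ ∫ w, traceBound K b θ ν w ≤ C := by
  obtain ⟨C₁, hC₁, hthin⟩ := exists_integral_thinSet_le (N := N) K (N + b - 1)
  have hN : (1 : ℝ) ≤ N := by exact_mod_cast Nat.one_le_iff_ne_zero.2 (NeZero.ne N)
  have m1 : MeasurableSet (Metric.ball (0 : Euc N) 2) := Metric.isOpen_ball.measurableSet
  have m2 : MeasurableSet (Metric.ball (0 : Euc N) 1)ᶜ := Metric.isOpen_ball.measurableSet.compl
  have i1 := (integrable_indicator_iff m1).2
    (integrableOn_norm_rpow_ball (N := N) hθ (R := 2) (by norm_num))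
  have i2 := (integrable_indicator_iff m2).2
    (integrableOn_norm_rpow_compl_ball (N := N) hb one_pos)
  refine ⟨(∫ w in Metric.ball (0 : Euc N) 2, ‖w‖ ^ (θ - N)) +
    (∫ w in (Metric.ball (0 : Euc N) 1)ᶜ, ‖w‖ ^ (-(N + b))) + C₁, ?_, fun ν hν => ?_⟩
  · have h1 : 0 ≤ ∫ w in Metric.ball (0 : Euc N) 2, ‖w‖ ^ (θ - N) :=
      integral_nonneg fun _ => by positivity
    have h2 : 0 ≤ ∫ w in (Metric.ball (0 : Euc N) 1)ᶜ, ‖w‖ ^ (-(N + b)) :=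
      integral_nonneg fun _ => by positivity
    positivity
  · have m3 : MeasurableSet (thinSet K ν ∩ Metric.closedBall 0 1) :=
      (measurableSet_thinSet K ν).inter Metric.isClosed_closedBall.measurableSet
    have i3 := (integrable_indicator_iff m3).2
      (integrableOn_thinSet hK hν (q := N + b - 1) (by linarith) (by linarith))
    refine ⟨(i1.add i2).add i3, ?_⟩
    have e : traceBound K b θ ν = ((Metric.ball 0 2).indicator (fun w => ‖w‖ ^ (θ - N)) +
      (Metric.ball 0 1)ᶜ.indicator (fun w => ‖w‖ ^ (-(N + b)))) +
      (thinSet K ν ∩ Metric.closedBall 0 1).indicator (fun w => ‖w‖ ^ (-(N + b - 1))) := rfl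
    rw [e, integral_add' (i1.add i2) i3, integral_add' i1 i2, integral_indicator m1,
      integral_indicator m2, integral_indicator m3]
    linarith [hthin ν hν]

-- Where y lies both outside Ω and in the half-space, the integrand is the corrected increment times
-- the kernel: ‖w‖^(θ-N) near x₀, with w = y - x₀, and the bare kernel at infinity. Where y lies in
-- exactly one of the two sets, w is between the paraboloids; there the corrector alone is of first
-- order and contributes ‖w‖^(-(N+b-1)) for ‖w‖ < 1. The majorant depends neither on t nor on the
-- kernel.
set_option maxHeartbeats 800000 in
theorem abs_traceIntegrand_le {K b θ : ℝ} (hb : 0 < b) (hθ : 0 < θ) (hθ1 : θ ≤ 1) (hM : 0 ≤ M)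
    (hκ : KernelProfile (N + b) κ κ') {x₀ ν : Euc N} (hν : ‖ν‖ = 1)
    (hnb : ∀ y, (y ∈ Ω → inner ℝ ν (y - x₀) ≤ K * ‖y - x₀‖ ^ 2) ∧
      (y ∉ Ω → -(K * ‖y - x₀‖ ^ 2) ≤ inner ℝ ν (y - x₀)))
    (hK : 0 < K) {B : Euc N →L[ℝ] Euc N} (hB : ‖B‖ ≤ M)
    (hBV : ∀ x y, x ≠ y → ‖x - x₀‖ ≤ ‖x - y‖ →
        |inner ℝ (V x - V y) ν - (1 + ‖x - y‖ ^ 2)⁻¹ * inner ℝ (B (x - y)) ν| ≤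
          3 * M * ‖x - y‖ ^ (b + θ) ∧
        |inner ℝ (V x - V y) ν - (1 + ‖x - y‖ ^ 2)⁻¹ * inner ℝ (B (x - y)) ν| ≤ 3 * M)
    {t : ℝ} (ht : 0 ≤ t) (htK : 4 * K * t ≤ 1) {y : Euc N} (hy : y ≠ x₀) :
    |traceIntegrand Ω V B x₀ ν κ (x₀ - t • ν) y| ≤
      4 * M * 2 ^ (N + b) * traceBound K b θ ν (y - x₀) := by
  have hN : (1 : ℝ) ≤ N := by exact_mod_cast Nat.one_le_iff_ne_zero.2 (NeZero.ne N)
  have hGn := traceBound_nonneg K b θ ν (y - x₀)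
  set x := x₀ - t • ν with hx
  set w := y - x₀ with hw
  have hw0 : 0 < ‖w‖ := norm_pos_iff.2 (sub_ne_zero.2 hy)
  have hzw : x - y = -(t • ν + w) := by rw [hx, hw]; abel
  have hxx : ‖x - x₀‖ = t := by
    rw [hx, sub_sub_cancel_left, norm_neg, norm_smul, hν, mul_one, Real.norm_eq_abs, abs_of_nonneg ht]
  have hz2 : ‖x - y‖ ^ 2 = t ^ 2 + 2 * t * inner ℝ ν w + ‖w‖ ^ 2 := by
    rw [hzw, norm_neg, norm_add_sq_real, norm_smul, hν, inner_smul_left, Real.norm_eq_abs,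
      abs_of_nonneg ht]
    simp; ring
  by_cases hcase : y ∉ Ω ∨ 0 < inner ℝ ν w
  swap
  · rw [not_or, not_not] at hcase
    rw [traceIntegrand, indicator_of_notMem (by simpa using hcase.1),
      indicator_of_notMem (by simpa using hcase.2)]
    simp; positivity
  have hlow : -(K * ‖w‖ ^ 2) ≤ inner ℝ ν w := by
    rcases hcase with h | h
    · exact (hnb y).2 h
    · nlinarith [sq_nonneg ‖w‖]
  -- Since 4Kt ≤ 1, the cross term 2t⟨ν, w⟩ is at least -‖w‖²/2. Shifting the base point inwards
  -- thus keeps ‖x - y‖ at least t and at least ‖w‖/2, so bounds in ‖x - y‖ become bounds in w.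
  have hz3 : t ^ 2 + ‖w‖ ^ 2 / 2 ≤ ‖x - y‖ ^ 2 := by
    rw [hz2]
    have : 2 * t * -(K * ‖w‖ ^ 2) ≤ 2 * t * inner ℝ ν w := by gcongr
    nlinarith [sq_nonneg ‖w‖]
  have hzw2 : ‖w‖ / 2 ≤ ‖x - y‖ :=
    le_of_sq_le_sq (by nlinarith [sq_nonneg t, sq_nonneg ‖w‖]) (norm_nonneg _)
  have hzt : t ≤ ‖x - y‖ := le_of_sq_le_sq (by nlinarith [sq_nonneg ‖w‖]) (norm_nonneg _)
  set r := ‖x - y‖ with hr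
  have hr0 : 0 < r := by linarith
  have hxy : x ≠ y := by
    rintro h
    rw [hr, h, sub_self, norm_zero] at hr0
    exact lt_irrefl _ hr0
  obtain ⟨hBV1, hBV2⟩ := hBV x y hxy (hxx.trans_le hzt)
  set F := (1 + r ^ 2)⁻¹ * inner ℝ (B (x - y)) ν with hF
  have hκ0 := hκ.nonneg (r ^ 2) (by positivity)
  have hκ1 := hκ.le r hr0
  have hrp : ∀ a : ℝ, 0 ≤ a → a ≤ N + b → r ^ (-a) ≤ 2 ^ (N + b) * ‖w‖ ^ (-a) := fun a ha hab => by
    refine (Real.rpow_le_rpow_of_nonpos (by positivity) hzw2 (by linarith)).trans ?_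
    rw [Real.div_rpow hw0.le (by norm_num), Real.rpow_neg (by norm_num : (0 : ℝ) ≤ 2), div_inv_eq_mul,
      mul_comm]
    gcongr
    norm_num
  have hFb : |F| ≤ M * r ∧ |F| ≤ M := by
    have h1 : |inner ℝ (B (x - y)) ν| ≤ M * r := by
      refine (abs_real_inner_le_norm _ _).trans ?_
      rw [hν, mul_one]
      exact (B.le_opNorm _).trans (by gcongr)
    have hφ0 : 0 < (1 + r ^ 2)⁻¹ := by positivity
    have hφ1 : (1 + r ^ 2)⁻¹ ≤ 1 := inv_le_one_of_one_le₀ (by nlinarith [sq_nonneg r])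
    have hφr : (1 + r ^ 2)⁻¹ * r ≤ 1 := by
      rw [inv_mul_le_iff₀ (by positivity)]
      nlinarith [sq_nonneg (r - 1)]
    rw [hF, abs_mul, abs_of_pos hφ0]
    constructor
    · calc _ ≤ 1 * (M * r) := by gcongr
        _ = _ := one_mul _
    · calc _ ≤ (1 + r ^ 2)⁻¹ * (M * r) := by gcongr
        _ = M * ((1 + r ^ 2)⁻¹ * r) := by ring
        _ ≤ M := mul_le_of_le_one_right hM hφr
  have hg1 : 0 ≤ (Metric.ball 0 2).indicator (fun w : Euc N => ‖w‖ ^ (θ - N)) w :=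
    indicator_nonneg (fun _ _ => by positivity) _
  have hg2 : 0 ≤ (Metric.ball 0 1)ᶜ.indicator (fun w : Euc N => ‖w‖ ^ (-(N + b))) w :=
    indicator_nonneg (fun _ _ => by positivity) _
  have hg3 : 0 ≤ (thinSet K ν ∩ Metric.closedBall 0 1).indicator
    (fun w : Euc N => ‖w‖ ^ (-(N + b - 1))) w := indicator_nonneg (fun _ _ => by positivity) _
  set g1 := (Metric.ball 0 2).indicator (fun w : Euc N => ‖w‖ ^ (θ - N)) w
  set g2 := (Metric.ball 0 1)ᶜ.indicator (fun w : Euc N => ‖w‖ ^ (-(N + b))) w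
  set g3 := (thinSet K ν ∩ Metric.closedBall 0 1).indicator
    (fun w : Euc N => ‖w‖ ^ (-(N + b - 1))) w
  have hG : traceBound K b θ ν w = g1 + g2 + g3 := rfl
  rw [hG]
  have hJF : |inner ℝ (V x - V y) ν * κ (r ^ 2) - F * κ (r ^ 2)| ≤
      3 * M * 2 ^ (N + b) * (g1 + g2) := by
    rw [← sub_mul, abs_mul, abs_of_nonneg hκ0]
    rcases lt_or_ge ‖w‖ 1 with h1 | h1
    · have e1 : g1 = ‖w‖ ^ (θ - N) :=
        indicator_of_mem (by rw [mem_ball_zero_iff]; linarith) _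
      calc _ ≤ 3 * M * r ^ (b + θ) * r ^ (-(N + b)) := by gcongr
        _ = 3 * M * r ^ (-(N - θ)) := by
            rw [mul_assoc, ← Real.rpow_add hr0]; congr 2; ring
        _ ≤ 3 * M * (2 ^ (N + b) * ‖w‖ ^ (-(N - θ))) := by
            have : -((N : ℝ) + b) + b = -N := by ring
            by_cases hθ0 : 0 ≤ N - θ
            · gcongr
              exact hrp _ hθ0 (by linarith)
            · linarith
        _ = 3 * M * 2 ^ (N + b) * g1 := by rw [e1, neg_sub]; ring
        _ ≤ _ := by gcongr; linarith
    · have e1 : g2 = ‖w‖ ^ (-(N + b)) := indicator_of_mem (by simpa using h1) _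
      calc _ ≤ 3 * M * r ^ (-(N + b)) := by gcongr
        _ ≤ 3 * M * (2 ^ (N + b) * ‖w‖ ^ (-(N + b))) := by
            gcongr; exact hrp _ (by positivity) le_rfl
        _ = 3 * M * 2 ^ (N + b) * g2 := by rw [e1]; ring
        _ ≤ _ := by gcongr; linarith
  have hFt : w ∈ thinSet K ν → |F * κ (r ^ 2)| ≤ M * 2 ^ (N + b) * (g2 + g3) := by
    intro hthin
    rw [abs_mul, abs_of_nonneg hκ0]
    rcases lt_or_ge ‖w‖ 1 with h1 | h1
    · have e1 : g3 = ‖w‖ ^ (-(N + b - 1)) :=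
        indicator_of_mem (s := thinSet K ν ∩ Metric.closedBall 0 1)
          ⟨hthin, by simpa using h1.le⟩ _
      calc _ ≤ M * r * r ^ (-(N + b)) := by gcongr; exact hFb.1
        _ = M * r ^ (-(N + b - 1)) := by
            rw [mul_assoc]
            conv_lhs => rw [← Real.rpow_one r, ← Real.rpow_mul hr0.le, one_mul, ← Real.rpow_add hr0]
            congr 2; ring
        _ ≤ M * (2 ^ (N + b) * ‖w‖ ^ (-(N + b - 1))) := by
            gcongr; exact hrp _ (by linarith) (by linarith)
        _ = M * 2 ^ (N + b) * g3 := by rw [e1]; ring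
        _ ≤ _ := by gcongr; linarith
    · have e1 : g2 = ‖w‖ ^ (-(N + b)) := indicator_of_mem (by simpa using h1) _
      calc _ ≤ M * r ^ (-(N + b)) := by gcongr; exact hFb.2
        _ ≤ M * (2 ^ (N + b) * ‖w‖ ^ (-(N + b))) := by
            gcongr; exact hrp _ (by positivity) le_rfl
        _ = M * 2 ^ (N + b) * g2 := by rw [e1]; ring
        _ ≤ _ := by gcongr; linarith
  obtain ⟨P, hP⟩ : ∃ P, P = M * (2 : ℝ) ^ (N + b) := ⟨_, rfl⟩
  have hP0 : 0 ≤ P := by rw [hP]; positivity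
  rw [mul_assoc 3, ← hP] at hJF
  rw [← hP] at hFt
  rw [mul_assoc 4, ← hP]
  have hPg1 := mul_nonneg hP0 hg1
  have hPg2 := mul_nonneg hP0 hg2
  have hPg3 := mul_nonneg hP0 hg3
  rw [traceIntegrand]
  by_cases h1 : y ∈ Ω <;> by_cases h2 : 0 < inner ℝ ν w
  · rw [indicator_of_notMem (by simpa using h1), indicator_of_mem (by exact h2), zero_sub, abs_neg]
    refine (hFt ?_).trans (by linarith)
    rw [thinSet, Set.mem_ofPred_eq, abs_of_pos h2]
    exact (hnb y).1 h1
  · exact absurd hcase (by simp [h1, h2])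
  · rw [indicator_of_mem (by simpa using h1), indicator_of_mem (by exact h2)]
    exact hJF.trans (by linarith)
  · rw [indicator_of_mem (by simpa using h1), indicator_of_notMem (by exact h2), sub_zero]
    have h3 := hFt (by
      rw [thinSet, Set.mem_ofPred_eq, abs_of_nonpos (not_lt.1 h2)]
      linarith)
    have h4 := abs_sub_abs_le_abs_sub (inner ℝ (V x - V y) ν * κ (r ^ 2)) (F * κ (r ^ 2))
    linarith

end Trace

end HigherNeumann

namespace HigherNeumann

/-! ### Existence of the normal trace. -/

section Trace

variable {N : ℕ} [NeZero N] {Ω : Set (Euc N)} {V : Euc N → Euc N} {M : ℝ} {κ κ' : ℝ → ℝ}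

theorem le_norm_sub_of_normal_bound {K : ℝ} {x₀ ν y : Euc N} (hν : ‖ν‖ = 1)
    (hlow : -(K * ‖y - x₀‖ ^ 2) ≤ inner ℝ ν (y - x₀)) {t : ℝ} (ht : 0 ≤ t) (htK : 4 * K * t ≤ 1) :
    t ≤ ‖x₀ - t • ν - y‖ := by
  set w := y - x₀ with hw
  have hzw : x₀ - t • ν - y = -(t • ν + w) := by rw [hw]; abel
  have hz2 : ‖x₀ - t • ν - y‖ ^ 2 = t ^ 2 + 2 * t * inner ℝ ν w + ‖w‖ ^ 2 := by
    rw [hzw, norm_neg, norm_add_sq_real, norm_smul, hν, inner_smul_left, Real.norm_eq_abs,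
      abs_of_nonneg ht]
    simp; ring
  have : 2 * t * -(K * ‖w‖ ^ 2) ≤ 2 * t * inner ℝ ν w := by gcongr
  exact le_of_sq_le_sq (by nlinarith [sq_nonneg ‖w‖]) (norm_nonneg _)

theorem reflection_span_singleton {ν : Euc N} (hν : ‖ν‖ = 1) (z : Euc N) :
    (ℝ ∙ ν).reflection z = (2 * inner ℝ ν z) • ν - z := by
  rw [Submodule.reflection_apply, Submodule.starProjection_unit_singleton ℝ hν, two_smul, two_mul,
    add_smul]

/-- Subtracting the corrector does not change the integral: in z = x - y the half-space becomes ⟨ν,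
z⟩ < -t, invariant under the reflection z ↦ 2⟨ν, z⟩ν - z, and ⟨Bz, ν⟩ is odd under it because ⟨Bν,
ν⟩ = 0. Integrability of the kernel on the complement of the t-ball lets the two parts be integrated
separately. -/
theorem integral_traceIntegrand (hV : IsTameField V M) (hΩ : MeasurableSet Ω)
    (hκm : Measurable κ) (hκ0 : ∀ s, 0 ≤ s → 0 ≤ κ s) {x₀ ν : Euc N} (hν : ‖ν‖ = 1) {t : ℝ}
    (hfar : ∀ y ∉ Ω, t ≤ ‖x₀ - t • ν - y‖)
    (hint : IntegrableOn (fun z : Euc N => κ (‖z‖ ^ 2)) (Metric.ball 0 t)ᶜ)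
    {B : Euc N →L[ℝ] Euc N} (hB : ‖B‖ ≤ M) (hBν : inner ℝ (B ν) ν = 0) :
    ∫ y, traceIntegrand Ω V B x₀ ν κ (x₀ - t • ν) y =
      ∫ y in Ωᶜ, inner ℝ (V (x₀ - t • ν) - V y) ν * κ (‖x₀ - t • ν - y‖ ^ 2) := by
  have hM := hV.nonneg
  set x := x₀ - t • ν with hx
  set H : Set (Euc N) := {y | 0 < inner ℝ ν (y - x₀)} with hH
  have hHm : MeasurableSet H :=
    (isOpen_lt continuous_const (by fun_prop)).measurableSet
  have hpre : (fun z => x - z) ⁻¹' H = {z | inner ℝ ν z ∈ Iio (-t)} := by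
    ext z
    have : inner ℝ ν (x - z - x₀) = -t - inner ℝ ν z := by
      rw [hx, show x₀ - t • ν - z - x₀ = -(t • ν) - z by abel, inner_sub_right, inner_neg_right,
        inner_smul_right, real_inner_self_eq_norm_sq, hν]
      ring
    simp only [hH, mem_preimage, Set.mem_ofPred_eq, this, mem_Iio]
    constructor <;> intro h <;> linarith
  have hm : Measurable fun y : Euc N => κ (‖x - y‖ ^ 2) :=
    hκm.comp (by fun_prop : Continuous fun y : Euc N => ‖x - y‖ ^ 2).measurable
  have hVc := hV.contDiff.continuous
  have hJ : IntegrableOn (fun y => inner ℝ (V x - V y) ν * κ (‖x - y‖ ^ 2)) Ωᶜ := by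
    have h1 : IntegrableOn (fun y => 2 * M * κ (‖x - y‖ ^ 2)) Ωᶜ := by
      refine (integrableOn_sub_left (f := fun z => κ (‖z‖ ^ 2)) hΩ.compl x
        (hint.mono_set fun z hz => ?_)).const_mul _
      have := hfar _ hz
      simpa using this
    refine Integrable.mono' h1 ?_ (Eventually.of_forall fun y => ?_)
    · exact ((by fun_prop : Continuous fun y => inner ℝ (V x - V y) ν).measurable.mul
        hm).aestronglyMeasurable
    · rw [norm_mul, Real.norm_eq_abs (κ _), abs_of_nonneg (hκ0 _ (by positivity))]
      gcongr
      · exact hκ0 _ (by positivity)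
      · refine (norm_inner_le_norm _ _).trans ?_
        rw [hν, mul_one]
        exact (_root_.norm_sub_le _ _).trans (by linarith [hV.norm_le x, hV.norm_le y])
  have hF : IntegrableOn (fun y => (1 + ‖x - y‖ ^ 2)⁻¹ * inner ℝ (B (x - y)) ν * κ (‖x - y‖ ^ 2)) H := by
    have h1 : IntegrableOn (fun y => M * κ (‖x - y‖ ^ 2)) H := by
      refine (integrableOn_sub_left (f := fun z => κ (‖z‖ ^ 2)) hHm x
        (hint.mono_set ?_)).const_mul _
      rw [hpre]
      intro z hz
      have h2 : inner ℝ ν z < -t := hz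
      have h3 := abs_real_inner_le_norm ν z
      rw [hν, one_mul] at h3
      have h4 := neg_le_abs (inner ℝ ν z)
      simp; linarith
    refine Integrable.mono' h1 ?_ (Eventually.of_forall fun y => ?_)
    · refine (Measurable.mul ?_ hm).aestronglyMeasurable
      have : Continuous fun y : Euc N => (1 + ‖x - y‖ ^ 2)⁻¹ * inner ℝ (B (x - y)) ν :=
        (Continuous.inv₀ (by fun_prop) fun y => by positivity).mul (by fun_prop)
      exact this.measurable
    · rw [norm_mul, Real.norm_eq_abs (κ _), abs_of_nonneg (hκ0 _ (by positivity))]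
      gcongr
      · exact hκ0 _ (by positivity)
      · rw [norm_mul, Real.norm_eq_abs, abs_of_pos (by positivity), inv_mul_le_iff₀ (by positivity)]
        refine (norm_inner_le_norm _ _).trans ?_
        rw [hν, mul_one]
        refine (B.le_opNorm _).trans ((mul_le_mul_of_nonneg_right hB (norm_nonneg _)).trans ?_)
        rw [mul_comm _ M]
        gcongr
        nlinarith [sq_nonneg (‖x - y‖ - 1)]
  have hzero : ∫ y in H, (1 + ‖x - y‖ ^ 2)⁻¹ * inner ℝ (B (x - y)) ν * κ (‖x - y‖ ^ 2) = 0 := by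
    rw [setIntegral_sub_left (fun z => (1 + ‖z‖ ^ 2)⁻¹ * inner ℝ (B z) ν * κ (‖z‖ ^ 2)) H hHm x, hpre]
    refine integral_halfSpace_eq_zero_of_odd measurableSet_Iio fun z => ?_
    rw [LinearIsometryEquiv.norm_map, reflection_span_singleton hν, map_sub, map_smul,
      inner_sub_left, inner_smul_left, hBν]
    simp
  have e : traceIntegrand Ω V B x₀ ν κ x =
      Ωᶜ.indicator (fun y => inner ℝ (V x - V y) ν * κ (‖x - y‖ ^ 2)) -
      H.indicator (fun y => (1 + ‖x - y‖ ^ 2)⁻¹ * inner ℝ (B (x - y)) ν * κ (‖x - y‖ ^ 2)) := rfl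
  rw [e, integral_sub' ((integrable_indicator_iff hΩ.compl).2 hJ) ((integrable_indicator_iff hHm).2 hF),
    integral_indicator hΩ.compl, integral_indicator hHm, hzero, sub_zero]

theorem measurable_traceIntegrand (hV : IsTameField V M) (hΩ : MeasurableSet Ω)
    (hκm : Measurable κ) (B : Euc N →L[ℝ] Euc N) (x₀ ν x : Euc N) :
    Measurable (traceIntegrand Ω V B x₀ ν κ x) := by
  have hHm : MeasurableSet {y : Euc N | 0 < inner ℝ ν (y - x₀)} :=
    (isOpen_lt continuous_const (by fun_prop)).measurableSet
  have hm : Measurable fun y : Euc N => κ (‖x - y‖ ^ 2) :=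
    hκm.comp (by fun_prop : Continuous fun y : Euc N => ‖x - y‖ ^ 2).measurable
  have hVc := hV.contDiff.continuous
  have h1 : Continuous fun y : Euc N => (1 + ‖x - y‖ ^ 2)⁻¹ * inner ℝ (B (x - y)) ν :=
    (Continuous.inv₀ (by fun_prop) fun y => by positivity).mul (by fun_prop)
  exact (((by fun_prop : Continuous fun y => inner ℝ (V x - V y) ν).measurable.mul hm).indicator
    hΩ.compl).sub ((h1.measurable.mul hm).indicator hHm)

theorem regProfile_le {q ε s : ℝ} (hq : 0 ≤ q) (hε : 0 < ε) (hs : 0 ≤ s) :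
    regProfile q ε s ≤ ε ^ (-(q / 2)) := by
  rw [regProfile]
  calc _ ≤ ε ^ (-(q / 2)) * 1 := by
        gcongr ?_ * ?_
        · exact Real.rpow_le_rpow_of_nonpos hε (by linarith) (by linarith)
        · exact inv_le_one_of_one_le₀ (by nlinarith)
    _ = _ := mul_one _

theorem regProfile_nonneg {q ε s : ℝ} (hε : 0 < ε) (hs : 0 ≤ s) : 0 ≤ regProfile q ε s := by
  rw [regProfile]; positivity

theorem integrable_regProfile {b ε : ℝ} (hb : 0 < b) (hε : 0 < ε) :
    Integrable fun z : Euc N => regProfile (N + b) ε (‖z‖ ^ 2) := by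
  have hκ := kernelProfile_reg (q := N + b) (by positivity) hε
  have hm : Measurable fun z : Euc N => regProfile (N + b) ε (‖z‖ ^ 2) :=
    hκ.measurable.comp (by fun_prop : Continuous fun y : Euc N => ‖y‖ ^ 2).measurable
  rw [← integrableOn_univ, ← union_compl_self (Metric.ball (0 : Euc N) 1)]
  refine IntegrableOn.union ?_ ?_
  · refine Integrable.mono' (integrableOn_const (C := ε ^ (-((N + b) / 2)))
      measure_ball_lt_top.ne) hm.aestronglyMeasurable (Eventually.of_forall fun z => ?_)
    rw [Real.norm_eq_abs, abs_of_nonneg (regProfile_nonneg hε (by positivity))]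
    exact regProfile_le (by positivity) hε (by positivity)
  · refine integrableOn_of_norm_rpow_bound hm.aestronglyMeasurable hb one_pos (C := 1) fun z hz => ?_
    have hz0 : 0 < ‖z‖ := norm_pos_iff.2 hz
    rw [abs_of_nonneg (regProfile_nonneg hε (by positivity)), one_mul]
    exact hκ.le _ hz0

/-- The normal trace exists, and is also the limit of regularized boundary values, which are
uniformly bounded. -/
theorem IsBoundedC11Domain.exists_trace (hΩ : IsBoundedC11Domain Ω) (hV : IsTameField V M) {b : ℝ}
    (hb : 0 < b) (hb2 : b < 2) : ∃ C t₀ : ℝ, 0 ≤ C ∧ 0 < t₀ ∧ ∀ x ∈ frontier Ω,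
      (∀ t, 0 < t → t ≤ t₀ → ∀ y ∉ Ω, t ≤ ‖x - t • outerNormal Ω x - y‖) ∧
      ((b < 1 ∨ normalDeriv Ω V x = 0) →
      (∀ ε, 0 < ε → |∫ y in Ωᶜ, inner ℝ (V x - V y) (outerNormal Ω x) *
        regProfile (N + b) ε (‖x - y‖ ^ 2)| ≤ C) ∧
      ∃ L : ℝ,
        Tendsto (fun t : ℝ => ∫ y in Ωᶜ, inner ℝ (V (x - t • outerNormal Ω x) - V y)
          (outerNormal Ω x) * (‖x - t • outerNormal Ω x - y‖ ^ 2) ^ (-((N + b) / 2)))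
          (𝓝[>] 0) (𝓝 L) ∧
        Tendsto (fun ε : ℝ => ∫ y in Ωᶜ, inner ℝ (V x - V y) (outerNormal Ω x) *
          regProfile (N + b) ε (‖x - y‖ ^ 2)) (𝓝[>] 0) (𝓝 L)) := by
  obtain ⟨K, hK, hnb⟩ := hΩ.exists_normal_bound
  obtain ⟨θ, hθ, hθ1, hcor⟩ := hV.exists_corrector hb hb2
  obtain ⟨C, hC, hG⟩ := exists_integral_traceBound_le (N := N) (θ := θ) hK hb hb2 hθ
  have hM := hV.nonneg
  have hq : (0 : ℝ) ≤ N + b := by positivity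
  -- The depth (4K)⁻¹ is the range of t in which the paraboloid condition keeps x - tν at distance
  -- at least t from the complement of Ω.
  refine ⟨4 * M * 2 ^ (N + b) * C, (4 * K)⁻¹, by positivity, by positivity, fun x hx => ?_⟩
  have hν := hΩ.norm_outerNormal hx
  have hnx := hnb x hx
  set ν := outerNormal Ω x
  have htK : ∀ t : ℝ, t ≤ (4 * K)⁻¹ → 4 * K * t ≤ 1 := fun t ht => by
    have : 4 * K * t ≤ 4 * K * (4 * K)⁻¹ := by gcongr
    rwa [mul_inv_cancel₀ (by positivity)] at this
  have hfar : ∀ t, 0 ≤ t → t ≤ (4 * K)⁻¹ → ∀ y ∉ Ω, t ≤ ‖x - t • ν - y‖ :=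
    fun t ht0 ht y hy => le_norm_sub_of_normal_bound hν ((hnx y).2 hy) ht0 (htK t ht)
  refine ⟨fun t ht0 ht => hfar t ht0.le ht, fun h0 => ?_⟩
  obtain ⟨B, hB, hBν, hBV⟩ := hcor x ν hν h0
  obtain ⟨hGi, hGC⟩ := hG ν hν
  have hGi' : Integrable fun y => 4 * M * 2 ^ (N + b) * traceBound K b θ ν (y - x) :=
    (hGi.comp_sub_right x).const_mul _
  have hne : ∀ᵐ y : Euc N, y ≠ x := by
    simp [ae_iff, measure_singleton]
  have hκ0 := kernelProfile_rpow hq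
  have hbound : ∀ κ κ', KernelProfile (N + b) κ κ' → ∀ t, 0 ≤ t → t ≤ (4 * K)⁻¹ → ∀ᵐ y,
      ‖traceIntegrand Ω V B x ν κ (x - t • ν) y‖ ≤
        4 * M * 2 ^ (N + b) * traceBound K b θ ν (y - x) := fun κ κ' hκ t ht0 ht => by
    filter_upwards [hne] with y hy
    exact abs_traceIntegrand_le hb hθ hθ1 hM hκ hν hnx hK hB hBV ht0 (htK t ht) hy
  have hreg : ∀ ε, 0 < ε → ∫ y, traceIntegrand Ω V B x ν (regProfile (N + b) ε) x y =
      ∫ y in Ωᶜ, inner ℝ (V x - V y) ν * regProfile (N + b) ε (‖x - y‖ ^ 2) := fun ε hε => by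
    have := integral_traceIntegrand hV hΩ.measurableSet (kernelProfile_reg hq hε).measurable
      (fun s hs => regProfile_nonneg hε hs) (x₀ := x) hν
      (hfar 0 le_rfl (by positivity)) (integrable_regProfile hb hε).integrableOn hB hBν
    simpa using this
  have hbound0 : ∀ ε, 0 < ε → ∀ᵐ y, ‖traceIntegrand Ω V B x ν (regProfile (N + b) ε) x y‖ ≤
      4 * M * 2 ^ (N + b) * traceBound K b θ ν (y - x) := fun ε hε => by
    have := hbound _ _ (kernelProfile_reg hq hε) 0 le_rfl (by positivity)
    simpa using this
  -- The common limit is the corrected integral with the singular kernel at the boundary point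
  -- itself, where the uncorrected one need not converge absolutely. Both limits follow by dominated
  -- convergence with the same majorant.
  refine ⟨fun ε hε => ?_, ∫ y, traceIntegrand Ω V B x ν (fun s => s ^ (-((N + b) / 2))) x y, ?_, ?_⟩
  · rw [← hreg ε hε, ← Real.norm_eq_abs]
    refine (norm_integral_le_of_norm_le hGi' (hbound0 ε hε)).trans ?_
    rw [integral_const_mul, integral_sub_right_eq_self (traceBound K b θ ν)]
    gcongr
  · have h1 : Tendsto (fun t : ℝ => ∫ y, traceIntegrand Ω V B x ν (fun s => s ^ (-((N + b) / 2)))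
        (x - t • ν) y) (𝓝[>] 0)
        (𝓝 (∫ y, traceIntegrand Ω V B x ν (fun s => s ^ (-((N + b) / 2))) x y)) := by
      refine tendsto_integral_filter_of_dominated_convergence _ (Eventually.of_forall fun t =>
        (measurable_traceIntegrand hV hΩ.measurableSet hκ0.measurable _ _ _ _).aestronglyMeasurable)
        ?_ hGi' ?_
      · filter_upwards [Ioc_mem_nhdsGT (show (0 : ℝ) < (4 * K)⁻¹ by positivity)] with t ht
        exact hbound _ _ hκ0 t ht.1.le ht.2
      · filter_upwards [hne] with y hy
        have hxt : Tendsto (fun t : ℝ => x - t • ν) (𝓝[>] 0) (𝓝 x) := by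
          have : Tendsto (fun t : ℝ => x - t • ν) (𝓝 0) (𝓝 (x - (0 : ℝ) • ν)) :=
            Continuous.tendsto (by fun_prop) 0
          rw [zero_smul, sub_zero] at this
          exact this.mono_left nhdsWithin_le_nhds
        have hn : Tendsto (fun t : ℝ => ‖x - t • ν - y‖ ^ 2) (𝓝[>] 0) (𝓝 (‖x - y‖ ^ 2)) :=
          ((hxt.sub_const y).norm).pow 2
        have hnp : ‖x - y‖ ^ 2 ≠ 0 := by
          have := sub_ne_zero.2 hy.symm
          positivity
        have hk : Tendsto (fun t : ℝ => (‖x - t • ν - y‖ ^ 2) ^ (-((N + b) / 2))) (𝓝[>] 0)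
            (𝓝 ((‖x - y‖ ^ 2) ^ (-((N + b) / 2)))) :=
          (Real.continuousAt_rpow_const _ _ (Or.inl hnp)).tendsto.comp hn
        have hVt : Tendsto (fun t : ℝ => V (x - t • ν)) (𝓝[>] 0) (𝓝 (V x)) :=
          (hV.contDiff.continuous.tendsto x).comp hxt
        have hBt : Tendsto (fun t : ℝ => B (x - t • ν - y)) (𝓝[>] 0) (𝓝 (B (x - y))) :=
          (B.continuous.tendsto _).comp (hxt.sub_const y)
        unfold traceIntegrand
        refine Tendsto.sub ?_ ?_
        · by_cases hy1 : y ∈ Ωᶜ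
          · simp only [indicator_of_mem hy1]
            exact ((hVt.sub_const _).inner tendsto_const_nhds).mul hk
          · simp only [indicator_of_notMem hy1]
            exact tendsto_const_nhds
        · by_cases hy1 : y ∈ {y | 0 < inner ℝ ν (y - x)}
          · simp only [indicator_of_mem hy1]
            exact (((hn.const_add 1).inv₀
              (by positivity : (0 : ℝ) < 1 + ‖x - y‖ ^ 2).ne').mul (hBt.inner tendsto_const_nhds)).mul hk
          · simp only [indicator_of_notMem hy1]
            exact tendsto_const_nhds
    refine h1.congr' ?_
    filter_upwards [Ioc_mem_nhdsGT (show (0 : ℝ) < (4 * K)⁻¹ by positivity)] with t ht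
    refine integral_traceIntegrand hV hΩ.measurableSet hκ0.measurable
      (fun s hs => Real.rpow_nonneg hs _) hν (hfar t ht.1.le ht.2) ?_ hB hBν
    refine integrableOn_of_norm_rpow_bound (hκ0.measurable.comp
      (by fun_prop : Continuous fun y : Euc N => ‖y‖ ^ 2).measurable).aestronglyMeasurable hb ht.1
      (C := 1) fun z hz => ?_
    rw [one_mul]
    exact (abs_of_nonneg (Real.rpow_nonneg (sq_nonneg ‖z‖) _)).trans_le
      (hκ0.le _ (norm_pos_iff.2 hz))
  · have h1 : Tendsto (fun ε : ℝ => ∫ y, traceIntegrand Ω V B x ν (regProfile (N + b) ε) x y) (𝓝[>] 0)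
        (𝓝 (∫ y, traceIntegrand Ω V B x ν (fun s => s ^ (-((N + b) / 2))) x y)) := by
      refine tendsto_integral_filter_of_dominated_convergence _ ?_ ?_ hGi' ?_
      · filter_upwards [self_mem_nhdsWithin] with ε hε
        exact (measurable_traceIntegrand hV hΩ.measurableSet
          (kernelProfile_reg hq hε).measurable _ _ _ _).aestronglyMeasurable
      · filter_upwards [self_mem_nhdsWithin] with ε hε
        exact hbound0 ε hε
      · filter_upwards [hne] with y hy
        have hnp : 0 < ‖x - y‖ ^ 2 := by
          have := norm_pos_iff.2 (sub_ne_zero.2 hy.symm)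
          positivity
        have hk := tendsto_regProfile (q := N + b) hnp
        unfold traceIntegrand
        refine Tendsto.sub ?_ ?_
        · by_cases hy1 : y ∈ Ωᶜ
          · simp only [indicator_of_mem hy1]
            exact hk.const_mul _
          · simp only [indicator_of_notMem hy1]
            exact tendsto_const_nhds
        · by_cases hy1 : y ∈ {y | 0 < inner ℝ ν (y - x)}
          · simp only [indicator_of_mem hy1]
            exact hk.const_mul _
          · simp only [indicator_of_notMem hy1]
            exact tendsto_const_nhds
    refine h1.congr' ?_
    filter_upwards [self_mem_nhdsWithin] with ε hε
    exact hreg ε hε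

end Trace

end HigherNeumann

namespace HigherNeumann

/-! ### Decay of the regularized kernels for fixed ε. -/

section Decay

variable {N : ℕ} [NeZero N] {Ω : Set (Euc N)} {V : Euc N → Euc N} {M : ℝ} {κ κ' : ℝ → ℝ}

/-- A smooth radial kernel which decays, with its gradient, like `(1 + ‖z‖) ^ (-a)`. -/
structure DecayingProfile (N : ℕ) (a C : ℝ) (κ κ' : ℝ → ℝ) : Prop where
  hasDerivAt : ∀ s, 0 ≤ s → HasDerivAt κ (κ' s) s
  contDiff : ContDiff ℝ 1 fun z : Euc N => κ (‖z‖ ^ 2)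
  measurable : Measurable κ
  measurable' : Measurable κ'
  le : ∀ r, 0 ≤ r → |κ (r ^ 2)| ≤ C * (1 + r) ^ (-a)
  deriv_le : ∀ r, 0 ≤ r → |κ' (r ^ 2)| * r ≤ C * (1 + r) ^ (-a)

/-- Both r² + ε and 1 + εr² are at least m(1 + r)² with m = min(ε, 1)/2, which gives decay of order
q + 2. The constant degenerates as ε → 0, which is harmless: it only justifies Green's formula at
fixed ε. -/
theorem exists_decayingProfile_reg {q ε : ℝ} (hq : 0 ≤ q) (hε : 0 < ε) :
    ∃ C : ℝ, 0 ≤ C ∧ DecayingProfile N (q + 2) C (regProfile q ε) (regProfileDeriv q ε) := by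
  set m := min ε 1 / 2 with hm
  have hm0 : 0 < m := by positivity
  have hmε : 2 * m ≤ ε := by rw [hm]; linarith [min_le_left ε 1]
  have hm1 : 2 * m ≤ 1 := by rw [hm]; linarith [min_le_right ε 1]
  have h1 : ∀ r : ℝ, m * (1 + r) ^ 2 ≤ r ^ 2 + ε := fun r => by
    nlinarith [mul_nonneg hm0.le (sq_nonneg (1 - r)), sq_nonneg r,
      mul_nonneg (sub_nonneg.2 hm1) (sq_nonneg r)]
  have h2 : ∀ r : ℝ, m * (1 + r) ^ 2 ≤ 1 + ε * r ^ 2 := fun r => by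
    nlinarith [mul_nonneg hm0.le (sq_nonneg (1 - r)), sq_nonneg r,
      mul_nonneg (sub_nonneg.2 hmε) (sq_nonneg r)]
  set C₁ : ℝ := m ^ (-(q / 2)) * m⁻¹ with hC₁
  have hle : ∀ r : ℝ, 0 ≤ r → regProfile q ε (r ^ 2) ≤ C₁ * (1 + r) ^ (-(q + 2)) := fun r hr => by
    have hp : 0 < m * (1 + r) ^ 2 := by positivity
    rw [regProfile]
    calc (r ^ 2 + ε) ^ (-(q / 2)) * (1 + ε * r ^ 2)⁻¹
        ≤ (m * (1 + r) ^ 2) ^ (-(q / 2)) * (m * (1 + r) ^ 2)⁻¹ := by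
          gcongr ?_ * ?_
          · exact Real.rpow_le_rpow_of_nonpos hp (h1 r) (by linarith)
          · exact inv_anti₀ hp (h2 r)
      _ = C₁ * ((1 + r) ^ (-q) * ((1 + r) ^ 2)⁻¹) := by
          rw [Real.mul_rpow hm0.le (by positivity), sq_rpow_neg_half (by positivity), mul_inv]
          ring
      _ = _ := by
          rw [← Real.rpow_natCast, ← Real.rpow_neg (by positivity), ← Real.rpow_add (by positivity)]
          congr 2; push_cast; ring
  set C₂ : ℝ := q / 2 * (ε⁻¹ + 1) + (1 + ε) with hC₂
  have hC₂1 : 1 ≤ C₂ := by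
    have : 0 ≤ q / 2 * (ε⁻¹ + 1) := by positivity
    linarith
  refine ⟨C₂ * C₁, by positivity, fun s hs => hasDerivAt_regProfile hε hs, ?_,
    (kernelProfile_reg hq hε).measurable, (kernelProfile_reg hq hε).measurable', fun r hr => ?_,
    fun r hr => ?_⟩
  · unfold regProfile
    have hn : ContDiff ℝ 1 fun z : Euc N => ‖z‖ ^ 2 := contDiff_norm_sq ℝ
    exact ((hn.add contDiff_const).rpow_const_of_ne fun z => by positivity).mul
      ((contDiff_const.add (contDiff_const.mul hn)).inv fun z => by positivity)
  · rw [abs_of_nonneg (regProfile_nonneg hε (by positivity)), mul_assoc]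
    exact (hle r hr).trans (le_mul_of_one_le_left (by positivity) hC₂1)
  · have hκ0 := regProfile_nonneg (q := q) hε (sq_nonneg r)
    have h3 : (q / 2 * (r ^ 2 + ε)⁻¹ + ε * (1 + ε * r ^ 2)⁻¹) * r ≤ C₂ := by
      have e1 : (r ^ 2 + ε)⁻¹ * r ≤ ε⁻¹ + 1 := by
        rw [inv_mul_le_iff₀ (by positivity)]
        have : (r ^ 2 + ε) * (ε⁻¹ + 1) = r ^ 2 * ε⁻¹ + 1 + r ^ 2 + ε := by field_simp; ring
        rw [this]
        have : 0 ≤ r ^ 2 * ε⁻¹ := by positivity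
        nlinarith [sq_nonneg (r - 1)]
      have e2 : ε * (1 + ε * r ^ 2)⁻¹ * r ≤ 1 + ε := by
        rw [mul_right_comm, ← div_eq_mul_inv, div_le_iff₀ (by positivity)]
        nlinarith [mul_nonneg hε.le (sq_nonneg (r - 1)), mul_nonneg hε.le (sq_nonneg r),
          mul_nonneg (mul_nonneg hε.le hε.le) (sq_nonneg r)]
      calc _ = q / 2 * ((r ^ 2 + ε)⁻¹ * r) + ε * (1 + ε * r ^ 2)⁻¹ * r := by ring
        _ ≤ q / 2 * (ε⁻¹ + 1) + (1 + ε) := by gcongr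
    rw [regProfileDeriv, abs_mul, abs_neg, abs_of_nonneg hκ0, abs_of_nonneg (by positivity)]
    calc _ = ((q / 2 * (r ^ 2 + ε)⁻¹ + ε * (1 + ε * r ^ 2)⁻¹) * r) * regProfile q ε (r ^ 2) := by ring
      _ ≤ C₂ * (C₁ * (1 + r) ^ (-(q + 2))) := by
          gcongr
          exact hle r hr
      _ = _ := by ring

variable {a C : ℝ}

theorem DecayingProfile.norm_kernelFDeriv_le (hκ : DecayingProfile N a C κ κ') (hC : 0 ≤ C)
    (hV : IsTameField V M) (x y : Euc N) :
    ‖kernelFDeriv κ κ' V x y‖ ≤ 5 * M * C * (1 + ‖x - y‖) ^ (-a) := by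
  have hM := hV.nonneg
  rw [kernelFDeriv]
  refine (norm_add_le _ _).trans ?_
  rw [norm_smul, norm_smul, ContinuousLinearMap.norm_smulRight_apply, innerSL_apply_norm,
    Real.norm_eq_abs, Real.norm_eq_abs, abs_mul, abs_two]
  have h1 := hκ.le ‖x - y‖ (norm_nonneg _)
  have h2 := hκ.deriv_le ‖x - y‖ (norm_nonneg _)
  have h3 := hV.norm_fderiv_le x
  have h4 : ‖V x - V y‖ ≤ 2 * M :=
    (_root_.norm_sub_le _ _).trans (by linarith [hV.norm_le x, hV.norm_le y])
  calc _ = |κ (‖x - y‖ ^ 2)| * ‖fderiv ℝ V x‖ + 2 * (|κ' (‖x - y‖ ^ 2)| * ‖x - y‖) * ‖V x - V y‖ := by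
        ring
    _ ≤ C * (1 + ‖x - y‖) ^ (-a) * M + 2 * (C * (1 + ‖x - y‖) ^ (-a)) * (2 * M) := by gcongr
    _ = _ := by ring

theorem DecayingProfile.abs_diffDiv_le (hκ : DecayingProfile N a C κ κ') (hC : 0 ≤ C)
    (hV : IsTameField V M) (x y : Euc N) :
    |diffDiv κ κ' V x y| ≤ N * (5 * M * C) * (1 + ‖x - y‖) ^ (-a) := by
  rw [← coordTrace_kernelFDeriv, mul_assoc]
  exact (abs_coordTrace_le _).trans (by gcongr; exact hκ.norm_kernelFDeriv_le hC hV x y)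

theorem DecayingProfile.measurable_diffDiv (hκ : DecayingProfile N a C κ κ') (hV : IsTameField V M) :
    Measurable fun a : Euc N × Euc N => diffDiv κ κ' V a.1 a.2 := by
  have h1 := hκ.measurable
  have h2 := hκ.measurable'
  have h0 : Continuous (divergence V) := continuous_divergence (hV.contDiff.of_le (by norm_num))
  have hc := hV.contDiff.continuous
  have h3 : Continuous fun a : Euc N × Euc N => inner ℝ (V a.1 - V a.2) (a.1 - a.2) := by fun_prop
  have h3 := h3.measurable
  have h4 : Measurable fun a : Euc N × Euc N => ‖a.1 - a.2‖ ^ 2 :=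
    (by fun_prop : Continuous fun a : Euc N × Euc N => ‖a.1 - a.2‖ ^ 2).measurable
  have h5 : Measurable fun a : Euc N × Euc N => divergence V a.1 :=
    (h0.comp continuous_fst).measurable
  unfold diffDiv
  exact (h5.mul (h1.comp h4)).add (((h2.comp h4).const_mul 2).mul h3)

/-- The divergence of a decaying vector field on the whole space has integral zero. -/
theorem integral_divergence_eq_zero {F : Euc N → Euc N} (hF : ContDiff ℝ 1 F) {k : ℝ} (y : Euc N)
    (ha : N < a) (h0 : ∀ x, ‖F x‖ ≤ k * (1 + ‖x - y‖) ^ (-a))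
    (h1 : ∀ x, ‖fderiv ℝ F x‖ ≤ k * (1 + ‖x - y‖) ^ (-a)) : ∫ x, divergence F x = 0 := by
  have hcd : Continuous (fderiv ℝ F) := hF.continuous_fderiv (by norm_num)
  have hi : Integrable fun x : Euc N => k * (1 + ‖x - y‖) ^ (-a) :=
    ((integrable_one_add_norm (E := Euc N) (r := a) (by simpa using ha)).comp_sub_right y).const_mul k
  have hpt : ∀ (i : Fin N) x, ‖(fderiv ℝ F x (EuclideanSpace.single i 1)) i‖ ≤ ‖fderiv ℝ F x‖ :=
    fun i x => by
      have h2 := (fderiv ℝ F x).le_opNorm (EuclideanSpace.single i 1)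
      rw [PiLp.norm_single, norm_one, mul_one] at h2
      exact (PiLp.norm_apply_le _ i).trans h2
  have hii : ∀ i : Fin N, Integrable fun x => (fderiv ℝ F x (EuclideanSpace.single i 1)) i :=
    fun i => Integrable.mono' hi
      (by fun_prop : Continuous fun x => (fderiv ℝ F x (EuclideanSpace.single i 1)) i).aestronglyMeasurable
      (Eventually.of_forall fun x => (hpt i x).trans (h1 x))
  unfold divergence
  rw [integral_finsetSum _ fun i _ => hii i]
  refine Finset.sum_eq_zero fun i _ => ?_
  have he : ‖(EuclideanSpace.single i 1 : Euc N)‖ = 1 := by rw [PiLp.norm_single, norm_one]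
  have hlim : ∀ (x : Euc N) (l : Filter ℝ), Tendsto (fun s : ℝ => |s|) l atTop →
      Tendsto (fun s : ℝ => F (x + s • EuclideanSpace.single i 1) i) l (𝓝 0) := fun x l hl => by
    have hN : (0 : ℝ) ≤ N := Nat.cast_nonneg _
    have h3 : Tendsto (fun s : ℝ => 1 + ‖x + s • (EuclideanSpace.single i 1 : Euc N) - y‖) l atTop := by
      refine tendsto_atTop_mono (fun s => ?_) (tendsto_atTop_add_const_right _ (-‖x - y‖) hl)
      have := norm_sub_norm_le (s • (EuclideanSpace.single i 1 : Euc N)) (-(x - y))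
      rw [norm_smul, he, mul_one, Real.norm_eq_abs, norm_neg, sub_neg_eq_add,
        show s • (EuclideanSpace.single i 1 : Euc N) + (x - y) =
          x + s • (EuclideanSpace.single i 1 : Euc N) - y by abel] at this
      linarith
    have h4 := ((tendsto_rpow_neg_atTop (y := a) (by linarith)).comp h3).const_mul k
    rw [mul_zero] at h4
    exact squeeze_zero_norm (fun s => (PiLp.norm_apply_le _ i).trans (h0 _)) h4
  refine integral_lineDeriv_eq_zero (f := fun x => F x i) (EuclideanSpace.single i 1) he (hii i)
    (fun x t => ?_) (fun x => hlim x _ tendsto_abs_atBot_atTop)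
    (fun x => hlim x _ tendsto_abs_atTop_atTop)
  have h3 : HasDerivAt (fun s : ℝ => x + s • (EuclideanSpace.single i 1 : Euc N))
      (EuclideanSpace.single i 1) t := by
    simpa using ((hasDerivAt_id t).smul_const (EuclideanSpace.single i 1 : Euc N)).const_add x
  have h4 := ((hF.differentiable (by norm_num) _).hasFDerivAt.comp_hasDerivAt t h3)
  have h5 := (EuclideanSpace.proj i : Euc N →L[ℝ] ℝ).hasFDerivAt.comp_hasDerivAt t h4
  exact h5

end Decay

end HigherNeumann

namespace HigherNeumann

/-! ### Green's formula for regularized kernels. -/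

section Green

variable {N : ℕ} [NeZero N] {Ω : Set (Euc N)} {V : Euc N → Euc N} {M : ℝ} {κ κ' : ℝ → ℝ}
  {p : Euc N → ℝ} {c₀ : ℝ} {c : Euc N} {a C : ℝ}

/-- A convolution kernel that is integrable on ℝ^N is integrable on a product in which one factor is
finite and the other is dominated by volume. This covers both the volume and the surface double
integrals. -/
theorem integrable_prod_of_le_left {μ ν : Measure (Euc N)} [IsFiniteMeasure μ] [SFinite ν]
    (hν : ν ≤ volume) (ha : N < a) {k : ℝ} {T : Euc N × Euc N → ℝ}
    (hT : AEStronglyMeasurable T (μ.prod ν))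
    (hb : ∀ᵐ z ∂(μ.prod ν), |T z| ≤ k * (1 + ‖z.1 - z.2‖) ^ (-a)) : Integrable T (μ.prod ν) := by
  have hh : Integrable fun z : Euc N => k * (1 + ‖z‖) ^ (-a) :=
    (integrable_one_add_norm (by simpa using ha)).const_mul k
  have hx : ∀ x : Euc N, Integrable (fun y => k * (1 + ‖x - y‖) ^ (-a)) volume :=
    fun x => hh.comp_sub_left x
  have hc : Continuous fun z : Euc N × Euc N => k * (1 + ‖z.1 - z.2‖) ^ (-a) :=
    continuous_const.mul ((by fun_prop : Continuous fun z : Euc N × Euc N => 1 + ‖z.1 - z.2‖).rpow_const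
      fun z => Or.inl (by positivity))
  have hH : Integrable (fun z : Euc N × Euc N => k * (1 + ‖z.1 - z.2‖) ^ (-a)) (μ.prod ν) := by
    rw [integrable_prod_iff hc.aestronglyMeasurable]
    refine ⟨Eventually.of_forall fun x => (hx x).mono_measure hν, ?_⟩
    refine Integrable.mono' (integrable_const (∫ z : Euc N, ‖k * (1 + ‖z‖) ^ (-a)‖))
      hc.aestronglyMeasurable.norm.integral_prod_right' (Eventually.of_forall fun x => ?_)
    rw [Real.norm_eq_abs, abs_of_nonneg (integral_nonneg fun _ => norm_nonneg _)]
    refine (integral_mono_measure hν (Eventually.of_forall fun _ => norm_nonneg _) (hx x).norm).trans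
      (le_of_eq ?_)
    exact integral_sub_left_eq_self (fun z : Euc N => ‖k * (1 + ‖z‖) ^ (-a)‖) volume x
  exact Integrable.mono' hH hT hb

theorem integrable_prod_of_le_right {μ ν : Measure (Euc N)} [SFinite μ] [IsFiniteMeasure ν]
    (hμ : μ ≤ volume) (ha : N < a) {k : ℝ} {T : Euc N × Euc N → ℝ}
    (hT : AEStronglyMeasurable T (μ.prod ν))
    (hb : ∀ᵐ z ∂(μ.prod ν), |T z| ≤ k * (1 + ‖z.1 - z.2‖) ^ (-a)) : Integrable T (μ.prod ν) := by
  rw [← integrable_swap_iff]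
  refine integrable_prod_of_le_left hμ ha hT.prod_swap (k := k) ?_
  have := Measure.measurePreserving_swap (μ := ν) (ν := μ) |>.quasiMeasurePreserving.ae hb
  filter_upwards [this] with z hz
  rw [norm_sub_rev]
  exact hz

/-- The divergence of `x ↦ p x κ (‖x - y‖²) (V x - V y)`. -/
theorem divergence_mul_kernel (hV : IsTameField V M) (hp : ∀ x, p x = c₀ + inner ℝ c x)
    (hκ : DecayingProfile N a C κ κ') (x y : Euc N) :
    divergence (fun x => p x • (κ (‖x - y‖ ^ 2) • (V x - V y))) x =
      p x * diffDiv κ κ' V x y + κ (‖x - y‖ ^ 2) * inner ℝ c (V x - V y) := by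
  have h1 := hasFDerivAt_kernel (x := x) (y := y) (κ' := κ')
    (hV.contDiff.differentiable (by norm_num)) (hκ.hasDerivAt _ (by positivity))
  have hpd : HasFDerivAt p (innerSL ℝ c) x := by
    have e : p = fun x => c₀ + innerSL ℝ c x := funext fun x => by rw [hp]; rfl
    rw [e]
    exact (innerSL ℝ c).hasFDerivAt.const_add c₀
  rw [divergence_smul hpd.differentiableAt h1.differentiableAt, divergence_eq_coordTrace, h1.fderiv,
    coordTrace_kernelFDeriv, hpd.fderiv]
  simp

set_option maxHeartbeats 800000 in
/-- Green's formula for the regularized operators. -/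
theorem IsBoundedC11Domain.integral_mul_diffDiv (hΩ : IsBoundedC11Domain Ω) (hV : IsTameField V M)
    (hp : ∀ x, p x = c₀ + inner ℝ c x) (hκ : DecayingProfile N a C κ κ') (hC : 0 ≤ C)
    (ha : N + 1 < a) :
    (∫ x in Ω, p x * ∫ y, diffDiv κ κ' V x y) + ∫ x in Ωᶜ, p x * ∫ y in Ω, diffDiv κ κ' V x y =
      ∫ x, p x * (∫ y in Ωᶜ, inner ℝ (V x - V y) (outerNormal Ω x) * κ (‖x - y‖ ^ 2))
        ∂(surfaceMeasure Ω) := by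
  have hfin := hΩ.isFiniteMeasure_surfaceMeasure
  have hfin' : IsFiniteMeasure (volume.restrict Ω) := ⟨by simpa using hΩ.isBounded.measure_lt_top⟩
  have hM := hV.nonneg
  have hΩm := hΩ.measurableSet
  obtain ⟨R, hR0, hR⟩ := hΩ.isBounded.subset_closedBall_lt 0 0
  have hcl : closure Ω ⊆ Metric.closedBall 0 R := closure_minimal hR Metric.isClosed_closedBall
  set P : ℝ := |c₀| + ‖c‖ * (R + 1) with hP
  have hP0 : 0 ≤ P := by positivity
  have hpb : ∀ x y, x ∈ closure Ω ∨ y ∈ closure Ω → |p x| ≤ P * (1 + ‖x - y‖) := by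
    intro x y h
    have hx : ‖x‖ ≤ R + ‖x - y‖ := by
      rcases h with h | h
      · have : ‖x‖ ≤ R := by simpa using hcl h
        linarith [norm_nonneg (x - y)]
      · have : ‖y‖ ≤ R := by simpa using hcl h
        linarith [norm_le_norm_add_norm_sub' x y]
    rw [hp]
    have h3 := (abs_add_le c₀ (inner ℝ c x)).trans
      (add_le_add_right (abs_real_inner_le_norm c x) _)
    have h4 : ‖c‖ * ‖x‖ ≤ ‖c‖ * (R + ‖x - y‖) := by gcongr
    have h5 : 0 ≤ (|c₀| + ‖c‖ * R) * ‖x - y‖ := by positivity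
    rw [hP]
    linarith [h5, norm_nonneg c]
  have hpow : ∀ r : ℝ, 0 ≤ r → (1 + r) * (1 + r) ^ (-a) = (1 + r) ^ (-(a - 1)) := fun r hr => by
    have : (0 : ℝ) < 1 + r := by positivity
    conv_lhs => rw [← Real.rpow_one (1 + r), ← Real.rpow_mul this.le, one_mul, ← Real.rpow_add this]
    congr 1; ring
  have hpow1 : ∀ r : ℝ, 0 ≤ r → (1 + r) ^ (-a) ≤ (1 + r) ^ (-(a - 1)) := fun r hr =>
    Real.rpow_le_rpow_of_exponent_le (by linarith) (by linarith)
  -- One power of decay is spent on the growth of p, which is at most P(1 + ‖x - y‖) as soon as x or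
  -- y lies in the closure of Ω.
  have ha1 : (N : ℝ) < a - 1 := by linarith
  have hpc : Continuous p := by
    have : p = fun x => c₀ + inner ℝ c x := funext hp
    rw [this]; fun_prop
  have hVc := hV.contDiff.continuous
  -- T + Q is the divergence in x of p κ (V x - V y). T is what the formula is about; Q comes from
  -- the constant gradient of p and is antisymmetric in (x, y).
  set T : Euc N → Euc N → ℝ := fun x y => p x * diffDiv κ κ' V x y with hT
  set Q : Euc N → Euc N → ℝ := fun x y => κ (‖x - y‖ ^ 2) * inner ℝ c (V x - V y) with hQ
  have hκc : Continuous fun z : Euc N × Euc N => κ (‖z.1 - z.2‖ ^ 2) :=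
    hκ.contDiff.continuous.comp (by fun_prop : Continuous fun z : Euc N × Euc N => z.1 - z.2)
  have hTm : Measurable (Function.uncurry T) :=
    (hpc.comp continuous_fst).measurable.mul (hκ.measurable_diffDiv hV)
  have hQm : Measurable (Function.uncurry Q) := by
    have : Continuous (Function.uncurry Q) := by
      exact hκc.mul (continuous_const.inner
        (by fun_prop : Continuous fun z : Euc N × Euc N => V z.1 - V z.2))
    exact this.measurable
  have hTb : ∀ x y, x ∈ closure Ω ∨ y ∈ closure Ω →
      |T x y| ≤ P * (N * (5 * M * C)) * (1 + ‖x - y‖) ^ (-(a - 1)) := fun x y h => by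
    rw [hT, abs_mul, ← hpow _ (norm_nonneg _)]
    calc _ ≤ (P * (1 + ‖x - y‖)) * (N * (5 * M * C) * (1 + ‖x - y‖) ^ (-a)) :=
          mul_le_mul (hpb x y h) (hκ.abs_diffDiv_le hC hV x y) (abs_nonneg _) (by positivity)
      _ = _ := by ring
  have hQb : ∀ x y, |Q x y| ≤ C * (‖c‖ * (2 * M)) * (1 + ‖x - y‖) ^ (-(a - 1)) := fun x y => by
    rw [hQ, abs_mul]
    have h2 : ‖V x - V y‖ ≤ 2 * M :=
      (_root_.norm_sub_le _ _).trans (by linarith [hV.norm_le x, hV.norm_le y])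
    calc _ ≤ (C * (1 + ‖x - y‖) ^ (-(a - 1))) * (‖c‖ * (2 * M)) := by
          gcongr
          · exact (hκ.le _ (norm_nonneg _)).trans
              (mul_le_mul_of_nonneg_left (hpow1 _ (norm_nonneg _)) hC)
          · exact (abs_real_inner_le_norm _ _).trans (by gcongr)
      _ = _ := by ring
  have hsub := subset_closure (s := Ω)
  have hmemΩ : ∀ᵐ x ∂(volume.restrict Ω), x ∈ closure Ω :=
    (ae_restrict_mem hΩm).mono fun x hx => hsub hx
  have hle : ∀ B : Set (Euc N), volume.restrict B ≤ (volume : Measure (Euc N)) :=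
    fun B => Measure.restrict_le_self
  have iTl : ∀ B : Set (Euc N), Integrable (Function.uncurry T)
      ((volume.restrict Ω).prod (volume.restrict B)) := fun B => by
    refine integrable_prod_of_le_left (k := P * (N * (5 * M * C))) (hle B) ha1
      hTm.aestronglyMeasurable ?_
    filter_upwards [Measure.quasiMeasurePreserving_fst.ae hmemΩ] with z hz
    exact hTb _ _ (Or.inl hz)
  have iQl : ∀ B : Set (Euc N), Integrable (Function.uncurry Q)
      ((volume.restrict Ω).prod (volume.restrict B)) := fun B =>
    integrable_prod_of_le_left (hle B) ha1 hQm.aestronglyMeasurable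
      (Eventually.of_forall fun z => hQb _ _)
  have iTr : ∀ B : Set (Euc N), Integrable (Function.uncurry T)
      ((volume.restrict B).prod (volume.restrict Ω)) := fun B => by
    refine integrable_prod_of_le_right (k := P * (N * (5 * M * C))) (hle B) ha1
      hTm.aestronglyMeasurable ?_
    filter_upwards [Measure.quasiMeasurePreserving_snd.ae hmemΩ] with z hz
    exact hTb _ _ (Or.inr hz)
  have iQr : ∀ B : Set (Euc N), Integrable (Function.uncurry Q)
      ((volume.restrict B).prod (volume.restrict Ω)) := fun B =>
    integrable_prod_of_le_right (hle B) ha1 hQm.aestronglyMeasurable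
      (Eventually.of_forall fun z => hQb _ _)
  have hQanti : ∀ x y, Q x y = -Q y x := fun x y => by
    simp only [hQ]
    rw [norm_sub_rev, ← neg_sub (V y), inner_neg_right]; ring
  have hFsmooth : ∀ y, ContDiff ℝ 1 fun x => p x • (κ (‖x - y‖ ^ 2) • (V x - V y)) := fun y => by
    have h1 : ContDiff ℝ 1 p := by
      have : p = fun x => c₀ + inner ℝ c x := funext hp
      rw [this]
      exact contDiff_const.add (contDiff_const.inner ℝ contDiff_id)
    have h2 : ContDiff ℝ 1 fun x : Euc N => κ (‖x - y‖ ^ 2) :=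
      hκ.contDiff.comp (contDiff_id.sub contDiff_const)
    exact h1.smul (h2.smul ((hV.contDiff.of_le (by norm_num)).sub contDiff_const))
  have hdiv : ∀ x y, divergence (fun x => p x • (κ (‖x - y‖ ^ 2) • (V x - V y))) x = T x y + Q x y :=
    fun x y => divergence_mul_kernel hV hp hκ x y
  -- the contribution of the exterior
  have S1 : (∫ x in Ω, ∫ y in Ωᶜ, T x y) + (∫ x in Ω, ∫ y in Ωᶜ, Q x y) =
      ∫ x, p x * (∫ y in Ωᶜ, inner ℝ (V x - V y) (outerNormal Ω x) * κ (‖x - y‖ ^ 2))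
        ∂(surfaceMeasure Ω) := by
    have e0 : (∫ x in Ω, ∫ y in Ωᶜ, T x y) + (∫ x in Ω, ∫ y in Ωᶜ, Q x y) =
        ∫ y in Ωᶜ, ∫ x in Ω, (T x y + Q x y) :=
      (integral_integral_add (iTl Ωᶜ) (iQl Ωᶜ)).symm.trans
        (integral_integral_swap (f := fun x y => T x y + Q x y) ((iTl Ωᶜ).add (iQl Ωᶜ)))
    rw [e0]
    have e1 : ∀ y, ∫ x in Ω, (T x y + Q x y) = ∫ x, inner ℝ
        (p x • (κ (‖x - y‖ ^ 2) • (V x - V y))) (outerNormal Ω x) ∂(surfaceMeasure Ω) := fun y => by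
      rw [← hΩ.integral_divergence (hFsmooth y)]
      simp only [hdiv]
    simp only [e1]
    rw [integral_integral_swap]
    · congr 1 with x
      rw [← integral_const_mul]
      congr 1 with y
      rw [real_inner_smul_left, real_inner_smul_left]
      ring
    · refine integrable_prod_of_le_right (hle _) ha1 (k := P * C * (2 * M)) ?_ ?_
      · have h1 : Continuous fun z : Euc N × Euc N => p z.2 • (κ (‖z.2 - z.1‖ ^ 2) • (V z.2 - V z.1)) := by
          have : Continuous fun z : Euc N × Euc N => κ (‖z.2 - z.1‖ ^ 2) :=
            hκ.contDiff.continuous.comp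
              (by fun_prop : Continuous fun z : Euc N × Euc N => z.2 - z.1)
          exact (hpc.comp continuous_snd).smul (this.smul (by fun_prop))
        exact h1.aestronglyMeasurable.inner hΩ.aestronglyMeasurable_outerNormal.comp_snd
      · filter_upwards [Measure.quasiMeasurePreserving_snd.ae (ae_mem_frontier Ω)] with z hz
        have h2 : ‖V z.2 - V z.1‖ ≤ 2 * M :=
          (_root_.norm_sub_le _ _).trans (by linarith [hV.norm_le z.2, hV.norm_le z.1])
        have h3 := hpb z.2 z.1 (Or.inl (frontier_subset_closure hz))
        have h4 := hκ.le ‖z.2 - z.1‖ (norm_nonneg _)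
        simp only [Function.uncurry]
        refine (abs_real_inner_le_norm _ _).trans ?_
        rw [hΩ.norm_outerNormal hz, mul_one, norm_smul, norm_smul, norm_sub_rev z.1,
          ← hpow _ (norm_nonneg _), Real.norm_eq_abs, Real.norm_eq_abs]
        calc _ ≤ (P * (1 + ‖z.2 - z.1‖)) * ((C * (1 + ‖z.2 - z.1‖) ^ (-a)) * (2 * M)) := by gcongr
          _ = _ := by ring
  -- the contribution of the interior
  have S2 : (∫ x in Ω, ∫ y in Ω, T x y) + (∫ x in Ω, ∫ y in Ω, Q x y) +
      ((∫ x in Ωᶜ, ∫ y in Ω, T x y) + (∫ x in Ωᶜ, ∫ y in Ω, Q x y)) = 0 := by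
    have h0 : ∀ y ∈ Ω, ∫ x, (T x y + Q x y) = 0 := fun y hy => by
      simp only [← hdiv]
      set k : ℝ := P * (C * (2 * M)) + P * (5 * M * C) + ‖c‖ * (C * (2 * M)) with hk
      have hVV : ∀ x, ‖V x - V y‖ ≤ 2 * M := fun x =>
        (_root_.norm_sub_le _ _).trans (by linarith [hV.norm_le x, hV.norm_le y])
      have hKb : ∀ x, ‖κ (‖x - y‖ ^ 2) • (V x - V y)‖ ≤ C * (2 * M) * (1 + ‖x - y‖) ^ (-a) := fun x => by
        rw [norm_smul, Real.norm_eq_abs]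
        calc _ ≤ (C * (1 + ‖x - y‖) ^ (-a)) * (2 * M) := by
              gcongr
              · exact hκ.le _ (norm_nonneg _)
              · exact hVV x
          _ = _ := by ring
      refine integral_divergence_eq_zero (hFsmooth y) (k := k) y ha1 (fun x => ?_) fun x => ?_
      · rw [norm_smul, Real.norm_eq_abs, ← hpow _ (norm_nonneg _)]
        calc _ ≤ (P * (1 + ‖x - y‖)) * (C * (2 * M) * (1 + ‖x - y‖) ^ (-a)) := by
              gcongr
              · exact hpb x y (Or.inr (hsub hy))
              · exact hKb x
          _ = P * (C * (2 * M)) * ((1 + ‖x - y‖) * (1 + ‖x - y‖) ^ (-a)) := by ring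
          _ ≤ _ := by
              gcongr
              rw [hk]
              have h1 : 0 ≤ P * (5 * M * C) := by positivity
              have h2 : 0 ≤ ‖c‖ * (C * (2 * M)) := by positivity
              linarith
      · have h1 := hasFDerivAt_kernel (x := x) (y := y) (κ' := κ')
          (hV.contDiff.differentiable (by norm_num)) (hκ.hasDerivAt _ (by positivity))
        have hpd : HasFDerivAt p (innerSL ℝ c) x := by
          have e : p = fun x => c₀ + innerSL ℝ c x := funext fun x => by rw [hp]; rfl
          rw [e]
          exact (innerSL ℝ c).hasFDerivAt.const_add c₀
        have e : fderiv ℝ (fun x => p x • κ (‖x - y‖ ^ 2) • (V x - V y)) x = _ :=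
          (hpd.smul h1).fderiv
        rw [e]
        refine (norm_add_le _ _).trans ?_
        rw [norm_smul, ContinuousLinearMap.norm_smulRight_apply, innerSL_apply_norm, Real.norm_eq_abs]
        have h5 : (0 : ℝ) ≤ (1 + ‖x - y‖) ^ (-(a - 1)) := by positivity
        calc _ ≤ (P * (1 + ‖x - y‖)) * (5 * M * C * (1 + ‖x - y‖) ^ (-a)) +
              ‖c‖ * (C * (2 * M) * (1 + ‖x - y‖) ^ (-(a - 1))) := by
              gcongr
              · exact hpb x y (Or.inr (hsub hy))
              · exact hκ.norm_kernelFDeriv_le hC hV x y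
              · exact (hKb x).trans
                  (mul_le_mul_of_nonneg_left (hpow1 _ (norm_nonneg _)) (by positivity))
          _ = P * (5 * M * C) * ((1 + ‖x - y‖) * (1 + ‖x - y‖) ^ (-a)) +
              ‖c‖ * (C * (2 * M)) * (1 + ‖x - y‖) ^ (-(a - 1)) := by ring
          _ ≤ _ := by
              rw [hpow _ (norm_nonneg _), ← add_mul]
              gcongr
              rw [hk]
              have h1 : 0 ≤ P * (C * (2 * M)) := by positivity
              linarith
    have iT := iTr univ
    have iQ := iQr univ
    rw [Measure.restrict_univ] at iT iQ
    have h1 : ∫ x, ∫ y in Ω, (T x y + Q x y) = 0 := by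
      rw [integral_integral_swap (f := fun x y => T x y + Q x y) (iT.add iQ), setIntegral_congr_fun hΩm h0, integral_zero]
    have h2 := integral_add_compl hΩm (iT.add iQ).integral_prod_left
    have h3 := integral_integral_add (iTr Ω) (iQr Ω)
    have h4 := integral_integral_add (iTr Ωᶜ) (iQr Ωᶜ)
    exact (congrArg₂ (· + ·) h3 h4).symm.trans (h2.trans h1)
  -- By antisymmetry the contribution of Q over Ω × Ω vanishes, and its contributions over the two
  -- mixed products are opposite, so Q disappears from the sum of S1 and S2.
  have q1 : ∫ x in Ω, ∫ y in Ω, Q x y = 0 := by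
    have h1 := integral_integral_swap (iQl Ω)
    have h2 : ∫ y in Ω, ∫ x in Ω, Q x y = -∫ x in Ω, ∫ y in Ω, Q x y := by
      rw [← integral_neg]
      congr 1 with y
      rw [← integral_neg]
      congr 1 with x
      exact hQanti x y
    linarith
  have q2 : ∫ x in Ωᶜ, ∫ y in Ω, Q x y = -∫ x in Ω, ∫ y in Ωᶜ, Q x y := by
    rw [integral_integral_swap (iQr Ωᶜ), ← integral_neg]
    congr 1 with y
    rw [← integral_neg]
    congr 1 with x
    exact hQanti x y
  have hG : ∀ x, Integrable (diffDiv κ κ' V x) := fun x => by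
    refine Integrable.mono' (g := fun y => N * (5 * M * C) * (1 + ‖x - y‖) ^ (-a))
      (((integrable_one_add_norm (E := Euc N) (r := a) (by simp; linarith)).comp_sub_left x).const_mul _)
      ((hκ.measurable_diffDiv hV).comp
        (by fun_prop : Measurable fun y : Euc N => (x, y))).aestronglyMeasurable
      (Eventually.of_forall fun y => hκ.abs_diffDiv_le hC hV x y)
  have e1 : ∫ x in Ω, p x * ∫ y, diffDiv κ κ' V x y =
      (∫ x in Ω, ∫ y in Ω, T x y) + ∫ x in Ω, ∫ y in Ωᶜ, T x y := by
    refine Eq.trans ?_ (integral_add (iTl Ω).integral_prod_left (iTl Ωᶜ).integral_prod_left)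
    congr 1 with x
    simp only [hT]
    rw [← integral_add_compl hΩm (hG x), integral_const_mul, integral_const_mul, mul_add]
  have e2 : ∫ x in Ωᶜ, p x * ∫ y in Ω, diffDiv κ κ' V x y = ∫ x in Ωᶜ, ∫ y in Ω, T x y := by
    congr 1 with x
    rw [← integral_const_mul]
  rw [e1, e2, ← S1]
  linarith

end Green

end HigherNeumann

namespace HigherNeumann

/-! ### Bounds for the gradient and the Laplacian of a Schwartz function. -/

section Schwartz

variable {E F : Type*} [NormedAddCommGroup E] [NormedSpace ℝ E] [NormedAddCommGroup F]
  [NormedSpace ℝ F]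

theorem exists_norm_schwartz_le (g : 𝓢(E, F)) : ∃ C, ∀ x, ‖g x‖ ≤ C :=
  ⟨_, SchwartzMap.norm_le_seminorm ℝ g⟩

theorem exists_norm_fderiv_schwartz_le (g : 𝓢(E, F)) : ∃ C, ∀ x, ‖fderiv ℝ g x‖ ≤ C :=
  exists_norm_schwartz_le (SchwartzMap.fderivCLM ℝ E F g)

theorem exists_norm_fderiv_schwartz_sub_le (g : 𝓢(E, F)) :
    ∃ C, ∀ x y, ‖fderiv ℝ g x - fderiv ℝ g y‖ ≤ C * ‖x - y‖ := by
  obtain ⟨C, hC⟩ := exists_norm_fderiv_schwartz_le (SchwartzMap.fderivCLM ℝ E F g)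
  refine ⟨C, fun x y => ?_⟩
  exact Convex.norm_image_sub_le_of_norm_fderiv_le (𝕜 := ℝ)
    (fun z _ => (SchwartzMap.fderivCLM ℝ E F g).differentiableAt)
    (fun z _ => hC z) convex_univ (mem_univ y) (mem_univ x)

theorem exists_norm_mul_schwartz_le (g : 𝓢(E, F)) : ∃ C, ∀ x, ‖g x‖ * (1 + ‖x‖) ≤ C := by
  refine ⟨SchwartzMap.seminorm ℝ 0 0 g + SchwartzMap.seminorm ℝ 1 0 g, fun x => ?_⟩
  have h0 := SchwartzMap.norm_le_seminorm ℝ g x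
  have h1 := SchwartzMap.norm_pow_mul_le_seminorm ℝ g 1 x
  rw [pow_one] at h1
  linarith

variable {N : ℕ} [NeZero N]

/-- The Riesz isomorphism as a linear map. -/
noncomputable def rieszCLM (N : ℕ) : (Euc N →L[ℝ] ℝ) →L[ℝ] Euc N where
  toFun := (InnerProductSpace.toDual ℝ (Euc N)).symm
  map_add' := map_add _
  map_smul' r x := by rw [map_smulₛₗ, conj_trivial, RingHom.id_apply]
  cont := (InnerProductSpace.toDual ℝ (Euc N)).symm.continuous

theorem inner_rieszCLM (l : Euc N →L[ℝ] ℝ) (v : Euc N) : inner ℝ (rieszCLM N l) v = l v :=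
  InnerProductSpace.toDual_symm_apply

/-- The gradient of a Schwartz function, as a Schwartz function. -/
noncomputable def schwartzGradient (u : 𝓢(Euc N, ℝ)) : 𝓢(Euc N, Euc N) :=
  SchwartzMap.postcompCLM (rieszCLM N) (SchwartzMap.fderivCLM ℝ (Euc N) ℝ u)

theorem coe_schwartzGradient (u : 𝓢(Euc N, ℝ)) : ⇑(schwartzGradient u) = ∇ (u : Euc N → ℝ) := rfl

/-- The divergence of a Schwartz field, as a Schwartz function. -/
noncomputable def schwartzDivergence (V : 𝓢(Euc N, Euc N)) : 𝓢(Euc N, ℝ) :=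
  SchwartzMap.postcompCLM (coordTraceCLM N) (SchwartzMap.fderivCLM ℝ (Euc N) (Euc N) V)

theorem coe_schwartzDivergence (V : 𝓢(Euc N, Euc N)) :
    ⇑(schwartzDivergence V) = divergence V := by
  ext x
  exact coordTraceCLM_apply (fderiv ℝ V x)

theorem laplacian_eq_divergence_gradient (u : 𝓢(Euc N, ℝ)) :
    Laplacian.laplacian (u : Euc N → ℝ) = divergence (∇ (u : Euc N → ℝ)) := by
  rw [InnerProductSpace.laplacian_eq_iteratedFDeriv_orthonormalBasis _
    (EuclideanSpace.basisFun (Fin N) ℝ)]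
  ext x
  refine Finset.sum_congr rfl fun i _ => ?_
  have h1 : HasFDerivAt (fderiv ℝ (u : Euc N → ℝ)) (fderiv ℝ (fderiv ℝ u) x) x :=
    (SchwartzMap.fderivCLM ℝ (Euc N) ℝ u).differentiableAt.hasFDerivAt
  have h2 := (rieszCLM N).hasFDerivAt.comp x h1
  have h3 : fderiv ℝ (∇ (u : Euc N → ℝ)) x = _ := h2.fderiv
  rw [h3, iteratedFDeriv_two_apply]
  have h4 : ∀ v : Euc N, v i = inner ℝ v (EuclideanSpace.single i (1 : ℝ)) := fun v => by
    simp [EuclideanSpace.inner_single_right]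
  rw [h4]
  rw [ContinuousLinearMap.comp_apply, inner_rieszCLM]
  simp

/-- The only point where the Schwartz property enters the estimates: everything later uses a single
constant M, which bounds V and its derivatives, the decay of Δu, and the second differences of Δu at
small and at large scale. -/
theorem exists_tame (u : 𝓢(Euc N, ℝ)) : ∃ M, IsTameField (∇ (u : Euc N → ℝ)) M ∧
    (∀ x, |divergence (∇ (u : Euc N → ℝ)) x| * (1 + ‖x‖) ≤ M) ∧
    (∀ x z, |2 * divergence (∇ (u : Euc N → ℝ)) x - divergence (∇ (u : Euc N → ℝ)) (x - z) -
      divergence (∇ (u : Euc N → ℝ)) (x + z)| ≤ M * ‖z‖ ^ 2) ∧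
    (∀ x z, |2 * divergence (∇ (u : Euc N → ℝ)) x - divergence (∇ (u : Euc N → ℝ)) (x - z) -
      divergence (∇ (u : Euc N → ℝ)) (x + z)| ≤ M) := by
  rw [← coe_schwartzGradient, ← coe_schwartzDivergence]
  set V := schwartzGradient u
  set f := schwartzDivergence V
  obtain ⟨C₁, h1⟩ := exists_norm_schwartz_le V
  obtain ⟨C₂, h2⟩ := exists_norm_fderiv_schwartz_le V
  obtain ⟨C₃, h3⟩ := exists_norm_fderiv_schwartz_sub_le V
  obtain ⟨C₄, h4⟩ := exists_norm_mul_schwartz_le f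
  obtain ⟨C₅, h5⟩ := exists_norm_schwartz_le f
  obtain ⟨C₆, h6⟩ := exists_norm_fderiv_schwartz_sub_le f
  have e1 := le_abs_self C₁
  have e2 := le_abs_self C₂
  have e3 := le_abs_self C₃
  have e4 := le_abs_self C₄
  have e5 := le_abs_self C₅
  have e6 := le_abs_self C₆
  have p1 := abs_nonneg C₁
  have p2 := abs_nonneg C₂
  have p3 := abs_nonneg C₃
  have p4 := abs_nonneg C₄
  have p5 := abs_nonneg C₅
  have p6 := abs_nonneg C₆
  -- The coefficient 4 is the total weight of the three values in a second difference; the 2 counts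
  -- the Taylor remainders at x + z and x - z.
  refine ⟨|C₁| + |C₂| + |C₃| + |C₄| + 4 * |C₅| + 2 * |C₆|, ⟨V.smooth 2, fun x => ?_, fun x => ?_,
    fun x y => ?_⟩, fun x => ?_, fun x z => ?_, fun x z => ?_⟩
  · linarith [h1 x]
  · linarith [h2 x]
  · exact (h3 x y).trans (by gcongr; linarith)
  · have := h4 x
    rw [Real.norm_eq_abs] at this
    linarith
  · have hL : LipschitzWith ⟨|C₆|, p6⟩ (fderiv ℝ f) :=
      LipschitzWith.of_dist_le_mul fun a b => by
        rw [dist_eq_norm, dist_eq_norm]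
        exact (h6 a b).trans (by gcongr; exact e6)
    have k1 := norm_sub_sub_fderiv_le f.differentiable hL x (x + z)
    have k2 := norm_sub_sub_fderiv_le f.differentiable hL x (x - z)
    rw [add_sub_cancel_left, Real.norm_eq_abs] at k1
    rw [sub_sub_cancel_left, map_neg, norm_neg, Real.norm_eq_abs] at k2
    change _ ≤ |C₆| * ‖z‖ ^ 2 at k1
    change _ ≤ |C₆| * ‖z‖ ^ 2 at k2
    have : |2 * f x - f (x - z) - f (x + z)| ≤ 2 * |C₆| * ‖z‖ ^ 2 := by
      rw [abs_le] at k1 k2 ⊢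
      constructor <;> linarith [k1.1, k1.2, k2.1, k2.2]
    exact this.trans (by gcongr; linarith)
  · have k0 := abs_le.1 (h5 x)
    have k1 := abs_le.1 (h5 (x - z))
    have k2 := abs_le.1 (h5 (x + z))
    rw [abs_le]
    constructor <;> linarith [k0.1, k0.2, k1.1, k1.2, k2.1, k2.2]

end Schwartz

end HigherNeumann

namespace HigherNeumann

/-! ### The operator inside Ω through second differences. -/

section Interior

variable {N : ℕ} [NeZero N] {V : Euc N → Euc N} {f : Euc N → ℝ} {M : ℝ} {κ κ' : ℝ → ℝ} {a C : ℝ}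

/-- The symmetric second difference of `f` at `x`, with the sign of `-Δ`. -/
def secondDiff (f : Euc N → ℝ) (x z : Euc N) : ℝ := 2 * f x - f (x - z) - f (x + z)

/-- The reflection z ↦ -z preserves both A and the kernel, so the integral is the mean of those with
x - z and x + z. They converge separately since the kernel is integrable on A, which is either the
complement of a ball or, for regularized kernels, the whole space. -/
theorem integral_sub_mul_eq_half_secondDiff (hf : Continuous f) (hfb : ∀ x, |f x| ≤ M)
    {A : Set (Euc N)} (hA : MeasurableSet A) (hAs : ∀ z, -z ∈ A ↔ z ∈ A)
    (hκ : IntegrableOn (fun z : Euc N => κ (‖z‖ ^ 2)) A) (x : Euc N) :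
    ∫ z in A, (f x - f (x - z)) * κ (‖z‖ ^ 2) = 1 / 2 * ∫ z in A, secondDiff f x z * κ (‖z‖ ^ 2) := by
  have hb : ∀ w : Euc N, ‖f x - f w‖ ≤ 2 * M := fun w => by
    rw [Real.norm_eq_abs]
    exact (abs_sub _ _).trans (by linarith [hfb x, hfb w])
  have i1 : IntegrableOn (fun z => (f x - f (x - z)) * κ (‖z‖ ^ 2)) A :=
    Integrable.bdd_mul hκ (by fun_prop : Continuous fun z => f x - f (x - z)).aestronglyMeasurable
      (Eventually.of_forall fun z => hb (x - z))
  have i2 : IntegrableOn (fun z => (f x - f (x + z)) * κ (‖z‖ ^ 2)) A :=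
    Integrable.bdd_mul hκ (by fun_prop : Continuous fun z => f x - f (x + z)).aestronglyMeasurable
      (Eventually.of_forall fun z => hb (x + z))
  have e : ∫ z in A, (f x - f (x - z)) * κ (‖z‖ ^ 2) = ∫ z in A, (f x - f (x + z)) * κ (‖z‖ ^ 2) := by
    rw [← integral_indicator hA, ← integral_indicator hA, ← integral_neg_eq_self]
    congr 1 with z
    by_cases hz : z ∈ A
    · rw [indicator_of_mem hz, indicator_of_mem ((hAs z).2 hz), norm_neg, sub_neg_eq_add]
    · rw [indicator_of_notMem hz, indicator_of_notMem (mt (hAs z).1 hz)]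
  have e2 : ∫ z in A, secondDiff f x z * κ (‖z‖ ^ 2) =
      (∫ z in A, (f x - f (x - z)) * κ (‖z‖ ^ 2)) + ∫ z in A, (f x - f (x + z)) * κ (‖z‖ ^ 2) := by
    rw [← integral_add i1 i2]
    congr 1 with z
    rw [secondDiff]; ring
  rw [e2, ← e]; ring

/-- A dominating function for second differences against a singular kernel. -/
noncomputable def secondDiffBound (N : ℕ) (M b : ℝ) (z : Euc N) : ℝ :=
  (Metric.ball 0 1).indicator (fun z => M * ‖z‖ ^ ((2 - b) - N)) z +
    (Metric.ball 0 1)ᶜ.indicator (fun z => M * ‖z‖ ^ (-(N + b))) z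

theorem integrable_secondDiffBound {b : ℝ} (hb : 0 < b) (hb2 : b < 2) :
    Integrable (secondDiffBound N M b) :=
  ((integrable_indicator_iff Metric.isOpen_ball.measurableSet).2
    ((integrableOn_norm_rpow_ball (N := N) (by linarith) one_pos).const_mul M)).add
  ((integrable_indicator_iff Metric.isOpen_ball.measurableSet.compl).2
    ((integrableOn_norm_rpow_compl_ball (N := N) hb one_pos).const_mul M))

theorem abs_secondDiff_mul_le {b : ℝ} (hκ : KernelProfile (N + b) κ κ') {x : Euc N}
    (h2 : ∀ z, |secondDiff f x z| ≤ M * ‖z‖ ^ 2) (h0 : ∀ z, |secondDiff f x z| ≤ M) {z : Euc N}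
    (hz : z ≠ 0) : |secondDiff f x z * κ (‖z‖ ^ 2)| ≤ secondDiffBound N M b z := by
  have hr : 0 < ‖z‖ := norm_pos_iff.2 hz
  have hM : 0 ≤ M := (abs_nonneg _).trans (h0 0)
  rw [abs_mul, abs_of_nonneg (hκ.nonneg _ (by positivity)), secondDiffBound]
  have hκ0 := hκ.nonneg (‖z‖ ^ 2) (by positivity)
  by_cases h1 : z ∈ Metric.ball (0 : Euc N) 1
  · rw [indicator_of_mem h1, indicator_of_notMem (notMem_compl_iff.2 h1), add_zero]
    calc _ ≤ M * ‖z‖ ^ 2 * ‖z‖ ^ (-(N + b)) := by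
          gcongr
          · exact h2 z
          · exact hκ.le _ hr
      _ = _ := by
          rw [mul_assoc, ← Real.rpow_natCast, ← Real.rpow_add hr]
          congr 2; push_cast; ring
  · rw [indicator_of_notMem h1, indicator_of_mem (mem_compl h1), zero_add]
    gcongr
    · exact h0 z
    · exact hκ.le _ hr

/-- Integrating by parts in the second variable. -/
theorem DecayingProfile.integral_diffDiv (hκ : DecayingProfile N a C κ κ') (hC : 0 ≤ C)
    (hV : IsTameField V M) (ha : N < a) (x : Euc N) :
    ∫ y, diffDiv κ κ' V x y = ∫ y, (divergence V x - divergence V y) * κ (‖x - y‖ ^ 2) := by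
  have hM := hV.nonneg
  have hint : Integrable fun y : Euc N => N * (5 * M * C) * (1 + ‖x - y‖) ^ (-a) :=
    ((integrable_one_add_norm (E := Euc N) (r := a) (by simpa using ha)).comp_sub_left x).const_mul _
  have hm : Measurable (Function.uncurry (diffDiv κ κ' V)) := hκ.measurable_diffDiv hV
  have hm1 : Measurable fun y => diffDiv κ κ' V x y := hm.of_uncurry_left
  have hm2 : Measurable fun y => diffDiv κ κ' V y x := hm.of_uncurry_right
  have i1 : Integrable fun y => diffDiv κ κ' V x y :=
    Integrable.mono' hint hm1.aestronglyMeasurable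
      (Eventually.of_forall fun y => hκ.abs_diffDiv_le hC hV x y)
  have i2 : Integrable fun y => diffDiv κ κ' V y x :=
    Integrable.mono' hint hm2.aestronglyMeasurable
      (Eventually.of_forall fun y => by
        have := hκ.abs_diffDiv_le hC hV y x
        rwa [norm_sub_rev y x] at this)
  have hd : ∀ y, HasFDerivAt (fun y => κ (‖y - x‖ ^ 2) • (V y - V x)) (kernelFDeriv κ κ' V y x) y :=
    fun y => hasFDerivAt_kernel (hV.contDiff.differentiable (by norm_num))
      (hκ.hasDerivAt _ (by positivity))
  -- With the arguments exchanged the integrand is a divergence in y, so its integral is zero.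
  -- Subtracting it removes the terms in κ', which are symmetric in x and y, and leaves the
  -- difference of the divergences.
  have h0 : ∫ y, diffDiv κ κ' V y x = 0 := by
    have hF : ContDiff ℝ 1 fun y => κ (‖y - x‖ ^ 2) • (V y - V x) := by
      have h2 : ContDiff ℝ 1 fun y : Euc N => κ (‖y - x‖ ^ 2) :=
        hκ.contDiff.comp (contDiff_id.sub contDiff_const)
      exact h2.smul ((hV.contDiff.of_le (by norm_num)).sub contDiff_const)
    have h1 := integral_divergence_eq_zero hF (k := 5 * M * C) x ha (fun y => ?_) fun y => ?_
    · rw [← h1]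
      congr 1 with y
      rw [divergence_eq_coordTrace, (hd y).fderiv, coordTrace_kernelFDeriv]
    · rw [norm_smul, Real.norm_eq_abs]
      have hVV : ‖V y - V x‖ ≤ 5 * M :=
        (_root_.norm_sub_le _ _).trans (by linarith [hV.norm_le x, hV.norm_le y])
      calc _ ≤ (C * (1 + ‖y - x‖) ^ (-a)) * (5 * M) := by
            gcongr
            exact hκ.le _ (norm_nonneg _)
        _ = _ := by ring
    · rw [(hd y).fderiv]
      exact hκ.norm_kernelFDeriv_le hC hV y x
  have h3 : ∫ y, diffDiv κ κ' V x y = (∫ y, diffDiv κ κ' V x y) - ∫ y, diffDiv κ κ' V y x := by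
    rw [h0, sub_zero]
  rw [h3, ← integral_sub i1 i2]
  congr 1 with y
  rw [diffDiv, diffDiv, norm_sub_rev y x, ← neg_sub (V x) (V y), ← neg_sub x y, inner_neg_neg]
  ring

/-- Regularized operators on the whole space are bounded and converge to a principal value. -/
theorem interior_limit (hV : IsTameField V M)
    (h2 : ∀ x z, |secondDiff (divergence V) x z| ≤ M * ‖z‖ ^ 2)
    (h0 : ∀ x z, |secondDiff (divergence V) x z| ≤ M) {b : ℝ} (hb : 0 < b) (hb2 : b < 2) :
    ∃ K : ℝ, ∀ x, (∀ ε, 0 < ε →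
        |∫ y, diffDiv (regProfile (N + b) ε) (regProfileDeriv (N + b) ε) V x y| ≤ K) ∧
      Tendsto (fun ε : ℝ => ∫ y, diffDiv (regProfile (N + b) ε) (regProfileDeriv (N + b) ε) V x y)
        (𝓝[>] 0)
        (𝓝 (1 / 2 * ∫ z, secondDiff (divergence V) x z * (‖z‖ ^ 2) ^ (-((N + b) / 2)))) := by
  have hq : (0 : ℝ) ≤ N + b := by positivity
  have hf : Continuous (divergence V) := continuous_divergence (hV.contDiff.of_le (by norm_num))
  have hne : ∀ᵐ z : Euc N, z ≠ 0 := by simp [ae_iff, measure_singleton]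
  have hbi := integrable_secondDiffBound (N := N) (M := M) hb hb2
  refine ⟨1 / 2 * ∫ z, secondDiffBound N M b z, fun x => ?_⟩
  have hreg : ∀ ε, 0 < ε → ∫ y, diffDiv (regProfile (N + b) ε) (regProfileDeriv (N + b) ε) V x y =
      1 / 2 * ∫ z, secondDiff (divergence V) x z * regProfile (N + b) ε (‖z‖ ^ 2) := fun ε hε => by
    obtain ⟨C, hC, hκ⟩ := exists_decayingProfile_reg (N := N) hq hε
    rw [hκ.integral_diffDiv hC hV (by linarith)]
    have h3 := integral_sub_mul_eq_half_secondDiff (κ := regProfile (N + b) ε) hf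
      hV.abs_divergence_le MeasurableSet.univ (fun z => by simp)
      (integrable_regProfile hb hε).integrableOn x
    rw [setIntegral_univ, setIntegral_univ] at h3
    rw [← h3, ← integral_sub_left_eq_self (fun y => (divergence V x - divergence V y) *
      regProfile (N + b) ε (‖x - y‖ ^ 2)) volume x]
    simp only [sub_sub_cancel]
  refine ⟨fun ε hε => ?_, ?_⟩
  · rw [hreg ε hε, abs_mul, abs_of_pos (by norm_num : (0 : ℝ) < 1 / 2), ← Real.norm_eq_abs]
    gcongr
    refine norm_integral_le_of_norm_le hbi ?_
    filter_upwards [hne] with z hz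
    exact abs_secondDiff_mul_le (kernelProfile_reg hq hε) (h2 x) (h0 x) hz
  · have h3 : Tendsto (fun ε : ℝ => ∫ z, secondDiff (divergence V) x z *
        regProfile (N + b) ε (‖z‖ ^ 2)) (𝓝[>] 0)
        (𝓝 (∫ z, secondDiff (divergence V) x z * (‖z‖ ^ 2) ^ (-((N + b) / 2)))) := by
      refine tendsto_integral_filter_of_dominated_convergence _ ?_ ?_ hbi ?_
      · filter_upwards [self_mem_nhdsWithin] with ε hε
        have h4 : Continuous fun z => secondDiff (divergence V) x z := by
          unfold secondDiff; fun_prop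
        exact (h4.measurable.mul ((kernelProfile_reg hq hε).measurable.comp
          (by fun_prop : Continuous fun z : Euc N => ‖z‖ ^ 2).measurable)).aestronglyMeasurable
      · filter_upwards [self_mem_nhdsWithin] with ε hε
        filter_upwards [hne] with z hz
        exact abs_secondDiff_mul_le (kernelProfile_reg hq hε) (h2 x) (h0 x) hz
      · filter_upwards [hne] with z hz
        have : 0 < ‖z‖ ^ 2 := by
          have := norm_pos_iff.2 hz
          positivity
        exact (tendsto_regProfile this).const_mul _
    refine (h3.const_mul (1 / 2)).congr' ?_
    filter_upwards [self_mem_nhdsWithin] with ε hε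
    exact (hreg ε hε).symm

/-- Outside each excised ball the integral is half that of the second difference, and these converge
absolutely as the ball shrinks. The minus sign appears because the operator acts on -Δu while f =
Δu. -/
theorem higherFracLap_eq {σ s : ℝ} (hσ0 : 0 < σ) (hσ1 : σ < 1) (hs : s = 1 + σ) (u : Euc N → ℝ)
    (hu : Laplacian.laplacian u = f) (hf : Continuous f) (hfb : ∀ x, |f x| ≤ C)
    (h2 : ∀ x z, |secondDiff f x z| ≤ M * ‖z‖ ^ 2)
    (h0 : ∀ x z, |secondDiff f x z| ≤ M) (x : Euc N) :
    higherFracLap s u x = -(normConst N σ *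
      (1 / 2 * ∫ z, secondDiff f x z * (‖z‖ ^ 2) ^ (-((N + 2 * σ) / 2)))) := by
  have hq : (0 : ℝ) ≤ N + 2 * σ := by positivity
  have hκ := kernelProfile_rpow hq
  have hne : ∀ᵐ z : Euc N, z ≠ 0 := by simp [ae_iff, measure_singleton]
  have hm : Measurable fun z : Euc N => (‖z‖ ^ 2) ^ (-((N + 2 * σ) / 2)) :=
    hκ.measurable.comp (by fun_prop : Continuous fun y : Euc N => ‖y‖ ^ 2).measurable
  rw [higherFracLap, regionalFracLap, hs, add_sub_cancel_left, smul_eq_mul, ← mul_neg]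
  congr 1
  refine Tendsto.limUnder_eq ?_
  have hlim : Tendsto (fun ε : ℝ => ∫ z, (Metric.ball 0 ε)ᶜ.indicator
      (fun z => secondDiff f x z * (‖z‖ ^ 2) ^ (-((N + 2 * σ) / 2))) z) (𝓝[>] 0)
      (𝓝 (∫ z, secondDiff f x z * (‖z‖ ^ 2) ^ (-((N + 2 * σ) / 2)))) := by
    have h4 : Continuous fun z => secondDiff f x z := by unfold secondDiff; fun_prop
    have hbd : ∀ z : Euc N, z ≠ 0 → |secondDiff f x z * (‖z‖ ^ 2) ^ (-((N + 2 * σ) / 2))| ≤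
      secondDiffBound N M (2 * σ) z := fun z hz => abs_secondDiff_mul_le hκ (h2 x) (h0 x) hz
    refine tendsto_integral_filter_of_dominated_convergence _ ?_ ?_
      (integrable_secondDiffBound (N := N) (M := M) (b := 2 * σ) (by linarith) (by linarith)) ?_
    · exact Eventually.of_forall fun ε => ((h4.measurable.mul hm).indicator
        Metric.isOpen_ball.measurableSet.compl).aestronglyMeasurable
    · refine Eventually.of_forall fun ε => ?_
      filter_upwards [hne] with z hz
      exact (norm_indicator_le_norm_self _ _).trans (hbd z hz)
    · filter_upwards [hne] with z hz
      refine tendsto_const_nhds.congr' ?_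
      filter_upwards [Ioo_mem_nhdsGT (norm_pos_iff.2 hz)] with ε hε
      rw [indicator_of_mem]
      simpa using hε.2.le
  rw [show -(1 / 2 * ∫ z, secondDiff f x z * (‖z‖ ^ 2) ^ (-((N + 2 * σ) / 2))) =
    -(1 / 2) * ∫ z, secondDiff f x z * (‖z‖ ^ 2) ^ (-((N + 2 * σ) / 2)) by ring]
  refine (hlim.const_mul (-(1 / 2))).congr' ?_
  filter_upwards [self_mem_nhdsWithin] with ε hε
  have hε : 0 < ε := hε
  have hmb : MeasurableSet (Metric.ball (0 : Euc N) ε)ᶜ := Metric.isOpen_ball.measurableSet.compl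
  have hint : IntegrableOn (fun z : Euc N => (‖z‖ ^ 2) ^ (-((N + 2 * σ) / 2))) (Metric.ball 0 ε)ᶜ := by
    refine integrableOn_of_norm_rpow_bound hm.aestronglyMeasurable (b := 2 * σ) (by linarith) hε
      (C := 1) fun z hz => ?_
    rw [one_mul]
    exact (abs_of_nonneg (Real.rpow_nonneg (sq_nonneg ‖z‖) _)).trans_le
      (hκ.le _ (norm_pos_iff.2 hz))
  have h5 := integral_sub_mul_eq_half_secondDiff (κ := fun s => s ^ (-((N + 2 * σ) / 2))) hf hfb hmb
    (fun z => by simp) hint x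
  rw [integral_indicator hmb, neg_mul, ← h5, ← integral_neg]
  have hpre : (fun z => x - z) ⁻¹' (univ \ Metric.ball x ε) = (Metric.ball (0 : Euc N) ε)ᶜ := by
    ext z
    simp
  have h6 := setIntegral_sub_left (fun z => -((f x - f (x - z)) * (‖z‖ ^ 2) ^ (-((N + 2 * σ) / 2))))
    (univ \ Metric.ball x ε) (MeasurableSet.univ.diff Metric.isOpen_ball.measurableSet) x
  rw [hpre] at h6
  rw [← h6]
  congr 1 with y
  simp only [sub_sub_cancel, hu, smul_eq_mul]
  by_cases hxy : x = y
  · simp [hxy]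
  · rw [sq_rpow_neg_half (norm_pos_iff.2 (sub_ne_zero.2 hxy)), Real.rpow_neg (norm_nonneg _)]
    ring

end Interior

end HigherNeumann

namespace HigherNeumann

/-! ### The three limits ε → 0. -/

section Limits

variable {N : ℕ} [NeZero N] {Ω : Set (Euc N)} {V : Euc N → Euc N} {M : ℝ} {κ κ' : ℝ → ℝ}
  {p : Euc N → ℝ}

/-- At distance at least t from the complement of Ω the operator is an absolutely convergent
integral, and the inner product with ν can be moved inside. -/
theorem innerNormalComponent_eq (hΩ : IsBoundedC11Domain Ω) {u : Euc N → ℝ}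
    (hV : IsTameField (∇ u) M) {σ : ℝ} (hσ : 0 < σ) {x : Euc N}
    {t : ℝ} (ht : 0 < t) (hfar : ∀ y ∉ Ω, t ≤ ‖x - t • outerNormal Ω x - y‖) :
    innerNormalComponent σ Ω u x t = normConst N σ * ∫ y in Ωᶜ,
      inner ℝ (∇ u (x - t • outerNormal Ω x) - ∇ u y) (outerNormal Ω x) *
        (‖x - t • outerNormal Ω x - y‖ ^ 2) ^ (-((N + 2 * σ) / 2)) := by
  have hκ := kernelProfile_rpow (q := N + 2 * σ) (by positivity)
  set ν := outerNormal Ω x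
  have hVc := hV.contDiff.continuous
  have hm : Measurable fun z : Euc N => (‖z‖ ^ 2) ^ (-((N + 2 * σ) / 2)) :=
    hκ.measurable.comp (by fun_prop : Continuous fun y : Euc N => ‖y‖ ^ 2).measurable
  have hint : IntegrableOn (fun y => (‖x - t • ν - y‖ ^ 2) ^ (-((N + 2 * σ) / 2))) Ωᶜ := by
    refine integrableOn_sub_left (f := fun z => (‖z‖ ^ 2) ^ (-((N + 2 * σ) / 2)))
      hΩ.measurableSet.compl (x - t • ν) (IntegrableOn.mono_set (integrableOn_of_norm_rpow_bound
        hm.aestronglyMeasurable (b := 2 * σ) (by linarith) ht (C := 1) fun z hz => ?_) fun z hz => ?_)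
    · rw [one_mul]
      exact (abs_of_nonneg (Real.rpow_nonneg (sq_nonneg ‖z‖) _)).trans_le
        (hκ.le _ (norm_pos_iff.2 hz))
    · have := hfar _ hz
      simpa using this
  have hint2 : IntegrableOn (fun y => (‖x - t • ν - y‖ ^ 2) ^ (-((N + 2 * σ) / 2)) •
      (∇ u (x - t • ν) - ∇ u y)) Ωᶜ :=
    hint.smul_bdd (2 * M)
      (by fun_prop : Continuous fun y => ∇ u (x - t • ν) - ∇ u y).aestronglyMeasurable
      (Eventually.of_forall fun y => (norm_sub_le _ _).trans (by
        linarith [hV.norm_le (x - t • ν), hV.norm_le y]))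
  rw [innerNormalComponent, regionalFracLap_eq_of_disjoint (A := Ωᶜ) σ _ ht fun y hy => hfar y hy,
    real_inner_smul_left, real_inner_comm, ← integral_inner hint2]
  congr 2 with y
  rw [real_inner_smul_right, real_inner_comm, mul_comm]

theorem tendsto_integral_diffDiv_reg (hΩ : IsBoundedC11Domain Ω) (hV : IsTameField V M) {q : ℝ}
    (hq : 0 ≤ q) {x : Euc N} (hx : x ∉ closure Ω) :
    Tendsto (fun ε : ℝ => ∫ y in Ω, diffDiv (regProfile q ε) (regProfileDeriv q ε) V x y) (𝓝[>] 0)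
      (𝓝 (∫ y in Ω, diffDiv (fun s => s ^ (-(q / 2))) (fun s => -(q / 2) * s ^ (-(q / 2) - 1)) V x y)) := by
  have hM := hV.nonneg
  have hδ := hΩ.infDist_pos hx
  set δ := Metric.infDist x Ω
  have hfar : ∀ y ∈ Ω, δ ≤ ‖x - y‖ := fun y hy => by
    rw [← dist_eq_norm]; exact Metric.infDist_le_dist_of_mem hy
  have hne : ∀ y ∈ Ω, 0 < ‖x - y‖ := fun y hy => hδ.trans_le (hfar y hy)
  refine tendsto_integral_filter_of_dominated_convergence
    (fun _ => (N * M + 2 * (q + 2) * M) * δ ^ (-q)) ?_ ?_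
    (integrableOn_const hΩ.isBounded.measure_lt_top.ne) ?_
  · filter_upwards [self_mem_nhdsWithin] with ε hε
    have hm : Measurable (Function.uncurry (diffDiv (regProfile q ε) (regProfileDeriv q ε) V)) :=
      (kernelProfile_reg hq hε).measurable_diffDiv hV
    exact hm.of_uncurry_left.aestronglyMeasurable
  · filter_upwards [self_mem_nhdsWithin] with ε hε
    filter_upwards [ae_restrict_mem hΩ.measurableSet] with y hy
    refine (hV.abs_diffDiv_le (kernelProfile_reg hq hε)
      (sub_ne_zero.1 (norm_pos_iff.1 (hne y hy)))).trans ?_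
    exact mul_le_mul_of_nonneg_left (Real.rpow_le_rpow_of_nonpos hδ (hfar y hy) (by linarith))
      (by positivity)
  · filter_upwards [ae_restrict_mem hΩ.measurableSet] with y hy
    have hp : 0 < ‖x - y‖ ^ 2 := by
      have := hne y hy
      positivity
    exact ((tendsto_regProfile hp).const_mul _).add
      (((tendsto_regProfileDeriv hp).const_mul 2).mul_const _)

theorem measurable_regProfile (q ε : ℝ) : Measurable (regProfile q ε) := by
  unfold regProfile
  fun_prop

theorem IsBoundedC11Domain.aestronglyMeasurable_trace (hΩ : IsBoundedC11Domain Ω)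
    (hV : IsTameField V M) (hκ : Measurable κ) :
    AEStronglyMeasurable (fun x => ∫ y in Ωᶜ, inner ℝ (V x - V y) (outerNormal Ω x) *
      κ (‖x - y‖ ^ 2)) (surfaceMeasure Ω) := by
  have hfin := hΩ.isFiniteMeasure_surfaceMeasure
  have hVc := hV.contDiff.continuous
  have h1 : Continuous fun z : Euc N × Euc N => V z.1 - V z.2 := by fun_prop
  have h2 : Measurable fun z : Euc N × Euc N => κ (‖z.1 - z.2‖ ^ 2) :=
    hκ.comp (by fun_prop : Continuous fun z : Euc N × Euc N => ‖z.1 - z.2‖ ^ 2).measurable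
  have h3 : AEStronglyMeasurable (fun z : Euc N × Euc N => inner ℝ (V z.1 - V z.2) (outerNormal Ω z.1) *
      κ (‖z.1 - z.2‖ ^ 2)) ((surfaceMeasure Ω).prod (volume.restrict Ωᶜ)) :=
    (h1.aestronglyMeasurable.inner hΩ.aestronglyMeasurable_outerNormal.comp_fst).mul
      h2.aestronglyMeasurable
  exact h3.integral_prod_right'

theorem IsBoundedC11Domain.ae_notMem_closure (hΩ : IsBoundedC11Domain Ω) :
    ∀ᵐ x ∂(volume.restrict Ωᶜ), x ∉ closure Ω := by
  filter_upwards [ae_restrict_mem hΩ.measurableSet.compl,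
    ae_restrict_of_ae (measure_eq_zero_iff_ae_notMem.1 (volume_frontier hΩ))] with x hx hxf
  exact fun h => hxf ⟨h, by rw [hΩ.isOpen.interior_eq]; exact hx⟩

theorem tendsto_integral_exterior (hΩ : IsBoundedC11Domain Ω) (hV : IsTameField V M)
    (hpc : Continuous p) {b : ℝ} (hb : 0 < b) {g : Euc N → ℝ} (hg : IntegrableOn g Ωᶜ)
    (hgd : ∀ κ κ', KernelProfile (N + b) κ κ' → ∀ x ∉ closure Ω,
      |p x * ∫ y in Ω, diffDiv κ κ' V x y| ≤ g x) :
    Tendsto (fun ε : ℝ => ∫ x in Ωᶜ, p x * ∫ y in Ω,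
      diffDiv (regProfile (N + b) ε) (regProfileDeriv (N + b) ε) V x y) (𝓝[>] 0)
      (𝓝 (∫ x in Ωᶜ, p x * ∫ y in Ω, diffDiv (fun s => s ^ (-((N + b) / 2)))
        (fun s => -((N + b) / 2) * s ^ (-((N + b) / 2) - 1)) V x y)) := by
  have hq : (0 : ℝ) ≤ N + b := by positivity
  have hext := hΩ.ae_notMem_closure
  refine tendsto_integral_filter_of_dominated_convergence g ?_ ?_ hg ?_
  · filter_upwards [self_mem_nhdsWithin] with ε hε
    have hm := (kernelProfile_reg hq hε).measurable_diffDiv hV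
    exact hpc.aestronglyMeasurable.mul
      (hm.stronglyMeasurable.integral_prod_right' (ν := volume.restrict Ω)).aestronglyMeasurable
  · filter_upwards [self_mem_nhdsWithin] with ε hε
    filter_upwards [hext] with x hx
    exact hgd _ _ (kernelProfile_reg hq hε) x hx
  · filter_upwards [hext] with x hx
    exact (tendsto_integral_diffDiv_reg hΩ hV hq hx).const_mul _

theorem tendsto_integral_interior (hΩ : IsBoundedC11Domain Ω) (hV : IsTameField V M)
    (h2 : ∀ x z, |secondDiff (divergence V) x z| ≤ M * ‖z‖ ^ 2)
    (h0 : ∀ x z, |secondDiff (divergence V) x z| ≤ M)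
    (hpc : Continuous p) {b : ℝ} (hb : 0 < b) (hb2 : b < 2) :
    IntegrableOn (fun x => p x * (1 / 2 * ∫ z, secondDiff (divergence V) x z *
      (‖z‖ ^ 2) ^ (-((N + b) / 2)))) Ω ∧
    Tendsto (fun ε : ℝ => ∫ x in Ω, p x * ∫ y,
      diffDiv (regProfile (N + b) ε) (regProfileDeriv (N + b) ε) V x y) (𝓝[>] 0)
      (𝓝 (∫ x in Ω, p x * (1 / 2 * ∫ z, secondDiff (divergence V) x z *
      (‖z‖ ^ 2) ^ (-((N + b) / 2))))) := by
  have hq : (0 : ℝ) ≤ N + b := by positivity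
  obtain ⟨K, hK⟩ := interior_limit hV h2 h0 hb hb2
  have hf : Continuous (divergence V) := continuous_divergence (hV.contDiff.of_le (by norm_num))
  obtain ⟨P, hP⟩ := hΩ.isBounded.isCompact_closure.exists_bound_of_continuousOn hpc.continuousOn
  have hpb : ∀ x ∈ Ω, |p x| ≤ |P| := fun x hx => (hP x (subset_closure hx)).trans (le_abs_self P)
  have hlim : ∀ x, |1 / 2 * ∫ z, secondDiff (divergence V) x z * (‖z‖ ^ 2) ^ (-((N + b) / 2))| ≤ K :=
    fun x => le_of_tendsto (hK x).2.abs (by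
      filter_upwards [self_mem_nhdsWithin] with ε hε
      exact (hK x).1 ε hε)
  have hb0 : ∀ x ∈ Ω, ∀ D : ℝ, |D| ≤ K → ‖p x * D‖ ≤ |P| * K := fun x hx D hD => by
    rw [norm_mul, Real.norm_eq_abs, Real.norm_eq_abs]
    exact mul_le_mul (hpb x hx) hD (abs_nonneg _) (abs_nonneg _)
  have hci : IntegrableOn (fun _ : Euc N => |P| * K) Ω :=
    integrableOn_const hΩ.isBounded.measure_lt_top.ne
  refine ⟨Integrable.mono' hci ?_ ?_, ?_⟩
  · have h4 : Continuous fun z : Euc N × Euc N => secondDiff (divergence V) z.1 z.2 := by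
      unfold secondDiff; fun_prop
    have h5 : Measurable fun z : Euc N × Euc N => (‖z.2‖ ^ 2) ^ (-((N + b) / 2)) :=
      (kernelProfile_rpow hq).measurable.comp
        (by fun_prop : Continuous fun z : Euc N × Euc N => ‖z.2‖ ^ 2).measurable
    have h6 : StronglyMeasurable fun x => ∫ z, secondDiff (divergence V) x z *
        (‖z‖ ^ 2) ^ (-((N + b) / 2)) :=
      (h4.measurable.mul h5).stronglyMeasurable.integral_prod_right' (ν := volume)
    exact hpc.aestronglyMeasurable.mul (h6.const_mul (1 / 2)).aestronglyMeasurable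
  · filter_upwards [ae_restrict_mem hΩ.measurableSet] with x hx
    exact hb0 x hx _ (hlim x)
  · refine tendsto_integral_filter_of_dominated_convergence _ ?_ ?_ hci ?_
    · filter_upwards [self_mem_nhdsWithin] with ε hε
      have hm := (kernelProfile_reg hq hε).measurable_diffDiv hV
      exact hpc.aestronglyMeasurable.mul
        (hm.stronglyMeasurable.integral_prod_right' (ν := volume)).aestronglyMeasurable
    · filter_upwards [self_mem_nhdsWithin] with ε hε
      filter_upwards [ae_restrict_mem hΩ.measurableSet] with x hx
      exact hb0 x hx _ ((hK x).1 ε hε)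
    · exact Eventually.of_forall fun x => (hK x).2.const_mul _

/-- Bounds and limits are required only where p ≠ 0, which is all that the vanishing of p a
provides; at zeros of p the product vanishes identically. Measurability of p L is inherited from the
regularized traces. -/
theorem tendsto_integral_surface (hΩ : IsBoundedC11Domain Ω) (hV : IsTameField V M)
    (hpc : Continuous p) {q C : ℝ} (hC : 0 ≤ C) {L : Euc N → ℝ}
    (hbd : ∀ x ∈ frontier Ω, p x ≠ 0 → ∀ ε, 0 < ε → |∫ y in Ωᶜ,
      inner ℝ (V x - V y) (outerNormal Ω x) * regProfile q ε (‖x - y‖ ^ 2)| ≤ C)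
    (hlim : ∀ x ∈ frontier Ω, p x ≠ 0 → Tendsto (fun ε : ℝ => ∫ y in Ωᶜ,
      inner ℝ (V x - V y) (outerNormal Ω x) * regProfile q ε (‖x - y‖ ^ 2)) (𝓝[>] 0) (𝓝 (L x))) :
    Integrable (fun x => p x * L x) (surfaceMeasure Ω) ∧
    Tendsto (fun ε : ℝ => ∫ x, p x * (∫ y in Ωᶜ,
      inner ℝ (V x - V y) (outerNormal Ω x) * regProfile q ε (‖x - y‖ ^ 2)) ∂(surfaceMeasure Ω))
      (𝓝[>] 0) (𝓝 (∫ x, p x * L x ∂(surfaceMeasure Ω))) := by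
  have hfin := hΩ.isFiniteMeasure_surfaceMeasure
  obtain ⟨P, hP⟩ := hΩ.isCompact_frontier.exists_bound_of_continuousOn hpc.continuousOn
  have hae := IsBoundedC11Domain.ae_mem_frontier Ω
  set I : ℝ → Euc N → ℝ := fun ε x => ∫ y in Ωᶜ,
      inner ℝ (V x - V y) (outerNormal Ω x) * regProfile q ε (‖x - y‖ ^ 2) with hI
  have hm : ∀ ε, AEStronglyMeasurable (fun x => p x * I ε x) (surfaceMeasure Ω) := fun ε =>
    hpc.aestronglyMeasurable.mul (hΩ.aestronglyMeasurable_trace hV (measurable_regProfile q ε))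
  have hb : ∀ ε, 0 < ε → ∀ x ∈ frontier Ω, |p x * I ε x| ≤ |P| * C := fun ε hε x hx => by
    by_cases hpx : p x = 0
    · rw [hpx, zero_mul, abs_zero]; positivity
    · rw [abs_mul]
      exact mul_le_mul ((hP x hx).trans (le_abs_self P)) (hbd x hx hpx ε hε) (abs_nonneg _)
        (abs_nonneg _)
  have ht : ∀ x ∈ frontier Ω, Tendsto (fun ε => p x * I ε x) (𝓝[>] 0) (𝓝 (p x * L x)) :=
    fun x hx => by
      by_cases hpx : p x = 0
      · simp [hpx]
      · exact (hlim x hx hpx).const_mul _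
  have htae : ∀ᵐ x ∂(surfaceMeasure Ω), Tendsto (fun ε => p x * I ε x) (𝓝[>] 0) (𝓝 (p x * L x)) :=
    hae.mono ht
  refine ⟨Integrable.mono' (integrable_const (|P| * C))
    (aestronglyMeasurable_of_tendsto_ae (𝓝[>] (0 : ℝ)) hm htae) ?_, ?_⟩
  · filter_upwards [hae] with x hx
    refine le_of_tendsto (ht x hx).abs ?_
    filter_upwards [self_mem_nhdsWithin] with ε hε
    exact hb ε hε x hx
  · refine tendsto_integral_filter_of_dominated_convergence (fun _ => |P| * C)
      (Eventually.of_forall hm) ?_ (integrable_const _) htae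
    filter_upwards [self_mem_nhdsWithin] with ε hε
    filter_upwards [hae] with x hx
    exact hb ε hε x hx

end Limits

end HigherNeumann

namespace HigherNeumann

/-! ### Assembly of the integration by parts formula. -/

section Formula

variable {N : ℕ} [NeZero N] {Ω : Set (Euc N)} {M σ : ℝ} {p : Euc N → ℝ}

theorem regionalFracLap_of_normConst_eq_zero (h : normConst N σ = 0) {F : Type*}
    [NormedAddCommGroup F] [NormedSpace ℝ F] (A : Set (Euc N)) (w : Euc N → F) :
    regionalFracLap σ A w = 0 := by
  ext x
  simp [regionalFracLap, h]

theorem divergence_zero : divergence (0 : Euc N → Euc N) = 0 := by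
  ext x
  simp [divergence]

theorem IsBoundedC11Domain.ae_divergence_regionalFracLap (hΩ : IsBoundedC11Domain Ω)
    {V : Euc N → Euc N} (hV : IsTameField V M) (hσ : 0 < σ) :
    ∀ᵐ x ∂(volume.restrict Ωᶜ), divergence (regionalFracLap σ Ω V) x = normConst N σ *
      ∫ y in Ω, diffDiv (fun s => s ^ (-((N + 2 * σ) / 2)))
        (fun s => -((N + 2 * σ) / 2) * s ^ (-((N + 2 * σ) / 2) - 1)) V x y :=
  hΩ.ae_notMem_closure.mono fun _ hx => hΩ.divergence_regionalFracLap hV hσ hx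

theorem IsBoundedC11Domain.integrableOn_mul_integral_diffDiv (hΩ : IsBoundedC11Domain Ω)
    {V : Euc N → Euc N} (hV : IsTameField V M) (hσ : 0 < σ) (hc : normConst N σ ≠ 0)
    (hp : Continuous p)
    (hint : IntegrableOn (fun x => |divergence (regionalFracLap σ Ω V) x * p x|) Ωᶜ) :
    IntegrableOn (fun x => p x * ∫ y in Ω, diffDiv (fun s => s ^ (-((N + 2 * σ) / 2)))
      (fun s => -((N + 2 * σ) / 2) * s ^ (-((N + 2 * σ) / 2) - 1)) V x y) Ωᶜ := by
  have hm := (kernelProfile_rpow (q := N + 2 * σ) (by positivity)).measurable_diffDiv hV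
  refine Integrable.mono' (hint.const_mul |normConst N σ|⁻¹)
    (hp.aestronglyMeasurable.mul (hm.stronglyMeasurable.integral_prod_right'
      (ν := volume.restrict Ω)).aestronglyMeasurable) ?_
  filter_upwards [hΩ.ae_divergence_regionalFracLap hV hσ] with x hx
  have := abs_ne_zero.2 hc
  rw [hx, Real.norm_eq_abs, abs_mul, abs_mul, abs_mul]
  refine le_of_eq ?_
  field_simp

/-- Integration by parts against an affine function, when the normalizing constant is nonzero. -/
theorem IsBoundedC11Domain.integral_mul_higherFracLap (hΩ : IsBoundedC11Domain Ω) {s c₀ : ℝ}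
    {cv : Euc N} (hσ0 : 0 < σ) (hσ1 : σ < 1) (hs : s = 1 + σ) (hc : normConst N σ ≠ 0)
    (hp : ∀ x, p x = c₀ + inner ℝ cv x) (u : 𝓢(Euc N, ℝ))
    (hu : IntegrableOn (fun x =>
      |divergence (regionalFracLap σ Ω (∇ (u : Euc N → ℝ))) x * p x|) Ωᶜ) :
    (∀ x ∈ frontier Ω, p x ≠ 0 → ∃ L : ℝ,
      Tendsto (innerNormalComponent σ Ω u x) (𝓝[>] 0) (𝓝 L)) ∧
    IntegrableOn (fun x => p x * higherFracLap s u x) Ω ∧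
    IntegrableOn (fun x => p x * neumannOne σ Ω u x) Ωᶜ ∧
    Integrable (fun x => p x * neumannTwo σ Ω u x) (surfaceMeasure Ω) ∧
    ∫ x in Ω, p x * higherFracLap s u x =
      -(∫ x in Ωᶜ, p x * neumannOne σ Ω u x)
        - ∫ x, p x * neumannTwo σ Ω u x ∂(surfaceMeasure Ω) := by
  obtain ⟨M, hV, hdec, h2, h0⟩ := exists_tame u
  have hb : 0 < 2 * σ := by linarith
  have hb2 : 2 * σ < 2 := by linarith
  have hpc : Continuous p := by
    rw [funext hp]; fun_prop
  have hD := hΩ.integrableOn_mul_integral_diffDiv hV hσ0 hc hpc hu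
  -- The dichotomy on which both the exterior majorant and the normal trace depend; the
  -- integrability hypothesis is needed to get the second alternative.
  have hzero : 2 * σ < 1 ∨ ∀ z ∈ frontier Ω, p z * normalDeriv Ω (∇ (u : Euc N → ℝ)) z = 0 := by
    rcases lt_or_ge (2 * σ) 1 with h | h
    · exact Or.inl h
    · exact Or.inr fun z hz => hΩ.mul_normalDeriv_eq_zero hV hp h hb2 hD hz
  obtain ⟨g, hg, hgd⟩ := hΩ.exists_dominating hV hdec hp hb hb2 hzero
  obtain ⟨C, t₀, hC, ht₀, htr⟩ := hΩ.exists_trace hV hb hb2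
  have hor : ∀ x ∈ frontier Ω, p x ≠ 0 →
      2 * σ < 1 ∨ normalDeriv Ω (∇ (u : Euc N → ℝ)) x = 0 := fun x hx hpx =>
    hzero.imp_right fun h => (mul_eq_zero.1 (h x hx)).resolve_left hpx
  have hlim : ∀ x ∈ frontier Ω, p x ≠ 0 → ∃ L : ℝ,
      Tendsto (innerNormalComponent σ Ω u x) (𝓝[>] 0) (𝓝 (normConst N σ * L)) ∧
      Tendsto (fun ε : ℝ => ∫ y in Ωᶜ, inner ℝ (∇ (u : Euc N → ℝ) x - ∇ (u : Euc N → ℝ) y)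
        (outerNormal Ω x) * regProfile (N + 2 * σ) ε (‖x - y‖ ^ 2)) (𝓝[>] 0) (𝓝 L) := by
    intro x hx hpx
    obtain ⟨hfar, htr⟩ := htr x hx
    obtain ⟨-, L, hL, hL'⟩ := htr (hor x hx hpx)
    refine ⟨L, (hL.const_mul (normConst N σ)).congr' ?_, hL'⟩
    filter_upwards [Ioc_mem_nhdsGT ht₀] with t ht
    exact (innerNormalComponent_eq hΩ hV hσ0 ht.1 (hfar t ht.1 ht.2)).symm
  choose! L hL hL' using hlim
  have hN2 : ∀ᵐ x ∂(surfaceMeasure Ω), p x * neumannTwo σ Ω u x = normConst N σ * (p x * L x) := by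
    filter_upwards [IsBoundedC11Domain.ae_mem_frontier Ω] with x hx
    by_cases hpx : p x = 0
    · simp [hpx]
    · rw [neumannTwo, (hL x hx hpx).limUnder_eq]
      ring
  have hN1 : ∀ᵐ x ∂(volume.restrict Ωᶜ), p x * neumannOne σ Ω u x = -normConst N σ * (p x *
      ∫ y in Ω, diffDiv (fun s => s ^ (-((N + 2 * σ) / 2)))
        (fun s => -((N + 2 * σ) / 2) * s ^ (-((N + 2 * σ) / 2) - 1)) (∇ (u : Euc N → ℝ)) x y) := by
    filter_upwards [hΩ.ae_divergence_regionalFracLap hV hσ0] with x hx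
    rw [neumannOne, hx]
    ring
  have hH : ∀ x, p x * higherFracLap s u x = -normConst N σ * (p x * (1 / 2 *
      ∫ z, secondDiff (divergence (∇ (u : Euc N → ℝ))) x z * (‖z‖ ^ 2) ^ (-((N + 2 * σ) / 2)))) := by
    intro x
    rw [higherFracLap_eq hσ0 hσ1 hs u (laplacian_eq_divergence_gradient u)
      (continuous_divergence (hV.contDiff.of_le (by norm_num)))
      (fun x => hV.abs_divergence_le x) h2 h0 x]
    ring
  obtain ⟨hiI, hiT⟩ := tendsto_integral_interior hΩ hV h2 h0 hpc hb hb2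
  obtain ⟨hsI, hsT⟩ := tendsto_integral_surface hΩ hV hpc hC
    (fun x hx hpx ε hε => ((htr x hx).2 (hor x hx hpx)).1 ε hε) hL'
  have heT := tendsto_integral_exterior hΩ hV hpc hb hg hgd
  -- Green's formula holds for each ε > 0, so the limit of the surface integrals is the sum of the
  -- limits of the two volume integrals.
  have key := tendsto_nhds_unique (hsT.congr' (by
    filter_upwards [self_mem_nhdsWithin] with ε hε
    obtain ⟨C', hC', hκ⟩ := exists_decayingProfile_reg (N := N) (q := N + 2 * σ) (by positivity) hε
    exact (hΩ.integral_mul_diffDiv hV hp hκ hC' (by linarith)).symm)) (hiT.add heT)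
  refine ⟨fun x hx hpx => ⟨_, hL x hx hpx⟩, ?_, ?_, ?_, ?_⟩
  · simp_rw [hH]
    exact hiI.const_mul _
  · exact (hD.const_mul _).congr (hN1.mono fun _ h => h.symm)
  · exact (hsI.const_mul _).congr (hN2.mono fun _ h => h.symm)
  · rw [integral_congr_ae hN1, integral_congr_ae hN2]
    simp_rw [hH]
    rw [integral_const_mul, integral_const_mul, integral_const_mul, key]
    ring

end Formula

end HigherNeumann

theorem proposition2p5 {N : ℕ} [NeZero N] (σ s : ℝ) (hσ0 : 0 < σ) (hσ1 : σ < 1) (hs : s = 1 + σ)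
    (Ω : Set (HigherNeumann.Euc N)) (hΩ : HigherNeumann.IsBoundedC11Domain Ω)
    (p : HigherNeumann.Euc N → ℝ) (hp : p ∈ HigherNeumann.affinePolynomials N)
    (u : 𝓢(HigherNeumann.Euc N, ℝ))
    (hu : IntegrableOn (fun x =>
      |HigherNeumann.divergence (HigherNeumann.regionalFracLap σ Ω (∇ (u : HigherNeumann.Euc N → ℝ))) x
        * p x|) Ωᶜ) :
    (∀ x ∈ frontier Ω, p x ≠ 0 → ∃ L : ℝ,
      Tendsto (HigherNeumann.innerNormalComponent σ Ω u x) (𝓝[>] 0) (𝓝 L)) ∧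
    IntegrableOn (fun x => p x * HigherNeumann.higherFracLap s u x) Ω ∧
    IntegrableOn (fun x => p x * HigherNeumann.neumannOne σ Ω u x) Ωᶜ ∧
    Integrable (fun x => p x * HigherNeumann.neumannTwo σ Ω u x)
      (HigherNeumann.surfaceMeasure Ω) ∧
    ∫ x in Ω, p x * HigherNeumann.higherFracLap s u x =
      -(∫ x in Ωᶜ, p x * HigherNeumann.neumannOne σ Ω u x)
        - ∫ x, p x * HigherNeumann.neumannTwo σ Ω u x ∂(HigherNeumann.surfaceMeasure Ω) := by
  obtain ⟨c₀, cv, hp⟩ := hp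
  -- Extracting information from the hypothesis requires division by the normalizing constant. Its
  -- positivity is never proved: were it zero, all the operators would vanish and every claim would
  -- be trivial.
  by_cases hc : HigherNeumann.normConst N σ = 0
  · have hz : ∀ (A : Set (HigherNeumann.Euc N)) (w : HigherNeumann.Euc N → HigherNeumann.Euc N),
        HigherNeumann.regionalFracLap σ A w = 0 :=
      HigherNeumann.regionalFracLap_of_normConst_eq_zero hc
    have h0 : ∀ x, HigherNeumann.higherFracLap s (u : HigherNeumann.Euc N → ℝ) x = 0 := fun x => by
      rw [HigherNeumann.higherFracLap, hs, add_sub_cancel_left,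
        HigherNeumann.regionalFracLap_of_normConst_eq_zero hc]
      rfl
    have h1 : ∀ x, HigherNeumann.neumannOne σ Ω (u : HigherNeumann.Euc N → ℝ) x = 0 := fun x => by
      simp [HigherNeumann.neumannOne, hz, HigherNeumann.divergence_zero]
    have h2 : ∀ x, HigherNeumann.innerNormalComponent σ Ω (u : HigherNeumann.Euc N → ℝ) x =
        fun _ => 0 := fun x => by
      ext t
      simp [HigherNeumann.innerNormalComponent, hz]
    have h3 : ∀ x, HigherNeumann.neumannTwo σ Ω (u : HigherNeumann.Euc N → ℝ) x = 0 := fun x => by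
      rw [HigherNeumann.neumannTwo, h2]
      exact tendsto_const_nhds.limUnder_eq
    refine ⟨fun x _ _ => ⟨0, by rw [h2]; exact tendsto_const_nhds⟩, ?_, ?_, ?_, ?_⟩ <;>
      simp [h0, h1, h3]
  · exact hΩ.integral_mul_higherFracLap hσ0 hσ1 hs hc hp u hu
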